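/- **Setting.** For each security parameter $\varrho$ a (possibly randomised) generator outputs asymmetric bilinear groups $(\mathbb G,\hat{\mathbb G},\mathbb G_T)$ of prime order $p>2^{\varrho}$ with generators $g,\hat g$ and a non-degenerate bilinear map $e$. Algorithms are non-uniform probabilistic algorithms (straight-line programs using Boolean gates, arithmetic and uniform sampling modulo $p$, group and pairing operations, and access to the bit encodings of group elements); efficient (PPT) means polynomial size in $\varrho$. $\mathcal P$-BDH$_1$ asks to distinguish $(g,g^b,g^{ab},g^c,\hat g,\hat g^a,\hat g^b,g^{abc})$ from $(g,g^b,g^{ab},g^c,\hat g,\hat g^a,\hat g^b,g^{z})$, and DDH$_2$ asks to distinguish $(g,\hat g,\hat g^a,\hat g^b,\hat g^{ab})$ from $(g,\hat g,\hat g^a,\hat g^b,\hat g^{z})$, with $a,b,c,z$ uniform in $\mathbb Z_p$; $\mathbf{Adv}$ denotes the absolute difference of the probabilities of output $1$, and each assumption says that it is negligible for every efficient algorithm. **The function.** Let $d\ge1$ be a constant, $n=n(\varrho)$ polynomially bounded with $n>\log_2 p$, $\mu=2$, and $\omega=n-\log_2 p$. Identities are $(\mathsf{id}_1,\dots,\mathsf{id}_\ell)$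 with $1\le\ell\le d$ and $\mathsf{id}_i\in\{(1,x):x\in\mathbb Z_p^*\}$; indices range over $1\le i_1\le d$, $1\le l_1,l_2\le n$. For an auxiliary input $\mathbf y\in(\mathbb Z_p^2)^d$, master key generation picks $\alpha_v,\boldsymbol\alpha_w[l_1],\boldsymbol\alpha_h[i_1,i_2,l_1]$ ($i_2=0,1,2$) and $\mathbf s[l_2]$ uniformly in $\mathbb Z_p^*$ and sets $v=g^{\alpha_v}$, $\mathbf w=g^{\boldsymbol\alpha_w}$, $\mathbf h=g^{\boldsymbol\alpha_h}$ and, with the same exponents, $\hat v,\hat{\mathbf w},\hat{\mathbf h}$ as powers of $\hat g$. The public key $\mathsf{mpk}$ consists of $v,\mathbf w,\mathbf h$, $\mathbf J[l_2]=v^{\mathbf s[l_2]}$, $\mathbf C_w[l_2,l_1]=\mathbf w[l_1]^{\mathbf s[l_2]}$ and, for $i_2=1,2$, $\mathbf C[i_1,i_2,l_2,l_1]=(\mathbf h[i_1,0,l_1]^{\mathbf y_{i_1}[i_2]\Delta(l_2,l_1)}\,\mathbf h[i_1,i_2,l_1])^{\mathbf s[l_2]}$, where $\Delta$ is the Kronecker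 delta; the secret key is $\mathsf{msk}=(\hat v,\hat{\mathbf w},\hat{\mathbf h})$. For $X\in\{0,1\}^n$, $$\mathsf{Eval}(\mathsf{mpk},\mathsf{id},X)=\Big(\prod_{l_2}\mathbf J[l_2]^{x_{l_2}},\ \prod_{l_2}\mathbf C_w[l_2,l_1]^{x_{l_2}},\ \prod_{l_2}\big(\prod_{i_2=1}^{2}\mathbf C[i_1,i_2,l_2,l_1]^{\mathsf{id}_{i_1}[i_2]}\big)^{x_{l_2}}\Big)_{i_1\le\ell,\ l_1\le n}.$$ For $\mathsf{id}$ of level $\ell$ put $F_{i_1}[l_1]=\prod_{i_2=1}^{2}\hat{\mathbf h}[i_1,i_2,l_1]^{\mathsf{id}_{i_1}[i_2]}$. A private key for $\mathsf{id}$ consists, for each $l_1$ (omitted below) and with fresh exponents $r_w,r_{i_1},s'_j,s_{j,k,i_1},s_{w,j,k}$ uniform in $\mathbb Z_p^*$ ($i_1\le\ell<j\le d$, $k=1,2$), of $D=\prod_{i_1\le\ell}F_{i_1}^{r_{i_1}}\hat{\mathbf w}^{r_w}$, $D_w=\hat v^{r_w}$, $D_{i_1}=\hat v^{r_{i_1}}$,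 $K_{j,k}=\prod_{i_1\le\ell}F_{i_1}^{s_{j,k,i_1}}\,\hat{\mathbf h}[j,k]^{s'_j}\,\hat{\mathbf w}^{s_{w,j,k}}$, $L_j=\hat v^{s'_j}$, $L_{j,k,i_1}=\hat v^{s_{j,k,i_1}}$, $L_{w,j,k}=\hat v^{s_{w,j,k}}$. Delegation to $(\mathsf{id},x)$ with $x\in\{1\}\times\mathbb Z_p^*$ raises all of $K,L,L_w$ to one random power $z\in\mathbb Z_p^*$ (for each $l_1$; keep the names), forms $K_*=\prod_kK_{\ell+1,k}^{x[k]}$, $L_{*,i_1}=\prod_kL_{\ell+1,k,i_1}^{x[k]}$ for $i_1\le\ell$, $L_{*,\ell+1}=L_{\ell+1}$, $L_{*,w}=\prod_kL_{w,\ell+1,k}^{x[k]}$, multiplies $D,D_w,D_{i_1}$ by $K_*,L_{*,w},L_{*,i_1}$ (with $D_{\ell+1}=1$ before), and, for $j\ge\ell+2$ with random $\tau_{j,k}\in\mathbb Z_p^*$, multiplies $K_{j,k},L_{w,j,k},L_{j,k,i_1}$ by the $\tau_{j,k}$-th powers of $K_*,L_{*,w},L_{*,i_1}$ (with $L_{j,k,\ell+1}=1$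 before). $\mathsf{HF}$ uses $\mathbf y^{(0)}=[(1,0)|\dots|(1,0)]$. Its sibling $\mathsf{LHF}$ uses, for a target $\mathsf{id}^\dagger$ of level $\ell^\dagger$ with $i$-th component $(1,x_i^\dagger)$, the vector $\mathbf y^{(1)}$ with $\mathbf y^{(1)}_i=(-x^\dagger_i,1)$ for $i\le\ell^\dagger$ and $(1,0)$ for $i>\ell^\dagger$; everything else is unchanged. **Experiments.** The selective-identity adversary $\mathcal A$, given the groups, chooses $\mathsf{id}^\dagger$. Key pairs $(\mathsf{mpk}_0,\mathsf{msk}_0)$ of $\mathsf{HF}$ and $(\mathsf{mpk}_1,\mathsf{msk}_1)$ of $\mathsf{LHF}$ for $\mathsf{id}^\dagger$ are generated; $\mathcal A$ gets $\mathsf{mpk}_0$ in $\mathsf{REAL}$ and $\mathsf{mpk}_1$ in $\mathsf{LOSSY}$, and may adaptively ask to create keys, to create delegated keys from created ones, and to reveal created keys of identities that are not prefixes of $\mathsf{id}^\dagger$ (keys coming from the corresponding master secret key); it outputs a bit $d_{\mathcal A}$. With $\lambda(f)=\log_2(|\mathrm{Dom} f|/|\mathrm{Im} f|)$, the bit $d_{\neg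 abort}$ is $1$ iff $\lambda(\mathsf{Eval}(\mathsf{mpk}_1,\mathsf{id},\cdot))=0$ for every revealed $\mathsf{id}$ and $\lambda(\mathsf{Eval}(\mathsf{mpk}_1,\mathsf{id}^\dagger,\cdot))\ge\omega$ (the pre-output stage is the trivial one). Let $$\mathbf{Adv}^{\rm lossy}_{\mathsf{HF},\mathsf{LHF},\omega}(\mathcal A)=\big|\Pr[d_{\mathcal A}\wedge d_{\neg abort}=1\mid\mathsf{REAL}]-\Pr[d_{\mathcal A}\wedge d_{\neg abort}=1\mid\mathsf{LOSSY}]\big|.$$ **Theorem.** 1. If the $\mathcal P$-BDH$_1$ and DDH$_2$ assumptions hold, then $\mathsf{HF}$ (with sibling $\mathsf{LHF}$) is $(\omega,1)$-partially lossy against selective-identity adversaries: for every PPT selective-identity adversary $\mathcal A$ and every non-negligible $\zeta$ with values in $(0,1)$ there are non-negligible $\epsilon_1,\epsilon_2$ with $\epsilon_1\epsilon_2=1$ such that (i) $\mathbf{Adv}^{\rm lossy}_{\mathsf{HF},\mathsf{LHF},\omega}(\mathcal A)$ is negligible; (ii) $\Pr[d_{\neg abort}=1\mid\mathsf{REAL}]\ge\epsilon_1$;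 (iii) if $\Pr[d_{\mathcal A}=1\mid\mathsf{REAL}]-\frac12>\zeta$, then $\Pr[d_{\mathcal A}=1\mid\mathsf{REAL}\wedge d_{\neg abort}=1]-\frac12>\epsilon_2\zeta$. 2. For every selective-identity adversary $\mathcal A$ making at most $q$ reveal-key queries there are algorithms $\mathcal B_1,\mathcal B_2$ with $$\mathbf{Adv}^{\rm lossy}_{\mathsf{HF},\mathsf{LHF},\omega}(\mathcal A)\le n\cdot\big((2d+1)\,\mathbf{Adv}^{\mathcal P\text{-}\mathrm{BDH}_1}(\mathcal B_1)+q\,\mathbf{Adv}^{\mathrm{DDH}_2}(\mathcal B_2)\big),$$ whose running times are comparable to that of $\mathcal A$: at most that of $\mathcal A$ plus $T(\varrho+Q)$, where $T$ is a polynomial independent of $\mathcal A$ and $\varrho$, and $Q$ is the number of oracle queries (of all kinds) in the program of $\mathcal A$. 3. For $\mathsf{mpk}_1$ generated with $\mathbf y^{(1)}$ for a target $\mathsf{id}^\dagger$ and exponents $\mathbf s$, and every identity $\mathsf{id}$: $\lambda(\mathsf{Eval}(\mathsf{mpk}_1,\mathsf{id},\cdot))\ge\omega$ if and only if $\mathsf{id}$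 is a prefix of $\mathsf{id}^\dagger$. If it is, $\mathsf{Eval}(\mathsf{mpk}_1,\mathsf{id},X)$ depends only on $\langle\mathbf s,X\rangle\in\mathbb Z_p$; if it is not, $\mathsf{Eval}(\mathsf{mpk}_1,\mathsf{id},\cdot)$ is injective. -/

import Mathlib

noncomputable section

namespace LossyHIB

/-! ## Asymmetric bilinear groups of prime order -/

/-- A description of asymmetric bilinear groups `(G, Ĝ, G_T)` of prime order `p`, with generators
`g`, `ĝ`, a non-degenerate bilinear map `e`, and injective encodings of the group elements as bit
strings. -/
structure BilinearGroup where
  p : ℕ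
  prime : p.Prime
  G : Type
  Gh : Type
  GT : Type
  [commGroupG : CommGroup G]
  [commGroupGh : CommGroup Gh]
  [commGroupGT : CommGroup GT]
  card_G : Nat.card G = p
  card_Gh : Nat.card Gh = p
  card_GT : Nat.card GT = p
  g : G
  gh : Gh
  e : G →* Gh →* GT
  nondegenerate : e g gh ≠ 1
  encG : G → List Bool
  encGh : Gh → List Bool
  encGT : GT → List Bool
  encG_injective : Function.Injective encG
  encGh_injective : Function.Injective encGh
  encGT_injective : Function.Injective encGT

attribute [instance] BilinearGroup.commGroupG BilinearGroup.commGroupGh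
  BilinearGroup.commGroupGT

instance BilinearGroup.factPrime (𝔹 : BilinearGroup) : Fact 𝔹.p.Prime := ⟨𝔹.prime⟩

/-- Exponentiation of a group element by a residue modulo `p`. -/
def zexp {M : Type} [Monoid M] {p : ℕ} (x : M) (a : ZMod p) : M := x ^ a.val

/-- `Z_p`. -/
abbrev BilinearGroup.Zp (𝔹 : BilinearGroup) : Type := ZMod 𝔹.p

/-- `Z_p^*`. -/
abbrev BilinearGroup.Zpu (𝔹 : BilinearGroup) : Type := (ZMod 𝔹.p)ˣ

/-! ## The machine model

Algorithms are non-uniform probabilistic straight-line programs (circuits) over a memory of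
registers.  Programs do not depend on the groups; every elementary operation has unit cost, decoding
a string costs its length.  Boolean gates, arithmetic modulo `p`, the group operations and access to
the bits of scalars and of encodings of group elements are available. -/

/-- Contents of a register. -/
inductive Val (𝔹 : BilinearGroup) : Type
  | bit (b : Bool)
  | scalar (x : 𝔹.Zp)
  | g (x : 𝔹.G)
  | gh (x : 𝔹.Gh)
  | gt (x : 𝔹.GT)

namespace Val

variable {𝔹 : BilinearGroup}

def toBit : Val 𝔹 → Bool
  | bit b => b
  | _ => false

def toScalar : Val 𝔹 → 𝔹.Zp
  | scalar x => x
  | _ => 0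

/-- Multiplication in whichever of the three groups both arguments lie. -/
def mul : Val 𝔹 → Val 𝔹 → Val 𝔹
  | g x, g y => g (x * y)
  | gh x, gh y => gh (x * y)
  | gt x, gt y => gt (x * y)
  | _, _ => bit false

/-- Exponentiation by a scalar in any of the three groups. -/
def pow : Val 𝔹 → Val 𝔹 → Val 𝔹
  | g x, scalar a => g (zexp x a)
  | gh x, scalar a => gh (zexp x a)
  | gt x, scalar a => gt (zexp x a)
  | _, _ => bit false

def pair : Val 𝔹 → Val 𝔹 → Val 𝔹
  | g x, gh y => gt (𝔹.e x y)
  | _, _ => bit false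

/-- The bit string representing a value. -/
def encode : Val 𝔹 → List Bool
  | bit b => [b]
  | scalar x => Nat.bits x.val
  | g x => 𝔹.encG x
  | gh x => 𝔹.encGh x
  | gt x => 𝔹.encGT x

open Classical in
def decodeG (l : List Bool) : Val 𝔹 :=
  if h : ∃ x, 𝔹.encG x = l then g h.choose else bit false

open Classical in
def decodeGh (l : List Bool) : Val 𝔹 :=
  if h : ∃ x, 𝔹.encGh x = l then gh h.choose else bit false

open Classical in
def decodeGT (l : List Bool) : Val 𝔹 :=
  if h : ∃ x, 𝔹.encGT x = l then gt h.choose else bit false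

end Val

/-- The memory: infinitely many registers. -/
abbrev Mem (𝔹 : BilinearGroup) : Type := ℕ → Val 𝔹

/-- The memory with all registers empty. -/
def Mem.empty (𝔹 : BilinearGroup) : Mem 𝔹 := fun _ => Val.bit false

/-- Write a list of values in consecutive registers, starting at `base`. -/
def Mem.write {𝔹 : BilinearGroup} (m : Mem 𝔹) (base : ℕ) (vs : List (Val 𝔹)) : Mem 𝔹 :=
  fun r => if base ≤ r then (vs[r - base]?).getD (m r) else m r

/-- Local instructions.  The first argument is the register that receives the result; the other
arguments are source registers, except for the bit of `bit`, the number `k` of `lit`, the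
position `i` of `getBit` and the length `len` of the decoding instructions. -/
inductive Instr : Type
  | bit (dst : ℕ) (b : Bool)
  | nand (dst a b : ℕ)
  | select (dst c a b : ℕ)
  | isEq (dst a b : ℕ)
  | lit (dst k : ℕ)
  | sadd (dst a b : ℕ)
  | smul (dst a b : ℕ)
  | sinv (dst a : ℕ)
  | genG (dst : ℕ)
  | genGh (dst : ℕ)
  | mul (dst a b : ℕ)
  | pow (dst a b : ℕ)
  | pair (dst a b : ℕ)
  | getBit (dst a i : ℕ)
  | decG (dst base len : ℕ)
  | decGh (dst base len : ℕ)
  | decGT (dst base len : ℕ)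
  | rndBit (dst : ℕ)
  | rndScalar (dst : ℕ)
  | rndUnit (dst : ℕ)

namespace Instr

def cost : Instr → ℕ
  | decG _ _ len => len + 1
  | decGh _ _ len => len + 1
  | decGT _ _ len => len + 1
  | _ => 1

/-- The bits in `len` consecutive registers. -/
def readBits {𝔹 : BilinearGroup} (m : Mem 𝔹) (base len : ℕ) : List Bool :=
  (List.range len).map fun i => (m (base + i)).toBit

open Classical in
/-- Execution of one local instruction. -/
def exec {𝔹 : BilinearGroup} : Instr → Mem 𝔹 → PMF (Mem 𝔹)
  | bit d b, m => PMF.pure (m.write d [.bit b])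
  | nand d a b, m => PMF.pure (m.write d [.bit !((m a).toBit && (m b).toBit)])
  | select d c a b, m => PMF.pure (m.write d [if (m c).toBit then m a else m b])
  | isEq d a b, m => PMF.pure (m.write d [.bit (decide (m a = m b))])
  | lit d k, m => PMF.pure (m.write d [.scalar (k : 𝔹.Zp)])
  | sadd d a b, m => PMF.pure (m.write d [.scalar ((m a).toScalar + (m b).toScalar)])
  | smul d a b, m => PMF.pure (m.write d [.scalar ((m a).toScalar * (m b).toScalar)])
  | sinv d a, m => PMF.pure (m.write d [.scalar ((m a).toScalar)⁻¹])
  | genG d, m => PMF.pure (m.write d [.g 𝔹.g])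
  | genGh d, m => PMF.pure (m.write d [.gh 𝔹.gh])
  | mul d a b, m => PMF.pure (m.write d [(m a).mul (m b)])
  | pow d a b, m => PMF.pure (m.write d [(m a).pow (m b)])
  | pair d a b, m => PMF.pure (m.write d [(m a).pair (m b)])
  | getBit d a i, m => PMF.pure (m.write d [.bit (((m a).encode[i]?).getD false)])
  | decG d base len, m => PMF.pure (m.write d [Val.decodeG (readBits m base len)])
  | decGh d base len, m => PMF.pure (m.write d [Val.decodeGh (readBits m base len)])
  | decGT d base len, m => PMF.pure (m.write d [Val.decodeGT (readBits m base len)])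
  | rndBit d, m => (PMF.uniformOfFintype Bool).map fun b => m.write d [.bit b]
  | rndScalar d, m => (PMF.uniformOfFintype 𝔹.Zp).map fun x => m.write d [.scalar x]
  | rndUnit d, m =>
      (PMF.uniformOfFintype 𝔹.Zpu).map fun x => m.write d [.scalar (x : 𝔹.Zp)]

end Instr

/-- Execution of a straight-line program. -/
def runInstrs {𝔹 : BilinearGroup} : List Instr → Mem 𝔹 → PMF (Mem 𝔹)
  | [], m => PMF.pure m
  | i :: is, m => (i.exec m).bind (runInstrs is)

/-- Running time of a straight-line program. -/
def instrTime (B : List Instr) : ℕ := (B.map Instr.cost).sum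

/-! ## Asymptotics -/

def PolyBounded (f : ℕ → ℕ) : Prop := ∃ P : Polynomial ℕ, ∀ ϱ, f ϱ ≤ P.eval ϱ

def Negligible (f : ℕ → ℝ) : Prop :=
  Asymptotics.SuperpolynomialDecay Filter.atTop (fun ϱ : ℕ => (ϱ : ℝ)) f

def NonNegligible (f : ℕ → ℝ) : Prop := ¬ Negligible f

/-- Probability of an event. -/
def prob {α : Type} (μ : PMF α) (s : Set α) : ℝ := (μ.toOuterMeasure s).toReal

/-! ## Complexity assumptions -/

/-- The tuple `(g, g^b, g^{ab}, g^c, ĝ, ĝ^a, ĝ^b, g^z)`. -/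
def pbdhTuple (𝔹 : BilinearGroup) (a b c z : 𝔹.Zp) : List (Val 𝔹) :=
  [.g 𝔹.g, .g (zexp 𝔹.g b), .g (zexp 𝔹.g (a * b)), .g (zexp 𝔹.g c),
    .gh 𝔹.gh, .gh (zexp 𝔹.gh a), .gh (zexp 𝔹.gh b), .g (zexp 𝔹.g z)]

/-- The tuple `(g, ĝ, ĝ^a, ĝ^b, ĝ^z)`. -/
def ddhTuple (𝔹 : BilinearGroup) (a b z : 𝔹.Zp) : List (Val 𝔹) :=
  [.g 𝔹.g, .gh 𝔹.gh, .gh (zexp 𝔹.gh a), .gh (zexp 𝔹.gh b), .gh (zexp 𝔹.gh z)]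

/-- `z = abc` in the first distribution (`real`), `z` uniform in the second one. -/
def pbdhDist (𝔹 : BilinearGroup) (real : Bool) : PMF (List (Val 𝔹)) :=
  (PMF.uniformOfFintype (𝔹.Zp × 𝔹.Zp × 𝔹.Zp × 𝔹.Zp)).map fun x =>
    pbdhTuple 𝔹 x.1 x.2.1 x.2.2.1 (if real then x.1 * x.2.1 * x.2.2.1 else x.2.2.2)

/-- `z = ab` in the first distribution (`real`), `z` uniform in the second one. -/
def ddhDist (𝔹 : BilinearGroup) (real : Bool) : PMF (List (Val 𝔹)) :=
  (PMF.uniformOfFintype (𝔹.Zp × 𝔹.Zp × 𝔹.Zp)).map fun x =>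
    ddhTuple 𝔹 x.1 x.2.1 (if real then x.1 * x.2.1 else x.2.2)

/-- Output bit (register `0`) of a program whose input tuple, drawn from `dist`, is loaded in the
registers `0, 1, …`; the groups are generated by `gen`. -/
def distinguish (gen : PMF BilinearGroup) (dist : ∀ 𝔹, PMF (List (Val 𝔹))) (B : List Instr) :
    PMF Bool :=
  gen.bind fun 𝔹 => (dist 𝔹).bind fun x =>
    (runInstrs B ((Mem.empty 𝔹).write 0 x)).map fun m => (m 0).toBit

def advPBDH1 (gen : PMF BilinearGroup) (B : List Instr) : ℝ :=
  |prob (distinguish gen (fun 𝔹 => pbdhDist 𝔹 true) B) {true} -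
    prob (distinguish gen (fun 𝔹 => pbdhDist 𝔹 false) B) {true}|

def advDDH2 (gen : PMF BilinearGroup) (B : List Instr) : ℝ :=
  |prob (distinguish gen (fun 𝔹 => ddhDist 𝔹 true) B) {true} -
    prob (distinguish gen (fun 𝔹 => ddhDist 𝔹 false) B) {true}|

def PBDH1Assumption (gen : ℕ → PMF BilinearGroup) : Prop :=
  ∀ B : ℕ → List Instr, PolyBounded (fun ϱ => instrTime (B ϱ)) →
    Negligible fun ϱ => advPBDH1 (gen ϱ) (B ϱ)

def DDH2Assumption (gen : ℕ → PMF BilinearGroup) : Prop :=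
  ∀ B : ℕ → List Instr, PolyBounded (fun ϱ => instrTime (B ϱ)) →
    Negligible fun ϱ => advDDH2 (gen ϱ) (B ϱ)

/-! ## Hierarchical identity-based trapdoor functions -/

/-- The algorithms of a HIB-TDF over fixed groups.  Identities are non-empty lists of at most `depth`
elements of `Comp`.  The last fields fix how keys are presented to an algorithm (as lists of register
contents) and how an identity component is read from a register (`none`: no component);
`dflt` only serves to give a meaning to a malformed choice of a target identity. -/
structure HIBTDF (𝔹 : BilinearGroup) where
  depth : ℕ
  Comp : Type
  Inp : Type
  Out : Type
  MPK : Type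
  MSK : Type
  SK : Type
  mkg : PMF (MPK × MSK)
  kg : MSK → List Comp → PMF SK
  del : MPK → List Comp → SK → Comp → PMF SK
  eval : MPK → List Comp → Inp → Out
  inv : MPK → List Comp → SK → Out → Inp
  wireMPK : MPK → List (Val 𝔹)
  wireSK : SK → List (Val 𝔹)
  readComp : Val 𝔹 → Option Comp
  dflt : Comp

/-- A sibling has its own master key generation, which takes an identity as auxiliary input, and its
own key generation; all other algorithms are shared. -/
structure Sibling {𝔹 : BilinearGroup} (S : HIBTDF 𝔹) where
  mkg : List S.Comp → PMF (S.MPK × S.MSK)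
  kg : S.MSK → List S.Comp → PMF S.SK

/-- A pre-output stage: input `ζ, mpk₁, msk₁, IS, id*`. -/
abbrev PreOutput {𝔹 : BilinearGroup} (S : HIBTDF 𝔹) : Type :=
  ℝ → S.MPK → S.MSK → List (List S.Comp) → List S.Comp → PMF Bool

/-- The trivial pre-output stage, which always outputs `1`. -/
def trivialPreOutput {𝔹 : BilinearGroup} (S : HIBTDF 𝔹) : PreOutput S :=
  fun _ _ _ _ _ => PMF.pure true

/-- `λ(f) = log₂ (|Dom f| / |Im f|)`. -/
def lossiness {α β : Type} (f : α → β) : ℝ :=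
  Real.logb 2 ((Nat.card α : ℝ) / (Nat.card (Set.range f) : ℝ))

/-- The identity in the `depth` consecutive registers starting at `base`: the components up to the
first register that does not hold one. -/
def HIBTDF.readId {𝔹 : BilinearGroup} (S : HIBTDF 𝔹) (m : Mem 𝔹) (base : ℕ) : List S.Comp :=
  (((List.range S.depth).map fun i => S.readComp (m (base + i))).takeWhile
    Option.isSome).reduceOption

/-- The target identity chosen by the adversary (a malformed choice is replaced by `[dflt]`). -/
def HIBTDF.readTarget {𝔹 : BilinearGroup} (S : HIBTDF 𝔹) (m : Mem 𝔹) (base : ℕ) : List S.Comp :=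
  match S.readId m base with
  | [] => [S.dflt]
  | id => id

/-! ## Selective-identity adversaries and the two experiments -/

/-- Commands of an adversary: local instructions and oracle queries.  A query is made only if the
bit in register `flag` is `1`; identities and components are read from registers `id`, `x`;
the answer to a reveal query is written from register `dst` on. -/
inductive Cmd : Type
  | loc (i : Instr)
  | createKey (flag id : ℕ)
  | createDelegatedKey (flag id x : ℕ)
  | revealKey (flag id dst : ℕ)

namespace Cmd

def cost : Cmd → ℕ
  | loc i => i.cost
  | _ => 1

def isQuery : Cmd → Bool
  | loc _ => false
  | _ => true

end Cmd

/-- A selective-identity adversary: `choose` leaves the target identity in the registers from `0`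
on; then the master public key is written in the registers from `0` on, `attack` is run, and the
output bit is found in register `0`. -/
structure Adversary where
  choose : List Instr
  attack : List Cmd

/-- Running time of an adversary. -/
def Adversary.time (A : Adversary) : ℕ := instrTime A.choose + (A.attack.map Cmd.cost).sum

/-- Number of oracle-query gates of an adversary (of all three kinds). -/
def Adversary.queries (A : Adversary) : ℕ := A.attack.countP Cmd.isQuery

/-- State of an experiment: memory of the adversary, created keys (the list `QS` with the keys, last
one first), the list `IS` of revealed identities, number of reveal queries made. -/
structure GameState {𝔹 : BilinearGroup} (S : HIBTDF 𝔹) where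
  mem : Mem 𝔹
  keys : List (List S.Comp × S.SK)
  revealed : List (List S.Comp)
  reveals : ℕ

open Classical in
/-- The last key that was created for an identity, if any. -/
def lookupKey {C K : Type} (keys : List (List C × K)) (id : List C) : Option K :=
  (keys.find? fun e => decide (e.1 = id)).map Prod.snd

open Classical in
/-- Execution of a command against a challenger with key generation `kg`, delegation `del` and
target identity `target`.  Revealing a key for a prefix of the target is refused (`⊥`). -/
def Cmd.exec {𝔹 : BilinearGroup} (S : HIBTDF 𝔹) (kg : List S.Comp → PMF S.SK)
    (del : List S.Comp → S.SK → S.Comp → PMF S.SK) (target : List S.Comp) :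
    Cmd → GameState S → PMF (GameState S)
  | loc i, st => (i.exec st.mem).map fun m => { st with mem := m }
  | createKey flag r, st =>
      let id := S.readId st.mem r
      if (st.mem flag).toBit = true ∧ id ≠ [] then
        (kg id).map fun sk => { st with keys := (id, sk) :: st.keys }
      else PMF.pure st
  | createDelegatedKey flag r x, st =>
      let id := S.readId st.mem r
      match lookupKey st.keys id, S.readComp (st.mem x) with
      | some sk, some c =>
          if (st.mem flag).toBit = true ∧ id.length < S.depth then
            (del id sk c).map fun sk' => { st with keys := (id ++ [c], sk') :: st.keys }
          else PMF.pure st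
      | _, _ => PMF.pure st
  | revealKey flag r dst, st =>
      let id := S.readId st.mem r
      if (st.mem flag).toBit = true then
        match lookupKey st.keys id with
        | some sk =>
            if id <+: target then
              PMF.pure { st with mem := st.mem.write dst [.bit false], reveals := st.reveals + 1 }
            else
              PMF.pure { st with
                mem := st.mem.write dst (.bit true :: S.wireSK sk)
                revealed := id :: st.revealed
                reveals := st.reveals + 1 }
        | none =>
            PMF.pure { st with mem := st.mem.write dst [.bit false], reveals := st.reveals + 1 }
      else PMF.pure st

/-- Execution of a list of commands. -/
def runCmds {𝔹 : BilinearGroup} (S : HIBTDF 𝔹) (kg : List S.Comp → PMF S.SK)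
    (del : List S.Comp → S.SK → S.Comp → PMF S.SK) (target : List S.Comp) :
    List Cmd → GameState S → PMF (GameState S)
  | [], st => PMF.pure st
  | c :: cs, st => (c.exec S kg del target st).bind (runCmds S kg del target cs)

/-- Result of an experiment: the bits `d_A` and `d_{¬abort}`, and the number of reveal queries. -/
structure Outcome where
  dA : Bool
  notAbort : Bool
  reveals : ℕ

open Classical in
/-- The experiment `REAL` (`lossy = false`) or `LOSSY` (`lossy = true`) over fixed groups. -/
def experimentAt {𝔹 : BilinearGroup} (S : HIBTDF 𝔹) (L : Sibling S) (P : PreOutput S)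
    (ω ζ : ℝ) (A : Adversary) (lossy : Bool) : PMF Outcome :=
  (runInstrs A.choose (Mem.empty 𝔹)).bind fun m =>
  let target := S.readTarget m 0
  S.mkg.bind fun k₀ =>
  (L.mkg target).bind fun k₁ =>
  let mpk := if lossy then k₁.1 else k₀.1
  let kg := if lossy then L.kg k₁.2 else S.kg k₀.2
  (runCmds S kg (S.del mpk) target A.attack
    { mem := m.write 0 (S.wireMPK mpk), keys := [], revealed := [], reveals := 0 }).bind fun st =>
  let d₁ : Prop := (∀ id ∈ st.revealed, lossiness (S.eval k₁.1 id) = 0) ∧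
    ω ≤ lossiness (S.eval k₁.1 target)
  (P ζ k₁.1 k₁.2 st.revealed target).map fun d₂ =>
    { dA := (st.mem 0).toBit, notAbort := decide d₁ && d₂, reveals := st.reveals }

/-- The experiments, including the generation of the groups. -/
def experiment (gen : PMF BilinearGroup) (S : ∀ 𝔹, HIBTDF 𝔹) (L : ∀ 𝔹, Sibling (S 𝔹))
    (P : ∀ 𝔹, PreOutput (S 𝔹)) (ω : BilinearGroup → ℝ) (ζ : ℝ) (A : Adversary) (lossy : Bool) :
    PMF Outcome :=
  gen.bind fun 𝔹 => experimentAt (S 𝔹) (L 𝔹) (P 𝔹) (ω 𝔹) ζ A lossy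

/-- `|Pr[d_A ∧ d_{¬abort} = 1 | REAL] - Pr[d_A ∧ d_{¬abort} = 1 | LOSSY]|`. -/
def advLossy (gen : PMF BilinearGroup) (S : ∀ 𝔹, HIBTDF 𝔹) (L : ∀ 𝔹, Sibling (S 𝔹))
    (P : ∀ 𝔹, PreOutput (S 𝔹)) (ω : BilinearGroup → ℝ) (ζ : ℝ) (A : Adversary) : ℝ :=
  |prob (experiment gen S L P ω ζ A false) {o | o.dA = true ∧ o.notAbort = true} -
    prob (experiment gen S L P ω ζ A true) {o | o.dA = true ∧ o.notAbort = true}|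

/-- In both experiments the adversary makes at most `q` reveal queries. -/
def RevealsAtMost (gen : PMF BilinearGroup) (S : ∀ 𝔹, HIBTDF 𝔹) (L : ∀ 𝔹, Sibling (S 𝔹))
    (P : ∀ 𝔹, PreOutput (S 𝔹)) (ω : BilinearGroup → ℝ) (ζ : ℝ) (A : Adversary) (q : ℕ) : Prop :=
  ∀ lossy, ∀ o ∈ (experiment gen S L P ω ζ A lossy).support, o.reveals ≤ q

/-- `(ω, δ)`-partial lossiness against selective-identity adversaries of a HIB-TDF, with the sibling
`L` and the pre-output stage `P`. -/
def PartiallyLossy (gen : ℕ → PMF BilinearGroup) (S : ℕ → ∀ 𝔹, HIBTDF 𝔹)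
    (L : ∀ ϱ 𝔹, Sibling (S ϱ 𝔹)) (P : ∀ ϱ 𝔹, PreOutput (S ϱ 𝔹))
    (ω : ℕ → BilinearGroup → ℝ) (δ : ℕ → ℝ) : Prop :=
  ∀ A : ℕ → Adversary, PolyBounded (fun ϱ => (A ϱ).time) →
  ∀ ζ : ℕ → ℝ, (∀ ϱ, ζ ϱ ∈ Set.Ioo (0 : ℝ) 1) → NonNegligible ζ →
  ∃ ε₁ ε₂ : ℕ → ℝ, NonNegligible ε₁ ∧ NonNegligible ε₂ ∧ (∀ ϱ, δ ϱ = ε₁ ϱ * ε₂ ϱ) ∧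
    Negligible (fun ϱ => advLossy (gen ϱ) (S ϱ) (L ϱ) (P ϱ) (ω ϱ) (ζ ϱ) (A ϱ)) ∧
    ∀ ϱ,
      let real := experiment (gen ϱ) (S ϱ) (L ϱ) (P ϱ) (ω ϱ) (ζ ϱ) (A ϱ) false
      ε₁ ϱ ≤ prob real {o | o.notAbort = true} ∧
      (ζ ϱ < prob real {o | o.dA = true} - 1 / 2 →
        ε₂ ϱ * ζ ϱ < prob real {o | o.dA = true ∧ o.notAbort = true} /
          prob real {o | o.notAbort = true} - 1 / 2)

/-! ## The construction -/

section Construction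

variable {𝔹 : BilinearGroup}

structure MasterPublicKey (𝔹 : BilinearGroup) (d μ n : ℕ) where
  v : 𝔹.G
  w : Fin n → 𝔹.G
  /-- `h i₁ i₂ l₁`, with `i₂ = 0, …, μ` -/
  h : Fin d → Fin (μ + 1) → Fin n → 𝔹.G
  /-- `J l₂` -/
  J : Fin n → 𝔹.G
  /-- `Cw l₂ l₁` -/
  Cw : Fin n → Fin n → 𝔹.G
  /-- `C i₁ i₂ l₂ l₁`, with `i₂ = 1, …, μ` -/
  C : Fin d → Fin μ → Fin n → Fin n → 𝔹.G

structure MasterSecretKey (𝔹 : BilinearGroup) (d μ n : ℕ) where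
  vh : 𝔹.Gh
  wh : Fin n → 𝔹.Gh
  hh : Fin d → Fin (μ + 1) → Fin n → 𝔹.Gh

/-- A private key for an identity of level `ℓ`; the components `D i₁` with `i₁ > ℓ`, as well as the
delegation components `K, L, L', Lw` with `j ≤ ℓ` or with `i₁ > ℓ`, which are not part of the key,
are set to `1`. -/
structure PrivateKey (𝔹 : BilinearGroup) (d μ n : ℕ) where
  D : Fin n → 𝔹.Gh
  Dw : Fin n → 𝔹.Gh
  /-- `Di i₁ l₁` -/
  Di : Fin d → Fin n → 𝔹.Gh
  /-- `K j k l₁` -/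
  K : Fin d → Fin μ → Fin n → 𝔹.Gh
  /-- `L j l₁` -/
  L : Fin d → Fin n → 𝔹.Gh
  /-- `L' j k i₁ l₁` -/
  L' : Fin d → Fin μ → Fin d → Fin n → 𝔹.Gh
  /-- `Lw j k l₁` -/
  Lw : Fin d → Fin μ → Fin n → 𝔹.Gh

def listOf {α : Type} {m : ℕ} (f : Fin m → List α) : List α := (List.ofFn f).flatten

def MasterPublicKey.wire {d μ n : ℕ} (k : MasterPublicKey 𝔹 d μ n) : List (Val 𝔹) :=
  [.g k.v] ++ (listOf fun l => [.g (k.w l)]) ++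
    (listOf fun i => listOf fun i₂ => listOf fun l => [.g (k.h i i₂ l)]) ++
    (listOf fun l => [.g (k.J l)]) ++ (listOf fun l₂ => listOf fun l₁ => [.g (k.Cw l₂ l₁)]) ++
    (listOf fun i => listOf fun i₂ => listOf fun l₂ => listOf fun l₁ => [.g (k.C i i₂ l₂ l₁)])

def PrivateKey.wire {d μ n : ℕ} (k : PrivateKey 𝔹 d μ n) : List (Val 𝔹) :=
  (listOf fun l => [.gh (k.D l)]) ++ (listOf fun l => [.gh (k.Dw l)]) ++
    (listOf fun i => listOf fun l => [.gh (k.Di i l)]) ++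
    (listOf fun j => listOf fun a => listOf fun l => [.gh (k.K j a l)]) ++
    (listOf fun j => listOf fun l => [.gh (k.L j l)]) ++
    (listOf fun j => listOf fun a => listOf fun i => listOf fun l => [.gh (k.L' j a i l)]) ++
    (listOf fun j => listOf fun a => listOf fun l => [.gh (k.Lw j a l)])

/-- Random exponents `α_v, α_w, α_h, s` of the master key generation. -/
abbrev MKgCoins (𝔹 : BilinearGroup) (d μ n : ℕ) : Type :=
  𝔹.Zpu × (Fin n → 𝔹.Zpu) × (Fin d → Fin (μ + 1) → Fin n → 𝔹.Zpu) × (Fin n → 𝔹.Zpu)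

/-- Master key generation for the auxiliary input `y` and given random exponents. -/
def masterKeys {d μ n : ℕ} (y : Fin d → Fin μ → 𝔹.Zp) (ρ : MKgCoins 𝔹 d μ n) :
    MasterPublicKey 𝔹 d μ n × MasterSecretKey 𝔹 d μ n :=
  let αv := ρ.1
  let αw := ρ.2.1
  let αh := ρ.2.2.1
  let s := ρ.2.2.2
  let v : 𝔹.G := zexp 𝔹.g αv.val
  let w : Fin n → 𝔹.G := fun l₁ => zexp 𝔹.g (αw l₁).val
  let h : Fin d → Fin (μ + 1) → Fin n → 𝔹.G := fun i₁ i₂ l₁ => zexp 𝔹.g (αh i₁ i₂ l₁).val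
  ({ v := v
     w := w
     h := h
     J := fun l₂ => zexp v (s l₂).val
     Cw := fun l₂ l₁ => zexp (w l₁) (s l₂).val
     C := fun i₁ i₂ l₂ l₁ =>
       zexp (zexp (h i₁ 0 l₁) (if l₂ = l₁ then y i₁ i₂ else 0) * h i₁ i₂.succ l₁) (s l₂).val },
   { vh := zexp 𝔹.gh αv.val
     wh := fun l₁ => zexp 𝔹.gh (αw l₁).val
     hh := fun i₁ i₂ l₁ => zexp 𝔹.gh (αh i₁ i₂ l₁).val })

/-- Master key generation with auxiliary input `y`. -/
def extMKg {d μ n : ℕ} (y : Fin d → Fin μ → 𝔹.Zp) :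
    PMF (MasterPublicKey 𝔹 d μ n × MasterSecretKey 𝔹 d μ n) :=
  (PMF.uniformOfFintype (MKgCoins 𝔹 d μ n)).map (masterKeys y)

/-- The random exponents `r_w, r_{i₁}, s, s', s_w` of the key generation, uniform in `Z_p^*`. -/
abbrev KgCoins (𝔹 : BilinearGroup) (d μ n : ℕ) : Type :=
  (Fin n → 𝔹.Zpu) × (Fin d → Fin n → 𝔹.Zpu) × (Fin d → Fin μ → Fin d → Fin n → 𝔹.Zpu) ×
    (Fin d → Fin n → 𝔹.Zpu) × (Fin d → Fin μ → Fin n → 𝔹.Zpu)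

/-- The `i`-th component of an identity (the zero vector beyond its length). -/
def idComp {μ : ℕ} (id : List (Fin μ → 𝔹.Zp)) (i : ℕ) : Fin μ → 𝔹.Zp := id.getD i 0

/-- Key generation with given random exponents. -/
def keyOf {d μ n : ℕ} (msk : MasterSecretKey 𝔹 d μ n) (id : List (Fin μ → 𝔹.Zp))
    (ρ : KgCoins 𝔹 d μ n) : PrivateKey 𝔹 d μ n :=
  let rw' := ρ.1
  let r := ρ.2.1
  let s := ρ.2.2.1
  let s' := ρ.2.2.2.1
  let sw := ρ.2.2.2.2
  let ℓ := id.length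
  let F : Fin d → Fin n → 𝔹.Gh := fun i₁ l₁ =>
    ∏ i₂ : Fin μ, zexp (msk.hh i₁ i₂.succ l₁) (idComp id i₁ i₂)
  { D := fun l₁ => (∏ i₁ : Fin d, if i₁.val < ℓ then zexp (F i₁ l₁) (r i₁ l₁).val else 1) *
      zexp (msk.wh l₁) (rw' l₁).val
    Dw := fun l₁ => zexp msk.vh (rw' l₁).val
    Di := fun i₁ l₁ => if i₁.val < ℓ then zexp msk.vh (r i₁ l₁).val else 1
    K := fun j k l₁ => if ℓ ≤ j.val then
      (∏ i₁ : Fin d, if i₁.val < ℓ then zexp (F i₁ l₁) (s j k i₁ l₁).val else 1) *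
        zexp (msk.hh j k.succ l₁) (s' j l₁).val * zexp (msk.wh l₁) (sw j k l₁).val else 1
    L := fun j l₁ => if ℓ ≤ j.val then zexp msk.vh (s' j l₁).val else 1
    L' := fun j k i₁ l₁ =>
      if ℓ ≤ j.val ∧ i₁.val < ℓ then zexp msk.vh (s j k i₁ l₁).val else 1
    Lw := fun j k l₁ => if ℓ ≤ j.val then zexp msk.vh (sw j k l₁).val else 1 }

set_option synthInstance.maxSize 1024 in
set_option synthInstance.maxHeartbeats 200000 in
/-- Key generation. -/
def hfKg {d μ n : ℕ} (msk : MasterSecretKey 𝔹 d μ n) (id : List (Fin μ → 𝔹.Zp)) :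
    PMF (PrivateKey 𝔹 d μ n) :=
  (PMF.uniformOfFintype (KgCoins 𝔹 d μ n)).map (keyOf msk id)

/-- The random exponents `z, τ_{j,k}` of the delegation, for each `l₁`. -/
abbrev DelCoins (𝔹 : BilinearGroup) (d μ n : ℕ) : Type :=
  (Fin n → 𝔹.Zpu) × (Fin d → Fin μ → Fin n → 𝔹.Zpu)

/-- Delegation, with given random exponents, from an identity to the child with last component `x`,
which is on level `m` (counted from `0`). -/
def delegateKey {d μ n : ℕ} (m : Fin d) (sk : PrivateKey 𝔹 d μ n) (x : Fin μ → 𝔹.Zp)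
    (ρ : DelCoins 𝔹 d μ n) : PrivateKey 𝔹 d μ n :=
  let z := ρ.1
  let τ := ρ.2
  -- step 1: randomized delegation component
  let Kh : Fin d → Fin μ → Fin n → 𝔹.Gh := fun j k l₁ => zexp (sk.K j k l₁) (z l₁).val
  let Lh : Fin d → Fin n → 𝔹.Gh := fun j l₁ => zexp (sk.L j l₁) (z l₁).val
  let Lh' : Fin d → Fin μ → Fin d → Fin n → 𝔹.Gh := fun j k i₁ l₁ =>
    zexp (sk.L' j k i₁ l₁) (z l₁).val
  let Lwh : Fin d → Fin μ → Fin n → 𝔹.Gh := fun j k l₁ => zexp (sk.Lw j k l₁) (z l₁).val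
  -- step 2: partial decryption key
  let Kp : Fin n → 𝔹.Gh := fun l₁ => ∏ k : Fin μ, zexp (Kh m k l₁) (x k)
  let Lp : Fin d → Fin n → 𝔹.Gh := fun i₁ l₁ =>
    if i₁ = m then Lh m l₁ else ∏ k : Fin μ, zexp (Lh' m k i₁ l₁) (x k)
  let Lwp : Fin n → 𝔹.Gh := fun l₁ => ∏ k : Fin μ, zexp (Lwh m k l₁) (x k)
  -- steps 3 to 5
  { D := fun l₁ => sk.D l₁ * Kp l₁
    Dw := fun l₁ => sk.Dw l₁ * Lwp l₁
    Di := fun i₁ l₁ => sk.Di i₁ l₁ * Lp i₁ l₁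
    K := fun j k l₁ => if m < j then Kh j k l₁ * zexp (Kp l₁) (τ j k l₁).val else 1
    L := fun j l₁ => if m < j then Lh j l₁ else 1
    L' := fun j k i₁ l₁ =>
      if m < j then Lh' j k i₁ l₁ * zexp (Lp i₁ l₁) (τ j k l₁).val else 1
    Lw := fun j k l₁ => if m < j then Lwh j k l₁ * zexp (Lwp l₁) (τ j k l₁).val else 1 }

/-- Delegation (there is nothing to delegate below the last level). -/
def hfDel {d μ n : ℕ} (id : List (Fin μ → 𝔹.Zp)) (sk : PrivateKey 𝔹 d μ n)
    (x : Fin μ → 𝔹.Zp) : PMF (PrivateKey 𝔹 d μ n) :=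
  if h : id.length < d then
    (PMF.uniformOfFintype (DelCoins 𝔹 d μ n)).map (delegateKey ⟨id.length, h⟩ sk x)
  else PMF.pure sk

/-- Output of the evaluation: `C_{id,v}`, the `CT_{id,w}[l₁]` and the `CT_id[i₁,l₁]`; the
components with `i₁ > ℓ` are absent, that is, set to `1`. -/
abbrev EvalOut (𝔹 : BilinearGroup) (d n : ℕ) : Type :=
  𝔹.G × (Fin n → 𝔹.G) × (Fin d → Fin n → 𝔹.G)

/-- `x` if the bit is `1`, and the unit element otherwise. -/
def bitExp {M : Type} [Monoid M] (x : M) (b : Bool) : M := if b then x else 1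

/-- Evaluation on an `n`-bit input. -/
def hfEval {d μ n : ℕ} (mpk : MasterPublicKey 𝔹 d μ n) (id : List (Fin μ → 𝔹.Zp))
    (X : Fin n → Bool) : EvalOut 𝔹 d n :=
  let Cid : Fin d → Fin n → Fin n → 𝔹.G := fun i₁ l₂ l₁ =>
    ∏ i₂ : Fin μ, zexp (mpk.C i₁ i₂ l₂ l₁) (idComp id i₁ i₂)
  (∏ l₂ : Fin n, bitExp (mpk.J l₂) (X l₂),
    fun l₁ => ∏ l₂ : Fin n, bitExp (mpk.Cw l₂ l₁) (X l₂),
    fun i₁ l₁ => if i₁.val < id.length then ∏ l₂ : Fin n, bitExp (Cid i₁ l₂ l₁) (X l₂) else 1)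

open Classical in
/-- Inversion. -/
def hfInv {d μ n : ℕ} (id : List (Fin μ → 𝔹.Zp)) (sk : PrivateKey 𝔹 d μ n)
    (C : EvalOut 𝔹 d n) : Fin n → Bool :=
  fun l₁ => decide (¬ (𝔹.e C.1 (sk.D l₁) * (𝔹.e (C.2.1 l₁) (sk.Dw l₁))⁻¹ *
    ∏ i₁ : Fin d, (if i₁.val < id.length then (𝔹.e (C.2.2 i₁ l₁) (sk.Di i₁ l₁))⁻¹ else 1) = 1))

/-- The HIB-TDF with parameters `d, μ, n` and `Σ_ID` given by `vec : Comp → Z_p^μ`.  The auxiliary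
input of the injective setup is `y⁽⁰⁾`. -/
abbrev hf (d μ n : ℕ) {Comp : Type} (vec : Comp → Fin μ → 𝔹.Zp)
    (readComp : Val 𝔹 → Option Comp) (dflt : Comp) (y₀ : Fin d → Fin μ → 𝔹.Zp) : HIBTDF 𝔹 where
  depth := d
  Comp := Comp
  Inp := Fin n → Bool
  Out := EvalOut 𝔹 d n
  MPK := MasterPublicKey 𝔹 d μ n
  MSK := MasterSecretKey 𝔹 d μ n
  SK := PrivateKey 𝔹 d μ n
  mkg := extMKg y₀
  kg := fun msk id => hfKg msk (id.map vec)
  del := fun _ id sk x => hfDel (id.map vec) sk (vec x)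
  eval := fun mpk id X => hfEval mpk (id.map vec) X
  inv := fun _ id sk C => hfInv (id.map vec) sk C
  wireMPK := MasterPublicKey.wire
  wireSK := PrivateKey.wire
  readComp := readComp
  dflt := dflt

/-! ## The selective-identity variant: `μ = 2`, `Σ_ID = {(1, x) : x ∈ Z_p^*}` -/

/-- The identity component `(1, x)`. -/
def unitVec (x : 𝔹.Zpu) : Fin 2 → 𝔹.Zp := ![1, (x : 𝔹.Zp)]

open Classical in
/-- A component `(1, x)` is passed to the challenger as the non-zero scalar `x`. -/
def readUnit : Val 𝔹 → Option 𝔹.Zpu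
  | .scalar x => if h : x ≠ 0 then some (Units.mk0 x h) else none
  | _ => none

/-- `y⁽⁰⁾ = [(1,0) | … | (1,0)]`. -/
def auxInjective (𝔹 : BilinearGroup) (d : ℕ) : Fin d → Fin 2 → 𝔹.Zp := fun _ => ![1, 0]

/-- `y⁽¹⁾`: `(-id_i, 1)` on the levels of the given identity and `(1, 0)` below. -/
def auxLossy (d : ℕ) (id : List 𝔹.Zpu) : Fin d → Fin 2 → 𝔹.Zp := fun i =>
  match id[i.val]? with
  | some x => ![-(x : 𝔹.Zp), 1]
  | none => ![1, 0]

/-- The HIB-TDF in the selective setting. -/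
abbrev selHF (d n : ℕ) (𝔹 : BilinearGroup) : HIBTDF 𝔹 :=
  hf d 2 n unitVec readUnit 1 (auxInjective 𝔹 d)

/-- Its sibling. -/
abbrev selLHF (d n : ℕ) (𝔹 : BilinearGroup) : Sibling (selHF d n 𝔹) where
  mkg := fun id => extMKg (auxLossy d id)
  kg := (selHF d n 𝔹).kg

/-- `⟨s, X⟩`. -/
def innerBits {n : ℕ} (s : Fin n → 𝔹.Zpu) (X : Fin n → Bool) : 𝔹.Zp :=
  ∑ l : Fin n, if X l then (s l : 𝔹.Zp) else 0

end Construction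

end LossyHIB

end

open LossyHIB

set_option linter.unusedSimpArgs false
set_option linter.unusedVariables false
set_option linter.constructorNameAsVariable false

noncomputable section

namespace LossyHIB

/-! ## Exponents -/

section Exponents

variable {M : Type} [CommGroup M] {p : ℕ} [Fact p.Prime]

theorem zexp_zero (x : M) : zexp x (0 : ZMod p) = 1 := by simp [zexp]

theorem zexp_one (x : M) : zexp x (1 : ZMod p) = x := by
  have : Fact (1 < p) := ⟨(Fact.out : p.Prime).one_lt⟩
  simp [zexp, ZMod.val_one]

theorem zexp_add {x : M} (hx : x ^ p = 1) (a b : ZMod p) :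
    zexp x (a + b) = zexp x a * zexp x b := by
  rw [zexp, zexp, zexp, ZMod.val_add, ← pow_eq_pow_mod _ hx, pow_add]

theorem zexp_zexp {x : M} (hx : x ^ p = 1) (a b : ZMod p) :
    zexp (zexp x a) b = zexp x (a * b) := by
  rw [zexp, zexp, zexp, ZMod.val_mul, ← pow_eq_pow_mod _ hx, pow_mul]

theorem zexp_sum {x : M} (hx : x ^ p = 1) {ι : Type} (s : Finset ι) (f : ι → ZMod p) :
    zexp x (∑ i ∈ s, f i) = ∏ i ∈ s, zexp x (f i) := by
  classical
  induction s using Finset.induction_on with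
  | empty => simp [zexp_zero]
  | insert a s ha ih => rw [Finset.sum_insert ha, Finset.prod_insert ha, zexp_add hx, ih]

theorem zexp_injective {x : M} (hx : x ^ p = 1) (h1 : x ≠ 1) :
    Function.Injective (fun a : ZMod p => zexp x a) := by
  intro a b hab
  have ho : orderOf x = p := orderOf_eq_prime hx h1
  have := pow_inj_mod.1 (show x ^ a.val = x ^ b.val from hab)
  rw [ho, Nat.mod_eq_of_lt (ZMod.val_lt a), Nat.mod_eq_of_lt (ZMod.val_lt b)] at this
  exact ZMod.val_injective p this

end Exponents

namespace BilinearGroup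

variable (𝔹 : BilinearGroup)

theorem pow_p_G (x : 𝔹.G) : x ^ 𝔹.p = 1 := by
  rw [← 𝔹.card_G]; exact pow_card_eq_one'

theorem pow_p_Gh (x : 𝔹.Gh) : x ^ 𝔹.p = 1 := by
  rw [← 𝔹.card_Gh]; exact pow_card_eq_one'

theorem g_ne_one : 𝔹.g ≠ 1 := fun h => 𝔹.nondegenerate (by rw [h]; simp)

theorem gh_ne_one : 𝔹.gh ≠ 1 := fun h => 𝔹.nondegenerate (by rw [h]; simp)

theorem zexp_g_inj {a b : 𝔹.Zp} : zexp 𝔹.g a = zexp 𝔹.g b ↔ a = b :=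
  (zexp_injective (𝔹.pow_p_G _) 𝔹.g_ne_one).eq_iff

theorem zexp_gh_inj {a b : 𝔹.Zp} : zexp 𝔹.gh a = zexp 𝔹.gh b ↔ a = b :=
  (zexp_injective (𝔹.pow_p_Gh _) 𝔹.gh_ne_one).eq_iff

end BilinearGroup

/-! ## Expectations -/

/-- Expectation of a real function. -/
def expec {α : Type*} (μ : PMF α) (f : α → ℝ) : ℝ := ∑' a, (μ a).toReal * f a

/-- Probability that a bit is `1`. -/
def pr (μ : PMF Bool) : ℝ := (μ true).toReal

section Expectation

variable {α : Type*} (μ : PMF α)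

theorem summable_toReal : Summable fun a => (μ a).toReal :=
  ENNReal.summable_toReal (by rw [μ.tsum_coe]; exact ENNReal.one_ne_top)

theorem tsum_toReal : ∑' a, (μ a).toReal = 1 := by
  rw [← ENNReal.tsum_toReal_eq (fun a => μ.apply_ne_top a), μ.tsum_coe, ENNReal.toReal_one]

variable {μ}

theorem expec_summable {f : α → ℝ} {C : ℝ} (h : ∀ a, |f a| ≤ C) :
    Summable fun a => (μ a).toReal * f a := by
  refine Summable.of_norm_bounded ((summable_toReal μ).mul_right C) fun a => ?_
  rw [Real.norm_eq_abs, abs_mul, abs_of_nonneg ENNReal.toReal_nonneg]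
  exact mul_le_mul_of_nonneg_left (h a) ENNReal.toReal_nonneg

theorem expec_const (c : ℝ) : expec μ (fun _ => c) = c := by
  rw [expec, tsum_mul_right, tsum_toReal, one_mul]

theorem expec_sub {f g : α → ℝ} {C D : ℝ} (hf : ∀ a, |f a| ≤ C) (hg : ∀ a, |g a| ≤ D) :
    expec μ (fun a => f a - g a) = expec μ f - expec μ g := by
  rw [expec, expec, expec, ← (expec_summable hf).tsum_sub (expec_summable hg)]
  simp only [mul_sub]

theorem expec_add {f g : α → ℝ} {C D : ℝ} (hf : ∀ a, |f a| ≤ C) (hg : ∀ a, |g a| ≤ D) :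
    expec μ (fun a => f a + g a) = expec μ f + expec μ g := by
  rw [expec, expec, expec, ← (expec_summable hf).tsum_add (expec_summable hg)]
  simp only [mul_add]

theorem expec_const_mul (c : ℝ) (f : α → ℝ) :
    expec μ (fun a => c * f a) = c * expec μ f := by
  rw [expec, expec, ← tsum_mul_left]
  exact tsum_congr fun a => by ring

theorem expec_congr {f g : α → ℝ} (h : ∀ a ∈ μ.support, f a = g a) : expec μ f = expec μ g := by
  refine tsum_congr fun a => ?_
  by_cases ha : a ∈ μ.support
  · rw [h a ha]
  · rw [PMF.mem_support_iff, not_not] at ha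
    simp [ha]

theorem expec_mono {f g : α → ℝ} {C D : ℝ} (hf : ∀ a, |f a| ≤ C) (hg : ∀ a, |g a| ≤ D)
    (h : ∀ a ∈ μ.support, f a ≤ g a) : expec μ f ≤ expec μ g := by
  refine (expec_summable hf).tsum_le_tsum (fun a => ?_) (expec_summable hg)
  by_cases ha : a ∈ μ.support
  · exact mul_le_mul_of_nonneg_left (h a ha) ENNReal.toReal_nonneg
  · rw [PMF.mem_support_iff, not_not] at ha
    simp [ha]

theorem abs_expec_sub_le {f g e : α → ℝ} {C D E : ℝ} (hf : ∀ a, |f a| ≤ C) (hg : ∀ a, |g a| ≤ D)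
    (he : ∀ a, |e a| ≤ E) (h : ∀ a ∈ μ.support, |f a - g a| ≤ e a) :
    |expec μ f - expec μ g| ≤ expec μ e := by
  have hfg : ∀ a, |f a - g a| ≤ C + D := fun a =>
    (abs_sub _ _).trans (add_le_add (hf a) (hg a))
  rw [← expec_sub hf hg, abs_le]
  constructor
  · have := expec_mono (μ := μ) (f := fun a => (-1 : ℝ) * e a) (g := fun a => f a - g a)
      (C := E) (by intro a; simpa [abs_mul] using he a) hfg
      (fun a ha => by have := (abs_le.1 (h a ha)).1; linarith)
    rw [expec_const_mul] at this
    linarith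
  · exact expec_mono hfg he fun a ha => (abs_le.1 (h a ha)).2

theorem pr_nonneg (ν : PMF Bool) : 0 ≤ pr ν := ENNReal.toReal_nonneg

theorem pr_le_one (ν : PMF Bool) : pr ν ≤ 1 :=
  ENNReal.toReal_le_of_le_ofReal zero_le_one (by simpa using ν.coe_le_one true)

theorem abs_pr_le (ν : PMF Bool) : |pr ν| ≤ 1 := by
  rw [abs_of_nonneg (pr_nonneg ν)]; exact pr_le_one ν

theorem abs_pr_sub_le (ν ν' : PMF Bool) : |pr ν - pr ν'| ≤ 1 := by
  rw [abs_le]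
  constructor <;> linarith [pr_nonneg ν, pr_le_one ν, pr_nonneg ν', pr_le_one ν']

theorem pr_pure (b : Bool) : pr (PMF.pure b) = if b then 1 else 0 := by
  cases b <;> simp [pr, PMF.pure_apply]

theorem pr_bind (F : α → PMF Bool) : pr (μ.bind F) = expec μ fun a => pr (F a) := by
  rw [pr, PMF.bind_apply, ENNReal.tsum_toReal_eq
    (fun a => ENNReal.mul_ne_top (μ.apply_ne_top a) ((F a).apply_ne_top true))]
  simp only [ENNReal.toReal_mul, expec, pr]

theorem expec_uniform {β : Type*} [Fintype β] [Nonempty β] (f : β → ℝ) :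
    expec (PMF.uniformOfFintype β) f = (∑ b, f b) / Fintype.card β := by
  rw [expec, tsum_fintype, Finset.sum_div]
  refine Finset.sum_congr rfl fun b _ => ?_
  rw [PMF.uniformOfFintype_apply, ENNReal.toReal_inv, ENNReal.toReal_natCast, inv_mul_eq_div]

/-! ## Closeness of distributions -/

/-- No test distinguishes the two distributions with advantage more than `ε`. -/
def Close {β : Type*} (ε : ℝ) (ν ν' : PMF β) : Prop :=
  ∀ F : β → PMF Bool, |pr (ν.bind F) - pr (ν'.bind F)| ≤ ε

theorem Close.refl {β : Type*} (ν : PMF β) : Close 0 ν ν := fun F => by simp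

theorem Close.of_eq {β : Type*} {ν ν' : PMF β} (h : ν = ν') : Close 0 ν ν' := h ▸ Close.refl ν

theorem Close.mono {β : Type*} {ε ε' : ℝ} {ν ν' : PMF β} (h : Close ε ν ν') (he : ε ≤ ε') :
    Close ε' ν ν' := fun F => (h F).trans he

theorem Close.symm {β : Type*} {ε : ℝ} {ν ν' : PMF β} (h : Close ε ν ν') : Close ε ν' ν :=
  fun F => by rw [abs_sub_comm]; exact h F

theorem Close.trans {β : Type*} {ε ε' : ℝ} {ν ν' ν'' : PMF β} (h : Close ε ν ν')
    (h' : Close ε' ν' ν'') : Close (ε + ε') ν ν'' := fun F =>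
  (abs_sub_le _ _ _).trans (add_le_add (h F) (h' F))

theorem Close.bind_left {β γ : Type*} {ε : ℝ} {ν ν' : PMF β} (h : Close ε ν ν')
    (G : β → PMF γ) : Close ε (ν.bind G) (ν'.bind G) := fun F => by
  rw [PMF.bind_bind, PMF.bind_bind]; exact h _

theorem Close.map {β γ : Type*} {ε : ℝ} {ν ν' : PMF β} (h : Close ε ν ν')
    (G : β → γ) : Close ε (ν.map G) (ν'.map G) := h.bind_left _

theorem Close.bind_right {β γ : Type*} {ε : ℝ} (ν : PMF β)
    {G H : β → PMF γ} (h : ∀ b, Close ε (G b) (H b)) : Close ε (ν.bind G) (ν.bind H) := fun F => by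
  rw [PMF.bind_bind, PMF.bind_bind, pr_bind, pr_bind]
  refine (abs_expec_sub_le (e := fun _ => ε) (fun a => abs_pr_le _) (fun a => abs_pr_le _)
    (fun a => le_rfl) fun a _ => h a F).trans ?_
  rw [expec_const]

theorem Close.bind {β γ : Type*} {ε ε' : ℝ} {ν ν' : PMF β} {G H : β → PMF γ}
    (hν : Close ε ν ν') (h : ∀ b, Close ε' (G b) (H b)) :
    Close (ε + ε') (ν.bind G) (ν'.bind H) :=
  (hν.bind_left G).trans (Close.bind_right ν' h)

theorem Close.pr {ε : ℝ} {ν ν' : PMF Bool} (h : Close ε ν ν') : |pr ν - pr ν'| ≤ ε := by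
  have := h PMF.pure
  rwa [PMF.bind_pure, PMF.bind_pure] at this

end Expectation

/-! ## Uniform distributions -/

section Uniform

variable {α β : Type} [Fintype α] [Nonempty α] [Fintype β] [Nonempty β]

theorem uniform_map_of_bijective {f : α → β} (hf : Function.Bijective f) :
    (PMF.uniformOfFintype α).map f = PMF.uniformOfFintype β := by
  classical
  ext b
  obtain ⟨a, rfl⟩ := hf.2 b
  rw [PMF.map_apply, tsum_eq_single a]
  · simp [Fintype.card_of_bijective hf]
  · intro a' ha'
    rw [if_neg]
    exact fun h => ha' (hf.1 h).symm

theorem uniform_map_of_fibers [DecidableEq β] {f : α → β} (k : ℕ)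
    (hf : ∀ b, (Finset.univ.filter fun a => b = f a).card = k) :
    (PMF.uniformOfFintype α).map f = PMF.uniformOfFintype β := by
  ext b
  have hcard : Fintype.card α = k * Fintype.card β := by
    have := Finset.card_eq_sum_card_fiberwise (f := f) (s := Finset.univ) (t := Finset.univ)
      (fun _ _ => Finset.mem_coe.2 (Finset.mem_univ _))
    rw [Finset.card_univ] at this
    rw [this, Finset.sum_congr rfl (g := fun _ => k)]
    · simp [mul_comm]
    · intro b _
      rw [← hf b]
      refine congrArg Finset.card ?_
      ext a
      simp [eq_comm]
  have hk : k ≠ 0 := by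
    rintro rfl
    have : Fintype.card α ≠ 0 := Fintype.card_ne_zero
    omega
  rw [PMF.map_apply, tsum_fintype, PMF.uniformOfFintype_apply]
  simp only [PMF.uniformOfFintype_apply]
  rw [← Finset.sum_filter, Finset.sum_const, hf b, hcard, nsmul_eq_mul]
  push_cast
  rw [ENNReal.mul_inv (Or.inr (by simp)) (Or.inr (by simp)), ← mul_assoc,
    ENNReal.mul_inv_cancel (by simpa using hk) (by simp), one_mul]

theorem uniform_map_of_surjective_hom {A B : Type} [Fintype A] [Fintype B] [AddGroup A]
    [AddGroup B] (f : A →+ B) (hf : Function.Surjective f) :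
    (PMF.uniformOfFintype A).map f = PMF.uniformOfFintype B := by
  classical
  refine uniform_map_of_fibers (Finset.univ.filter fun a => 0 = f a).card fun b => ?_
  obtain ⟨a₀, rfl⟩ := hf b
  refine Finset.card_bij' (fun a _ => a - a₀) (fun a _ => a + a₀) ?_ ?_ ?_ ?_
  · intro a ha
    simp only [Finset.mem_filter, Finset.mem_univ, true_and] at ha ⊢
    rw [map_sub, ← ha, sub_self]
  · intro a ha
    simp only [Finset.mem_filter, Finset.mem_univ, true_and] at ha ⊢
    rw [map_add, ← ha, zero_add]
  · simp
  · simp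

theorem uniform_comp_injective {I J R : Type} [Fintype I] [DecidableEq I] [Fintype J]
    [DecidableEq J] [Fintype R] [AddGroup R] {ι : J → I} (hι : Function.Injective ι) :
    (PMF.uniformOfFintype (I → R)).map (fun f => f ∘ ι) = PMF.uniformOfFintype (J → R) :=
  uniform_map_of_surjective_hom
    (A := I → R) (B := J → R) ⟨⟨fun f => f ∘ ι, rfl⟩, fun _ _ => rfl⟩
    (fun g => ⟨Function.extend ι g 0, funext fun j => hι.extend_apply _ _ j⟩)

theorem uniform_eval {I R : Type} [Fintype I] [DecidableEq I] [Fintype R] [AddGroup R] (i : I) :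
    (PMF.uniformOfFintype (I → R)).map (fun f => f i) = PMF.uniformOfFintype R :=
  uniform_map_of_surjective_hom
    (A := I → R) (B := R) ⟨⟨fun f => f i, rfl⟩, fun _ _ => rfl⟩
    (fun g => ⟨fun _ => g, rfl⟩)

theorem uniform_prod_bind {γ : Type*} (F : α × β → PMF γ) :
    (PMF.uniformOfFintype (α × β)).bind F =
      (PMF.uniformOfFintype α).bind fun a => (PMF.uniformOfFintype β).bind fun b => F (a, b) := by
  ext c
  simp only [PMF.bind_apply, PMF.uniformOfFintype_apply, Fintype.card_prod, ← ENNReal.tsum_mul_left]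
  rw [ENNReal.tsum_prod']
  refine tsum_congr fun a => tsum_congr fun b => ?_
  rw [← mul_assoc, Nat.cast_mul, ENNReal.mul_inv (Or.inr (by simp)) (Or.inr (by simp))]

theorem close_uniform_of_injective {j : α → β} (hj : Function.Injective j) :
    Close (1 - (Fintype.card α : ℝ) / Fintype.card β)
      ((PMF.uniformOfFintype α).map j) (PMF.uniformOfFintype β) := by
  classical
  intro F
  rw [PMF.bind_map, pr_bind, pr_bind, expec_uniform, expec_uniform]
  set f : β → ℝ := fun b => pr (F b) with hf
  have hβ : (0 : ℝ) < Fintype.card β := by exact_mod_cast Fintype.card_pos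
  have hα : (0 : ℝ) < Fintype.card α := by exact_mod_cast Fintype.card_pos
  have hle : (Fintype.card α : ℝ) ≤ Fintype.card β := by
    exact_mod_cast Fintype.card_le_of_injective j hj
  have hsplit : ∑ b, f b = ∑ a, f (j a) + ∑ b ∈ Finset.univ \ Finset.univ.image j, f b := by
    rw [← Finset.sum_sdiff (Finset.subset_univ (Finset.univ.image j)), add_comm,
      Finset.sum_image (fun a _ b _ h => hj h)]
  have h0 : ∀ b, 0 ≤ f b := fun b => pr_nonneg _
  have h1 : ∀ b, f b ≤ 1 := fun b => pr_le_one _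
  have hA0 : 0 ≤ ∑ a, f (j a) := Finset.sum_nonneg fun _ _ => h0 _
  have hA1 : ∑ a, f (j a) ≤ Fintype.card α := by
    refine (Finset.sum_le_sum (fun a _ => h1 (j a))).trans ?_
    simp
  have hB0 : 0 ≤ ∑ b ∈ Finset.univ \ Finset.univ.image j, f b :=
    Finset.sum_nonneg fun _ _ => h0 _
  have hB1 : ∑ b ∈ Finset.univ \ Finset.univ.image j, f b ≤
      (Fintype.card β : ℝ) - Fintype.card α := by
    refine (Finset.sum_le_sum (fun a _ => h1 a)).trans ?_
    rw [Finset.sum_const, nsmul_eq_mul, mul_one, Finset.card_sdiff_of_subset (Finset.subset_univ _),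
      Finset.card_image_of_injective _ hj, Finset.card_univ, Finset.card_univ,
      Nat.cast_sub (Fintype.card_le_of_injective j hj)]
  change |(∑ a, f (j a)) / (Fintype.card α : ℝ) - (∑ b, f b) / (Fintype.card β : ℝ)| ≤ _
  rw [hsplit]
  set A := ∑ a, f (j a)
  set B := ∑ b ∈ Finset.univ \ Finset.univ.image j, f b
  set x : ℝ := (Fintype.card α : ℝ)
  set y : ℝ := (Fintype.card β : ℝ)
  rw [abs_le, show (1 : ℝ) - x / y = (y - x) / y by field_simp,
    show A / x - (A + B) / y = (A * (y - x) - B * x) / (x * y) by field_simp; ring]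
  constructor
  · rw [← neg_div, div_le_div_iff₀ hβ (by positivity)]
    nlinarith [mul_nonneg hA0 (sub_nonneg.2 hle), mul_le_mul_of_nonneg_right hB1 hα.le,
      mul_le_mul_of_nonneg_right (show B * x ≤ (y - x) * x + A * (y - x) by
        nlinarith [mul_nonneg hA0 (sub_nonneg.2 hle), mul_le_mul_of_nonneg_right hB1 hα.le]) hβ.le]
  · rw [div_le_div_iff₀ (by positivity) hβ]
    nlinarith [mul_le_mul_of_nonneg_right (show A * (y - x) - B * x ≤ x * (y - x) by
        nlinarith [mul_nonneg hB0 hα.le, mul_le_mul_of_nonneg_right hA1 (sub_nonneg.2 hle)]) hβ.le]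

/-- Uniform units are close to uniform residues. -/
theorem close_units {I : Type} [Fintype I] [DecidableEq I] (𝔹 : BilinearGroup) :
    Close ((Fintype.card I : ℝ) / 𝔹.p)
      ((PMF.uniformOfFintype (I → 𝔹.Zpu)).map fun f i => (f i : 𝔹.Zp))
      (PMF.uniformOfFintype (I → 𝔹.Zp)) := by
  refine (close_uniform_of_injective (j := fun (f : I → 𝔹.Zpu) i => (f i : 𝔹.Zp))
    fun f g h => funext fun i => Units.ext (congrFun h i)).mono ?_
  have hp : (0 : ℝ) < 𝔹.p := by exact_mod_cast 𝔹.prime.pos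
  have hp1 : (1 : ℝ) ≤ 𝔹.p := by exact_mod_cast 𝔹.prime.one_lt.le
  rw [Fintype.card_fun, Fintype.card_fun, ZMod.card, ZMod.card_units_eq_totient,
    Nat.totient_prime 𝔹.prime]
  push_cast [Nat.cast_sub 𝔹.prime.one_lt.le]
  rw [← div_pow, show ((𝔹.p : ℝ) - 1) / 𝔹.p = 1 + (-(1 / (𝔹.p : ℝ))) by field_simp; ring]
  have hb := one_add_mul_le_pow (a := -(1 / (𝔹.p : ℝ)))
    (by have : 1 / (𝔹.p : ℝ) ≤ 1 := by rw [div_le_one hp]; exact hp1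
        linarith) (Fintype.card I)
  have : (Fintype.card I : ℝ) * -(1 / (𝔹.p : ℝ)) = -((Fintype.card I : ℝ) / 𝔹.p) := by
    field_simp
  linarith

/-- Two experiments that agree unless one of several uniform residues vanishes. -/
theorem close_of_eq_of_ne_zero {γ ι : Type} [Fintype ι] {𝔹 : BilinearGroup} (h : ι → α → 𝔹.Zp)
    (hu : ∀ i, (PMF.uniformOfFintype α).map (h i) = PMF.uniformOfFintype 𝔹.Zp)
    {F G : α → PMF γ} (hFG : ∀ a, (∀ i, h i a ≠ 0) → F a = G a) :
    Close ((Fintype.card ι : ℝ) / 𝔹.p)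
      ((PMF.uniformOfFintype α).bind F) ((PMF.uniformOfFintype α).bind G) := by
  classical
  intro T
  rw [PMF.bind_bind, PMF.bind_bind, pr_bind, pr_bind]
  have hz : ∀ i, expec (PMF.uniformOfFintype α) (fun a => if h i a = 0 then (1 : ℝ) else 0) =
      1 / 𝔹.p := by
    intro i
    have h1 : pr ((PMF.uniformOfFintype α).bind fun a => PMF.pure (decide (h i a = 0))) =
        pr ((PMF.uniformOfFintype 𝔹.Zp).bind fun z => PMF.pure (decide (z = 0))) := by
      rw [← hu i, PMF.bind_map]; rfl
    rw [pr_bind, pr_bind, expec_uniform (β := 𝔹.Zp)] at h1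
    simp only [pr_pure, decide_eq_true_eq] at h1
    rw [h1, ZMod.card]
    simp
  refine (abs_expec_sub_le (e := fun a => ∑ i, if h i a = 0 then (1 : ℝ) else 0)
    (E := Fintype.card ι) (fun a => abs_pr_le _) (fun a => abs_pr_le _) (fun a => ?_)
    fun a _ => ?_).trans ?_
  · rw [abs_of_nonneg (Finset.sum_nonneg fun i _ => by split_ifs <;> norm_num)]
    refine (Finset.sum_le_sum (g := fun _ => (1 : ℝ)) fun i _ => by split_ifs <;> norm_num).trans ?_
    simp
  · by_cases ha : ∀ i, h i a ≠ 0
    · rw [hFG a ha, sub_self, abs_zero]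
      exact Finset.sum_nonneg fun i _ => by split_ifs <;> norm_num
    · push Not at ha
      obtain ⟨i, hi⟩ := ha
      refine (abs_pr_sub_le _ _).trans ?_
      refine le_trans ?_ (Finset.single_le_sum (f := fun i => if h i a = 0 then (1 : ℝ) else 0)
        (fun i _ => by split_ifs <;> norm_num) (Finset.mem_univ i))
      simp [hi]
  · rw [expec_uniform]
    rw [Finset.sum_comm, Finset.sum_div]
    simp only [expec_uniform] at hz
    rw [Finset.sum_congr rfl fun i _ => hz i]
    simp [div_eq_mul_inv]

end Uniform

/-! ## Circuits over typed variables -/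

/-- Types of variables: scalars, exponents in `G`, exponents in `Ĝ`, bits. -/
inductive Kind
  | s | g | gh | bit
deriving DecidableEq

/-- The register content that represents a residue as a value of a given kind. -/
def emb {𝔹 : BilinearGroup} : Kind → 𝔹.Zp → Val 𝔹
  | .s, z => .scalar z
  | .g, z => .g (zexp 𝔹.g z)
  | .gh, z => .gh (zexp 𝔹.gh z)
  | .bit, z => .bit (decide (z ≠ 0))

open Classical in
/-- A truth value as a residue. -/
def ind {𝔹 : BilinearGroup} (P : Prop) : 𝔹.Zp := if P then 1 else 0

theorem ind_ne_zero {𝔹 : BilinearGroup} {P : Prop} : (ind P : 𝔹.Zp) ≠ 0 ↔ P := by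
  have := 𝔹.factPrime
  by_cases h : P <;> simp [ind, h]

theorem emb_injective {𝔹 : BilinearGroup} {k : Kind} (hk : k ≠ .bit) :
    Function.Injective (emb (𝔹 := 𝔹) k) := by
  intro a b h
  cases k
  · simpa [emb] using h
  · exact 𝔹.zexp_g_inj.1 (by simpa [emb] using h)
  · exact 𝔹.zexp_gh_inj.1 (by simpa [emb] using h)
  · exact absurd rfl hk

theorem write_one {𝔹 : BilinearGroup} (m : Mem 𝔹) (r : ℕ) (v : Val 𝔹) :
    m.write r [v] = Function.update m r v := by
  funext x
  rw [Mem.write, Function.update_apply]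
  by_cases h : r ≤ x
  · rw [if_pos h]
    by_cases h' : x = r
    · subst h'; simp
    · rw [if_neg h', List.getElem?_eq_none (by simp; omega)]
      rfl
  · rw [if_neg h, if_neg (by omega)]

theorem bits_getD (x i : ℕ) : (x.bits[i]?).getD false = x.testBit i := by
  induction i generalizing x with
  | zero =>
    induction x using Nat.binaryRec' with
    | zero => simp
    | bit b n h _ => rw [Nat.bits_append_bit _ _ h]; simp
  | succ i ih =>
    induction x using Nat.binaryRec' with
    | zero => simp
    | bit b n h _ => rw [Nat.bits_append_bit _ _ h, Nat.testBit_bit_succ, ← ih]; simp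

theorem mod_two_pow_succ' (x i : ℕ) :
    x % 2 ^ (i + 1) = x % 2 ^ i + 2 ^ i * (x.testBit i).toNat := by
  rw [Nat.mod_pow_succ, Nat.toNat_testBit]

theorem runInstrs_append {𝔹 : BilinearGroup} (B B' : List Instr) (m : Mem 𝔹) :
    runInstrs (B ++ B') m = (runInstrs B m).bind (runInstrs B') := by
  induction B generalizing m with
  | nil => simp [runInstrs]
  | cons i B ih =>
    simp only [List.cons_append, runInstrs, PMF.bind_bind]
    congr 1
    funext m'
    exact ih m'

theorem runInstrs_singleton {𝔹 : BilinearGroup} (i : Instr) (m : Mem 𝔹) :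
    runInstrs [i] m = i.exec m := by
  simp only [runInstrs]
  exact PMF.bind_pure _

theorem instrTime_append (B B' : List Instr) :
    instrTime (B ++ B') = instrTime B + instrTime B' := by
  simp [instrTime]

/-- Functions of the variables, for all groups at once. -/
abbrev Fn (ν : Type) := ∀ 𝔹 : BilinearGroup, (ν → 𝔹.Zp) → 𝔹.Zp

/-- Functions of typed variables that are computed by a circuit of a given size. -/
inductive Cp {ν : Type} (nb : ℕ) (kd : ν → Kind) : Kind → ℕ → Fn ν → Prop
  | var (v : ν) : Cp nb kd (kd v) 1 fun _ σ => σ v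
  | lit (k : ℕ) : Cp nb kd .s 1 fun _ _ => k
  | gen : Cp nb kd .g 1 fun _ _ => 1
  | genh : Cp nb kd .gh 1 fun _ _ => 1
  | sadd {c c' f f'} : Cp nb kd .s c f → Cp nb kd .s c' f' →
      Cp nb kd .s (c + c' + 1) fun 𝔹 σ => f 𝔹 σ + f' 𝔹 σ
  | smul {c c' f f'} : Cp nb kd .s c f → Cp nb kd .s c' f' →
      Cp nb kd .s (c + c' + 1) fun 𝔹 σ => f 𝔹 σ * f' 𝔹 σ
  | inv {c f} : Cp nb kd .s c f → Cp nb kd .s (c + 1) fun 𝔹 σ => (f 𝔹 σ)⁻¹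
  | gadd {k c c' f f'} : k = .g ∨ k = .gh → Cp nb kd k c f → Cp nb kd k c' f' →
      Cp nb kd k (c + c' + 1) fun 𝔹 σ => f 𝔹 σ + f' 𝔹 σ
  | gsmul {k c c' f f'} : k = .g ∨ k = .gh → Cp nb kd k c f → Cp nb kd .s c' f' →
      Cp nb kd k (c + c' + 1) fun 𝔹 σ => f 𝔹 σ * f' 𝔹 σ
  | eq {k c c' f f'} : k ≠ .bit → Cp nb kd k c f → Cp nb kd k c' f' →
      Cp nb kd .bit (c + c' + 1) fun 𝔹 σ => ind (f 𝔹 σ = f' 𝔹 σ)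
  | nand {c c' f f'} : Cp nb kd .bit c f → Cp nb kd .bit c' f' →
      Cp nb kd .bit (c + c' + 1) fun 𝔹 σ => ind (¬ (f 𝔹 σ ≠ 0 ∧ f' 𝔹 σ ≠ 0))
  | sel {k c c' c'' f f' f''} : Cp nb kd .bit c f → Cp nb kd k c' f' → Cp nb kd k c'' f'' →
      Cp nb kd k (c + c' + c'' + 1) fun 𝔹 σ => open Classical in if f 𝔹 σ ≠ 0 then f' 𝔹 σ else f'' 𝔹 σ
  | mono {k c c' f} : Cp nb kd k c f → c ≤ c' → Cp nb kd k c' f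
  | tbit {c f} (i : ℕ) : Cp nb kd .s c f →
      Cp nb kd .bit (c + 1) fun 𝔹 σ => ind ((f 𝔹 σ).val.testBit i = true)
  | congrOn {k c f f'} : Cp nb kd k c f → (∀ 𝔹 : BilinearGroup, 𝔹.p < 2 ^ nb → ∀ σ, f 𝔹 σ = f' 𝔹 σ) →
      Cp nb kd k c f'

/-- Execution of a list of instructions that are deterministic on a given memory. -/
def RunsTo {𝔹 : BilinearGroup} (B : List Instr) (m m' : Mem 𝔹) : Prop :=
  runInstrs B m = PMF.pure m'

theorem RunsTo.append {𝔹 : BilinearGroup} {B B' : List Instr} {m m' m'' : Mem 𝔹}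
    (h : RunsTo B m m') (h' : RunsTo B' m' m'') : RunsTo (B ++ B') m m'' := by
  rw [RunsTo, runInstrs_append, show runInstrs B m = _ from h, PMF.pure_bind]
  exact h'

theorem RunsTo.single {𝔹 : BilinearGroup} {i : Instr} {m : Mem 𝔹} {d : ℕ} {v : Val 𝔹}
    (h : i.exec m = PMF.pure (m.write d [v])) : RunsTo [i] m (Function.update m d v) := by
  rw [RunsTo, runInstrs_singleton, h, write_one]

/-- `B` computes `f` in register `t`, using registers in `[t, t + c)` only. -/
def Compiles {ν : Type} (nb : ℕ) (kd : ν → Kind) (addr : ν → ℕ) (k : Kind) (c : ℕ) (f : Fn ν) (t : ℕ)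
    (B : List Instr) : Prop :=
  instrTime B ≤ c ∧ ∀ 𝔹 : BilinearGroup, 𝔹.p < 2 ^ nb → ∀ (σ : ν → 𝔹.Zp) (m : Mem 𝔹),
    (∀ v, m (addr v) = emb (kd v) (σ v)) →
    ∃ m', RunsTo B m m' ∧ m' t = emb k (f 𝔹 σ) ∧ ∀ r, r < t ∨ t + c ≤ r → m' r = m r

section Compile

variable {ν : Type} {nb : ℕ} {kd : ν → Kind} {addr : ν → ℕ} {k k' k'' : Kind} {c c' : ℕ} {f f' : Fn ν}
  {t : ℕ}

theorem Compiles.unary {B : List Instr} (h : Compiles nb kd addr k c f t B) {h₁ : Fn ν} (i : Instr)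
    (hi : i.cost = 1)
    (he : ∀ (𝔹 : BilinearGroup) (σ : ν → 𝔹.Zp) (m : Mem 𝔹), m t = emb k (f 𝔹 σ) →
      i.exec m = PMF.pure (m.write t [emb k' (h₁ 𝔹 σ)])) :
    Compiles nb kd addr k' (c + 1) h₁ t (B ++ [i]) := by
  refine ⟨by rw [instrTime_append]; simpa [instrTime, hi] using h.1, fun 𝔹 hp σ m hm => ?_⟩
  obtain ⟨m', hr, ht, ho⟩ := h.2 𝔹 hp σ m hm
  refine ⟨_, hr.append (RunsTo.single (he 𝔹 σ m' ht)), by simp, fun r hr' => ?_⟩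
  rw [Function.update_of_ne (by omega), ho r (by omega)]

theorem Compiles.binary {B B' : List Instr} (h : Compiles nb kd addr k c f t B)
    (h' : Compiles nb kd addr k' c' f' (t + 1) B') (ha : ∀ v, addr v < t) {h₁ : Fn ν} (i : Instr)
    (hi : i.cost = 1)
    (he : ∀ (𝔹 : BilinearGroup) (σ : ν → 𝔹.Zp) (m : Mem 𝔹), m t = emb k (f 𝔹 σ) →
      m (t + 1) = emb k' (f' 𝔹 σ) →
      i.exec m = PMF.pure (m.write t [emb k'' (h₁ 𝔹 σ)])) :
    Compiles nb kd addr k'' (c + c' + 1) h₁ t (B ++ B' ++ [i]) := by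
  refine ⟨?_, fun 𝔹 hp σ m hm => ?_⟩
  · have := h.1; have := h'.1
    simp only [instrTime_append]
    simp only [instrTime, List.map_cons, List.map_nil, List.sum_cons, List.sum_nil, hi] at *
    omega
  obtain ⟨m', hr, ht, ho⟩ := h.2 𝔹 hp σ m hm
  obtain ⟨m'', hr', ht', ho'⟩ := h'.2 𝔹 hp σ m' fun v => by
    rw [ho _ (Or.inl (ha v)), hm]
  refine ⟨_, (hr.append hr').append (RunsTo.single (he 𝔹 σ m'' ?_ ht')), by simp, fun r hr' => ?_⟩
  · rw [ho' t (Or.inl (by omega)), ht]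
  · rw [Function.update_of_ne (by omega), ho' r (by omega), ho r (by omega)]

theorem Compiles.nullary {h₁ : Fn ν} (i : Instr) (hi : i.cost = 1)
    (he : ∀ (𝔹 : BilinearGroup) (σ : ν → 𝔹.Zp) (m : Mem 𝔹),
      (∀ v, m (addr v) = emb (kd v) (σ v)) →
      i.exec m = PMF.pure (m.write t [emb k (h₁ 𝔹 σ)])) :
    Compiles nb kd addr k 1 h₁ t [i] := by
  refine ⟨by simp [instrTime, hi], fun 𝔹 _ σ m hm => ?_⟩
  refine ⟨_, RunsTo.single (he 𝔹 σ m hm), by simp, fun r hr' => ?_⟩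
  rw [Function.update_of_ne (by omega)]

theorem Cp.pos (h : Cp nb kd k c f) : 1 ≤ c := by
  induction h <;> omega

theorem Cp.compile (h : Cp nb kd k c f) (t : ℕ) (ha : ∀ v, addr v < t) :
    ∃ B, Compiles nb kd addr k c f t B := by
  induction h generalizing t with
  | var v =>
    exact ⟨_, Compiles.nullary (.select t (addr v) (addr v) (addr v)) rfl fun 𝔹 σ m hm => by
      simp [Instr.exec, hm]⟩
  | lit k => exact ⟨_, Compiles.nullary (.lit t k) rfl fun 𝔹 σ m hm => rfl⟩
  | gen =>
    exact ⟨_, Compiles.nullary (.genG t) rfl fun 𝔹 σ m hm => by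
      simp [Instr.exec, emb, zexp_one]⟩
  | genh =>
    exact ⟨_, Compiles.nullary (.genGh t) rfl fun 𝔹 σ m hm => by
      simp [Instr.exec, emb, zexp_one]⟩
  | sadd h h' ih ih' =>
    obtain ⟨B, hB⟩ := ih t ha
    obtain ⟨B', hB'⟩ := ih' (t + 1) fun v => (ha v).trans (Nat.lt_succ_self t)
    exact ⟨_, hB.binary hB' ha (.sadd t t (t + 1)) rfl fun 𝔹 σ m h₁ h₂ => by
      simp [Instr.exec, h₁, h₂, emb, Val.toScalar]⟩
  | smul h h' ih ih' =>
    obtain ⟨B, hB⟩ := ih t ha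
    obtain ⟨B', hB'⟩ := ih' (t + 1) fun v => (ha v).trans (Nat.lt_succ_self t)
    exact ⟨_, hB.binary hB' ha (.smul t t (t + 1)) rfl fun 𝔹 σ m h₁ h₂ => by
      simp [Instr.exec, h₁, h₂, emb, Val.toScalar]⟩
  | inv h ih =>
    obtain ⟨B, hB⟩ := ih t ha
    exact ⟨_, hB.unary (.sinv t t) rfl fun 𝔹 σ m h₁ => by
      simp [Instr.exec, h₁, emb, Val.toScalar]⟩
  | gadd hk h h' ih ih' =>
    obtain ⟨B, hB⟩ := ih t ha
    obtain ⟨B', hB'⟩ := ih' (t + 1) fun v => (ha v).trans (Nat.lt_succ_self t)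
    refine ⟨_, hB.binary hB' ha (.mul t t (t + 1)) rfl fun 𝔹 σ m h₁ h₂ => ?_⟩
    rcases hk with rfl | rfl
    · simp [Instr.exec, h₁, h₂, emb, Val.mul, zexp_add (𝔹.pow_p_G _)]
    · simp [Instr.exec, h₁, h₂, emb, Val.mul, zexp_add (𝔹.pow_p_Gh _)]
  | gsmul hk h h' ih ih' =>
    obtain ⟨B, hB⟩ := ih t ha
    obtain ⟨B', hB'⟩ := ih' (t + 1) fun v => (ha v).trans (Nat.lt_succ_self t)
    refine ⟨_, hB.binary hB' ha (.pow t t (t + 1)) rfl fun 𝔹 σ m h₁ h₂ => ?_⟩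
    rcases hk with rfl | rfl
    · simp [Instr.exec, h₁, h₂, emb, Val.pow, zexp_zexp (𝔹.pow_p_G _)]
    · simp [Instr.exec, h₁, h₂, emb, Val.pow, zexp_zexp (𝔹.pow_p_Gh _)]
  | eq hk h h' ih ih' =>
    obtain ⟨B, hB⟩ := ih t ha
    obtain ⟨B', hB'⟩ := ih' (t + 1) fun v => (ha v).trans (Nat.lt_succ_self t)
    refine ⟨_, hB.binary hB' ha (.isEq t t (t + 1)) rfl fun 𝔹 σ m h₁ h₂ => ?_⟩
    simp only [Instr.exec, emb, ind_ne_zero]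
    rw [h₁, h₂]
    simp only [(emb_injective hk).eq_iff]
  | nand h h' ih ih' =>
    obtain ⟨B, hB⟩ := ih t ha
    obtain ⟨B', hB'⟩ := ih' (t + 1) fun v => (ha v).trans (Nat.lt_succ_self t)
    refine ⟨_, hB.binary hB' ha (.nand t t (t + 1)) rfl fun 𝔹 σ m h₁ h₂ => ?_⟩
    simp only [Instr.exec, h₁, h₂, emb, ind_ne_zero, Val.toBit]
    simp
  | @sel k c c' c'' f f' f'' h h' h'' ih ih' ih'' =>
    obtain ⟨B, hB⟩ := ih t ha
    obtain ⟨B', hB'⟩ := ih' (t + 1) fun v => (ha v).trans (Nat.lt_succ_self t)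
    obtain ⟨B'', hB''⟩ := ih'' (t + 2) fun v => (ha v).trans (by omega)
    have := h.pos
    refine ⟨B ++ B' ++ B'' ++ [.select t t (t + 1) (t + 2)], ?_, fun 𝔹 hp σ m hm => ?_⟩
    · have := hB.1; have := hB'.1; have := hB''.1
      simp only [instrTime_append]
      simp only [instrTime, List.map_cons, List.map_nil, List.sum_cons, List.sum_nil,
        Instr.cost] at *
      omega
    obtain ⟨m', hr, ht, ho⟩ := hB.2 𝔹 hp σ m hm
    obtain ⟨m'', hr', ht', ho'⟩ := hB'.2 𝔹 hp σ m' fun v => by rw [ho _ (Or.inl (ha v)), hm]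
    obtain ⟨m₃, hr'', ht'', ho''⟩ := hB''.2 𝔹 hp σ m'' fun v => by
      rw [ho' _ (Or.inl ((ha v).trans (by omega))), ho _ (Or.inl (ha v)), hm]
    refine ⟨_, ((hr.append hr').append hr'').append (RunsTo.single (d := t)
      (v := emb k (open Classical in if f 𝔹 σ ≠ 0 then f' 𝔹 σ else f'' 𝔹 σ)) ?_), by simp,
      fun r hr' => ?_⟩
    · have h1 : m₃ t = emb .bit (f 𝔹 σ) := by
        rw [ho'' t (Or.inl (by omega)), ho' t (Or.inl (by omega)), ht]
      have h2 : m₃ (t + 1) = emb k (f' 𝔹 σ) := by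
        rw [ho'' (t + 1) (Or.inl (by omega)), ht']
      simp only [Instr.exec, h1, h2, ht'', emb, Val.toBit, decide_eq_true_eq]
      split_ifs <;> rfl
    · rw [Function.update_of_ne (by omega), ho'' r (by omega), ho' r (by omega), ho r (by omega)]
  | mono h hle ih =>
    obtain ⟨B, hB⟩ := ih t ha
    refine ⟨B, hB.1.trans hle, fun 𝔹 hp σ m hm => ?_⟩
    obtain ⟨m', hr, ht, ho⟩ := hB.2 𝔹 hp σ m hm
    exact ⟨m', hr, ht, fun r hr => ho r (by omega)⟩
  | tbit i h ih =>
    obtain ⟨B, hB⟩ := ih t ha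
    exact ⟨_, hB.unary (.getBit t t i) rfl fun 𝔹 σ m h₁ => by
      simp only [Instr.exec, h₁, emb, Val.encode, ind_ne_zero, bits_getD,
        Bool.decide_eq_true]⟩
  | congrOn h he ih =>
    obtain ⟨B, hB⟩ := ih t ha
    refine ⟨B, hB.1, fun 𝔹 hp σ m hm => ?_⟩
    rw [← he 𝔹 hp]
    exact hB.2 𝔹 hp σ m hm

/-! ### Derived circuits -/

theorem Cp.congr (h : Cp nb kd k c f) (hf : ∀ 𝔹 σ, f 𝔹 σ = f' 𝔹 σ) : Cp nb kd k c f' := by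
  have : f = f' := funext fun 𝔹 => funext fun σ => hf 𝔹 σ
  rwa [← this]

theorem Cp.rename {ν' : Type} {kd' : ν' → Kind} (e : ν → ν') (he : ∀ v, kd' (e v) = kd v)
    (h : Cp nb kd k c f) : Cp nb kd' k c fun 𝔹 σ => f 𝔹 fun v => σ (e v) := by
  induction h with
  | var v => rw [← he v]; exact .var _
  | lit k => exact .lit k
  | gen => exact .gen
  | genh => exact .genh
  | sadd _ _ ih ih' => exact .sadd ih ih'
  | smul _ _ ih ih' => exact .smul ih ih'
  | inv _ ih => exact .inv ih
  | gadd hk _ _ ih ih' => exact .gadd hk ih ih'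
  | gsmul hk _ _ ih ih' => exact .gsmul hk ih ih'
  | eq hk _ _ ih ih' => exact .eq hk ih ih'
  | nand _ _ ih ih' => exact .nand ih ih'
  | sel _ _ _ ih ih' ih'' => exact .sel ih ih' ih''
  | mono _ hle ih => exact .mono ih hle
  | tbit i _ ih => exact .tbit i ih
  | congrOn _ he ih => exact .congrOn ih fun 𝔹 hp σ => he 𝔹 hp _

theorem Cp.var' {k : Kind} (v : ν) (h : kd v = k) : Cp nb kd k 1 fun _ σ => σ v := h ▸ .var v

theorem Cp.zero (nb : ℕ) (kd : ν → Kind) (k : Kind) (hk : k ≠ .bit) : Cp nb kd k 3 fun _ _ => 0 := by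
  cases k
  · exact ((Cp.lit 0).mono (by norm_num)).congr fun 𝔹 σ => by simp
  · exact (Cp.gsmul (Or.inl rfl) .gen (.lit 0)).congr fun 𝔹 σ => by simp
  · exact (Cp.gsmul (Or.inr rfl) .genh (.lit 0)).congr fun 𝔹 σ => by simp
  · exact absurd rfl hk

theorem Cp.add (hk : k ≠ .bit) (h : Cp nb kd k c f) (h' : Cp nb kd k c' f') :
    Cp nb kd k (c + c' + 1) fun 𝔹 σ => f 𝔹 σ + f' 𝔹 σ := by
  cases k
  · exact .sadd h h'
  · exact .gadd (Or.inl rfl) h h'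
  · exact .gadd (Or.inr rfl) h h'
  · exact absurd rfl hk

theorem Cp.mul (hk : k ≠ .bit) (h : Cp nb kd k c f) (h' : Cp nb kd .s c' f') :
    Cp nb kd k (c + c' + 1) fun 𝔹 σ => f 𝔹 σ * f' 𝔹 σ := by
  cases k
  · exact .smul h h'
  · exact .gsmul (Or.inl rfl) h h'
  · exact .gsmul (Or.inr rfl) h h'
  · exact absurd rfl hk

theorem Cp.mul' (hk : k ≠ .bit) (h' : Cp nb kd .s c' f') (h : Cp nb kd k c f) :
    Cp nb kd k (c' + c + 1) fun 𝔹 σ => f' 𝔹 σ * f 𝔹 σ :=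
  ((Cp.mul hk h h').mono (by omega)).congr fun 𝔹 σ => mul_comm _ _

theorem Cp.tt : Cp nb kd .bit 3 fun _ _ => ind True :=
  (Cp.eq (k := .s) (by decide) (.lit 0) (.lit 0)).congr fun 𝔹 σ => by simp

variable {P P' : ∀ 𝔹 : BilinearGroup, (ν → 𝔹.Zp) → Prop}

theorem Cp.not (h : Cp nb kd .bit c fun 𝔹 σ => ind (P 𝔹 σ)) :
    Cp nb kd .bit (c + 4) fun 𝔹 σ => ind (¬ P 𝔹 σ) :=
  (Cp.nand h .tt).congr fun 𝔹 σ => by simp [ind_ne_zero]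

theorem Cp.and (h : Cp nb kd .bit c fun 𝔹 σ => ind (P 𝔹 σ))
    (h' : Cp nb kd .bit c' fun 𝔹 σ => ind (P' 𝔹 σ)) :
    Cp nb kd .bit (c + c' + 5) fun 𝔹 σ => ind (P 𝔹 σ ∧ P' 𝔹 σ) :=
  (Cp.nand (Cp.nand h h') .tt).congr fun 𝔹 σ => by simp [ind_ne_zero]

theorem Cp.or (h : Cp nb kd .bit c fun 𝔹 σ => ind (P 𝔹 σ))
    (h' : Cp nb kd .bit c' fun 𝔹 σ => ind (P' 𝔹 σ)) :
    Cp nb kd .bit (c + c' + 9) fun 𝔹 σ => ind (P 𝔹 σ ∨ P' 𝔹 σ) :=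
  ((Cp.nand h.not h'.not).mono (by omega)).congr fun 𝔹 σ => by
    simp only [ind_ne_zero, not_and_or, not_not]

theorem Cp.const (P : Prop) : Cp nb kd .bit 3 fun _ _ => ind P := by
  by_cases h : P
  · exact Cp.tt.congr fun 𝔹 σ => by simp [h]
  · exact (Cp.eq (k := .s) (by decide) (.lit 0) (.lit 1)).mono (by norm_num) |>.congr
      fun 𝔹 σ => by
        have := 𝔹.factPrime
        simp [h]

open Classical in
theorem Cp.ite (h : Cp nb kd .bit c fun 𝔹 σ => ind (P 𝔹 σ)) (h₁ : Cp nb kd k c' f)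
    {c'' : ℕ} (h₂ : Cp nb kd k c'' f') :
    Cp nb kd k (c + c' + c'' + 1) fun 𝔹 σ => if P 𝔹 σ then f 𝔹 σ else f' 𝔹 σ :=
  (Cp.sel h h₁ h₂).congr fun 𝔹 σ => by simp only [ind_ne_zero]

theorem Cp.nonzero (hk : k ≠ .bit) (h : Cp nb kd k c f) :
    Cp nb kd .bit (c + 8) fun 𝔹 σ => ind (f 𝔹 σ ≠ 0) :=
  ((Cp.eq hk h (.zero nb kd k hk)).not).mono (by omega)

theorem Cp.eq_zero (hk : k ≠ .bit) (h : Cp nb kd k c f) :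
    Cp nb kd .bit (c + 4) fun 𝔹 σ => ind (f 𝔹 σ = 0) :=
  (Cp.eq hk h (.zero nb kd k hk))

theorem Cp.list_sum {ι : Type} (hk : k ≠ .bit) (l : List ι) {f : ι → Fn ν}
    (h : ∀ i ∈ l, Cp nb kd k c (f i)) :
    Cp nb kd k (l.length * (c + 1) + 3) fun 𝔹 σ => (l.map fun i => f i 𝔹 σ).sum := by
  induction l with
  | nil => exact (Cp.zero nb kd k hk).mono (by simp)
  | cons a l ih =>
    refine ((Cp.add hk (h a (by simp)) (ih fun i hi => h i (by simp [hi]))).mono ?_).congr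
      fun 𝔹 σ => by simp
    simp only [List.length_cons]
    ring_nf
    omega

theorem Cp.sum {ι : Type} [Fintype ι] (hk : k ≠ .bit) {f : ι → Fn ν}
    (h : ∀ i, Cp nb kd k c (f i)) :
    Cp nb kd k (Fintype.card ι * (c + 1) + 3) fun 𝔹 σ => ∑ i, f i 𝔹 σ := by
  refine ((Cp.list_sum hk (Finset.univ : Finset ι).toList fun i _ => h i).mono ?_).congr
    fun 𝔹 σ => ?_
  · simp [Finset.length_toList]
  · rw [Finset.sum_map_toList]

theorem Cp.list_forall {ι : Type} (l : List ι)
    {P : ι → ∀ 𝔹 : BilinearGroup, (ν → 𝔹.Zp) → Prop}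
    (h : ∀ i ∈ l, Cp nb kd .bit c fun 𝔹 σ => ind (P i 𝔹 σ)) :
    Cp nb kd .bit (l.length * (c + 5) + 3) fun 𝔹 σ => ind (∀ i ∈ l, P i 𝔹 σ) := by
  induction l with
  | nil => exact (Cp.tt.mono (by simp)).congr fun 𝔹 σ => by simp
  | cons a l ih =>
    refine ((Cp.and (h a (by simp)) (ih fun i hi => h i (by simp [hi]))).mono ?_).congr
      fun 𝔹 σ => by simp
    simp only [List.length_cons]
    ring_nf
    omega

theorem Cp.forall {ι : Type} [Fintype ι] {P : ι → ∀ 𝔹 : BilinearGroup, (ν → 𝔹.Zp) → Prop}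
    (h : ∀ i, Cp nb kd .bit c fun 𝔹 σ => ind (P i 𝔹 σ)) :
    Cp nb kd .bit (Fintype.card ι * (c + 5) + 3) fun 𝔹 σ => ind (∀ i, P i 𝔹 σ) :=
  ((Cp.list_forall (Finset.univ : Finset ι).toList fun i _ => h i).mono
    (by simp [Finset.length_toList])).congr fun 𝔹 σ => by simp

theorem Cp.exists {ι : Type} [Fintype ι] {P : ι → ∀ 𝔹 : BilinearGroup, (ν → 𝔹.Zp) → Prop}
    (h : ∀ i, Cp nb kd .bit c fun 𝔹 σ => ind (P i 𝔹 σ)) :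
    Cp nb kd .bit (Fintype.card ι * (c + 9) + 7) fun 𝔹 σ => ind (∃ i, P i 𝔹 σ) :=
  ((Cp.forall fun i => (h i).not).not.mono (by ring_nf; omega)).congr fun 𝔹 σ => by simp

/-- Auxiliary circuit for `-1`: no bit below position `i` of `2⁻¹` is set. -/
theorem Cp.low_zero (i : ℕ) : Cp nb kd .bit (12 * i + 3) fun 𝔹 _ =>
    ind ((((2 : ℕ) : 𝔹.Zp)⁻¹).val % 2 ^ i = 0) := by
  induction i with
  | zero => exact Cp.tt.congr fun 𝔹 σ => by simp [Nat.mod_one]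
  | succ i ih =>
    refine (Cp.and ih (Cp.tbit i (.inv (.lit 2))).not).mono (by ring_nf; omega) |>.congr
      fun 𝔹 σ => ?_
    congr 1
    rw [mod_two_pow_succ']
    cases h : (((2 : ℕ) : 𝔹.Zp)⁻¹).val.testBit i <;> simp

theorem Cp.low_pred (i : ℕ) : Cp nb kd .s (i * (12 * i + 40) + 3) fun 𝔹 _ =>
    (((((2 : ℕ) : 𝔹.Zp)⁻¹).val % 2 ^ i : ℕ) : 𝔹.Zp) +
      (open Classical in if (((2 : ℕ) : 𝔹.Zp)⁻¹).val % 2 ^ i = 0 then ((2 ^ i : ℕ) : 𝔹.Zp) else 0)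
      - 1 := by
  induction i with
  | zero => exact (Cp.zero nb kd .s (by decide)).congr fun 𝔹 σ => by simp [Nat.mod_one]
  | succ i ih =>
    have hb : Cp nb kd .bit 3 fun 𝔹 _ => ind ((((2 : ℕ) : 𝔹.Zp)⁻¹).val.testBit i = true) :=
      Cp.tbit i (.inv (.lit 2))
    refine ((Cp.add (by decide) ih (Cp.ite (Cp.low_zero i)
      (Cp.ite hb (.zero nb kd .s (by decide)) (.lit (2 ^ i)))
      (Cp.ite hb (.lit (2 ^ i)) (.zero nb kd .s (by decide))))).mono
        (by ring_nf; omega)).congr fun 𝔹 σ => ?_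
    generalize (((2 : ℕ) : 𝔹.Zp)⁻¹).val = x
    rw [mod_two_pow_succ']
    cases h : x.testBit i <;>
    by_cases h0 : x % 2 ^ i = 0 <;> simp [h0, pow_succ] <;> ring

/-- Size of the circuit for `-1`. -/
def negCost (nb : ℕ) : ℕ := nb * (12 * nb + 40) + 12

theorem Cp.neg_one : Cp nb kd .s (negCost nb) fun _ _ => -1 := by
  refine Cp.congrOn ((Cp.ite (Cp.eq_zero (k := .s) (by decide) (Cp.lit 2)) (.lit 1)
    (Cp.mul (by decide) (Cp.lit 2) (Cp.low_pred nb))).mono (by simp only [negCost]; omega)) ?_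
  intro 𝔹 hp σ
  have := 𝔹.factPrime
  by_cases h2 : ((2 : ℕ) : 𝔹.Zp) = 0
  · rw [if_pos h2]
    have : (1 : 𝔹.Zp) + 1 = 0 := by rw [← h2]; norm_num
    push_cast
    linear_combination this
  · rw [if_neg h2]
    have hv : (((2 : ℕ) : 𝔹.Zp)⁻¹).val % 2 ^ nb = (((2 : ℕ) : 𝔹.Zp)⁻¹).val :=
      Nat.mod_eq_of_lt ((ZMod.val_lt _).trans hp)
    have hv0 : (((2 : ℕ) : 𝔹.Zp)⁻¹).val ≠ 0 := by
      rw [Ne, ZMod.val_eq_zero, inv_eq_zero]; exact h2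
    rw [hv, if_neg hv0, ZMod.natCast_zmod_val, add_zero, mul_sub, mul_inv_cancel₀ h2]
    push_cast
    ring

theorem Cp.neg (hk : k ≠ .bit) (h : Cp nb kd k c f) :
    Cp nb kd k (c + negCost nb + 1) fun 𝔹 σ => - f 𝔹 σ :=
  (Cp.mul hk h Cp.neg_one).congr fun 𝔹 σ => by ring

theorem Cp.sub (hk : k ≠ .bit) (h : Cp nb kd k c f) (h' : Cp nb kd k c' f') :
    Cp nb kd k (c + c' + negCost nb + 2) fun 𝔹 σ => f 𝔹 σ - f' 𝔹 σ :=
  ((Cp.add hk h (h'.neg hk)).mono (by omega)).congr fun 𝔹 σ => by ring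

end Compile

/-! ## Programs with named variables next to a copy of the adversary's memory -/

/-- Typed variables with distinct addresses below `V`. -/
structure Layout (Nm : Type) where
  nb : ℕ
  kd : Nm → Kind
  addr : Nm → ℕ
  V : ℕ
  inj : Function.Injective addr
  lt : ∀ x, addr x < V

/-- `mem` holds the variables `σ` and, from register `K` on, the memory `m`. -/
structure Layout.Rep {Nm : Type} (L : Layout Nm) (K : ℕ) {𝔹 : BilinearGroup} (σ : Nm → 𝔹.Zp)
    (m mem : Mem 𝔹) : Prop where
  var : ∀ x, mem (L.addr x) = emb (L.kd x) (σ x)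
  reg : ∀ r, mem (K + r) = m r

abbrev Sem (Nm : Type) := ∀ 𝔹 : BilinearGroup, (Nm → 𝔹.Zp) → Mem 𝔹 → PMF ((Nm → 𝔹.Zp) × Mem 𝔹)

/-- Probabilistic transformations of variables and memory that are realized by a program of a given
running time, whatever the address of the copy of the memory is. -/
def Rlz {Nm : Type} (L : Layout Nm) (c : ℕ) (sem : Sem Nm) : Prop :=
  ∃ W, ∀ K, L.V + W ≤ K → ∃ B, instrTime B ≤ c ∧ ∀ 𝔹 : BilinearGroup, 𝔹.p < 2 ^ L.nb →
    ∀ σ m mem, L.Rep K σ m mem → ∀ (β : Type) (φ : Mem 𝔹 → PMF β)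
      (ψ : (Nm → 𝔹.Zp) × Mem 𝔹 → PMF β),
      (∀ σ' m' mem', L.Rep K σ' m' mem' → φ mem' = ψ (σ', m')) →
      (runInstrs B mem).bind φ = (sem 𝔹 σ m).bind ψ

section Rlz

variable {Nm : Type} {L : Layout Nm} {c c' : ℕ} {sem sem' : Sem Nm}

theorem Rlz.nil : Rlz L 0 fun _ σ m => PMF.pure (σ, m) :=
  ⟨0, fun K _ => ⟨[], by simp [instrTime], fun 𝔹 _ σ m mem h β φ ψ hφ => by
    simp only [runInstrs, PMF.pure_bind]; exact hφ _ _ _ h⟩⟩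

theorem Rlz.seq (h : Rlz L c sem) (h' : Rlz L c' sem') :
    Rlz L (c + c') fun 𝔹 σ m => (sem 𝔹 σ m).bind fun s => sem' 𝔹 s.1 s.2 := by
  obtain ⟨W, hW⟩ := h
  obtain ⟨W', hW'⟩ := h'
  refine ⟨max W W', fun K hK => ?_⟩
  obtain ⟨B, hB, h⟩ := hW K (by omega)
  obtain ⟨B', hB', h'⟩ := hW' K (by omega)
  refine ⟨B ++ B', by rw [instrTime_append]; omega, fun 𝔹 hp σ m mem hr β φ ψ hφ => ?_⟩
  rw [runInstrs_append, PMF.bind_bind, PMF.bind_bind]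
  exact h 𝔹 hp σ m mem hr β _ _ fun σ' m' mem' hr' => h' 𝔹 hp σ' m' mem' hr' β φ ψ hφ

theorem Rlz.mono (h : Rlz L c sem) (hc : c ≤ c') : Rlz L c' sem := by
  obtain ⟨W, hW⟩ := h
  refine ⟨W, fun K hK => ?_⟩
  obtain ⟨B, hB, h⟩ := hW K hK
  exact ⟨B, hB.trans hc, h⟩

theorem Rlz.congr (h : Rlz L c sem) (he : ∀ 𝔹 σ m, sem 𝔹 σ m = sem' 𝔹 σ m) : Rlz L c sem' := by
  have : sem = sem' := funext fun 𝔹 => funext fun σ => funext fun m => he 𝔹 σ m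
  rwa [← this]

theorem Rlz.of_runsTo {g : ∀ 𝔹 : BilinearGroup, (Nm → 𝔹.Zp) → Mem 𝔹 → (Nm → 𝔹.Zp) × Mem 𝔹} (W : ℕ)
    (h : ∀ K, L.V + W ≤ K → ∃ B, instrTime B ≤ c ∧ ∀ 𝔹 : BilinearGroup, 𝔹.p < 2 ^ L.nb →
      ∀ σ m mem, L.Rep K σ m mem →
        ∃ mem', RunsTo B mem mem' ∧ L.Rep K (g 𝔹 σ m).1 (g 𝔹 σ m).2 mem') :
    Rlz L c fun 𝔹 σ m => PMF.pure (g 𝔹 σ m) := by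
  refine ⟨W, fun K hK => ?_⟩
  obtain ⟨B, hB, h⟩ := h K hK
  refine ⟨B, hB, fun 𝔹 hp σ m mem hr β φ ψ hφ => ?_⟩
  obtain ⟨mem', h1, h2⟩ := h 𝔹 hp σ m mem hr
  rw [show runInstrs B mem = _ from h1, PMF.pure_bind, PMF.pure_bind]
  exact hφ _ _ _ h2

open Classical in
theorem Layout.Rep.update_var {K : ℕ} {𝔹 : BilinearGroup} {σ : Nm → 𝔹.Zp} {m mem : Mem 𝔹}
    (h : L.Rep K σ m mem) (hK : L.V ≤ K) (x : Nm) (z : 𝔹.Zp) :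
    L.Rep K (Function.update σ x z) m (Function.update mem (L.addr x) (emb (L.kd x) z)) := by
  refine ⟨fun y => ?_, fun r => ?_⟩
  · by_cases hy : y = x
    · subst hy; simp
    · rw [Function.update_of_ne hy, Function.update_of_ne fun h => hy (L.inj h), h.var]
  · have := L.lt x
    rw [Function.update_of_ne (by omega), h.reg]

theorem Layout.Rep.scratch {K : ℕ} {𝔹 : BilinearGroup} {σ : Nm → 𝔹.Zp} {m mem mem' : Mem 𝔹}
    (h : L.Rep K σ m mem) (he : ∀ r, r < L.V ∨ K ≤ r → mem' r = mem r) :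
    L.Rep K σ m mem' :=
  ⟨fun x => by rw [he _ (Or.inl (L.lt x)), h.var], fun r => by rw [he _ (Or.inr (by omega)), h.reg]⟩

theorem Layout.Rep.write {K : ℕ} {𝔹 : BilinearGroup} {σ : Nm → 𝔹.Zp} {m mem : Mem 𝔹}
    (h : L.Rep K σ m mem) (hK : L.V ≤ K) (d : ℕ) (vs : List (Val 𝔹)) :
    L.Rep K σ (m.write d vs) (mem.write (K + d) vs) := by
  refine ⟨fun y => ?_, fun r => ?_⟩
  · have := L.lt y
    rw [Mem.write, if_neg (by omega), h.var]
  · simp only [Mem.write]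
    by_cases hr : d ≤ r
    · rw [if_pos hr, if_pos (by omega), show K + r - (K + d) = r - d by omega, h.reg]
    · rw [if_neg hr, if_neg (by omega), h.reg]

open Classical in
/-- Semantics of an assignment. -/
def assign {Nm : Type} (x : Nm) (f : ∀ 𝔹 : BilinearGroup, (Nm → 𝔹.Zp) → Mem 𝔹 → 𝔹.Zp) : Sem Nm :=
  fun 𝔹 σ m => PMF.pure (Function.update σ x (f 𝔹 σ m), m)

theorem Rlz.assign {f : Fn Nm} {x : Nm} (h : Cp L.nb L.kd (L.kd x) c f) :
    Rlz L (c + 1) (assign x fun 𝔹 σ _ => f 𝔹 σ) := by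
  classical
  refine Rlz.of_runsTo (g := fun 𝔹 σ m => (Function.update σ x (f 𝔹 σ), m)) c fun K hK => ?_
  obtain ⟨B, hB, h⟩ := h.compile (addr := L.addr) L.V L.lt
  refine ⟨B ++ [.select (L.addr x) L.V L.V L.V], ?_, fun 𝔹 hp σ m mem hr => ?_⟩
  · rw [instrTime_append]; simpa [instrTime, Instr.cost] using hB
  obtain ⟨mem', h1, h2, h3⟩ := h 𝔹 hp σ mem hr.var
  refine ⟨_, h1.append (RunsTo.single (d := L.addr x) (v := emb (L.kd x) (f 𝔹 σ)) ?_), ?_⟩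
  · simp [Instr.exec, h2]
  · exact (hr.scratch fun r hr' => h3 r (by omega)).update_var (by omega) x _

theorem Rlz.readScalar {x : Nm} (hx : L.kd x = .s) (r : ℕ) :
    Rlz L 2 (LossyHIB.assign x fun _ _ m => (m r).toScalar) := by
  classical
  refine Rlz.of_runsTo (g := fun 𝔹 σ m => (Function.update σ x (m r).toScalar, m)) 1
    fun K hK => ?_
  refine ⟨[.lit L.V 0] ++ [.sadd (L.addr x) (K + r) L.V], by simp [instrTime, Instr.cost],
    fun 𝔹 hp σ m mem hr => ?_⟩
  refine ⟨_, (RunsTo.single (d := L.V) (v := emb .s 0) ?_).append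
    (RunsTo.single (d := L.addr x) (v := emb (L.kd x) (m r).toScalar) ?_),
      (hr.scratch fun r hr' => Function.update_of_ne (by omega) _ _).update_var (by omega) x _⟩
  · simp [Instr.exec, emb]
  · simp only [Instr.exec]
    rw [Function.update_of_ne (by omega), Function.update_self, hr.reg, hx]
    simp [emb, Val.toScalar]

theorem Rlz.readBit {x : Nm} (hx : L.kd x = .bit) (r : ℕ) :
    Rlz L 2 (LossyHIB.assign x fun _ _ m => ind ((m r).toBit = true)) := by
  classical
  refine Rlz.of_runsTo (g := fun 𝔹 σ m => (Function.update σ x (ind ((m r).toBit = true)), m)) 1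
    fun K hK => ?_
  refine ⟨[.nand L.V (K + r) (K + r)] ++ [.nand (L.addr x) L.V L.V],
    by simp [instrTime, Instr.cost], fun 𝔹 hp σ m mem hr => ?_⟩
  refine ⟨_, (RunsTo.single (d := L.V) (v := .bit !(m r).toBit) ?_).append
    (RunsTo.single (d := L.addr x) (v := emb (L.kd x) (ind ((m r).toBit = true))) ?_),
      (hr.scratch fun r hr' => Function.update_of_ne (by omega) _ _).update_var (by omega) x _⟩
  · simp [Instr.exec, hr.reg]
  · simp only [Instr.exec]
    rw [Function.update_self, hx]
    simp only [emb, ind_ne_zero]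
    generalize (m r).toBit = b
    cases b <;> simp [Val.toBit]

open Classical in
theorem Rlz.writeIf {x y : Nm} (hy : L.kd y = .bit) (r : ℕ) :
    Rlz L 1 fun _ σ m => PMF.pure (σ, if σ y ≠ 0 then m.write r [emb (L.kd x) (σ x)] else m) := by
  refine Rlz.of_runsTo
    (g := fun _ σ m => (σ, if σ y ≠ 0 then m.write r [emb (L.kd x) (σ x)] else m)) 1
    fun K hK => ?_
  refine ⟨[.select (K + r) (L.addr y) (L.addr x) (K + r)], by simp [instrTime, Instr.cost],
    fun 𝔹 hp σ m mem hr => ?_⟩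
  refine ⟨mem.write (K + r) [if σ y ≠ 0 then emb (L.kd x) (σ x) else m r], ?_, ?_⟩
  · rw [RunsTo, runInstrs_singleton]
    simp only [Instr.exec, hr.var, hr.reg, hy, emb, Val.toBit, decide_eq_true_eq]
  · dsimp only
    split_ifs with h
    · exact hr.write (by omega) r _
    · have := hr.write (by omega) r [m r]
      rwa [write_one m, Function.update_eq_self] at this

open Classical in
theorem write_cons {𝔹 : BilinearGroup} (m : Mem 𝔹) (r : ℕ) (v : Val 𝔹) (vs : List (Val 𝔹)) :
    m.write r (v :: vs) = (m.write r [v]).write (r + 1) vs := by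
  funext x
  simp only [Mem.write]
  by_cases h : r ≤ x
  · rw [if_pos h]
    by_cases h' : r + 1 ≤ x
    · obtain ⟨k, rfl⟩ := Nat.exists_eq_add_of_le h'
      rw [if_pos h', show r + 1 + k - r = k + 1 by omega, show r + 1 + k - (r + 1) = k by omega]
      simp
    · obtain rfl : x = r := by omega
      simp
  · rw [if_neg h, if_neg (by omega), if_neg h]

theorem write_nil {𝔹 : BilinearGroup} (m : Mem 𝔹) (r : ℕ) : m.write r [] = m := by
  funext x; simp [Mem.write]

open Classical in
theorem Rlz.writeListIf {y : Nm} (hy : L.kd y = .bit) (l : List Nm) (r : ℕ) :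
    Rlz L l.length fun _ σ m =>
      PMF.pure (σ, if σ y ≠ 0 then m.write r (l.map fun x => emb (L.kd x) (σ x)) else m) := by
  induction l generalizing r with
  | nil => exact Rlz.nil.congr fun 𝔹 σ m => by simp [write_nil]
  | cons a l ih =>
    refine ((Rlz.seq (Rlz.writeIf (x := a) hy r) (ih (r + 1))).mono
      (by simp [add_comm])).congr fun 𝔹 σ m => ?_
    rw [PMF.pure_bind, List.map_cons, write_cons m r (emb _ _) (l.map _)]
    dsimp only
    split_ifs <;> rfl

/-! ### Families of variables -/

/-- Overwrites a family of variables. -/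
def setF {ι Nm R : Type} (e : ι → Nm) (f : ι → R) (σ : Nm → R) : Nm → R := Function.extend e f σ

theorem setF_same {ι R : Type} {e : ι → Nm} (he : Function.Injective e) (f : ι → R) (σ : Nm → R)
    (i : ι) : setF e f σ (e i) = f i := he.extend_apply _ _ _

theorem setF_ne {ι R : Type} {e : ι → Nm} (f : ι → R) (σ : Nm → R) {x : Nm} (h : ∀ i, e i ≠ x) :
    setF e f σ x = σ x := Function.extend_apply' _ _ _ fun ⟨i, hi⟩ => h i hi

theorem Rlz.assignAll {ι : Type} [Fintype ι] {e : ι → Nm} (he : Function.Injective e)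
    {f : ι → ∀ 𝔹 : BilinearGroup, (Nm → 𝔹.Zp) → Mem 𝔹 → 𝔹.Zp}
    (h : ∀ i, Rlz L c (LossyHIB.assign (e i) (f i)))
    (hf : ∀ i 𝔹 σ σ' m, (∀ x, (∀ j, e j ≠ x) → σ x = σ' x) → f i 𝔹 σ m = f i 𝔹 σ' m) :
    Rlz L (Fintype.card ι * c) fun 𝔹 σ m => PMF.pure (setF e (fun i => f i 𝔹 σ m) σ, m) := by
  classical
  have key : ∀ l : List ι, Rlz L (l.length * c) fun 𝔹 σ m => PMF.pure
      (fun x => if hx : ∃ i, i ∈ l ∧ e i = x then f hx.choose 𝔹 σ m else σ x, m) := by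
    intro l
    induction l with
    | nil => exact (Rlz.nil.mono (by simp)).congr fun 𝔹 σ m => by simp
    | cons a l ih =>
      refine ((Rlz.seq (h a) ih).mono (by simp [add_mul, add_comm])).congr fun 𝔹 σ m => ?_
      rw [LossyHIB.assign, PMF.pure_bind]
      dsimp only
      congr 2
      funext x
      have hinv : ∀ i, f i 𝔹 (Function.update σ (e a) (f a 𝔹 σ m)) m = f i 𝔹 σ m := fun i =>
        hf i 𝔹 _ _ m fun y hy => Function.update_of_ne (fun h => hy a h.symm) _ _
      by_cases hx : ∃ i, i ∈ l ∧ e i = x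
      · have hx' : ∃ i, i ∈ a :: l ∧ e i = x := by
          obtain ⟨i, hi, hix⟩ := hx; exact ⟨i, by simp [hi], hix⟩
        rw [dif_pos hx, dif_pos hx', hinv]
        congr 1
        exact he (hx.choose_spec.2.trans hx'.choose_spec.2.symm)
      · rw [dif_neg hx]
        by_cases hax : e a = x
        · have hx' : ∃ i, i ∈ a :: l ∧ e i = x := ⟨a, by simp, hax⟩
          rw [dif_pos hx', he (hx'.choose_spec.2.trans hax.symm), ← hax, Function.update_self]
        · rw [Function.update_of_ne (Ne.symm hax), dif_neg]
          rintro ⟨i, hi, hix⟩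
          rcases List.mem_cons.1 hi with rfl | hi
          · exact hax hix
          · exact hx ⟨i, hi, hix⟩
  refine ((key (Finset.univ : Finset ι).toList).mono (by simp [Finset.length_toList])).congr
    fun 𝔹 σ m => ?_
  congr 2
  funext x
  by_cases hx : ∃ i, e i = x
  · obtain ⟨i, rfl⟩ := hx
    have hx : ∃ j, j ∈ (Finset.univ : Finset ι).toList ∧ e j = e i := ⟨i, by simp, rfl⟩
    rw [setF_same he, dif_pos hx, he hx.choose_spec.2]
  · rw [setF_ne _ _ fun i hi => hx ⟨i, hi⟩, dif_neg]
    rintro ⟨i, _, hi⟩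
    exact hx ⟨i, hi⟩

open Classical in
theorem Rlz.sample {x : Nm} (hx : L.kd x = .s) : Rlz L 1 fun 𝔹 σ m =>
    (PMF.uniformOfFintype 𝔹.Zp).map fun z => (Function.update σ x z, m) := by
  refine ⟨0, fun K hK => ⟨[.rndScalar (L.addr x)], by simp [instrTime, Instr.cost],
    fun 𝔹 hp σ m mem hr β φ ψ hφ => ?_⟩⟩
  rw [runInstrs_singleton, Instr.exec, PMF.bind_map, PMF.bind_map]
  congr 1
  funext z
  refine hφ _ _ _ ?_
  have := hr.update_var (by omega) x z
  rwa [hx, emb, ← write_one] at this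

theorem Rlz.sampleFin (k : ℕ) {e : Fin k → Nm} (he : Function.Injective e)
    (hk : ∀ i, L.kd (e i) = .s) :
    Rlz L k fun 𝔹 σ m => (PMF.uniformOfFintype (Fin k → 𝔹.Zp)).map fun z => (setF e z σ, m) := by
  classical
  induction k with
  | zero =>
    refine Rlz.nil.congr fun 𝔹 σ m => ?_
    have : (fun z : Fin 0 → 𝔹.Zp => (setF e z σ, m)) = Function.const _ (σ, m) := by
      funext z
      simp only [Function.const]
      congr 1
      funext x
      exact setF_ne _ _ fun i => i.elim0
    rw [this, PMF.map_const]
  | succ k ih =>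
    refine ((Rlz.seq (Rlz.sample (hk 0)) (ih (e := fun i => e i.succ)
      (fun i j h => Fin.succ_injective _ (he h)) fun i => hk _)).mono (by omega)).congr
        fun 𝔹 σ m => ?_
    rw [← uniform_map_of_bijective (Fin.consEquiv fun _ : Fin (k + 1) => 𝔹.Zp).bijective,
      PMF.map_comp, PMF.bind_map, PMF.map, uniform_prod_bind]
    congr 1
    funext z
    simp only [Function.comp, PMF.map]
    congr 1
    funext w
    simp only [Function.comp, Fin.consEquiv, Equiv.coe_fn_mk]
    congr 2
    funext x
    by_cases hx : ∃ i, e i = x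
    · obtain ⟨i, rfl⟩ := hx
      rw [setF_same he]
      refine Fin.cases ?_ (fun j => ?_) i
      · rw [setF_ne, Function.update_self, Fin.cons_zero]
        exact fun i h => Fin.succ_ne_zero i (he h)
      · rw [setF_same (e := fun i : Fin k => e i.succ)
          (fun i j h => Fin.succ_injective _ (he h)), Fin.cons_succ]
    · rw [setF_ne _ _ fun i hi => hx ⟨_, hi⟩, setF_ne _ _ fun i hi => hx ⟨_, hi⟩,
        Function.update_of_ne fun h => hx ⟨0, h.symm⟩]

theorem Rlz.sampleAll {ι : Type} [Fintype ι] [DecidableEq ι] {e : ι → Nm}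
    (he : Function.Injective e) (hk : ∀ i, L.kd (e i) = .s) :
    Rlz L (Fintype.card ι) fun 𝔹 σ m =>
      (PMF.uniformOfFintype (ι → 𝔹.Zp)).map fun z => (setF e z σ, m) := by
  have eq := Fintype.equivFin ι
  refine (Rlz.sampleFin (L := L) (Fintype.card ι) (e := fun i => e (eq.symm i))
    (fun i j h => eq.symm.injective (he h)) fun i => hk _).congr fun 𝔹 σ m => ?_
  rw [← uniform_map_of_bijective (Equiv.arrowCongr eq (Equiv.refl 𝔹.Zp)).bijective, PMF.map_comp]
  congr 1
  funext z
  simp only [Function.comp]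
  congr 1
  funext x
  by_cases hx : ∃ i, e i = x
  · obtain ⟨i, rfl⟩ := hx
    rw [setF_same he]
    have := setF_same (e := fun i => e (eq.symm i)) (fun i j h => eq.symm.injective (he h))
      ((Equiv.arrowCongr eq (Equiv.refl 𝔹.Zp)) z) σ (eq i)
    simpa using this
  · rw [setF_ne _ _ fun i hi => hx ⟨_, hi⟩, setF_ne _ _ fun i hi => hx ⟨_, hi⟩]

/-! ### Shifted instructions -/

/-- An instruction that acts on the registers from `K` on. -/
def Instr.shift (K : ℕ) : Instr → Instr
  | .bit d b => .bit (K + d) b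
  | .nand d a b => .nand (K + d) (K + a) (K + b)
  | .select d c a b => .select (K + d) (K + c) (K + a) (K + b)
  | .isEq d a b => .isEq (K + d) (K + a) (K + b)
  | .lit d k => .lit (K + d) k
  | .sadd d a b => .sadd (K + d) (K + a) (K + b)
  | .smul d a b => .smul (K + d) (K + a) (K + b)
  | .sinv d a => .sinv (K + d) (K + a)
  | .genG d => .genG (K + d)
  | .genGh d => .genGh (K + d)
  | .mul d a b => .mul (K + d) (K + a) (K + b)
  | .pow d a b => .pow (K + d) (K + a) (K + b)
  | .pair d a b => .pair (K + d) (K + a) (K + b)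
  | .getBit d a i => .getBit (K + d) (K + a) i
  | .decG d base len => .decG (K + d) (K + base) len
  | .decGh d base len => .decGh (K + d) (K + base) len
  | .decGT d base len => .decGT (K + d) (K + base) len
  | .rndBit d => .rndBit (K + d)
  | .rndScalar d => .rndScalar (K + d)
  | .rndUnit d => .rndUnit (K + d)

theorem Rlz.loc (i : Instr) : Rlz L i.cost fun _ σ m => (i.exec m).map fun m' => (σ, m') := by
  refine ⟨0, fun K hK => ⟨[i.shift K], by cases i <;> simp [instrTime, Instr.cost, Instr.shift],
    fun 𝔹 hp σ m mem hr β φ ψ hφ => ?_⟩⟩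
  have hrb : ∀ base len, Instr.readBits mem (K + base) len = Instr.readBits m base len := by
    intro base len
    simp only [Instr.readBits, add_assoc, hr.reg]
  have hw : ∀ d vs, φ (mem.write (K + d) vs) = ψ (σ, m.write d vs) := fun d vs =>
    hφ _ _ _ (hr.write (by omega) d vs)
  rw [runInstrs_singleton]
  cases i <;> dsimp only [Instr.shift, Instr.exec]
  case isEq => rw [hr.reg, hr.reg, PMF.pure_bind, PMF.pure_map, PMF.pure_bind, hw]
  all_goals
    simp only [hr.reg, hrb, PMF.pure_bind, PMF.pure_map, PMF.bind_map,
      PMF.map_comp, hw, Function.comp_def]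

theorem Rlz.locs (B : List Instr) :
    Rlz L (instrTime B) fun _ σ m => (runInstrs B m).map fun m' => (σ, m') := by
  induction B with
  | nil => exact Rlz.nil.congr fun 𝔹 σ m => by simp [runInstrs, PMF.pure_map]
  | cons i B ih =>
    refine ((Rlz.seq (Rlz.loc i) ih).mono (by simp [instrTime])).congr fun 𝔹 σ m => ?_
    rw [PMF.bind_map, runInstrs, PMF.map_bind]
    rfl

end Rlz

/-! ## The game with identities as zero-terminated vectors -/

section VGame

variable {𝔹 : BilinearGroup} {d : ℕ}

open Classical in
/-- The identity in `d` consecutive registers, as a vector whose components beyond the length of the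
identity are `0`. -/
def readV (d : ℕ) (m : Mem 𝔹) (base : ℕ) : Fin d → 𝔹.Zp := fun i =>
  if ∀ i' ≤ i, (m (base + i'.val)).toScalar ≠ 0 then (m (base + i.val)).toScalar else 0

open Classical in
def tgtOf (v : Fin d → 𝔹.Zp) : Fin d → 𝔹.Zp :=
  if ∃ i, v i ≠ 0 then v else fun i => if i.val = 0 then 1 else 0

/-- Prefixes of a target identity. -/
def pfxV (v t : Fin d → 𝔹.Zp) : Prop := ∀ i, v i = 0 ∨ v i = t i

/-- `i` is the first position beyond the end of an identity. -/
def curV (v : Fin d → 𝔹.Zp) (i : Fin d) : Prop := v i = 0 ∧ ∀ i' < i, v i' ≠ 0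

open Classical in
/-- The child of an identity. -/
def childV (v : Fin d → 𝔹.Zp) (x : 𝔹.Zp) : Fin d → 𝔹.Zp := fun i => if curV v i then x else v i

/-- Key generation, delegation and presentation of keys. -/
structure VGame (𝔹 : BilinearGroup) (d : ℕ) (κ : Type) where
  kg : (Fin d → 𝔹.Zp) → PMF κ
  del : (Fin d → 𝔹.Zp) → κ → 𝔹.Zp → PMF κ
  wire : (Fin d → 𝔹.Zp) → κ → List (Val 𝔹)

abbrev VState (𝔹 : BilinearGroup) (d : ℕ) (κ : Type) : Type :=
  Mem 𝔹 × List ((Fin d → 𝔹.Zp) × κ)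

open Classical in
def lookupV {κ : Type} (keys : List ((Fin d → 𝔹.Zp) × κ)) (v : Fin d → 𝔹.Zp) : Option κ :=
  (keys.find? fun e => decide (e.1 = v)).map Prod.snd

open Classical in
def execV {κ : Type} (O : VGame 𝔹 d κ) (t : Fin d → 𝔹.Zp) : Cmd → VState 𝔹 d κ → PMF (VState 𝔹 d κ)
  | .loc i, st => (i.exec st.1).map fun m => (m, st.2)
  | .createKey f r, st =>
      if (st.1 f).toBit = true ∧ ∃ i, readV d st.1 r i ≠ 0 then
        (O.kg (readV d st.1 r)).map fun k => (st.1, (readV d st.1 r, k) :: st.2)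
      else PMF.pure st
  | .createDelegatedKey f r x, st =>
      match lookupV st.2 (readV d st.1 r) with
      | some k =>
          if (st.1 f).toBit = true ∧ (st.1 x).toScalar ≠ 0 ∧ ∃ i, readV d st.1 r i = 0 then
            (O.del (readV d st.1 r) k (st.1 x).toScalar).map fun k' =>
              (st.1, (childV (readV d st.1 r) (st.1 x).toScalar, k') :: st.2)
          else PMF.pure st
      | none => PMF.pure st
  | .revealKey f r dst, st =>
      if (st.1 f).toBit = true then
        match lookupV st.2 (readV d st.1 r) with
        | some k =>
            if pfxV (readV d st.1 r) t then PMF.pure (st.1.write dst [.bit false], st.2)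
            else PMF.pure (st.1.write dst (.bit true :: O.wire (readV d st.1 r) k), st.2)
        | none => PMF.pure (st.1.write dst [.bit false], st.2)
      else PMF.pure st

def runV {κ : Type} (O : VGame 𝔹 d κ) (t : Fin d → 𝔹.Zp) :
    List Cmd → VState 𝔹 d κ → PMF (VState 𝔹 d κ)
  | [], st => PMF.pure st
  | c :: cs, st => (execV O t c st).bind (runV O t cs)

/-- Output bit of an adversary, for a setup that depends on the target identity. -/
def gameV {E κ : Type} (A : Adversary) (setup : (Fin d → 𝔹.Zp) → PMF E)
    (mpk : (Fin d → 𝔹.Zp) → E → List (Val 𝔹)) (O : (Fin d → 𝔹.Zp) → E → VGame 𝔹 d κ) : PMF Bool :=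
  (runInstrs A.choose (Mem.empty 𝔹)).bind fun m =>
  (setup (tgtOf (readV d m 0))).bind fun ev =>
  (runV (O (tgtOf (readV d m 0)) ev) (tgtOf (readV d m 0)) A.attack
    (m.write 0 (mpk (tgtOf (readV d m 0)) ev), [])).map fun st => (st.1 0).toBit

end VGame

/-! ## Simulators -/

/-- Variables that are available to a simulator: inputs, target identity, setup coins, identity,
parent key, new component, coins. -/
inductive BN (ni d : ℕ) (Ev Kc Co : Type) : Type
  | inp (i : Fin ni)
  | tg (i : Fin d)
  | ev (i : Ev)
  | id (i : Fin d)
  | par (k : Kc)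
  | x
  | co (c : Co)

def BN.kind {ni d : ℕ} {Ev Kc Co : Type} (ik : Fin ni → Kind) (kk : Kc → Kind) :
    BN ni d Ev Kc Co → Kind
  | .inp i => ik i
  | .par k => kk k
  | _ => .s

/-- Circuits that simulate the master public key, key generation, delegation and the presentation
of keys. -/
structure SimDesc (nb d : ℕ) where
  ni : ℕ
  ik : Fin ni → Kind
  Ev : Type
  Kc : Type
  Co : Type
  MI : Type
  WI : Type
  [fEv : Fintype Ev]
  [fKc : Fintype Kc]
  [fCo : Fintype Co]
  [fMI : Fintype MI]
  [fWI : Fintype WI]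
  [dEv : DecidableEq Ev]
  [dCo : DecidableEq Co]
  kk : Kc → Kind
  kk_ne : ∀ k, kk k ≠ .bit
  ml : List MI
  wl : List WI
  mpk : ∀ 𝔹 : BilinearGroup, (Fin ni → 𝔹.Zp) → (Fin d → 𝔹.Zp) → (Ev → 𝔹.Zp) → MI → 𝔹.Zp
  kg : ∀ 𝔹 : BilinearGroup, (Fin ni → 𝔹.Zp) → (Fin d → 𝔹.Zp) → (Ev → 𝔹.Zp) →
    (Fin d → 𝔹.Zp) → (Co → 𝔹.Zp) → Kc → 𝔹.Zp
  del : ∀ 𝔹 : BilinearGroup, (Fin ni → 𝔹.Zp) → (Fin d → 𝔹.Zp) → (Ev → 𝔹.Zp) →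
    (Fin d → 𝔹.Zp) → (Kc → 𝔹.Zp) → 𝔹.Zp → (Co → 𝔹.Zp) → Kc → 𝔹.Zp
  wire : ∀ 𝔹 : BilinearGroup, (Fin ni → 𝔹.Zp) → (Fin d → 𝔹.Zp) → (Ev → 𝔹.Zp) →
    (Fin d → 𝔹.Zp) → (Kc → 𝔹.Zp) → WI → 𝔹.Zp
  cost : ℕ
  mpk_cp : ∀ i, Cp (ν := BN ni d Ev Kc Co) nb (BN.kind ik kk) .g cost fun 𝔹 σ =>
    mpk 𝔹 (fun i => σ (.inp i)) (fun i => σ (.tg i)) (fun i => σ (.ev i)) i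
  kg_cp : ∀ k, Cp (ν := BN ni d Ev Kc Co) nb (BN.kind ik kk) (kk k) cost fun 𝔹 σ =>
    kg 𝔹 (fun i => σ (.inp i)) (fun i => σ (.tg i)) (fun i => σ (.ev i)) (fun i => σ (.id i))
      (fun i => σ (.co i)) k
  del_cp : ∀ k, Cp (ν := BN ni d Ev Kc Co) nb (BN.kind ik kk) (kk k) cost fun 𝔹 σ =>
    del 𝔹 (fun i => σ (.inp i)) (fun i => σ (.tg i)) (fun i => σ (.ev i)) (fun i => σ (.id i))
      (fun i => σ (.par i)) (σ .x) (fun i => σ (.co i)) k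
  wire_cp : ∀ k, Cp (ν := BN ni d Ev Kc Co) nb (BN.kind ik kk) .gh cost fun 𝔹 σ =>
    wire 𝔹 (fun i => σ (.inp i)) (fun i => σ (.tg i)) (fun i => σ (.ev i)) (fun i => σ (.id i))
      (fun i => σ (.par i)) k

attribute [instance] SimDesc.fEv SimDesc.fKc SimDesc.fCo SimDesc.fMI SimDesc.fWI SimDesc.dEv
  SimDesc.dCo

namespace SimDesc

variable {nb d : ℕ} (S : SimDesc nb d)

/-- The simulated key generation. -/
def game (𝔹 : BilinearGroup) (inp : Fin S.ni → 𝔹.Zp) (tg : Fin d → 𝔹.Zp) (ev : S.Ev → 𝔹.Zp) :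
    VGame 𝔹 d (S.Kc → 𝔹.Zp) where
  kg v := (PMF.uniformOfFintype (S.Co → 𝔹.Zp)).map fun co => S.kg 𝔹 inp tg ev v co
  del v k x := (PMF.uniformOfFintype (S.Co → 𝔹.Zp)).map fun co => S.del 𝔹 inp tg ev v k x co
  wire v k := S.wl.map fun i => emb .gh (S.wire 𝔹 inp tg ev v k i)

/-- Output bit of an adversary against the simulator. -/
def run (𝔹 : BilinearGroup) (A : Adversary) (inp : Fin S.ni → 𝔹.Zp) : PMF Bool :=
  gameV A (fun _ => PMF.uniformOfFintype (S.Ev → 𝔹.Zp))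
    (fun tg ev => S.ml.map fun i => emb .g (S.mpk 𝔹 inp tg ev i)) (fun tg ev => S.game 𝔹 inp tg ev)

abbrev BNm : Type := BN S.ni d S.Ev S.Kc S.Co

/-- The variables of the program that runs an adversary against the simulator. -/
inductive Nm (Q : ℕ) : Type
  | b (x : S.BNm)
  | rs (i : Fin d)
  | fl
  | fnd
  | g₁
  | g₂
  | tt
  | ff
  | mv (i : S.MI)
  | wv (i : S.WI)
  | pres (t : Fin Q)
  | kid (t : Fin Q) (i : Fin d)
  | key (t : Fin Q) (k : S.Kc)

variable {Q : ℕ}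

abbrev NmSum (Q : ℕ) : Type :=
  ((Fin S.ni ⊕ Fin d) ⊕ (S.Ev ⊕ Fin d) ⊕ (S.Kc ⊕ S.Co)) ⊕ (Fin d ⊕ Fin 7) ⊕ (S.MI ⊕ S.WI) ⊕
    Fin Q ⊕ (Fin Q × Fin d) ⊕ (Fin Q × S.Kc)

def Nm.toSum : S.Nm Q → S.NmSum Q
  | .b (.inp i) => .inl (.inl (.inl i))
  | .b (.tg i) => .inl (.inl (.inr i))
  | .b (.ev i) => .inl (.inr (.inl (.inl i)))
  | .b (.id i) => .inl (.inr (.inl (.inr i)))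
  | .b (.par i) => .inl (.inr (.inr (.inl i)))
  | .b (.co i) => .inl (.inr (.inr (.inr i)))
  | .b .x => .inr (.inl (.inr 0))
  | .rs i => .inr (.inl (.inl i))
  | .fl => .inr (.inl (.inr 1))
  | .fnd => .inr (.inl (.inr 2))
  | .g₁ => .inr (.inl (.inr 3))
  | .g₂ => .inr (.inl (.inr 4))
  | .tt => .inr (.inl (.inr 5))
  | .ff => .inr (.inl (.inr 6))
  | .mv i => .inr (.inr (.inl (.inl i)))
  | .wv i => .inr (.inr (.inl (.inr i)))
  | .pres t => .inr (.inr (.inr (.inl t)))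
  | .kid t i => .inr (.inr (.inr (.inr (.inl (t, i)))))
  | .key t k => .inr (.inr (.inr (.inr (.inr (t, k)))))

theorem Nm.toSum_injective : Function.Injective (Nm.toSum S (Q := Q)) := by
  intro a b h
  rcases a with (_ | _ | _ | _ | _ | _ | _) | _ | _ | _ | _ | _ | _ | _ | _ | _ | _ | _ | _ <;>
    rcases b with (_ | _ | _ | _ | _ | _ | _) | _ | _ | _ | _ | _ | _ | _ | _ | _ | _ | _ | _ <;>
    simp_all [Nm.toSum]

instance : Fintype (S.Nm Q) := Fintype.ofInjective _ (Nm.toSum_injective S)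

def Nm.kind : S.Nm Q → Kind
  | .b x => x.kind S.ik S.kk
  | .rs _ => .s
  | .mv _ => .g
  | .wv _ => .gh
  | .kid _ _ => .s
  | .key _ k => S.kk k
  | _ => .bit

def Nm.address : S.Nm Q → ℕ
  | .b (.inp i) => i
  | x => S.ni + Fintype.equivFin (S.Nm Q) x

theorem Nm.address_of (x : S.Nm Q) (h : ∀ i, x ≠ .b (.inp i)) :
    Nm.address S x = S.ni + Fintype.equivFin (S.Nm Q) x := by
  rcases x with (_ | _ | _ | _ | _ | _ | _) | _ | _ | _ | _ | _ | _ | _ | _ | _ | _ | _ | _ <;>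
    first | rfl | exact absurd rfl (h _)

theorem Nm.inp_or (x : S.Nm Q) : (∃ i, x = .b (.inp i)) ∨ ∀ i, x ≠ .b (.inp i) := by
  by_cases h : ∃ i, x = .b (.inp i)
  · exact .inl h
  · exact .inr fun i hi => h ⟨i, hi⟩

/-- The layout of the variables. -/
def layout (Q : ℕ) : Layout (S.Nm Q) where
  nb := nb
  kd := Nm.kind S
  addr := Nm.address S
  V := S.ni + Fintype.card (S.Nm Q)
  inj := by
    intro x y h
    rcases Nm.inp_or S x with ⟨i, rfl⟩ | hx <;> rcases Nm.inp_or S y with ⟨j, rfl⟩ | hy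
    · have h' : i.val = j.val := h
      rw [Fin.ext h']
    · rw [Nm.address_of S y hy] at h
      have h' : i.val = _ := h
      omega
    · rw [Nm.address_of S x hx] at h
      have h' : _ = j.val := h
      omega
    · rw [Nm.address_of S x hx, Nm.address_of S y hy] at h
      exact (Fintype.equivFin _).injective (Fin.ext (by omega))
  lt := by
    intro x
    rcases Nm.inp_or S x with ⟨i, rfl⟩ | hx
    · exact lt_of_lt_of_le i.isLt (Nat.le_add_right _ _)
    · rw [Nm.address_of S x hx]
      have := (Fintype.equivFin _ x).isLt
      omega

end SimDesc

theorem Rlz.assignCp {Nm : Type} {L : Layout Nm} {c : ℕ} {ι : Type} [Fintype ι] {e : ι → Nm}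
    (he : Function.Injective e) {f : ι → Fn Nm} (h : ∀ i, Cp L.nb L.kd (L.kd (e i)) c (f i))
    (hf : ∀ i 𝔹 σ σ', (∀ x, (∀ j, e j ≠ x) → σ x = σ' x) → f i 𝔹 σ = f i 𝔹 σ') :
    Rlz L (Fintype.card ι * (c + 1)) fun 𝔹 σ m => PMF.pure (setF e (fun i => f i 𝔹 σ) σ, m) :=
  Rlz.assignAll (f := fun i 𝔹 σ _ => f i 𝔹 σ) he (fun i => Rlz.assign (h i))
    fun i 𝔹 σ σ' _ => hf i 𝔹 σ σ'

theorem setF_spec {ι Nm R : Type} {e : ι → Nm} (he : Function.Injective e) (f : ι → R) (σ : Nm → R) :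
    ∃ σ', setF e f σ = σ' ∧ (∀ i, σ' (e i) = f i) ∧ ∀ x, (∀ i, e i ≠ x) → σ' x = σ x :=
  ⟨_, rfl, setF_same he f σ, fun _ h => setF_ne f σ h⟩

open Classical in
theorem update_spec {Nm R : Type} (e : Nm) (f : R) (σ : Nm → R) :
    ∃ σ', Function.update σ e f = σ' ∧ σ' e = f ∧ ∀ x, x ≠ e → σ' x = σ x :=
  ⟨_, rfl, Function.update_self _ _ _, fun _ h => Function.update_of_ne h _ _⟩

theorem Cp.bitVar {ν : Type} {nb : ℕ} {kd : ν → Kind} (v : ν) (h : kd v = .bit) :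
    Cp nb kd .bit 9 fun _ σ => ind (σ v ≠ 0) :=
  (Cp.not (Cp.nand (Cp.var' v h) .tt)).congr fun 𝔹 σ => by simp [ind_ne_zero]

namespace SimDesc

variable {nb d : ℕ} (S : SimDesc nb d) {Q : ℕ}

section Names

theorem inj_rs : Function.Injective (fun i : Fin d => (Nm.rs i : S.Nm Q)) := fun _ _ h => by
  simpa using h
theorem inj_id : Function.Injective (fun i : Fin d => (Nm.b (.id i) : S.Nm Q)) := fun _ _ h => by
  simpa using h
theorem inj_tg : Function.Injective (fun i : Fin d => (Nm.b (.tg i) : S.Nm Q)) := fun _ _ h => by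
  simpa using h
theorem inj_ev : Function.Injective (fun i : S.Ev => (Nm.b (.ev i) : S.Nm Q)) := fun _ _ h => by
  simpa using h
theorem inj_par : Function.Injective (fun i : S.Kc => (Nm.b (.par i) : S.Nm Q)) := fun _ _ h => by
  simpa using h
theorem inj_co : Function.Injective (fun i : S.Co => (Nm.b (.co i) : S.Nm Q)) := fun _ _ h => by
  simpa using h
theorem inj_mv : Function.Injective (fun i : S.MI => (Nm.mv i : S.Nm Q)) := fun _ _ h => by
  simpa using h
theorem inj_wv : Function.Injective (fun i : S.WI => (Nm.wv i : S.Nm Q)) := fun _ _ h => by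
  simpa using h
theorem inj_kid (t : Fin Q) : Function.Injective (fun i : Fin d => (Nm.kid t i : S.Nm Q)) :=
  fun _ _ h => by simpa using h
theorem inj_key (t : Fin Q) : Function.Injective (fun i : S.Kc => (Nm.key t i : S.Nm Q)) :=
  fun _ _ h => by simpa using h

end Names

/-! ### Reading identities -/

theorem cp_idPrefix {ν : Type} {nb : ℕ} {kd : ν → Kind} (e : Fin d → ν) (he : ∀ i, kd (e i) = .s)
    (i : Fin d) : Cp nb kd .s (d * 30 + 8) fun _ σ =>
      open Classical in if ∀ i' ≤ i, σ (e i') ≠ 0 then σ (e i) else 0 := by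
  refine ((Cp.ite (Cp.forall fun i' : Fin d => ((Cp.const (i' ≤ i)).not.or
    (Cp.nonzero (by decide) (Cp.var' (e i') (he i'))))) (Cp.var' (e i) (he i))
    (Cp.zero nb kd .s (by decide))).mono ?_).congr fun 𝔹 σ => ?_
  · simp only [Fintype.card_fin]; omega
  · simp only [imp_iff_not_or]; congr

def readIdCost (d : ℕ) : ℕ := d * 2 + d * (d * 30 + 8 + 1)

theorem rlz_readId (r : ℕ) : Rlz (S.layout Q) (readIdCost d) fun _ σ m =>
    PMF.pure (setF (fun i => Nm.b (.id i)) (readV d m r)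
      (setF Nm.rs (fun i : Fin d => (m (r + i.val)).toScalar) σ), m) := by
  have h1 := Rlz.assignAll (L := S.layout Q) (S.inj_rs (Q := Q)) (c := 2)
    (f := fun i _ _ m => (m (r + i.val)).toScalar) (fun i => Rlz.readScalar rfl _)
    (fun _ _ _ _ _ _ => rfl)
  have h2 := Rlz.assignCp (L := S.layout Q) (S.inj_id (Q := Q))
    (fun i => cp_idPrefix (fun i : Fin d => (Nm.rs i : S.Nm Q)) (fun _ => rfl) i)
    (fun i _ σ σ' h => by
      have : ∀ j : Fin d, σ (Nm.rs j) = σ' (Nm.rs j) := fun j => h _ (by simp)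
      simp only [this])
  refine ((Rlz.seq h1 h2).mono (by simp [readIdCost])).congr fun 𝔹 σ m => ?_
  rw [PMF.pure_bind]
  congr 3
  funext i
  simp only [setF_same (S.inj_rs (Q := Q)), readV]

theorem cp_curV {ν : Type} {nb : ℕ} {kd : ν → Kind} (e : Fin d → ν) (he : ∀ i, kd (e i) = .s)
    (i : Fin d) : Cp nb kd .bit (d * 30 + 13) fun 𝔹 σ =>
      ind (curV (𝔹 := 𝔹) (fun i => σ (e i)) i) := by
  refine ((Cp.and (Cp.eq_zero (by decide) (Cp.var' (e i) (he i))) (Cp.forall fun i' : Fin d =>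
    ((Cp.const (i' < i)).not.or (Cp.nonzero (by decide) (Cp.var' (e i') (he i')))))).mono
      ?_).congr fun 𝔹 σ => ?_
  · simp only [Fintype.card_fin]; omega
  · simp only [curV, imp_iff_not_or]

theorem cp_childV {ν : Type} {nb : ℕ} {kd : ν → Kind} (e : Fin d → ν) (he : ∀ i, kd (e i) = .s)
    (x : ν) (hx : kd x = .s) (i : Fin d) : Cp nb kd .s (d * 30 + 16) fun 𝔹 σ =>
      childV (𝔹 := 𝔹) (fun i => σ (e i)) (σ x) i :=
  (Cp.ite (cp_curV e he i) (Cp.var' x hx) (Cp.var' (e i) (he i))).congr fun 𝔹 σ => rfl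

theorem cp_pfxV {ν : Type} {nb : ℕ} {kd : ν → Kind} (e e' : Fin d → ν) (he : ∀ i, kd (e i) = .s)
    (he' : ∀ i, kd (e' i) = .s) : Cp nb kd .bit (d * 22 + 3) fun 𝔹 σ =>
      ind (pfxV (𝔹 := 𝔹) (fun i => σ (e i)) fun i => σ (e' i)) :=
  (Cp.forall fun i => (Cp.eq_zero (by decide) (Cp.var' (e i) (he i))).or
    (Cp.eq (k := .s) (by decide) (Cp.var' (e i) (he i)) (Cp.var' (e' i) (he' i)))).mono
      (by simp only [Fintype.card_fin]; omega)

/-! ### Created keys -/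

open Classical in
/-- The list of created keys that is represented by the variables of some slots. -/
def keysOf {𝔹 : BilinearGroup} (σ : S.Nm Q → 𝔹.Zp) :
    List (Fin Q) → List ((Fin d → 𝔹.Zp) × (S.Kc → 𝔹.Zp))
  | [] => []
  | t :: ts =>
      if σ (.pres t) ≠ 0 then (fun i => σ (.kid t i), fun k => σ (.key t k)) :: keysOf σ ts
      else keysOf σ ts

variable {S}

theorem keysOf_congr {𝔹 : BilinearGroup} {σ σ' : S.Nm Q → 𝔹.Zp} {l : List (Fin Q)}
    (h : ∀ t ∈ l, σ (.pres t) = σ' (.pres t) ∧ (∀ i, σ (.kid t i) = σ' (.kid t i)) ∧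
      ∀ k, σ (.key t k) = σ' (.key t k)) : S.keysOf σ l = S.keysOf σ' l := by
  induction l with
  | nil => rfl
  | cons t ts ih =>
    obtain ⟨h1, h2, h3⟩ := h t (by simp)
    simp only [keysOf, h1, h2, h3, ih fun t ht => h t (by simp [ht])]

def slotEq {𝔹 : BilinearGroup} (σ : S.Nm Q → 𝔹.Zp) (t : Fin Q) : Prop :=
  σ (.pres t) ≠ 0 ∧ ∀ i, σ (.kid t i) = σ (.b (.id i))

open Classical in
def parOf {𝔹 : BilinearGroup} (σ : S.Nm Q → 𝔹.Zp) (k : S.Kc) : List (Fin Q) → 𝔹.Zp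
  | [] => 0
  | t :: ts => if slotEq σ t then σ (.key t k) else parOf σ k ts

open Classical in
theorem lookupV_keysOf {𝔹 : BilinearGroup} (σ : S.Nm Q → 𝔹.Zp) (l : List (Fin Q))
    {v : Fin d → 𝔹.Zp} (hv : ∀ i, σ (.b (.id i)) = v i) :
    lookupV (S.keysOf σ l) v = if ∃ t ∈ l, slotEq σ t then some (fun k => parOf σ k l) else none := by
  obtain rfl : (fun i => σ (.b (.id i))) = v := funext hv
  induction l with
  | nil => simp [lookupV, keysOf]
  | cons t ts ih =>
    have hex : (∃ t' ∈ t :: ts, slotEq σ t') ↔ slotEq σ t ∨ ∃ t' ∈ ts, slotEq σ t' := by simp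
    simp only [hex, parOf]
    rw [keysOf]
    by_cases hp : σ (.pres t) ≠ 0
    · rw [if_pos hp]
      by_cases hk : slotEq σ t
      · rw [if_pos (.inl hk)]
        have : (fun i => σ (.kid t i)) = fun i => σ (.b (.id i)) := funext hk.2
        simp [lookupV, this, hk]
      · have h2 : ¬ (fun i => σ (.kid t i)) = fun i => σ (.b (.id i)) := fun h =>
          hk ⟨hp, fun i => congrFun h i⟩
        rw [lookupV, List.find?_cons_of_neg (by simpa using h2), ← lookupV, ih]
        simp [hk]
    · have hk : ¬ slotEq σ t := fun h => hp h.1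
      rw [if_neg hp, ih]
      simp [hk]

theorem cp_slotEq (t : Fin Q) : Cp nb (Nm.kind S) .bit (d * 8 + 17) fun 𝔹 σ =>
    ind (slotEq (S := S) (Q := Q) (𝔹 := 𝔹) σ t) :=
  ((Cp.and (Cp.bitVar (kd := Nm.kind S) (Nm.pres t) rfl) (Cp.forall fun i : Fin d =>
    Cp.eq (k := .s) (by decide) (Cp.var' (Nm.kid t i) rfl) (Cp.var' (Nm.b (.id i)) rfl))).mono
      (by simp only [Fintype.card_fin]; omega)).congr fun 𝔹 σ => rfl

theorem cp_parOf (k : S.Kc) (l : List (Fin Q)) :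
    Cp nb (Nm.kind S) (S.kk k) (l.length * (d * 8 + 19) + 3) fun 𝔹 σ =>
      parOf (S := S) (Q := Q) (𝔹 := 𝔹) σ k l := by
  induction l with
  | nil => exact (Cp.zero nb _ _ (S.kk_ne k)).mono (by simp)
  | cons t ts ih =>
    exact ((Cp.ite (cp_slotEq t) (Cp.var' (kd := Nm.kind S) (Nm.key t k) rfl) ih).mono (by
      rw [List.length_cons, Nat.add_mul]; omega)).congr fun 𝔹 σ => by rw [parOf]

theorem cp_found (l : List (Fin Q)) :
    Cp nb (Nm.kind S) .bit (l.length * (d * 8 + 26) + 7) fun 𝔹 σ =>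
      ind (∃ t ∈ l, slotEq (S := S) (Q := Q) (𝔹 := 𝔹) σ t) :=
  ((Cp.list_forall l fun t _ => (cp_slotEq t).not).not.mono
    (le_of_eq (by ring))).congr fun 𝔹 σ => by simp

theorem parOf_congr {𝔹 : BilinearGroup} {σ σ' : S.Nm Q → 𝔹.Zp} (k : S.Kc) (l : List (Fin Q))
    (h : ∀ i, σ (.b (.id i)) = σ' (.b (.id i))) (h' : ∀ t ∈ l, σ (.pres t) = σ' (.pres t) ∧
      (∀ i, σ (.kid t i) = σ' (.kid t i)) ∧ ∀ k, σ (.key t k) = σ' (.key t k)) :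
    parOf σ k l = parOf σ' k l := by
  induction l with
  | nil => rfl
  | cons t ts ih =>
    obtain ⟨h1, h2, h3⟩ := h' t (by simp)
    simp only [parOf, slotEq, h, h1, h2, h3, ih fun t ht => h' t (by simp [ht])]
    congr

variable (S) in
def lookupCost (Q : ℕ) : ℕ :=
  Q * (d * 8 + 26) + 7 + 1 + Fintype.card S.Kc * (Q * (d * 8 + 19) + 3 + 1)

open Classical in
theorem rlz_lookup (l : List (Fin Q)) (hl : l.length ≤ Q) :
    Rlz (S.layout Q) (S.lookupCost Q) fun 𝔹 σ m =>
      PMF.pure (setF (fun k => Nm.b (.par k)) (fun k => parOf σ k l)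
        (Function.update σ Nm.fnd (ind (∃ t ∈ l, slotEq (S := S) (Q := Q) (𝔹 := 𝔹) σ t))), m) := by
  have h1 := Rlz.assign (L := S.layout Q) (x := Nm.fnd)
    ((cp_found (S := S) l).mono (Nat.add_le_add_right (Nat.mul_le_mul_right _ hl) _))
  have h2 := Rlz.assignCp (L := S.layout Q) (S.inj_par (Q := Q))
    (fun k => (cp_parOf k l).mono (Nat.add_le_add_right (Nat.mul_le_mul_right _ hl) _))
    (fun k 𝔹 σ σ' h => parOf_congr k l (fun i => h _ (by simp)) fun t _ =>
      ⟨h _ (by simp), fun i => h _ (by simp), fun k => h _ (by simp)⟩)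
  refine ((Rlz.seq h1 h2).mono (by simp [lookupCost])).congr fun 𝔹 σ m => ?_
  rw [LossyHIB.assign, PMF.pure_bind]
  congr 3
  funext k
  exact parOf_congr k l (fun i => by simp) fun t _ => ⟨by simp, fun i => by simp, fun k => by simp⟩

/-! ### Commands -/

/-- The values of the inputs, the target identity and the setup coins. -/
def fixed {𝔹 : BilinearGroup} (σ : S.Nm Q → 𝔹.Zp) :
    (Fin S.ni → 𝔹.Zp) × (Fin d → 𝔹.Zp) × (S.Ev → 𝔹.Zp) :=
  (fun i => σ (.b (.inp i)), fun i => σ (.b (.tg i)), fun i => σ (.b (.ev i)))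

/-- `sem` performs the command `c` on the keys in the slots `l`, leaving keys in the slots `l'`. -/
def Performs (c : Cmd) (l l' : List (Fin Q)) (sem : Sem (S.Nm Q)) : Prop :=
  ∀ (𝔹 : BilinearGroup) (σ : S.Nm Q → 𝔹.Zp) (m : Mem 𝔹) (β : Type)
    (ψ : (S.Nm Q → 𝔹.Zp) × Mem 𝔹 → PMF β) (ψ' : VState 𝔹 d (S.Kc → 𝔹.Zp) → PMF β),
    (∀ σ' m', fixed σ' = fixed σ → ψ (σ', m') = ψ' (m', S.keysOf σ' l')) →
    (sem 𝔹 σ m).bind ψ = (execV (S.game 𝔹 (fixed σ).1 (fixed σ).2.1 (fixed σ).2.2) (fixed σ).2.1 c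
      (m, S.keysOf σ l)).bind ψ'

theorem performs_loc (i : Instr) (l : List (Fin Q)) :
    Performs (S := S) (.loc i) l l fun _ σ m => (i.exec m).map fun m' => (σ, m') := by
  intro 𝔹 σ m β ψ ψ' h
  rw [execV, PMF.bind_map, PMF.bind_map]
  congr 1
  funext m'
  exact h σ m' rfl

def createCost (S : SimDesc nb d) : ℕ :=
  readIdCost d + (2 + (Fintype.card S.Co + (Fintype.card S.Kc * (S.cost + 1) +
    (d * 2 + (9 + (d * 18 + 7) + 5 + 1)))))

theorem cp_ids_exists : Cp nb (Nm.kind S) .bit (d * 18 + 7) fun 𝔹 σ =>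
    ind (∃ i : Fin d, (σ : S.Nm Q → 𝔹.Zp) (.b (.id i)) ≠ 0) :=
  (Cp.exists fun i : Fin d => Cp.nonzero (k := .s) (by decide)
    (Cp.var' (kd := Nm.kind S) (Nm.b (.id i)) rfl)).mono (by simp)

theorem rlz_create (f r : ℕ) (t : Fin Q) (l : List (Fin Q)) (ht : t ∉ l) :
    ∃ sem, Rlz (S.layout Q) (createCost S) sem ∧
      Performs (S := S) (.createKey f r) l (t :: l) sem := by
  classical
  have h1 := S.rlz_readId (Q := Q) r
  have h2 := Rlz.readBit (L := S.layout Q) (x := Nm.fl) rfl f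
  have h3 := Rlz.sampleAll (L := S.layout Q) (S.inj_co (Q := Q)) (fun _ => rfl)
  have h4 := Rlz.assignCp (L := S.layout Q) (S.inj_key t) (fun k =>
    (S.kg_cp k).rename (kd' := Nm.kind S) Nm.b fun _ => rfl)
    (fun k 𝔹 σ σ' h => by simp [h])
  have h5 := Rlz.assignCp (L := S.layout Q) (S.inj_kid t) (fun i =>
    Cp.var' (kd := Nm.kind S) (Nm.b (.id i)) rfl) (fun k 𝔹 σ σ' h => by simp [h])
  have h6 := Rlz.assign (L := S.layout Q) (x := Nm.pres t)
    (Cp.and (Cp.bitVar (kd := Nm.kind S) Nm.fl rfl) cp_ids_exists)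
  refine ⟨_, (h1.seq (h2.seq (h3.seq (h4.seq (h5.seq h6))))).mono ?_, ?_⟩
  · simp [createCost]
  intro 𝔹 σ m β ψ ψ' h
  simp only [PMF.pure_bind, PMF.bind_bind, PMF.bind_map, Function.comp_def, LossyHIB.assign, execV]
  have hk : ∀ t' ∈ l, t ≠ t' ∧ t' ≠ t := fun t' h1 =>
    ⟨fun h2 => ht (h2 ▸ h1), fun h2 => ht (h2 ▸ h1)⟩
  obtain ⟨σ₁, e₁, s₁, n₁⟩ := setF_spec S.inj_rs (fun i : Fin d => (m (r + i.val)).toScalar) σ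
  obtain ⟨σ₂, e₂, s₂, n₂⟩ := setF_spec S.inj_id (readV d m r) σ₁
  obtain ⟨σ₃, e₃, s₃, n₃⟩ := update_spec Nm.fl (ind ((m f).toBit = true)) σ₂
  simp only [e₁, e₂, e₃]
  have hf₃ : fixed σ₃ = fixed σ := by simp [fixed, n₁, n₂, n₃]
  trans (PMF.uniformOfFintype (S.Co → 𝔹.Zp)).bind fun z => ψ' (m,
      if (m f).toBit = true ∧ ∃ i, readV d m r i ≠ 0 then
        (readV d m r, S.kg 𝔹 (fixed σ).1 (fixed σ).2.1 (fixed σ).2.2 (readV d m r) z) ::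
          S.keysOf σ l else S.keysOf σ l)
  · congr 1
    funext z
    obtain ⟨σ₄, e₄, s₄, n₄⟩ := setF_spec S.inj_co z σ₃
    obtain ⟨σ₅, e₅, s₅, n₅⟩ := setF_spec (S.inj_key t) (S.kg 𝔹 (fun i => σ₄ (.b (.inp i)))
      (fun i => σ₄ (.b (.tg i))) (fun i => σ₄ (.b (.ev i))) (fun i => σ₄ (.b (.id i)))
      (fun i => σ₄ (.b (.co i)))) σ₄
    obtain ⟨σ₆, e₆, s₆, n₆⟩ := setF_spec (S.inj_kid t) (fun i => σ₅ (.b (.id i))) σ₅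
    obtain ⟨σ₇, e₇, s₇, n₇⟩ := update_spec (Nm.pres t)
      (ind (σ₆ .fl ≠ 0 ∧ ∃ i, σ₆ (.b (.id i)) ≠ 0)) σ₆
    refine (congrArg (fun s => ψ (s, m)) (?_ : _ = σ₇)).trans ((h σ₇ m ?_).trans ?_)
    · rw [← e₇, ← e₆, ← e₅, ← e₄]; rfl
    · rw [← hf₃]; simp [fixed, n₄, n₅, n₆, n₇]
    have hfl : σ₆ .fl ≠ 0 ↔ (m f).toBit = true := by simp [n₆, n₅, n₄, s₃, ind_ne_zero]
    have hid : ∀ i, σ₅ (.b (.id i)) = readV d m r i := fun i => by simp [n₅, n₄, n₃, s₂]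
    have hid' : ∀ i, σ₆ (.b (.id i)) = readV d m r i := fun i => by simp [n₆, hid]
    have hl : S.keysOf σ₇ l = S.keysOf σ l := keysOf_congr fun t' h' => by
      simp [n₁, n₂, n₃, n₄, n₅, n₆, n₇, hk t' h']
    have hkid : (fun i => σ₇ (.kid t i)) = readV d m r := funext fun i => by simp [n₇, s₆, hid]
    have h1 : (fun i => σ₄ (.b (.id i))) = readV d m r := funext fun i => by simp [n₄, n₃, s₂]
    have h2 : (fun i => σ₄ (.b (.co i))) = z := funext s₄
    have h3 : fixed σ₄ = fixed σ := by rw [← hf₃]; simp [fixed, n₄]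
    have hkey : (fun k => σ₇ (.key t k)) =
        S.kg 𝔹 (fixed σ).1 (fixed σ).2.1 (fixed σ).2.2 (readV d m r) z := by
      rw [← h3, ← h1, ← h2]
      funext k
      simp [n₇, n₆, s₅, fixed]
    rw [keysOf, hl, s₇, hkid, hkey]
    simp only [ind_ne_zero, hfl, hid']
  by_cases hc : (m f).toBit = true ∧ ∃ i, readV d m r i ≠ 0
  · simp only [if_pos hc, PMF.bind_map, game, Function.comp_def]
  · simp only [if_neg hc, PMF.pure_bind, PMF.bind_const]

def delegateCost (S : SimDesc nb d) (Q : ℕ) : ℕ :=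
  readIdCost d + (2 + (2 + (S.lookupCost Q + (Fintype.card S.Co + (Fintype.card S.Kc * (S.cost + 1) +
    (d * (d * 30 + 16 + 1) + (9 + 9 + 5 + (9 + (d * 14 + 7) + 5) + 5 + 1)))))))

theorem cp_ids_vanish : Cp nb (Nm.kind S) .bit (d * 14 + 7) fun 𝔹 σ =>
    ind (∃ i : Fin d, (σ : S.Nm Q → 𝔹.Zp) (.b (.id i)) = 0) :=
  (Cp.exists fun i : Fin d => Cp.eq_zero (k := .s) (by decide)
    (Cp.var' (kd := Nm.kind S) (Nm.b (.id i)) rfl)).mono (by simp)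

theorem rlz_delegate (f r x : ℕ) (t : Fin Q) (l : List (Fin Q)) (ht : t ∉ l) (hl : l.length ≤ Q) :
    ∃ sem, Rlz (S.layout Q) (delegateCost S Q) sem ∧
      Performs (S := S) (.createDelegatedKey f r x) l (t :: l) sem := by
  classical
  have h1 := S.rlz_readId (Q := Q) r
  have h2 := Rlz.readBit (L := S.layout Q) (x := Nm.fl) rfl f
  have h2' := Rlz.readScalar (L := S.layout Q) (x := Nm.b .x) rfl x
  have h2'' := rlz_lookup (S := S) l hl
  have h3 := Rlz.sampleAll (L := S.layout Q) (S.inj_co (Q := Q)) (fun _ => rfl)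
  have h4 := Rlz.assignCp (L := S.layout Q) (S.inj_key t) (fun k =>
    (S.del_cp k).rename (kd' := Nm.kind S) Nm.b fun _ => rfl)
    (fun k 𝔹 σ σ' h => by simp [h])
  have h5 := Rlz.assignCp (L := S.layout Q) (S.inj_kid t) (fun i =>
    cp_childV (kd := Nm.kind S) (fun i => Nm.b (.id i)) (fun _ => rfl) (Nm.b .x) rfl i)
    (fun k 𝔹 σ σ' h => by simp [h])
  have h6 := Rlz.assign (L := S.layout Q) (x := Nm.pres t)
    (Cp.and (Cp.and (Cp.bitVar (kd := Nm.kind S) Nm.fl rfl) (Cp.bitVar (kd := Nm.kind S) Nm.fnd rfl))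
      (Cp.and (Cp.nonzero (k := .s) (by decide) (Cp.var' (kd := Nm.kind S) (Nm.b .x) rfl))
        cp_ids_vanish))
  refine ⟨_, (h1.seq (h2.seq (h2'.seq (h2''.seq (h3.seq (h4.seq (h5.seq h6))))))).mono ?_, ?_⟩
  · simp [delegateCost]
  intro 𝔹 σ m β ψ ψ' h
  simp only [PMF.pure_bind, PMF.bind_bind, PMF.bind_map, Function.comp_def, LossyHIB.assign, execV]
  have hk : ∀ t' ∈ l, t ≠ t' ∧ t' ≠ t := fun t' h1 =>
    ⟨fun h2 => ht (h2 ▸ h1), fun h2 => ht (h2 ▸ h1)⟩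
  obtain ⟨σ₁, e₁, s₁, n₁⟩ := setF_spec S.inj_rs (fun i : Fin d => (m (r + i.val)).toScalar) σ
  obtain ⟨σ₂, e₂, s₂, n₂⟩ := setF_spec S.inj_id (readV d m r) σ₁
  obtain ⟨σ₂', e₂', s₂', n₂'⟩ := update_spec Nm.fl (ind ((m f).toBit = true)) σ₂
  obtain ⟨σ₂₂, e₂₂, s₂₂, n₂₂⟩ := update_spec (Nm.b .x) ((m x).toScalar) σ₂'
  obtain ⟨σ₂₃, e₂₃, s₂₃, n₂₃⟩ := update_spec Nm.fnd (ind (∃ t ∈ l, slotEq σ₂₂ t)) σ₂₂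
  obtain ⟨σ₃, e₃, s₃, n₃⟩ := setF_spec S.inj_par (fun k => parOf σ₂₂ k l) σ₂₃
  simp only [e₁, e₂, e₂', e₂₂, e₂₃, e₃]
  have hf₃ : fixed σ₃ = fixed σ := by simp [fixed, n₁, n₂, n₃, n₂', n₂₂, n₂₃]
  have hlook := lookupV_keysOf σ₂₂ l (v := readV d m r) (fun i => by simp [n₂₂, n₂', s₂])
  rw [keysOf_congr (σ' := σ) fun t' _ => by simp [n₁, n₂, n₂', n₂₂]] at hlook
  rw [hlook]
  trans (PMF.uniformOfFintype (S.Co → 𝔹.Zp)).bind fun z => ψ' (m,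
      if ((m f).toBit = true ∧ ∃ t ∈ l, slotEq σ₂₂ t) ∧ ((m x).toScalar ≠ 0 ∧ ∃ i, readV d m r i = 0) then
        (childV (readV d m r) (m x).toScalar, S.del 𝔹 (fixed σ).1 (fixed σ).2.1 (fixed σ).2.2
          (readV d m r) (fun k => parOf σ₂₂ k l) (m x).toScalar z) ::
          S.keysOf σ l else S.keysOf σ l)
  · congr 1
    funext z
    obtain ⟨σ₄, e₄, s₄, n₄⟩ := setF_spec S.inj_co z σ₃
    obtain ⟨σ₅, e₅, s₅, n₅⟩ := setF_spec (S.inj_key t) (S.del 𝔹 (fun i => σ₄ (.b (.inp i)))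
      (fun i => σ₄ (.b (.tg i))) (fun i => σ₄ (.b (.ev i))) (fun i => σ₄ (.b (.id i)))
      (fun i => σ₄ (.b (.par i))) (σ₄ (.b .x)) (fun i => σ₄ (.b (.co i)))) σ₄
    obtain ⟨σ₆, e₆, s₆, n₆⟩ := setF_spec (S.inj_kid t)
      (childV (fun i => σ₅ (.b (.id i))) (σ₅ (.b .x))) σ₅
    obtain ⟨σ₇, e₇, s₇, n₇⟩ := update_spec (Nm.pres t)
      (ind ((σ₆ .fl ≠ 0 ∧ σ₆ .fnd ≠ 0) ∧ (σ₆ (.b .x) ≠ 0 ∧ ∃ i, σ₆ (.b (.id i)) = 0))) σ₆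
    refine (congrArg (fun s => ψ (s, m)) (?_ : _ = σ₇)).trans ((h σ₇ m ?_).trans ?_)
    · rw [← e₇, ← e₆, ← e₅, ← e₄]; rfl
    · rw [← hf₃]; simp [fixed, n₄, n₅, n₆, n₇]
    have hfl : σ₆ .fl ≠ 0 ↔ (m f).toBit = true := by
      simp [n₆, n₅, n₄, n₃, n₂₃, n₂₂, s₂', ind_ne_zero]
    have hfnd : σ₆ .fnd ≠ 0 ↔ ∃ t ∈ l, slotEq σ₂₂ t := by
      rw [show σ₆ .fnd = ind (∃ t ∈ l, slotEq σ₂₂ t) by simp [n₆, n₅, n₄, n₃, s₂₃], ind_ne_zero]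
    have hx : σ₅ (.b .x) = (m x).toScalar := by simp [n₅, n₄, n₃, n₂₃, s₂₂]
    have hx' : σ₆ (.b .x) = (m x).toScalar := by simp [n₆, hx]
    have hid : ∀ i, σ₅ (.b (.id i)) = readV d m r i := fun i => by
      simp [n₅, n₄, n₃, n₂₃, n₂₂, n₂', s₂]
    have hid' : ∀ i, σ₆ (.b (.id i)) = readV d m r i := fun i => by simp [n₆, hid]
    have hl : S.keysOf σ₇ l = S.keysOf σ l := keysOf_congr fun t' h' => by
      simp [n₁, n₂, n₂', n₂₂, n₂₃, n₃, n₄, n₅, n₆, n₇, hk t' h']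
    have hkid : (fun i => σ₇ (.kid t i)) = childV (readV d m r) (m x).toScalar := funext fun i => by
      simp [n₇, s₆, hid, hx]
    have h1 : (fun i => σ₄ (.b (.id i))) = readV d m r := funext fun i => by
      simp [n₄, n₃, n₂₃, n₂₂, n₂', s₂]
    have h2 : (fun i => σ₄ (.b (.co i))) = z := funext s₄
    have h3 : fixed σ₄ = fixed σ := by rw [← hf₃]; simp [fixed, n₄]
    have h4 : (fun k => σ₄ (.b (.par k))) = fun k => parOf σ₂₂ k l := funext fun k => by
      simp [n₄, s₃]
    have h5 : σ₄ (.b .x) = (m x).toScalar := by simp [n₄, n₃, n₂₃, s₂₂]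
    have hkey : (fun k => σ₇ (.key t k)) =
        S.del 𝔹 (fixed σ).1 (fixed σ).2.1 (fixed σ).2.2 (readV d m r) (fun k => parOf σ₂₂ k l)
          (m x).toScalar z := by
      rw [← h3, ← h1, ← h2, ← h4, ← h5]
      funext k
      simp [n₇, n₆, s₅, fixed]
    rw [keysOf, hl, s₇, hkid, hkey]
    simp only [ind_ne_zero, hfl, hfnd, hid', hx']
  by_cases hc : ∃ t ∈ l, slotEq σ₂₂ t
  · simp only [if_pos hc]
    by_cases hc' : (m f).toBit = true ∧ (m x).toScalar ≠ 0 ∧ ∃ i, readV d m r i = 0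
    · simp only [if_pos hc', PMF.bind_map, game, Function.comp_def, hc, hc'.1, hc'.2, true_and,
        ne_eq, not_false_eq_true, if_true]
    · have hc'' : ¬ (((m f).toBit = true ∧ ∃ t ∈ l, slotEq σ₂₂ t) ∧
          ((m x).toScalar ≠ 0 ∧ ∃ i, readV d m r i = 0)) := fun h => hc' ⟨h.1.1, h.2⟩
      simp only [if_neg hc', if_neg hc'', PMF.pure_bind, PMF.bind_const]
  · have hc'' : ¬ (((m f).toBit = true ∧ ∃ t ∈ l, slotEq σ₂₂ t) ∧
          ((m x).toScalar ≠ 0 ∧ ∃ i, readV d m r i = 0)) := fun h => hc h.1.2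
    simp only [if_neg hc, if_neg hc'', PMF.pure_bind, PMF.bind_const]

def revealCost (S : SimDesc nb d) (Q : ℕ) : ℕ :=
  readIdCost d + (2 + (S.lookupCost Q + (Fintype.card S.WI * (S.cost + 1) + (4 + (4 + (4 +
    ((9 + (9 + (d * 22 + 3 + 4) + 5 + 4) + 5 + 1) + ((9 + (9 + (d * 22 + 3 + 4) + 5) + 5 + 1) +
      (1 + (S.wl.length + 1))))))))))

theorem rlz_reveal (f r dst : ℕ) (t : Fin Q) (l : List (Fin Q)) (ht : t ∉ l) (hl : l.length ≤ Q) :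
    ∃ sem, Rlz (S.layout Q) (revealCost S Q) sem ∧
      Performs (S := S) (.revealKey f r dst) l (t :: l) sem := by
  classical
  have h1 := S.rlz_readId (Q := Q) r
  have h2 := Rlz.readBit (L := S.layout Q) (x := Nm.fl) rfl f
  have h3 := rlz_lookup (S := S) l hl
  have h4 := Rlz.assignCp (L := S.layout Q) (S.inj_wv (Q := Q)) (fun k =>
    (S.wire_cp k).rename (kd' := Nm.kind S) Nm.b fun _ => rfl)
    (fun k 𝔹 σ σ' h => by simp [h])
  have h5 := Rlz.assign (L := S.layout Q) (x := Nm.tt) (Cp.const (kd := Nm.kind S) True)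
  have h6 := Rlz.assign (L := S.layout Q) (x := Nm.ff) (Cp.const (kd := Nm.kind S) False)
  have h7 := Rlz.assign (L := S.layout Q) (x := Nm.pres t) (Cp.const (kd := Nm.kind S) False)
  have hb := Cp.and (Cp.bitVar (kd := Nm.kind S) Nm.fnd rfl)
      (cp_pfxV (nb := nb) (kd := Nm.kind S) (fun i => (Nm.b (.id i) : S.Nm Q)) (fun i => Nm.b (.tg i))
        (fun _ => rfl) (fun _ => rfl)).not
  have h8 := Rlz.assign (L := S.layout Q) (x := Nm.g₁)
    (Cp.and (Cp.bitVar (kd := Nm.kind S) Nm.fl rfl) hb.not)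
  have h9 := Rlz.assign (L := S.layout Q) (x := Nm.g₂)
    (Cp.and (Cp.bitVar (kd := Nm.kind S) Nm.fl rfl) hb)
  have hA := Rlz.writeListIf (L := S.layout Q) (y := Nm.g₁) rfl [Nm.ff] dst
  have hB := Rlz.writeListIf (L := S.layout Q) (y := Nm.g₂) rfl (Nm.tt :: S.wl.map Nm.wv) dst
  refine ⟨_, (h1.seq (h2.seq (h3.seq (h4.seq (h5.seq (h6.seq (h7.seq (h8.seq (h9.seq
    (hA.seq hB)))))))))).mono ?_, ?_⟩
  · simp [revealCost]
  intro 𝔹 σ m β ψ ψ' h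
  simp only [PMF.pure_bind, PMF.bind_bind, PMF.bind_map, Function.comp_def, LossyHIB.assign, execV]
  have hk : ∀ t' ∈ l, t ≠ t' ∧ t' ≠ t := fun t' h1 =>
    ⟨fun h2 => ht (h2 ▸ h1), fun h2 => ht (h2 ▸ h1)⟩
  obtain ⟨σ₁, e₁, s₁, n₁⟩ := setF_spec S.inj_rs (fun i : Fin d => (m (r + i.val)).toScalar) σ
  obtain ⟨σ₂, e₂, s₂, n₂⟩ := setF_spec S.inj_id (readV d m r) σ₁
  obtain ⟨σ₃, e₃, s₃, n₃⟩ := update_spec Nm.fl (ind ((m f).toBit = true)) σ₂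
  obtain ⟨σ₄, e₄, s₄, n₄⟩ := update_spec Nm.fnd (ind (∃ t ∈ l, slotEq σ₃ t)) σ₃
  obtain ⟨σ₅, e₅, s₅, n₅⟩ := setF_spec S.inj_par (fun k => parOf σ₃ k l) σ₄
  simp only [e₁, e₂, e₃, e₄, e₅]
  have hlook := lookupV_keysOf σ₃ l (v := readV d m r) (fun i => by simp [n₃, s₂])
  rw [keysOf_congr (σ' := σ) fun t' _ => by simp [n₁, n₂, n₃]] at hlook
  rw [hlook]
  have hf₅ : fixed σ₅ = fixed σ := by simp [fixed, n₁, n₂, n₃, n₄, n₅]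
  obtain ⟨σ₆, e₆, s₆, n₆⟩ := setF_spec S.inj_wv (S.wire 𝔹 (fun i => σ₅ (.b (.inp i)))
      (fun i => σ₅ (.b (.tg i))) (fun i => σ₅ (.b (.ev i))) (fun i => σ₅ (.b (.id i)))
      (fun i => σ₅ (.b (.par i)))) σ₅
  have e₆' := e₆
  obtain ⟨σ₇, e₇, s₇, n₇⟩ := update_spec Nm.tt (ind True) σ₆
  obtain ⟨σ₈, e₈, s₈, n₈⟩ := update_spec Nm.ff (ind False) σ₇
  obtain ⟨σ₉, e₉, s₉, n₉⟩ := update_spec (Nm.pres t) (ind False) σ₈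
  simp only [e₆, e₇, e₈, e₉]
  obtain ⟨σ₁₀, e₁₀, s₁₀, n₁₀⟩ := update_spec Nm.g₁ (ind (σ₉ .fl ≠ 0 ∧ ¬ (σ₉ .fnd ≠ 0 ∧
    ¬ pfxV (fun i => σ₉ (.b (.id i))) (fun i => σ₉ (.b (.tg i)))))) σ₉
  simp only [e₁₀]
  obtain ⟨σ₁₁, e₁₁, s₁₁, n₁₁⟩ := update_spec Nm.g₂ (ind (σ₁₀ .fl ≠ 0 ∧ (σ₁₀ .fnd ≠ 0 ∧
    ¬ pfxV (fun i => σ₁₀ (.b (.id i))) (fun i => σ₁₀ (.b (.tg i)))))) σ₁₀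
  simp only [e₁₁]
  have hf₁₁ : fixed σ₁₁ = fixed σ := by rw [← hf₅]; simp [fixed, n₆, n₇, n₈, n₉, n₁₀, n₁₁]
  have hl : S.keysOf σ₁₁ l = S.keysOf σ l := keysOf_congr fun t' h' => by
    simp [n₁, n₂, n₃, n₄, n₅, n₆, n₇, n₈, n₉, n₁₀, n₁₁, hk t' h']
  have hl' : S.keysOf σ₁₁ (t :: l) = S.keysOf σ l := by
    rw [keysOf, if_neg, hl]
    simp [n₁₁, n₁₀, s₉, ind]
  rw [h σ₁₁ _ hf₁₁, hl']
  have hid : (fun i => σ₉ (.b (.id i))) = readV d m r := funext fun i => by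
    simp [n₉, n₈, n₇, n₆, n₅, n₄, n₃, s₂]
  have hid' : (fun i => σ₁₀ (.b (.id i))) = readV d m r := by rw [← hid]; simp [n₁₀]
  have htg : (fun i => σ₉ (.b (.tg i))) = (fixed σ).2.1 := by
    rw [← hf₅]; simp [n₉, n₈, n₇, n₆, fixed]
  have htg' : (fun i => σ₁₀ (.b (.tg i))) = (fixed σ).2.1 := by rw [← htg]; simp [n₁₀]
  have hfl : σ₉ .fl ≠ 0 ↔ (m f).toBit = true := by
    simp [n₉, n₈, n₇, n₆, n₅, n₄, s₃, ind_ne_zero]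
  have hfl' : σ₁₀ .fl ≠ 0 ↔ (m f).toBit = true := by rw [← hfl]; simp [n₁₀]
  have hfnd : σ₉ .fnd ≠ 0 ↔ ∃ t ∈ l, slotEq σ₃ t := by
    rw [show σ₉ .fnd = ind (∃ t ∈ l, slotEq σ₃ t) by simp [n₉, n₈, n₇, n₆, n₅, s₄], ind_ne_zero]
  have hfnd' : σ₁₀ .fnd ≠ 0 ↔ ∃ t ∈ l, slotEq σ₃ t := by rw [← hfnd]; simp [n₁₀]
  have hg₁ : σ₁₁ .g₁ ≠ 0 ↔ (m f).toBit = true ∧ ¬ ((∃ t ∈ l, slotEq σ₃ t) ∧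
      ¬ pfxV (readV d m r) (fixed σ).2.1) := by
    rw [show σ₁₁ .g₁ = σ₁₀ .g₁ by simp [n₁₁], s₁₀, ind_ne_zero, hid, htg, hfl, hfnd]
  have hg₂ : σ₁₁ .g₂ ≠ 0 ↔ (m f).toBit = true ∧ ((∃ t ∈ l, slotEq σ₃ t) ∧
      ¬ pfxV (readV d m r) (fixed σ).2.1) := by
    rw [s₁₁, ind_ne_zero, hid', htg', hfl', hfnd']
  have hff : emb ((S.layout Q).kd Nm.ff) (σ₁₁ .ff) = (.bit false : Val 𝔹) := by
    rw [show σ₁₁ .ff = ind False by simp [n₁₁, n₁₀, n₉, s₈]]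
    simp [layout, Nm.kind, emb, ind]
  have htt : emb ((S.layout Q).kd Nm.tt) (σ₁₁ .tt) = (.bit true : Val 𝔹) := by
    rw [show σ₁₁ .tt = ind True by simp [n₁₁, n₁₀, n₉, n₈, s₇]]
    simp [layout, Nm.kind, emb, ind]
  have hwv : (S.wl.map Nm.wv).map (fun x : S.Nm Q => (emb ((S.layout Q).kd x) (σ₁₁ x) : Val 𝔹)) =
      (S.game 𝔹 (fixed σ).1 (fixed σ).2.1 (fixed σ).2.2).wire (readV d m r)
        (fun k => parOf σ₃ k l) := by
    have h1 : (fun i => σ₅ (.b (.id i))) = readV d m r := funext fun i => by simp [n₅, n₄, n₃, s₂]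
    have h2 : (fun k => σ₅ (.b (.par k))) = fun k => parOf σ₃ k l := funext s₅
    rw [← hf₅, ← h1, ← h2, List.map_map]
    refine List.map_congr_left fun i _ => ?_
    simp only [Function.comp]
    rw [show σ₁₁ (.wv i) = σ₆ (.wv i) by simp [n₁₁, n₁₀, n₉, n₈, n₇], s₆]
    rfl
  simp only [hg₁, hg₂, List.map_cons, List.map_nil, hff, htt, hwv]
  by_cases c1 : (m f).toBit = true
  · by_cases c2 : ∃ t ∈ l, slotEq σ₃ t
    · by_cases c3 : pfxV (readV d m r) (fixed σ).2.1 <;> simp [c1, c2, c3]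
    · simp [c1, c2]
  · simp [c1]

end SimDesc

theorem emb_zero_program (k : Kind) (a v : ℕ) (h : a ≠ v) : ∃ B, instrTime B ≤ 3 ∧
    ∀ (𝔹 : BilinearGroup) (mem : Mem 𝔹), ∃ mem', RunsTo B mem mem' ∧ mem' a = emb k (0 : 𝔹.Zp) ∧
      ∀ r, r ≠ a → r ≠ v → mem' r = mem r := by
  cases k
  · refine ⟨[.lit a 0], by simp [instrTime, Instr.cost], fun 𝔹 mem => ⟨_, RunsTo.single (d := a)
      (v := .scalar 0) (by simp [Instr.exec]), by simp [emb], fun r h1 _ => by simp [h1]⟩⟩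
  · refine ⟨[.genG a] ++ [.lit v 0] ++ [.pow a a v], by simp [instrTime, Instr.cost],
      fun 𝔹 mem => ⟨_, ((RunsTo.single (d := a) (v := .g 𝔹.g) (by simp [Instr.exec])).append
      (RunsTo.single (d := v) (v := .scalar 0) (by simp [Instr.exec]))).append
      (RunsTo.single (d := a) (v := .g (zexp 𝔹.g (0 : 𝔹.Zp))) ?_), by simp [emb],
      fun r h1 h2 => by simp [h1, h2]⟩⟩
    simp [Instr.exec, h, Val.pow]
  · refine ⟨[.genGh a] ++ [.lit v 0] ++ [.pow a a v], by simp [instrTime, Instr.cost],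
      fun 𝔹 mem => ⟨_, ((RunsTo.single (d := a) (v := .gh 𝔹.gh) (by simp [Instr.exec])).append
      (RunsTo.single (d := v) (v := .scalar 0) (by simp [Instr.exec]))).append
      (RunsTo.single (d := a) (v := .gh (zexp 𝔹.gh (0 : 𝔹.Zp))) ?_), by simp [emb],
      fun r h1 h2 => by simp [h1, h2]⟩⟩
    simp [Instr.exec, h, Val.pow]
  · refine ⟨[.bit a false], by simp [instrTime, Instr.cost], fun 𝔹 mem => ⟨_, RunsTo.single (d := a)
      (v := .bit false) (by simp [Instr.exec]), by simp [emb], fun r h1 _ => by simp [h1]⟩⟩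

theorem Layout.init {Nm : Type} (L : Layout Nm) (l : List Nm) : ∃ B, instrTime B ≤ l.length * 3 ∧
    ∀ (𝔹 : BilinearGroup) (mem : Mem 𝔹), ∃ mem', RunsTo B mem mem' ∧
      (∀ x ∈ l, mem' (L.addr x) = emb (L.kd x) (0 : 𝔹.Zp)) ∧
      ∀ r, (∀ x ∈ l, r ≠ L.addr x) → r ≠ L.V → mem' r = mem r := by
  classical
  induction l with
  | nil => exact ⟨[], by simp [instrTime], fun 𝔹 mem => ⟨mem, rfl, by simp, fun _ _ _ => rfl⟩⟩
  | cons x l ih =>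
    obtain ⟨B, hB, h⟩ := ih
    obtain ⟨B', hB', h'⟩ := emb_zero_program (L.kd x) (L.addr x) L.V (L.lt x).ne
    refine ⟨B' ++ B, by rw [instrTime_append, List.length_cons]; omega, fun 𝔹 mem => ?_⟩
    obtain ⟨m₁, r₁, a₁, f₁⟩ := h' 𝔹 mem
    obtain ⟨m₂, r₂, a₂, f₂⟩ := h 𝔹 m₁
    refine ⟨m₂, r₁.append r₂, fun y hy => ?_, fun r hr hV => ?_⟩
    · by_cases hyl : y ∈ l
      · exact a₂ y hyl
      · obtain rfl : y = x := by simpa [hyl] using hy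
        rw [f₂ _ (fun z hz he => hyl (by rwa [← L.inj he] at hz)) (L.lt _).ne, a₁]
    · rw [f₂ r (fun z hz => hr z (by simp [hz])) hV, f₁ r (hr x (by simp)) hV]

theorem small_iff (N : ℕ) (𝔹 : BilinearGroup) :
    (∃ i : Fin N, i.val ≠ 0 ∧ (((i.val : ℕ) : 𝔹.Zp)) = 0) ↔ 𝔹.p < N := by
  constructor
  · rintro ⟨i, h0, h⟩
    rw [ZMod.natCast_eq_zero_iff] at h
    exact (Nat.le_of_dvd (Nat.pos_of_ne_zero h0) h).trans_lt i.isLt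
  · exact fun h => ⟨⟨𝔹.p, h⟩, 𝔹.prime.ne_zero, by simp⟩

theorem Cp.small {ν : Type} {nb : ℕ} {kd : ν → Kind} (N : ℕ) :
    Cp nb kd .bit (N * 22 + 7) fun 𝔹 _ => ind (𝔹.p < N) :=
  ((Cp.exists fun i : Fin N => Cp.and (Cp.const (i.val ≠ 0))
    (Cp.eq_zero (k := .s) (by decide) (Cp.lit i.val))).mono (by simp)).congr fun 𝔹 σ => by
      rw [small_iff]

namespace SimDesc

variable {nb d : ℕ} {S : SimDesc nb d} {Q : ℕ}

variable (S) in
def queryCost (Q : ℕ) : ℕ := createCost S + delegateCost S Q + revealCost S Q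

theorem rlz_cmds (cs : List Cmd) (fr l : List (Fin Q)) (hfr : cs.countP Cmd.isQuery ≤ fr.length)
    (hl : (fr ++ l).Nodup) : ∃ sem, Rlz (S.layout Q)
      ((cs.map Cmd.cost).sum + cs.countP Cmd.isQuery * S.queryCost Q) sem ∧
      ∀ (𝔹 : BilinearGroup) (σ : S.Nm Q → 𝔹.Zp) (m : Mem 𝔹) (β : Type)
        (ψ : (S.Nm Q → 𝔹.Zp) × Mem 𝔹 → PMF β) (ψ' : VState 𝔹 d (S.Kc → 𝔹.Zp) → PMF β),
        (∀ σ' m' ks, ψ (σ', m') = ψ' (m', ks)) →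
        (sem 𝔹 σ m).bind ψ = (runV (S.game 𝔹 (fixed σ).1 (fixed σ).2.1 (fixed σ).2.2)
          (fixed σ).2.1 cs (m, S.keysOf σ l)).bind ψ' := by
  induction cs generalizing fr l with
  | nil =>
    exact ⟨_, Rlz.nil.mono (by simp), fun 𝔹 σ m β ψ ψ' h => by
      simp only [PMF.pure_bind, runV]; exact h _ _ _⟩
  | cons c cs ih =>
    have step : ∃ fr' l' sem, cs.countP Cmd.isQuery ≤ fr'.length ∧ (fr' ++ l').Nodup ∧
        Rlz (S.layout Q) (c.cost + (if c.isQuery then S.queryCost Q else 0)) sem ∧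
        Performs (S := S) c l l' sem := by
      cases c with
      | loc i => exact ⟨fr, l, _, by simpa [Cmd.isQuery] using hfr, hl,
          (Rlz.loc i).mono (by simp [Cmd.cost]), performs_loc i l⟩
      | createKey f r =>
        obtain _ | ⟨t, fr⟩ := fr
        · simp [Cmd.isQuery] at hfr
        have hn : (t :: (fr ++ l)).Nodup := hl
        have ht : t ∉ l := fun h => (List.nodup_cons.1 hn).1 (by simp [h])
        obtain ⟨sem, h1, h2⟩ := rlz_create (S := S) f r t l ht
        refine ⟨fr, t :: l, sem, by
          rw [List.countP_cons_of_pos (by rfl), List.length_cons] at hfr; omega, ?_, h1.mono ?_, h2⟩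
        · exact (List.perm_middle.nodup_iff).2 hn
        · simp [Cmd.isQuery, queryCost]; omega
      | createDelegatedKey f r x =>
        obtain _ | ⟨t, fr⟩ := fr
        · simp [Cmd.isQuery] at hfr
        have hn : (t :: (fr ++ l)).Nodup := hl
        have ht : t ∉ l := fun h => (List.nodup_cons.1 hn).1 (by simp [h])
        have hlen : l.length ≤ Q := by
          simpa using (List.nodup_append.1 (List.nodup_cons.1 hn).2).2.1.length_le_card
        obtain ⟨sem, h1, h2⟩ := rlz_delegate (S := S) f r x t l ht hlen
        refine ⟨fr, t :: l, sem, by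
          rw [List.countP_cons_of_pos (by rfl), List.length_cons] at hfr; omega, ?_, h1.mono ?_, h2⟩
        · exact (List.perm_middle.nodup_iff).2 hn
        · simp [Cmd.isQuery, queryCost]; omega
      | revealKey f r dst =>
        obtain _ | ⟨t, fr⟩ := fr
        · simp [Cmd.isQuery] at hfr
        have hn : (t :: (fr ++ l)).Nodup := hl
        have ht : t ∉ l := fun h => (List.nodup_cons.1 hn).1 (by simp [h])
        have hlen : l.length ≤ Q := by
          simpa using (List.nodup_append.1 (List.nodup_cons.1 hn).2).2.1.length_le_card
        obtain ⟨sem, h1, h2⟩ := rlz_reveal (S := S) f r dst t l ht hlen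
        refine ⟨fr, t :: l, sem, by
          rw [List.countP_cons_of_pos (by rfl), List.length_cons] at hfr; omega, ?_, h1.mono ?_, h2⟩
        · exact (List.perm_middle.nodup_iff).2 hn
        · simp [Cmd.isQuery, queryCost]; omega
    obtain ⟨fr', l', sem, hc, hn, h1, h2⟩ := step
    obtain ⟨sem', h1', h2'⟩ := ih fr' l' hc hn
    refine ⟨_, (h1.seq h1').mono ?_, fun 𝔹 σ m β ψ ψ' h => ?_⟩
    · rw [List.map_cons, List.sum_cons, List.countP_cons, Nat.add_mul]
      split_ifs <;> omega
    · rw [PMF.bind_bind, runV, PMF.bind_bind]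
      refine h2 𝔹 σ m β _ _ fun σ' m' hf => ?_
      dsimp only
      rw [h2' 𝔹 σ' m' β ψ ψ' h, hf]

variable (S) in
def setupCost : ℕ :=
  readIdCost d + (d * (d * 18 + 7 + 1 + 1 + 1 + 1) + (Fintype.card S.Ev +
    (Fintype.card S.MI * (S.cost + 1) + (4 + S.ml.length))))

variable (S) in
theorem rlz_setup : ∃ sem, Rlz (S.layout Q) S.setupCost sem ∧
      ∀ (𝔹 : BilinearGroup) (σ : S.Nm Q → 𝔹.Zp) (m : Mem 𝔹) (β : Type)
        (ψ : (S.Nm Q → 𝔹.Zp) × Mem 𝔹 → PMF β)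
        (ψ' : (S.Ev → 𝔹.Zp) → PMF β),
        (∀ σ' ev, fixed σ' = ((fixed σ).1, tgtOf (readV d m 0), ev) →
          ψ (σ', m.write 0 (S.ml.map fun i =>
            emb .g (S.mpk 𝔹 (fixed σ).1 (tgtOf (readV d m 0)) ev i))) = ψ' ev) →
        (sem 𝔹 σ m).bind ψ = (PMF.uniformOfFintype (S.Ev → 𝔹.Zp)).bind ψ' := by
  classical
  have h1 := S.rlz_readId (Q := Q) 0
  have h2 := Rlz.assignCp (L := S.layout Q) (S.inj_tg (Q := Q)) (fun i => Cp.ite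
    (cp_ids_exists (S := S)) (Cp.var' (kd := Nm.kind S) (Nm.b (.id i)) rfl)
      (Cp.lit (if i.val = 0 then 1 else 0))) (fun k 𝔹 σ σ' h => by simp [h])
  have h3 := Rlz.sampleAll (L := S.layout Q) (S.inj_ev (Q := Q)) (fun _ => rfl)
  have h4 := Rlz.assignCp (L := S.layout Q) (S.inj_mv (Q := Q)) (fun k =>
    (S.mpk_cp k).rename (kd' := Nm.kind S) Nm.b fun _ => rfl)
    (fun k 𝔹 σ σ' h => by simp [h])
  have h5 := Rlz.assign (L := S.layout Q) (x := Nm.tt) (Cp.const (kd := Nm.kind S) True)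
  have h6 := Rlz.writeListIf (L := S.layout Q) (y := Nm.tt) rfl (S.ml.map Nm.mv) 0
  refine ⟨_, (h1.seq (h2.seq (h3.seq (h4.seq (h5.seq h6))))).mono ?_, ?_⟩
  · simp [setupCost]
  intro 𝔹 σ m β ψ ψ' h
  simp only [PMF.pure_bind, PMF.bind_bind, PMF.bind_map, Function.comp_def, LossyHIB.assign]
  obtain ⟨σ₁, e₁, s₁, n₁⟩ := setF_spec S.inj_rs (fun i : Fin d => (m (0 + i.val)).toScalar) σ
  obtain ⟨σ₂, e₂, s₂, n₂⟩ := setF_spec S.inj_id (readV d m 0) σ₁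
  obtain ⟨σ₃, e₃, s₃, n₃⟩ := setF_spec S.inj_tg (fun i => if ∃ i : Fin d, σ₂ (Nm.b (.id i)) ≠ 0 then
    σ₂ (Nm.b (.id i)) else (((if i.val = 0 then 1 else 0 : ℕ)) : 𝔹.Zp)) σ₂
  simp only [e₁, e₂, e₃]
  congr 1
  funext ev
  obtain ⟨σ₄, e₄, s₄, n₄⟩ := setF_spec S.inj_ev ev σ₃
  obtain ⟨σ₅, e₅, s₅, n₅⟩ := setF_spec S.inj_mv (S.mpk 𝔹 (fun i => σ₄ (.b (.inp i)))
      (fun i => σ₄ (.b (.tg i))) (fun i => σ₄ (.b (.ev i)))) σ₄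
  obtain ⟨σ₆, e₆, s₆, n₆⟩ := update_spec Nm.tt (ind True) σ₅
  simp only [e₄]
  simp only [e₅]
  simp only [e₆]
  have ht : (fun i => σ₃ (.b (.tg i))) = tgtOf (readV d m 0) := by
    funext i
    simp only [s₃, s₂, tgtOf]
    split_ifs <;> simp_all
  have hf₄ : fixed σ₄ = ((fixed σ).1, tgtOf (readV d m 0), ev) := by
    rw [← ht]
    simp [fixed, n₄, n₃, n₂, n₁, s₄]
  have hf₆ : fixed σ₆ = ((fixed σ).1, tgtOf (readV d m 0), ev) := by
    rw [← hf₄]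
    simp [fixed, n₅, n₆]
  rw [← h σ₆ ev hf₆, if_pos (by rw [s₆, ind_ne_zero]; trivial), List.map_map]
  congr 4
  funext i
  have h4 : (fixed σ₄).1 = (fixed σ).1 ∧ (fixed σ₄).2.1 = tgtOf (readV d m 0) ∧
    (fixed σ₄).2.2 = ev := by rw [hf₄]; exact ⟨rfl, rfl, rfl⟩
  simp only [Function.comp]
  rw [n₆ _ (by simp), s₅, ← h4.1, ← h4.2.1, ← h4.2.2]
  rfl

variable (S) in
def finalCost (N : ℕ) : ℕ := 2 + (9 + (N * 22 + 7 + 4) + 5 + 1)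

variable (S) in
/-- Additional running time for simulating the oracles. -/
def overhead (Q N : ℕ) : ℕ :=
  Fintype.card (S.NmSum Q) * 3 + S.setupCost + Q * S.queryCost Q + finalCost N + 1

variable (S) in
theorem exists_program (A : Adversary) (N : ℕ) : ∃ B, instrTime B ≤ A.time + S.overhead A.queries N ∧
    ∀ 𝔹 : BilinearGroup, 𝔹.p < 2 ^ nb → ∀ inp : Fin S.ni → 𝔹.Zp,
      (runInstrs B ((Mem.empty 𝔹).write 0 (List.ofFn fun i => emb (S.ik i) (inp i)))).map
        (fun m => (m 0).toBit) = (S.run 𝔹 A inp).map fun b => b && decide (N ≤ 𝔹.p) := by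
  classical
  set Q := A.queries with hQ
  obtain ⟨B₀, hB₀, h₀⟩ := (S.layout Q).init
    ((Finset.univ.filter fun x : S.Nm Q => ∀ i, x ≠ .b (.inp i)).toList)
  have h1 := Rlz.locs (L := S.layout Q) A.choose
  obtain ⟨sem₂, h2, p2⟩ := S.rlz_setup (Q := Q)
  obtain ⟨sem₃, h3, p3⟩ := rlz_cmds (S := S) A.attack (List.finRange Q) []
    (by rw [List.length_finRange]; exact le_rfl) (by simpa using List.nodup_finRange Q)
  have h4 := Rlz.readBit (L := S.layout Q) (x := Nm.fl) rfl 0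
  have h5 := Rlz.assign (L := S.layout Q) (x := Nm.g₁)
    (Cp.and (Cp.bitVar (kd := Nm.kind S) Nm.fl rfl) (Cp.small (kd := Nm.kind S) N).not)
  obtain ⟨W, hW⟩ := h1.seq (h2.seq (h3.seq (h4.seq h5)))
  obtain ⟨B, hB, hrun⟩ := hW ((S.layout Q).V + W + 1) (by omega)
  set a := (S.layout Q).addr Nm.g₁
  refine ⟨B₀ ++ B ++ [.select 0 a a a], ?_, fun 𝔹 hp inp => ?_⟩
  · have hcard : Fintype.card (S.Nm Q) ≤ Fintype.card (S.NmSum Q) :=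
      Fintype.card_le_of_injective _ (Nm.toSum_injective S)
    have hlen : ((Finset.univ.filter fun x : S.Nm Q => ∀ i, x ≠ .b (.inp i)).toList).length ≤
        Fintype.card (S.Nm Q) := by
      rw [Finset.length_toList]; exact Finset.card_filter_le _ _
    have hA : A.time = instrTime A.choose + (A.attack.map Cmd.cost).sum := rfl
    have hQ' : A.attack.countP Cmd.isQuery = Q := rfl
    rw [hQ'] at hB
    rw [instrTime_append, instrTime_append, overhead, hA]
    have h1 : instrTime [Instr.select 0 a a a] = 1 := rfl
    rw [h1, finalCost]
    omega
  obtain ⟨mem, hr₀, hz, hne⟩ := h₀ 𝔹 ((Mem.empty 𝔹).write 0 (List.ofFn fun i => emb (S.ik i) (inp i)))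
  set σ₀ : S.Nm Q → 𝔹.Zp := fun x => match x with
    | .b (.inp i) => inp i
    | _ => 0 with hσ₀
  have hrep : (S.layout Q).Rep ((S.layout Q).V + W + 1) σ₀ (Mem.empty 𝔹) mem := by
    refine ⟨fun x => ?_, fun r => ?_⟩
    · rcases Nm.inp_or S x with ⟨i, rfl⟩ | hx
      · rw [hne]
        · have hi : (S.layout Q).addr (Nm.b (.inp i)) = i := rfl
          rw [hi, Mem.write]
          simp
          rfl
        · intro y hy he
          have := (S.layout Q).inj he
          simp only [Finset.mem_toList, Finset.mem_filter, Finset.mem_univ, true_and] at hy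
          exact hy i this.symm
        · exact ((S.layout Q).lt _).ne
      · rw [hz x (by simpa using hx)]
        congr 1
        rcases x with (_ | _ | _ | _ | _ | _ | _) | _ | _ | _ | _ | _ | _ | _ | _ | _ | _ | _ | _ <;>
          first | rfl | exact absurd rfl (hx _)
    · have hV : S.ni ≤ (S.layout Q).V := Nat.le_add_right _ _
      rw [hne]
      · rw [Mem.write, if_pos (Nat.zero_le _), List.getElem?_eq_none (by simp; omega)]
        rfl
      · intro x _ h
        have := (S.layout Q).lt x
        omega
      · omega
  have hfix : (fixed σ₀).1 = inp := rfl
  rw [runInstrs_append, runInstrs_append, show runInstrs B₀ _ = _ from hr₀, PMF.pure_bind,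
    PMF.map, PMF.bind_bind]
  rw [hrun 𝔹 hp σ₀ _ mem hrep Bool _ (fun s => PMF.pure (decide (s.1 Nm.g₁ ≠ 0)))]
  swap
  · intro σ' m' mem' hr
    rw [runInstrs_singleton, Instr.exec, PMF.pure_bind]
    simp only [ite_self, Function.comp, a, hr.var]
    rw [write_one, Function.update_self]
    rfl
  rw [PMF.bind_bind, PMF.bind_map, run, gameV, PMF.map_bind]
  congr 1
  funext m
  simp only [Function.comp]
  rw [PMF.bind_bind, PMF.map_bind]
  refine p2 𝔹 σ₀ m Bool _ _ fun σ' ev hσ' => ?_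
  dsimp only
  rw [PMF.bind_bind, PMF.map_comp, PMF.map]
  have hk : S.keysOf σ' [] = [] := rfl
  rw [p3 𝔹 σ' _ Bool _ (fun st => PMF.pure ((st.1 0).toBit && decide (N ≤ 𝔹.p))), hσ', hfix, hk]
  · rfl
  intro σ'' m'' ks
  simp only [LossyHIB.assign, PMF.pure_bind, Function.update_self, ind_ne_zero, not_lt]
  simp

end SimDesc

section VGame

variable {𝔹 : BilinearGroup} {d : ℕ}

/-! ## Comparing games -/

def mapKeys {κ₁ κ₂ : Type} (f : (Fin d → 𝔹.Zp) → κ₁ → κ₂) (st : VState 𝔹 d κ₁) : VState 𝔹 d κ₂ :=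
  (st.1, st.2.map fun e => (e.1, f e.1 e.2))

theorem lookupV_map {κ₁ κ₂ : Type} (f : (Fin d → 𝔹.Zp) → κ₁ → κ₂)
    (keys : List ((Fin d → 𝔹.Zp) × κ₁)) (v : Fin d → 𝔹.Zp) :
    lookupV (keys.map fun e => (e.1, f e.1 e.2)) v = (lookupV keys v).map (f v) := by
  induction keys with
  | nil => rfl
  | cons a l ih =>
    by_cases h : a.1 = v
    · simp [lookupV, h]
    · have e1 : lookupV (a :: l) v = lookupV l v := by
        simp only [lookupV]; rw [List.find?_cons_of_neg (by simpa using h)]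
      rw [e1, ← ih, List.map_cons]
      simp only [lookupV]
      rw [List.find?_cons_of_neg (by simpa using h)]

theorem execV_map {κ₁ κ₂ : Type} {O₁ : VGame 𝔹 d κ₁} {O₂ : VGame 𝔹 d κ₂} {t : Fin d → 𝔹.Zp}
    {f : (Fin d → 𝔹.Zp) → κ₁ → κ₂}
    (hkg : ∀ m r, O₂.kg (readV d m r) = (O₁.kg (readV d m r)).map (f (readV d m r)))
    (hdel : ∀ m r k x, x ≠ 0 → (∃ i, readV d m r i = 0) →
      O₂.del (readV d m r) (f (readV d m r) k) x =
        (O₁.del (readV d m r) k x).map (f (childV (readV d m r) x)))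
    (hw : ∀ v k, ¬pfxV v t → O₂.wire v (f v k) = O₁.wire v k) (c : Cmd) (st : VState 𝔹 d κ₁) :
    execV O₂ t c (mapKeys f st) = (execV O₁ t c st).map (mapKeys f) := by
  obtain ⟨m, ks⟩ := st
  rw [show mapKeys f (m, ks) = (m, ks.map fun e => (e.1, f e.1 e.2)) from rfl]
  cases c with
  | loc i =>
    simp only [execV, PMF.map_comp]; rfl
  | createKey g r =>
    simp only [execV]
    by_cases h : (m g).toBit = true ∧ ∃ i, readV d m r i ≠ 0
    · simp only [if_pos h]; rw [hkg, PMF.map_comp, PMF.map_comp]; rfl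
    · simp only [if_neg h]; rw [PMF.pure_map]; rfl
  | createDelegatedKey g r x =>
    simp only [execV, lookupV_map]
    cases hl : lookupV ks (readV d m r) with
    | none => simp only [Option.map_none]; rw [PMF.pure_map]; rfl
    | some k =>
      simp only [Option.map_some]
      by_cases h : (m g).toBit = true ∧ (m x).toScalar ≠ 0 ∧ ∃ i, readV d m r i = 0
      · simp only [if_pos h]; rw [hdel _ _ _ _ h.2.1 h.2.2, PMF.map_comp, PMF.map_comp]; rfl
      · simp only [if_neg h]; rw [PMF.pure_map]; rfl
  | revealKey g r dst =>
    simp only [execV, lookupV_map]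
    by_cases hf : (m g).toBit = true
    · simp only [if_pos hf]
      cases hl : lookupV ks (readV d m r) with
      | none => simp only [Option.map_none]; rw [PMF.pure_map]; rfl
      | some k =>
        simp only [Option.map_some]
        by_cases h : pfxV (readV d m r) t
        · simp only [if_pos h]; rw [PMF.pure_map]; rfl
        · simp only [if_neg h]; rw [PMF.pure_map, hw _ _ h]; rfl
    · simp only [if_neg hf]; rw [PMF.pure_map]; rfl

theorem runV_map {κ₁ κ₂ : Type} {O₁ : VGame 𝔹 d κ₁} {O₂ : VGame 𝔹 d κ₂} {t : Fin d → 𝔹.Zp}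
    {f : (Fin d → 𝔹.Zp) → κ₁ → κ₂}
    (hkg : ∀ m r, O₂.kg (readV d m r) = (O₁.kg (readV d m r)).map (f (readV d m r)))
    (hdel : ∀ m r k x, x ≠ 0 → (∃ i, readV d m r i = 0) →
      O₂.del (readV d m r) (f (readV d m r) k) x =
        (O₁.del (readV d m r) k x).map (f (childV (readV d m r) x)))
    (hw : ∀ v k, ¬pfxV v t → O₂.wire v (f v k) = O₁.wire v k) (cs : List Cmd) (st : VState 𝔹 d κ₁) :
    runV O₂ t cs (mapKeys f st) = (runV O₁ t cs st).map (mapKeys f) := by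
  induction cs generalizing st with
  | nil => rw [runV, runV, PMF.pure_map]
  | cons c cs ih =>
    rw [runV, runV, execV_map hkg hdel hw, PMF.bind_map, PMF.map_bind]
    congr 1
    funext st'
    exact ih st'

theorem runV_map_fst {κ₁ κ₂ : Type} {O₁ : VGame 𝔹 d κ₁} {O₂ : VGame 𝔹 d κ₂} {t : Fin d → 𝔹.Zp}
    (f : (Fin d → 𝔹.Zp) → κ₁ → κ₂)
    (hkg : ∀ m r, O₂.kg (readV d m r) = (O₁.kg (readV d m r)).map (f (readV d m r)))
    (hdel : ∀ m r k x, x ≠ 0 → (∃ i, readV d m r i = 0) →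
      O₂.del (readV d m r) (f (readV d m r) k) x =
        (O₁.del (readV d m r) k x).map (f (childV (readV d m r) x)))
    (hw : ∀ v k, ¬pfxV v t → O₂.wire v (f v k) = O₁.wire v k) (cs : List Cmd) (m : Mem 𝔹)
    {β : Type} (g : Mem 𝔹 → β) :
    (runV O₁ t cs (m, [])).map (fun s => g s.1) = (runV O₂ t cs (m, [])).map fun s => g s.1 := by
  have := runV_map hkg hdel hw cs (m, [])
  rw [show mapKeys f (m, []) = (m, []) from rfl] at this
  rw [this, PMF.map_comp]
  rfl

theorem execV_close {κ : Type} {O₁ O₂ : VGame 𝔹 d κ} {t : Fin d → 𝔹.Zp} {ε : ℝ} (hε : 0 ≤ ε)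
    (hkg : ∀ v, Close ε (O₁.kg v) (O₂.kg v))
    (hdel : ∀ v k x, x ≠ 0 → (∃ i, v i = 0) → Close ε (O₁.del v k x) (O₂.del v k x))
    (hw : ∀ v k, ¬pfxV v t → O₂.wire v k = O₁.wire v k) (c : Cmd) (st : VState 𝔹 d κ) :
    Close (if c.isQuery then ε else 0) (execV O₁ t c st) (execV O₂ t c st) := by
  cases c with
  | loc i => exact Close.refl _
  | createKey g r =>
    simp only [execV, Cmd.isQuery, if_true]
    split_ifs
    · exact (hkg _).map _
    · exact (Close.refl _).mono hε
  | createDelegatedKey g r x =>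
    simp only [execV, Cmd.isQuery, if_true]
    cases hl : lookupV st.2 (readV d st.1 r) with
    | none => exact (Close.refl _).mono hε
    | some k =>
      dsimp only
      split_ifs with h
      · exact (hdel _ _ _ h.2.1 h.2.2).map _
      · exact (Close.refl _).mono hε
  | revealKey g r dst =>
    refine (Close.of_eq ?_).mono (by simpa [Cmd.isQuery] using hε)
    simp only [execV]
    cases hl : lookupV st.2 (readV d st.1 r) with
    | none => rfl
    | some k =>
      by_cases h : pfxV (readV d st.1 r) t
      · simp only [if_pos h]
      · simp only [if_neg h, hw _ _ h]

theorem runV_close {κ : Type} {O₁ O₂ : VGame 𝔹 d κ} {t : Fin d → 𝔹.Zp} {ε : ℝ} (hε : 0 ≤ ε)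
    (hkg : ∀ v, Close ε (O₁.kg v) (O₂.kg v))
    (hdel : ∀ v k x, x ≠ 0 → (∃ i, v i = 0) → Close ε (O₁.del v k x) (O₂.del v k x))
    (hw : ∀ v k, ¬pfxV v t → O₂.wire v k = O₁.wire v k) (cs : List Cmd) (st : VState 𝔹 d κ) :
    Close (cs.countP Cmd.isQuery * ε) (runV O₁ t cs st) (runV O₂ t cs st) := by
  induction cs generalizing st with
  | nil => exact (Close.refl _).mono (by simp)
  | cons c cs ih =>
    rw [runV, runV]
    refine ((execV_close hε hkg hdel hw c st).bind fun st' => ih st').mono (le_of_eq ?_)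
    rw [List.countP_cons]
    split_ifs <;> push_cast <;> ring

/-! ## Identities -/

theorem curV_unique {v : Fin d → 𝔹.Zp} {i j : Fin d} (hi : curV v i) (hj : curV v j) : i = j := by
  rcases lt_trichotomy i j with h | h | h
  · exact absurd hi.1 (hj.2 i h)
  · exact h
  · exact absurd hj.1 (hi.2 j h)

theorem exists_curV {v : Fin d → 𝔹.Zp} (h : ∃ i, v i = 0) : ∃ m, curV v m := by
  classical
  obtain ⟨m, hm, hmin⟩ := (Finset.univ.filter fun i => v i = 0).exists_minimal
    (by obtain ⟨i, hi⟩ := h; exact ⟨i, by simpa using hi⟩)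
  refine ⟨m, by simpa using hm, fun i hi h0 => ?_⟩
  exact absurd (hmin (by simpa using h0) hi.le) (not_le.2 hi)

theorem childV_of_cur {v : Fin d → 𝔹.Zp} {m : Fin d} (h : curV v m) (x : 𝔹.Zp) :
    childV v x m = x := if_pos h

theorem childV_of_ne {v : Fin d → 𝔹.Zp} {m i : Fin d} (h : curV v m) (x : 𝔹.Zp) (hi : i ≠ m) :
    childV v x i = v i := if_neg fun hc => hi (curV_unique hc h)

theorem childV_eq_zero {v : Fin d → 𝔹.Zp} {x : 𝔹.Zp} (hx : x ≠ 0) (i : Fin d) :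
    childV v x i = 0 ↔ v i = 0 ∧ ¬ curV v i := by
  rw [childV]
  split_ifs with h <;> simp [h, hx]

theorem pfxV_of_child {v t : Fin d → 𝔹.Zp} {x : 𝔹.Zp} (hx : x ≠ 0) (h : pfxV (childV v x) t) :
    pfxV v t := fun i => by
  by_cases hi : curV v i
  · exact .inl hi.1
  · have := h i
    rwa [childV, if_neg hi] at this

end VGame

/-! ## Uniform distributions of functions -/

/-- Adding to each coordinate a function of the others such that the result determines the
original. -/
theorem uniform_map_injective {α : Type} [Fintype α] [Nonempty α] {f : α → α}
    (hf : Function.Injective f) :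
    (PMF.uniformOfFintype α).map f = PMF.uniformOfFintype α :=
  uniform_map_of_bijective (Finite.injective_iff_bijective.1 hf)

theorem uniform_map_comp_injective {I J R : Type} [Fintype I] [DecidableEq I] [Fintype J]
    [DecidableEq J] [Fintype R] [AddGroup R] {ι : J → I} (hι : Function.Injective ι)
    {T : (I → R) → I → R} (hT : Function.Injective T) :
    (PMF.uniformOfFintype (I → R)).map (fun f => T f ∘ ι) = PMF.uniformOfFintype (J → R) := by
  rw [show (fun f => T f ∘ ι) = (fun f => f ∘ ι) ∘ T from rfl, ← PMF.map_comp,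
    uniform_map_injective hT, uniform_comp_injective hι]

/-! ## Exponents of private keys -/

/-- Positions of the exponents of a private key: the row `D` (`none`) or `K j k`, with entries `w`
(`none`) or `i`; and the exponents of the `L j`. -/
abbrev E0 (d : ℕ) : Type := (Option (Fin d × Fin 2) × Option (Fin d)) ⊕ Fin d

abbrev KI (d n : ℕ) : Type := E0 d × Fin n

abbrev TI (d n : ℕ) : Type := Fin d × Fin 2 × Fin n

set_option synthInstance.maxSize 2048 in
instance instDecidableEqKI (d n : ℕ) : DecidableEq (KI d n) := inferInstance

set_option synthInstance.maxSize 2048 in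
instance instFintypeKI (d n : ℕ) : Fintype (KI d n) := inferInstance

instance instFintypeFunKI (d n : ℕ) (R : Type) [Fintype R] : Fintype (KI d n → R) := inferInstance

/-- Coins of the delegation: exponents for `V` and `fr`, the powers `z` and `τ`. -/
abbrev WC (d n : ℕ) : Type := (KI d n ⊕ KI d n) ⊕ (Fin n ⊕ TI d n)

set_option synthInstance.maxSize 2048 in
instance instDecidableEqWC (d n : ℕ) : DecidableEq (WC d n) := inferInstance

set_option synthInstance.maxSize 2048 in
instance instFintypeWC (d n : ℕ) : Fintype (WC d n) := inferInstance

instance instFintypeFunWC (d n : ℕ) (R : Type) [Fintype R] : Fintype (WC d n → R) := inferInstance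

section Exponents

variable {𝔹 : BilinearGroup} {d n : ℕ}

open Classical in
def vSg (v : Fin d → 𝔹.Zp) (V : KI d n → 𝔹.Zp) (l : Fin n) : 𝔹.Zp :=
  ∑ j, if curV v j then V (.inr j, l) else 0

open Classical in
def vMain (v : Fin d → 𝔹.Zp) (x : 𝔹.Zp) (V : KI d n → 𝔹.Zp) (ent : Option (Fin d)) (l : Fin n) :
    𝔹.Zp :=
  ∑ j, if curV v j then V (.inl (some (j, 0), ent), l) + x * V (.inl (some (j, 1), ent), l) else 0

def curE (v : Fin d → 𝔹.Zp) : Option (Fin d) → Prop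
  | none => False
  | some i => curV v i

open Classical in
/-- Exponents of a delegated key, for the exponents `e` of the parent key and `V` of its randomized
delegation component. The exponents of components that are not part of the key are `fr`. -/
def delV (v : Fin d → 𝔹.Zp) (x : 𝔹.Zp) (e V fr : KI d n → 𝔹.Zp) (τ : TI d n → 𝔹.Zp) :
    KI d n → 𝔹.Zp
  | (.inl (none, ent), l) =>
      if curE v ent then vSg v V l else e (.inl (none, ent), l) + vMain v x V ent l
  | (.inl (some (j, k), ent), l) =>
      if v j ≠ 0 ∨ curV v j then fr (.inl (some (j, k), ent), l)
      else if curE v ent then τ (j, k, l) * vSg v V l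
      else V (.inl (some (j, k), ent), l) + τ (j, k, l) * vMain v x V ent l
  | (.inr j, l) => if v j ≠ 0 ∨ curV v j then fr (.inr j, l) else V (.inr j, l)

theorem vSg_of_cur {v : Fin d → 𝔹.Zp} {m : Fin d} (hm : curV v m) (V : KI d n → 𝔹.Zp) (l : Fin n) :
    vSg v V l = V (.inr m, l) := by
  rw [vSg, Finset.sum_eq_single m]
  · rw [if_pos hm]
  · exact fun j _ hj => if_neg fun h => hj (curV_unique h hm)
  · simp

theorem vMain_of_cur {v : Fin d → 𝔹.Zp} {m : Fin d} (hm : curV v m) (x : 𝔹.Zp) (V : KI d n → 𝔹.Zp)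
    (ent : Option (Fin d)) (l : Fin n) :
    vMain v x V ent l = V (.inl (some (m, 0), ent), l) + x * V (.inl (some (m, 1), ent), l) := by
  rw [vMain, Finset.sum_eq_single m]
  · rw [if_pos hm]
  · exact fun j _ hj => if_neg fun h => hj (curV_unique h hm)
  · simp

theorem curE_of_cur {v : Fin d → 𝔹.Zp} {m : Fin d} (hm : curV v m) (ent : Option (Fin d)) :
    curE v ent ↔ ent = some m := by
  cases ent with
  | none => simp [curE]
  | some i => simpa [curE] using ⟨fun h => curV_unique h hm, fun h => h ▸ hm⟩

def e0Idx (q : E0 d) : ℕ := Fintype.equivFin (E0 d) q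

open Classical in
/-- Delegation from prefixes of the target of a level below `k` gives fresh keys; on level `k` the
first `u` exponents of the randomized delegation component are fresh. -/
def hybDel (k u : ℕ) (t v : Fin d → 𝔹.Zp) (e : KI d n → 𝔹.Zp) (x : 𝔹.Zp) (c : WC d n → 𝔹.Zp) :
    KI d n → 𝔹.Zp :=
  if pfxV v t ∧ ∃ i : Fin d, i.val < k ∧ v i = 0 then fun q => c (.inl (.inr q))
  else delV v x e
    (fun q => if pfxV v t ∧ (∃ i : Fin d, i.val = k ∧ curV v i) ∧ e0Idx q.1 < u then
      c (.inl (.inl q)) else c (.inr (.inl q.2)) * e q)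
    (fun q => c (.inl (.inr q))) (fun q => c (.inr (.inr q)))

theorem close_delV_fresh {v : Fin d → 𝔹.Zp} (hv : ∃ i, v i = 0) (x : 𝔹.Zp) (e : KI d n → 𝔹.Zp) :
    Close ((n : ℝ) / 𝔹.p)
      ((PMF.uniformOfFintype (WC d n → 𝔹.Zp)).map fun c => delV v x e (fun q => c (.inl (.inl q)))
        (fun q => c (.inl (.inr q))) (fun q => c (.inr (.inr q))))
      (PMF.uniformOfFintype (KI d n → 𝔹.Zp)) := by
  classical
  obtain ⟨m, hm⟩ := exists_curV hv
  let ι : KI d n → WC d n := fun q => match q with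
    | (.inl (none, ent), l) =>
        if ent = some m then .inl (.inl (.inr m, l)) else .inl (.inl (.inl (some (m, 0), ent), l))
    | (.inl (some (j, k), ent), l) =>
        if v j ≠ 0 ∨ curV v j then .inl (.inr (.inl (some (j, k), ent), l))
        else if ent = some m then .inr (.inr (j, k, l))
        else .inl (.inl (.inl (some (j, k), ent), l))
    | (.inr j, l) => if v j ≠ 0 ∨ curV v j then .inl (.inr (.inr j, l)) else .inl (.inl (.inr j, l))
  have hmm : v m ≠ 0 ∨ curV v m := .inr hm
  have hι : Function.Injective ι := by
    rintro ⟨(⟨_ | ⟨j, k⟩, ent⟩ | j), l⟩ ⟨(⟨_ | ⟨j', k'⟩, ent'⟩ | j'), l'⟩ h <;>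
      simp only [ι] at h <;> split_ifs at h <;> simp_all
  let T : (WC d n → 𝔹.Zp) → WC d n → 𝔹.Zp := fun c q => match q with
    | .inl (.inl (.inl (some (j, k), ent), l)) =>
        if j = m then
          if k = 0 then c q + e (.inl (none, ent), l) + x * c (.inl (.inl (.inl (some (m, 1), ent), l)))
          else c q
        else c q + c (.inr (.inr (j, k, l))) * (c (.inl (.inl (.inl (some (m, 0), ent), l))) +
          x * c (.inl (.inl (.inl (some (m, 1), ent), l))))
    | .inr (.inr (j, k, l)) =>
        if c (.inl (.inl (.inr m, l))) = 0 then c q else c q * c (.inl (.inl (.inr m, l)))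
    | _ => c q
  have hT : Function.Injective T := by
    intro c c' h
    have hq := fun q => congrFun h q
    have h1 : ∀ j l, c (.inl (.inl (.inr j, l))) = c' (.inl (.inl (.inr j, l))) := fun j l =>
      hq (.inl (.inl (.inr j, l)))
    have h2 : ∀ q, c (.inr (.inr q)) = c' (.inr (.inr q)) := by
      rintro ⟨j, k, l⟩
      have := hq (.inr (.inr (j, k, l)))
      simp only [T, ← h1] at this
      split_ifs at this with h0
      · exact this
      · exact mul_right_cancel₀ h0 this
    have h3 : ∀ ent l, c (.inl (.inl (.inl (some (m, 1), ent), l))) =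
        c' (.inl (.inl (.inl (some (m, 1), ent), l))) := fun ent l => by
      simpa [T] using hq (.inl (.inl (.inl (some (m, 1), ent), l)))
    have h4 : ∀ ent l, c (.inl (.inl (.inl (some (m, 0), ent), l))) =
        c' (.inl (.inl (.inl (some (m, 0), ent), l))) := fun ent l => by
      simpa [T, h3] using hq (.inl (.inl (.inl (some (m, 0), ent), l)))
    funext q
    rcases q with ((⟨⟨_ | ⟨j, k⟩, ent⟩ | j, l⟩ | q) | (q | q))
    · exact hq (.inl (.inl (.inl (none, ent), l)))
    · by_cases hj : j = m
      · subst hj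
        by_cases hk : k = 0
        · subst hk; exact h4 ent l
        · obtain rfl : k = 1 := by omega
          exact h3 ent l
      · simpa [T, hj, h2, h3, h4] using hq (.inl (.inl (.inl (some (j, k), ent), l)))
    · exact h1 j l
    · exact hq (.inl (.inr q))
    · exact hq (.inr (.inl q))
    · exact h2 q
  rw [← uniform_map_comp_injective (R := 𝔹.Zp) hι hT]
  have := close_of_eq_of_ne_zero (α := WC d n → 𝔹.Zp) (𝔹 := 𝔹)
    (fun (l : Fin n) c => c (.inl (.inl (.inr m, l)))) (fun l => uniform_eval _)
    (F := fun c => PMF.pure (delV v x e (fun q => c (.inl (.inl q)))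
        (fun q => c (.inl (.inr q))) (fun q => c (.inr (.inr q)))))
    (G := fun c => PMF.pure (T c ∘ ι)) ?_
  · rw [Fintype.card_fin] at this
    exact this
  intro c hc
  congr 1
  funext q
  rcases q with ⟨(⟨_ | ⟨j, k⟩, ent⟩ | j), l⟩
  · simp only [delV, vSg_of_cur hm, vMain_of_cur hm, curE_of_cur hm, Function.comp, ι]
    split_ifs with h
    · rfl
    · simp [T]; ring
  · simp only [delV, vSg_of_cur hm, vMain_of_cur hm, curE_of_cur hm, Function.comp, ι]
    split_ifs with h1 h2
    · rfl
    · simp [T, hc l]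
    · have hj : j ≠ m := fun h => h1 (h ▸ hmm)
      simp [T, hj]
  · simp only [delV, Function.comp, ι]
    split_ifs <;> rfl

theorem close_hybDel_succ (k : ℕ) {t v : Fin d → 𝔹.Zp} (hv : ∃ i, v i = 0) (e : KI d n → 𝔹.Zp)
    (x : 𝔹.Zp) : Close ((n : ℝ) / 𝔹.p)
      ((PMF.uniformOfFintype (WC d n → 𝔹.Zp)).map (hybDel k (Fintype.card (E0 d)) t v e x))
      ((PMF.uniformOfFintype (WC d n → 𝔹.Zp)).map (hybDel (k + 1) 0 t v e x)) := by
  classical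
  have h0 : (0 : ℝ) ≤ (n : ℝ) / 𝔹.p := by positivity
  have hidx : ∀ q : E0 d, e0Idx q < Fintype.card (E0 d) := fun q => Fin.isLt _
  by_cases hp : pfxV v t
  · by_cases hk : ∃ i : Fin d, i.val < k ∧ v i = 0
    · refine (Close.of_eq ?_).mono h0
      congr 1
      funext c
      obtain ⟨i, hi, hv⟩ := hk
      rw [hybDel, hybDel, if_pos ⟨hp, i, hi, hv⟩, if_pos ⟨hp, i, by omega, hv⟩]
    by_cases hc : ∃ i : Fin d, i.val = k ∧ curV v i
    · have e1 : hybDel k (Fintype.card (E0 d)) t v e x = fun c : WC d n → 𝔹.Zp =>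
          delV v x e (fun q => c (.inl (.inl q)))
            (fun q => c (.inl (.inr q))) (fun q => c (.inr (.inr q))) := by
        funext c
        rw [hybDel, if_neg fun h => hk h.2]
        congr 1
        funext q
        rw [if_pos ⟨hp, hc, hidx _⟩]
      have e2 : hybDel (k + 1) 0 t v e x = fun c : WC d n → 𝔹.Zp => c ∘ fun q => .inl (.inr q) := by
        funext c
        obtain ⟨i, hi, hv⟩ := hc
        rw [hybDel, if_pos ⟨hp, i, by omega, hv.1⟩]
        rfl
      rw [e1, e2, uniform_comp_injective (fun a b h => by simpa using h)]
      exact close_delV_fresh hv x e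
    · refine (Close.of_eq ?_).mono h0
      congr 1
      funext c
      rw [hybDel, hybDel, if_neg fun h => hk h.2, if_neg]
      · congr 1
        funext q
        rw [if_neg fun h => hc h.2.1, if_neg fun h => absurd h.2.2 (Nat.not_lt_zero _)]
      · rintro ⟨-, i, hi, hv⟩
        by_cases hik : i.val = k
        · refine hc ⟨i, hik, hv, fun i' hi' h0 => hk ⟨i', ?_, h0⟩⟩
          have : i'.val < i.val := hi'
          omega
        · exact hk ⟨i, by omega, hv⟩
  · refine (Close.of_eq ?_).mono h0
    congr 1
    funext c
    rw [hybDel, hybDel, if_neg fun h => hp h.1, if_neg fun h => hp h.1]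
    congr 1
    funext q
    rw [if_neg fun h => hp h.1, if_neg fun h => hp h.1]

end Exponents

/-! ## The game in terms of exponents -/

/-- Rows of a private key (`D` or `K j k`). -/
abbrev RI (d n : ℕ) : Type := Option (Fin d × Fin 2) × Fin n

/-- Components of a private key. -/
abbrev WI (d n : ℕ) : Type := RI d n ⊕ KI d n

set_option synthInstance.maxSize 2048 in
instance instFintypeWI (d n : ℕ) : Fintype (WI d n) := inferInstance

/-- Exponents of the master key generation, and two families of exponents that replace components of
the master public key. -/
inductive SI (d n : ℕ) : Type
  | v
  | w (l : Fin n)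
  | h (i : Fin d) (i₂ : Fin 3) (l : Fin n)
  | s (l : Fin n)
  | ow
  | oc (i : Fin d) (k : Fin 2)
deriving DecidableEq, Fintype

/-- Components of the master public key. -/
inductive MI (d n : ℕ) : Type
  | v
  | w (l : Fin n)
  | h (i : Fin d) (i₂ : Fin 3) (l : Fin n)
  | J (l : Fin n)
  | Cw (l₂ l₁ : Fin n)
  | C (i : Fin d) (k : Fin 2) (l₂ l₁ : Fin n)
deriving Fintype

def mpkList (d n : ℕ) : List (MI d n) :=
  [.v] ++ (listOf fun l => [.w l]) ++ (listOf fun i => listOf fun i₂ => listOf fun l => [.h i i₂ l]) ++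
    (listOf fun l => [.J l]) ++ (listOf fun l₂ => listOf fun l₁ => [.Cw l₂ l₁]) ++
    (listOf fun i => listOf fun k => listOf fun l₂ => listOf fun l₁ => [.C i k l₂ l₁])

def wireList (d n : ℕ) : List (WI d n) :=
  (listOf fun l => [.inl (none, l)]) ++ (listOf fun l => [.inr (.inl (none, none), l)]) ++
    (listOf fun i => listOf fun l => [.inr (.inl (none, some i), l)]) ++
    (listOf fun j => listOf fun a => listOf fun l => [.inl (some (j, a), l)]) ++
    (listOf fun j => listOf fun l => [.inr (.inr j, l)]) ++
    (listOf fun j => listOf fun a => listOf fun i => listOf fun l =>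
      [.inr (.inl (some (j, a), some i), l)]) ++
    (listOf fun j => listOf fun a => listOf fun l => [.inr (.inl (some (j, a), none), l)])

theorem map_listOf {α β : Type} {m : ℕ} (f : Fin m → List α) (g : α → β) :
    (listOf f).map g = listOf fun i => (f i).map g := by
  rw [listOf, listOf, List.map_flatten, List.map_ofFn]
  rfl

section World

variable {𝔹 : BilinearGroup} {d n : ℕ}

/-- The rows that are present in a key. -/
def rowAct (v : Fin d → 𝔹.Zp) : Option (Fin d × Fin 2) → Prop
  | none => True
  | some (j, _) => v j = 0

def entAct (v : Fin d → 𝔹.Zp) : Option (Fin d) → Prop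
  | none => True
  | some i => v i ≠ 0

/-- The exponents that are present in a key. -/
def actV (v : Fin d → 𝔹.Zp) : E0 d → Prop
  | .inl (R, ent) => rowAct v R ∧ entAct v ent
  | .inr j => v j = 0

def sgTerm (hs : Fin d → Fin 3 → Fin n → 𝔹.Zp) (e : KI d n → 𝔹.Zp) (l : Fin n) :
    Option (Fin d × Fin 2) → 𝔹.Zp
  | none => 0
  | some (j, k) => e (.inr j, l) * hs j k.succ l

open Classical in
/-- Discrete logarithms of the components `D`, `K j k` of a key. -/
def valOf (hs : Fin d → Fin 3 → Fin n → 𝔹.Zp) (ws : Fin n → 𝔹.Zp) (v : Fin d → 𝔹.Zp)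
    (e : KI d n → 𝔹.Zp) (r : RI d n) : 𝔹.Zp :=
  (∑ i, if v i ≠ 0 then e (.inl (r.1, some i), r.2) * (hs i 1 r.2 + v i * hs i 2 r.2) else 0) +
    e (.inl (r.1, none), r.2) * ws r.2 + sgTerm hs e r.2 r.1

open Classical in
/-- Discrete logarithms of the components of a key. -/
def wireOf (v : Fin d → 𝔹.Zp) (val : RI d n → 𝔹.Zp) (ex : KI d n → 𝔹.Zp) : WI d n → 𝔹.Zp
  | .inl r => if rowAct v r.1 then val r else 0
  | .inr q => if actV v q.1 then ex q else 0

open Classical in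
/-- The auxiliary input, for the injective and the lossy mode. -/
def yOf (b : Bool) (t : Fin d → 𝔹.Zp) (i : Fin d) (k : Fin 2) : 𝔹.Zp :=
  if b = true ∧ t i ≠ 0 then (if k = 0 then -t i else 1) else (if k = 0 then 1 else 0)

/-- Discrete logarithms of the master public key; the first `j` columns are lossy, and the diagonal
entries of column `ov` are arbitrary. -/
def mpkVal (j : ℕ) (ov : Option (Fin n)) (t : Fin d → 𝔹.Zp) (ev : SI d n → 𝔹.Zp) : MI d n → 𝔹.Zp
  | .v => ev .v
  | .w l => ev (.w l)
  | .h i i₂ l => ev (.h i i₂ l)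
  | .J l => ev .v * ev (.s l)
  | .Cw l₂ l₁ => if ov = some l₁ ∧ l₂ = l₁ then ev .ow else ev (.w l₁) * ev (.s l₂)
  | .C i k l₂ l₁ => if ov = some l₁ ∧ l₂ = l₁ then ev (.oc i k) else
      (ev (.h i 0 l₁) * (if l₂ = l₁ then yOf (decide (l₁.val < j)) t i k else 0) +
        ev (.h i k.succ l₁)) * ev (.s l₂)

def worldWire (ev : SI d n → 𝔹.Zp) (v : Fin d → 𝔹.Zp) (e : KI d n → 𝔹.Zp) : WI d n → 𝔹.Zp :=
  wireOf v (valOf (fun i i₂ l => ev (.h i i₂ l)) (fun l => ev (.w l)) v e) fun q => ev .v * e q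

/-- Keys are given by their exponents. -/
def worldGame (k u : ℕ) (t : Fin d → 𝔹.Zp) (ev : SI d n → 𝔹.Zp) : VGame 𝔹 d (KI d n → 𝔹.Zp) where
  kg _ := PMF.uniformOfFintype (KI d n → 𝔹.Zp)
  del v e x := (PMF.uniformOfFintype (WC d n → 𝔹.Zp)).map (hybDel k u t v e x)
  wire v e := (wireList d n).map fun i => emb .gh (worldWire ev v e i)

def world (𝔹 : BilinearGroup) (d n : ℕ) (A : Adversary) (k u j : ℕ) (ov : Option (Fin n)) : PMF Bool :=
  gameV A (fun _ => PMF.uniformOfFintype (SI d n → 𝔹.Zp))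
    (fun t ev => (mpkList d n).map fun i => emb .g (mpkVal j ov t ev i))
    (fun t ev => worldGame k u t ev)

theorem valOf_mul (hs : Fin d → Fin 3 → Fin n → 𝔹.Zp) (ws : Fin n → 𝔹.Zp) (v : Fin d → 𝔹.Zp)
    (z : Fin n → 𝔹.Zp) (e : KI d n → 𝔹.Zp) (r : RI d n) :
    valOf hs ws v (fun q => z q.2 * e q) r = z r.2 * valOf hs ws v e r := by
  obtain ⟨R, l⟩ := r
  have : sgTerm hs (fun q => z q.2 * e q) l R = z l * sgTerm hs e l R := by
    rcases R with _ | ⟨j, k⟩ <;> simp [sgTerm, mul_assoc]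
  simp only [valOf, this, mul_add, Finset.mul_sum, mul_assoc, mul_ite, mul_zero]

/-- Combination of the rows `K m k` of the component on the next level. -/
def valStar (hs : Fin d → Fin 3 → Fin n → 𝔹.Zp) (ws : Fin n → 𝔹.Zp) (v : Fin d → 𝔹.Zp)
    (V : KI d n → 𝔹.Zp) (m : Fin d) (x : 𝔹.Zp) (l : Fin n) : 𝔹.Zp :=
  valOf hs ws v V (some (m, 0), l) + x * valOf hs ws v V (some (m, 1), l)

theorem sum_childV (hs : Fin d → Fin 3 → Fin n → 𝔹.Zp) {v : Fin d → 𝔹.Zp} {x : 𝔹.Zp} (hx : x ≠ 0)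
    {m : Fin d} (hm : curV v m) (f : Fin d → 𝔹.Zp) (l : Fin n) :
    (open Classical in
      ∑ i, if childV v x i ≠ 0 then f i * (hs i 1 l + childV v x i * hs i 2 l) else 0) =
    (open Classical in ∑ i, if v i ≠ 0 then f i * (hs i 1 l + v i * hs i 2 l) else 0) +
      f m * (hs m 1 l + x * hs m 2 l) := by
  classical
  have hm0 : v m = 0 := hm.1
  rw [← Finset.add_sum_erase _ _ (Finset.mem_univ m), add_comm, childV_of_cur hm, if_pos hx]
  congr 1
  rw [← Finset.add_sum_erase (a := m) _ (fun i => if v i ≠ 0 then _ else _) (Finset.mem_univ m),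
    if_neg (not_not.2 hm0), zero_add]
  refine Finset.sum_congr rfl fun i hi => ?_
  rw [childV_of_ne hm x (Finset.ne_of_mem_erase hi)]

theorem valOf_delV_none (hs : Fin d → Fin 3 → Fin n → 𝔹.Zp) (ws : Fin n → 𝔹.Zp) {v : Fin d → 𝔹.Zp}
    {x : 𝔹.Zp} (hx : x ≠ 0) {m : Fin d} (hm : curV v m) (e V fr : KI d n → 𝔹.Zp)
    (τ : TI d n → 𝔹.Zp) (l : Fin n) :
    valOf hs ws (childV v x) (delV v x e V fr τ) (none, l) =
      valOf hs ws v e (none, l) + valStar hs ws v V m x l := by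
  classical
  have h1 : ∀ i, v i ≠ 0 → some i ≠ some m := fun i hi h => hi (by rw [Option.some.inj h]; exact hm.1)
  simp only [valOf, valStar, sgTerm, sum_childV hs hx hm, delV, curE_of_cur hm, vSg_of_cur hm,
    vMain_of_cur hm, reduceIte, reduceCtorEq]
  have : ∀ i, (if v i ≠ 0 then (if some i = some m then V (.inr m, l) else e (.inl (none, some i), l) +
      (V (.inl (some (m, 0), some i), l) + x * V (.inl (some (m, 1), some i), l))) *
        (hs i 1 l + v i * hs i 2 l) else 0) =
      (if v i ≠ 0 then e (.inl (none, some i), l) * (hs i 1 l + v i * hs i 2 l) else 0) +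
      ((if v i ≠ 0 then V (.inl (some (m, 0), some i), l) * (hs i 1 l + v i * hs i 2 l) else 0) +
      x * (if v i ≠ 0 then V (.inl (some (m, 1), some i), l) * (hs i 1 l + v i * hs i 2 l) else 0)) := by
    intro i
    by_cases hi : v i ≠ 0
    · simp only [if_pos hi, if_neg (h1 i hi)]; ring
    · simp only [if_neg hi]; ring
  simp only [this, Finset.sum_add_distrib, ← Finset.mul_sum, Fin.succ_zero_eq_one, Fin.succ_one_eq_two]
  ring

theorem valOf_delV_some (hs : Fin d → Fin 3 → Fin n → 𝔹.Zp) (ws : Fin n → 𝔹.Zp) {v : Fin d → 𝔹.Zp}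
    {x : 𝔹.Zp} (hx : x ≠ 0) {m : Fin d} (hm : curV v m) (e V fr : KI d n → 𝔹.Zp)
    (τ : TI d n → 𝔹.Zp) (j : Fin d) (k : Fin 2) (hj : childV v x j = 0) (l : Fin n) :
    valOf hs ws (childV v x) (delV v x e V fr τ) (some (j, k), l) =
      valOf hs ws v V (some (j, k), l) + τ (j, k, l) * valStar hs ws v V m x l := by
  classical
  have h1 : ∀ i, v i ≠ 0 → some i ≠ some m := fun i hi h => hi (by rw [Option.some.inj h]; exact hm.1)
  have h2 : ¬(v j ≠ 0 ∨ curV v j) := by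
    have := (childV_eq_zero hx j).1 hj
    tauto
  simp only [valOf, valStar, sgTerm, sum_childV hs hx hm, delV, curE_of_cur hm, vSg_of_cur hm,
    vMain_of_cur hm, reduceIte, reduceCtorEq, if_neg h2]
  have : ∀ i, (if v i ≠ 0 then (if some i = some m then τ (j, k, l) * V (.inr m, l) else
      V (.inl (some (j, k), some i), l) + τ (j, k, l) *
      (V (.inl (some (m, 0), some i), l) + x * V (.inl (some (m, 1), some i), l))) *
        (hs i 1 l + v i * hs i 2 l) else 0) =
      (if v i ≠ 0 then V (.inl (some (j, k), some i), l) * (hs i 1 l + v i * hs i 2 l) else 0) +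
      τ (j, k, l) *
      ((if v i ≠ 0 then V (.inl (some (m, 0), some i), l) * (hs i 1 l + v i * hs i 2 l) else 0) +
      x * (if v i ≠ 0 then V (.inl (some (m, 1), some i), l) * (hs i 1 l + v i * hs i 2 l) else 0)) := by
    intro i
    by_cases hi : v i ≠ 0
    · simp only [if_pos hi, if_neg (h1 i hi)]; ring
    · simp only [if_neg hi]; ring
  simp only [this, Finset.sum_add_distrib, ← Finset.mul_sum, Fin.succ_zero_eq_one, Fin.succ_one_eq_two]
  ring

theorem gameV_close {E₁ E₂ κ₁ κ₂ : Type} {ε : ℝ} {A : Adversary} {setup₁ : (Fin d → 𝔹.Zp) → PMF E₁}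
    {setup₂ : (Fin d → 𝔹.Zp) → PMF E₂} {mpk₁ : (Fin d → 𝔹.Zp) → E₁ → List (Val 𝔹)}
    {mpk₂ : (Fin d → 𝔹.Zp) → E₂ → List (Val 𝔹)} {O₁ : (Fin d → 𝔹.Zp) → E₁ → VGame 𝔹 d κ₁}
    {O₂ : (Fin d → 𝔹.Zp) → E₂ → VGame 𝔹 d κ₂}
    (h : ∀ t (m : Mem 𝔹), Close ε
      ((setup₁ t).bind fun ev =>
        (runV (O₁ t ev) t A.attack (m.write 0 (mpk₁ t ev), [])).map fun st => (st.1 0).toBit)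
      ((setup₂ t).bind fun ev =>
        (runV (O₂ t ev) t A.attack (m.write 0 (mpk₂ t ev), [])).map fun st => (st.1 0).toBit)) :
    Close ε (gameV A setup₁ mpk₁ O₁) (gameV A setup₂ mpk₂ O₂) :=
  Close.bind_right _ fun m => h _ m

theorem worldGame_level_succ (k : ℕ) (t : Fin d → 𝔹.Zp) (ev : SI d n → 𝔹.Zp) (cs : List Cmd)
    (st : VState 𝔹 d (KI d n → 𝔹.Zp)) :
    Close (cs.countP Cmd.isQuery * ((n : ℝ) / 𝔹.p))
      (runV (worldGame k (Fintype.card (E0 d)) t ev) t cs st)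
      (runV (worldGame (k + 1) 0 t ev) t cs st) := by
  have h0 : (0 : ℝ) ≤ (n : ℝ) / 𝔹.p := by positivity
  refine runV_close h0 ?_ ?_ ?_ _ _
  · intro v
    exact (Close.refl _).mono h0
  · intro v e x hx hv
    unfold worldGame
    exact close_hybDel_succ k hv e x
  · intro v e h
    rfl

theorem world_level_succ (A : Adversary) (k j : ℕ) (ov : Option (Fin n)) :
    Close (A.queries * ((n : ℝ) / 𝔹.p)) (world 𝔹 d n A k (Fintype.card (E0 d)) j ov)
      (world 𝔹 d n A (k + 1) 0 j ov) :=
  gameV_close fun t m => Close.bind_right _ fun ev =>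
    Close.map (worldGame_level_succ k t ev A.attack _) _

end World

/-! ## Circuits for exponents of keys -/

section Circuits

variable {ν : Type} {nb d n c : ℕ} {kd : ν → Kind}

theorem cp_curV_of {w : Fin d → Fn ν} (hw : ∀ i, Cp nb kd .s c (w i)) (i : Fin d) :
    Cp nb kd .bit (d * (c + 29) + c + 12) fun 𝔹 σ => ind (curV (fun i => w i 𝔹 σ) i) := by
  refine ((Cp.and (Cp.eq_zero (by decide) (hw i)) (Cp.forall fun i' : Fin d =>
    ((Cp.const (i' < i)).not.or (Cp.nonzero (by decide) (hw i'))))).mono ?_).congr fun 𝔹 σ => ?_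
  · simp only [Fintype.card_fin]; ring_nf; omega
  · simp only [curV, imp_iff_not_or]

theorem cp_pfxV_of {w t : Fin d → Fn ν} (hw : ∀ i, Cp nb kd .s c (w i))
    (ht : ∀ i, Cp nb kd .s c (t i)) : Cp nb kd .bit (d * (3 * c + 19) + 3) fun 𝔹 σ =>
      ind (pfxV (fun i => w i 𝔹 σ) fun i => t i 𝔹 σ) :=
  (Cp.forall fun i => (Cp.eq_zero (by decide) (hw i)).or
    (Cp.eq (k := .s) (by decide) (hw i) (ht i))).mono
      (by simp only [Fintype.card_fin]; ring_nf; omega)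

theorem cp_childV_of {w : Fin d → Fn ν} (hw : ∀ i, Cp nb kd .s c (w i)) {x : Fn ν}
    (hx : Cp nb kd .s c x) (i : Fin d) : Cp nb kd .s (d * (c + 29) + 3 * c + 13) fun 𝔹 σ =>
      childV (fun i => w i 𝔹 σ) (x 𝔹 σ) i :=
  ((Cp.ite (cp_curV_of hw i) hx (hw i)).mono (by ring_nf; omega)).congr fun 𝔹 σ => rfl

theorem cp_rowAct {w : Fin d → Fn ν} (hw : ∀ i, Cp nb kd .s c (w i)) (R : Option (Fin d × Fin 2)) :
    Cp nb kd .bit (c + 4) fun 𝔹 σ => ind (rowAct (fun i => w i 𝔹 σ) R) := by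
  rcases R with _ | ⟨j, k⟩
  · exact (Cp.const True).mono (by omega)
  · exact Cp.eq_zero (by decide) (hw j)

theorem cp_actV {w : Fin d → Fn ν} (hw : ∀ i, Cp nb kd .s c (w i)) (q : E0 d) :
    Cp nb kd .bit (2 * c + 17) fun 𝔹 σ => ind (actV (fun i => w i 𝔹 σ) q) := by
  rcases q with ⟨R, _ | i⟩ | j
  · exact ((cp_rowAct hw R).and (Cp.const True)).mono (by omega)
  · exact ((cp_rowAct hw R).and (Cp.nonzero (by decide) (hw i))).mono (by omega)
  · exact (Cp.eq_zero (by decide) (hw j)).mono (by omega)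

theorem cp_wireOf {w : Fin d → Fn ν} (hw : ∀ i, Cp nb kd .s c (w i)) {val : RI d n → Fn ν}
    {ex : KI d n → Fn ν} {c' : ℕ} {k : Kind} (hk : k ≠ .bit) (hval : ∀ r, Cp nb kd k c' (val r))
    (hex : ∀ q, Cp nb kd k c' (ex q)) (i : WI d n) :
    Cp nb kd k (2 * c + c' + 21) fun 𝔹 σ =>
      wireOf (fun i => w i 𝔹 σ) (fun r => val r 𝔹 σ) (fun q => ex q 𝔹 σ) i := by
  rcases i with r | q
  · exact ((cp_rowAct hw r.1).ite (hval r) (Cp.zero nb kd k hk)).mono (by omega)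
  · exact ((cp_actV hw q.1).ite (hex q) (Cp.zero nb kd k hk)).mono (by omega)

def valCost (d c : ℕ) : ℕ := d * (4 * c + 20) + 5 * c + 20

theorem cp_valOf {hs : Fin d → Fin 3 → Fin n → Fn ν} (hhs : ∀ i i₂ l, Cp nb kd .s c (hs i i₂ l))
    {ws : Fin n → Fn ν} (hws : ∀ l, Cp nb kd .s c (ws l)) {w : Fin d → Fn ν}
    (hw : ∀ i, Cp nb kd .s c (w i)) {k : Kind} (hk : k ≠ .bit) {e : KI d n → Fn ν}
    (he : ∀ q, Cp nb kd k c (e q)) (r : RI d n) :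
    Cp nb kd k (valCost d c + 2 * d * c) fun 𝔹 σ => valOf (fun i i₂ l => hs i i₂ l 𝔹 σ)
      (fun l => ws l 𝔹 σ) (fun i => w i 𝔹 σ) (fun q => e q 𝔹 σ) r := by
  have h1 : Cp nb kd k (2 * c + 3) fun 𝔹 σ => sgTerm (fun i i₂ l => hs i i₂ l 𝔹 σ)
      (fun q => e q 𝔹 σ) r.2 r.1 := by
    rcases r with ⟨_ | ⟨j, k'⟩, l⟩
    · exact (Cp.zero nb kd k hk).mono (by omega)
    · exact (Cp.mul hk (he _) (hhs _ _ _)).mono (by omega)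
  refine ((Cp.add hk (Cp.add hk (Cp.sum hk fun i : Fin d => Cp.ite (Cp.nonzero (by decide) (hw i))
    (Cp.mul hk (he (.inl (r.1, some i), r.2)) (Cp.sadd (hhs i 1 r.2) (Cp.smul (hw i) (hhs i 2 r.2))))
    (Cp.zero nb kd k hk)) (Cp.mul hk (he (.inl (r.1, none), r.2)) (hws r.2))) h1).mono ?_).congr
      fun 𝔹 σ => by simp only [valOf]; congr!
  simp only [Fintype.card_fin, valCost]; ring_nf; omega

/-- Cost of the sums in `delV`. -/
def starCost (d c : ℕ) : ℕ := d * (d * (c + 29) + 5 * c + 30) + 3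

theorem cp_vSg {w : Fin d → Fn ν} (hw : ∀ i, Cp nb kd .s c (w i)) {k : Kind} (hk : k ≠ .bit)
    {V : KI d n → Fn ν} (hV : ∀ q, Cp nb kd k c (V q)) (l : Fin n) :
    Cp nb kd k (starCost d c) fun 𝔹 σ => vSg (fun i => w i 𝔹 σ) (fun q => V q 𝔹 σ) l := by
  refine ((Cp.sum hk fun j : Fin d => Cp.ite (cp_curV_of hw j) (hV (.inr j, l))
    (Cp.zero nb kd k hk)).mono ?_).congr fun 𝔹 σ => rfl
  simp only [Fintype.card_fin, starCost]; ring_nf; nlinarith [Nat.zero_le (d * c)]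

theorem cp_vMain {w : Fin d → Fn ν} (hw : ∀ i, Cp nb kd .s c (w i)) {x : Fn ν}
    (hx : Cp nb kd .s c x) {k : Kind} (hk : k ≠ .bit)
    {V : KI d n → Fn ν} (hV : ∀ q, Cp nb kd k c (V q)) (ent : Option (Fin d)) (l : Fin n) :
    Cp nb kd k (starCost d c) fun 𝔹 σ =>
      vMain (fun i => w i 𝔹 σ) (x 𝔹 σ) (fun q => V q 𝔹 σ) ent l := by
  refine ((Cp.sum hk fun j : Fin d => Cp.ite (cp_curV_of hw j)
    (Cp.add hk (hV (.inl (some (j, 0), ent), l)) (Cp.mul' hk hx (hV (.inl (some (j, 1), ent), l))))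
    (Cp.zero nb kd k hk)).mono ?_).congr fun 𝔹 σ => rfl
  simp only [Fintype.card_fin, starCost]; ring_nf; nlinarith [Nat.zero_le (d * c)]

theorem cp_curE {w : Fin d → Fn ν} (hw : ∀ i, Cp nb kd .s c (w i)) (ent : Option (Fin d)) :
    Cp nb kd .bit (d * (c + 29) + c + 12) fun 𝔹 σ => ind (curE (fun i => w i 𝔹 σ) ent) := by
  rcases ent with _ | i
  · exact (Cp.const False).mono (by omega)
  · exact cp_curV_of hw i

def delCost (d c : ℕ) : ℕ := 2 * starCost d c + 2 * (d * (c + 29)) + 8 * c + 60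

theorem cp_delV {w : Fin d → Fn ν} (hw : ∀ i, Cp nb kd .s c (w i)) {x : Fn ν}
    (hx : Cp nb kd .s c x) {k : Kind} (hk : k ≠ .bit) {e V fr : KI d n → Fn ν} {τ : TI d n → Fn ν}
    (he : ∀ q, Cp nb kd k c (e q)) (hV : ∀ q, Cp nb kd k c (V q)) (hfr : ∀ q, Cp nb kd k c (fr q))
    (hτ : ∀ q, Cp nb kd .s c (τ q)) (q : KI d n) :
    Cp nb kd k (delCost d c) fun 𝔹 σ => delV (fun i => w i 𝔹 σ) (x 𝔹 σ) (fun q => e q 𝔹 σ)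
      (fun q => V q 𝔹 σ) (fun q => fr q 𝔹 σ) (fun q => τ q 𝔹 σ) q := by
  have hj : ∀ j, Cp nb kd .bit (d * (c + 29) + 2 * c + 29) fun 𝔹 σ =>
      ind (w j 𝔹 σ ≠ 0 ∨ curV (fun i => w i 𝔹 σ) j) := fun j =>
    ((Cp.nonzero (by decide) (hw j)).or (cp_curV_of hw j)).mono (by omega)
  rcases q with ⟨⟨_ | ⟨j, k'⟩, ent⟩ | j, l⟩
  · refine ((Cp.ite (cp_curE hw ent) (cp_vSg hw hk hV l) (Cp.add hk (he (.inl (none, ent), l))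
      (cp_vMain hw hx hk hV ent l))).mono ?_).congr fun 𝔹 σ => rfl
    simp only [delCost]; omega
  · refine ((Cp.ite (hj j) (hfr (.inl (some (j, k'), ent), l)) (Cp.ite (cp_curE hw ent)
      (Cp.mul' hk (hτ (j, k', l)) (cp_vSg hw hk hV l)) (Cp.add hk (hV (.inl (some (j, k'), ent), l))
      (Cp.mul' hk (hτ (j, k', l)) (cp_vMain hw hx hk hV ent l))))).mono ?_).congr fun 𝔹 σ => by rw [delV]; congr!
    simp only [delCost]; omega
  · refine ((Cp.ite (hj j) (hfr (.inr j, l)) (hV (.inr j, l))).mono ?_).congr fun 𝔹 σ => by rw [delV]; congr!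
    simp only [delCost]; omega

theorem cp_yOf (b : Bool) {t : Fin d → Fn ν} (ht : ∀ i, Cp nb kd .s c (t i)) (i : Fin d) (k : Fin 2) :
    Cp nb kd .s (2 * c + negCost nb + 40) fun 𝔹 σ => yOf b (fun i => t i 𝔹 σ) i k := by
  refine ((Cp.ite ((Cp.const (b = true)).and (Cp.nonzero (by decide) (ht i)))
    (Cp.ite (Cp.const (k = 0)) (Cp.neg (by decide) (ht i)) (Cp.lit 1))
    (Cp.ite (Cp.const (k = 0)) (Cp.lit 1) (Cp.zero nb kd .s (by decide)))).mono ?_).congr fun 𝔹 σ => ?_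
  · omega
  · simp only [yOf, Nat.cast_one]

theorem cp_pfx_and {w t : Fin d → Fn ν} (hw : ∀ i, Cp nb kd .s c (w i))
    (ht : ∀ i, Cp nb kd .s c (t i)) (P : Fin d → Prop)
    {X : Fin d → ∀ 𝔹 : BilinearGroup, (ν → 𝔹.Zp) → Prop}
    (hX : ∀ i, Cp nb kd .bit (d * (c + 29) + c + 12) fun 𝔹 σ => ind (X i 𝔹 σ)) :
    Cp nb kd .bit (d * (d * (c + 29) + 4 * c + 60) + 20) fun 𝔹 σ =>
      ind (pfxV (fun i => w i 𝔹 σ) (fun i => t i 𝔹 σ) ∧ ∃ i, P i ∧ X i 𝔹 σ) := by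
  refine (Cp.and (cp_pfxV_of hw ht) (Cp.exists fun i : Fin d => (Cp.const (P i)).and (hX i))).mono ?_
  simp only [Fintype.card_fin]; ring_nf; nlinarith [Nat.zero_le (d * c)]

end Circuits

theorem uniform_map_of_injective_prod {A B C : Type} [Fintype A] [Fintype B] [Fintype C] [Nonempty A]
    [Nonempty B] [Nonempty C] {f : A → B} {h : A → C}
    (hi : Function.Injective fun a => (f a, h a))
    (hc : Fintype.card A = Fintype.card B * Fintype.card C) :
    (PMF.uniformOfFintype A).map f = PMF.uniformOfFintype B := by
  have hb : Function.Bijective fun a => (f a, h a) :=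
    (Fintype.bijective_iff_injective_and_card _).2 ⟨hi, by rw [hc, Fintype.card_prod]⟩
  have h1 := uniform_map_of_bijective hb
  have h2 : (PMF.uniformOfFintype (B × C)).map Prod.fst = PMF.uniformOfFintype B := by
    rw [PMF.map, uniform_prod_bind]
    simp only [Function.comp, PMF.bind_const]
    exact PMF.bind_pure _
  rw [← h2, ← h1, PMF.map_comp]
  rfl

theorem uniform_map_add {I R : Type} [Fintype I] [DecidableEq I] [Fintype R] [AddGroup R] (s : I → R) :
    (PMF.uniformOfFintype (I → R)).map (fun c q => c q + s q) = PMF.uniformOfFintype (I → R) :=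
  uniform_map_injective fun a b h => funext fun q => by simpa using congrFun h q

/-! ## Simulation from a DDH tuple -/

section DDH

variable {𝔹 : BilinearGroup} {d n : ℕ}

abbrev DC (d n : ℕ) : Type := WC d n ⊕ Fin n

set_option synthInstance.maxSize 2048 in
instance instDecidableEqDC (d n : ℕ) : DecidableEq (DC d n) := inferInstance

set_option synthInstance.maxSize 2048 in
instance instFintypeDC (d n : ℕ) : Fintype (DC d n) := inferInstance

set_option synthInstance.maxSize 2048 in
instance instFintypeKK (d n : ℕ) : Fintype (KI d n ⊕ KI d n) := inferInstance

instance instFintypeFunDC (d n : ℕ) (R : Type) [Fintype R] : Fintype (DC d n → R) := inferInstance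

def flagV (k : ℕ) (t v : Fin d → 𝔹.Zp) : Prop := pfxV v t ∧ ∃ i : Fin d, i.val = k ∧ curV v i

def lowV (k : ℕ) (t v : Fin d → 𝔹.Zp) : Prop := pfxV v t ∧ ∃ i : Fin d, i.val < k ∧ v i = 0

open Classical in
def ddhShift (k u : ℕ) (t : Fin d → 𝔹.Zp) (a : 𝔹.Zp) (v : Fin d → 𝔹.Zp) (q : KI d n) : 𝔹.Zp :=
  if flagV k t v ∧ e0Idx q.1 = u then a else 0

open Classical in
/-- Keys are given by powers of `ĝ`; for keys with a randomized delegation component that is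
changed, the scalars are also known, up to the summand `a` in the exponent number `u`. -/
def ddhEmbed (k u : ℕ) (t : Fin d → 𝔹.Zp) (a : 𝔹.Zp) (v : Fin d → 𝔹.Zp) (e : KI d n → 𝔹.Zp) :
    KI d n ⊕ KI d n → 𝔹.Zp
  | .inl q => e q
  | .inr q => if flagV k t v then e q - ddhShift k u t a v q else 0

open Classical in
def ddhKg (k u : ℕ) (t : Fin d → 𝔹.Zp) (a : 𝔹.Zp) (v : Fin d → 𝔹.Zp) (co : DC d n → 𝔹.Zp) :
    KI d n ⊕ KI d n → 𝔹.Zp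
  | .inl q => co (.inl (.inl (.inr q))) + ddhShift k u t a v q
  | .inr q => if flagV k t v then co (.inl (.inl (.inr q))) else 0

open Classical in
def ddhV (k u : ℕ) (inp : Fin 5 → 𝔹.Zp) (t v : Fin d → 𝔹.Zp) (par : KI d n ⊕ KI d n → 𝔹.Zp)
    (co : DC d n → 𝔹.Zp) (q : KI d n) : 𝔹.Zp :=
  if flagV k t v then
    if e0Idx q.1 < u then co (.inl (.inl (.inl q)))
    else if e0Idx q.1 = u then (inp 4 * co (.inr q.2) + inp 2 * co (.inl (.inr (.inl q.2)))) +
      (inp 3 * co (.inr q.2) + co (.inl (.inr (.inl q.2)))) * par (.inr q)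
    else (inp 3 * co (.inr q.2) + co (.inl (.inr (.inl q.2)))) * par (.inr q)
  else par (.inl q) * co (.inl (.inr (.inl q.2)))

open Classical in
def ddhDel (k u : ℕ) (inp : Fin 5 → 𝔹.Zp) (t v : Fin d → 𝔹.Zp) (par : KI d n ⊕ KI d n → 𝔹.Zp)
    (x : 𝔹.Zp) (co : DC d n → 𝔹.Zp) (q : KI d n ⊕ KI d n) : 𝔹.Zp :=
  if lowV k t v then ddhKg k u t (inp 2) (childV v x) co q
  else match q with
    | .inl q => delV v x (fun q => par (.inl q)) (ddhV k u inp t v par co)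
        (fun q => co (.inl (.inl (.inr q)))) (fun q => co (.inl (.inr (.inr q)))) q
    | .inr _ => 0

theorem uniform_ddhKg (k u : ℕ) (t : Fin d → 𝔹.Zp) (a : 𝔹.Zp) (v : Fin d → 𝔹.Zp) :
    (PMF.uniformOfFintype (DC d n → 𝔹.Zp)).map (ddhKg k u t a v) =
      (PMF.uniformOfFintype (KI d n → 𝔹.Zp)).map (ddhEmbed k u t a v) := by
  have h1 : Function.Injective fun q : KI d n => (.inl (.inl (.inr q)) : DC d n) :=
    fun a b h => by simpa using h
  rw [← uniform_map_add (ddhShift k u t a v), ← uniform_comp_injective (R := 𝔹.Zp) h1, PMF.map_comp,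
    PMF.map_comp]
  congr 1
  funext co
  funext q
  rcases q with q | q
  · rfl
  · simp [ddhKg, ddhEmbed]

theorem not_flagV_child {k : ℕ} {t v : Fin d → 𝔹.Zp} {x : 𝔹.Zp} (hx : x ≠ 0)
    (h : ¬lowV k t v) : ¬flagV k t (childV v x) := by
  rintro ⟨hp, i, hi, hc⟩
  have h0 := (childV_eq_zero hx i).1 hc.1
  obtain ⟨m, hm⟩ := exists_curV ⟨i, h0.1⟩
  refine h ⟨pfxV_of_child hx hp, m, ?_, hm.1⟩
  rcases lt_trichotomy m i with hlt | rfl | hgt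
  · rw [← hi]; exact hlt
  · exact absurd hm h0.2
  · exact absurd h0.1 (hm.2 i hgt)

open Classical in
/-- The coins of the delegation that are implicit in the simulation. -/
def ddhCoins (k u : ℕ) (inp : Fin 5 → 𝔹.Zp) (t v : Fin d → 𝔹.Zp) (par : KI d n ⊕ KI d n → 𝔹.Zp)
    (ch : Prop) (co : DC d n → 𝔹.Zp) : WC d n → 𝔹.Zp
  | .inl (.inl q) => if ch ∧ flagV k t v ∧ e0Idx q.1 = u then ddhV k u inp t v par co q
      else co (.inl (.inl (.inl q)))
  | .inr (.inl l) => if flagV k t v then inp 3 * co (.inr l) + co (.inl (.inr (.inl l)))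
      else co (.inl (.inr (.inl l)))
  | c => co (.inl c)

theorem uniform_ddhCoins_of_eq (k u : ℕ) (inp : Fin 5 → 𝔹.Zp) (t v : Fin d → 𝔹.Zp)
    (par : KI d n ⊕ KI d n → 𝔹.Zp) :
    (PMF.uniformOfFintype (DC d n → 𝔹.Zp)).map (ddhCoins k u inp t v par False) =
      PMF.uniformOfFintype (WC d n → 𝔹.Zp) := by
  refine uniform_map_of_injective_prod (C := Fin n → 𝔹.Zp) (h := fun co l => co (.inr l)) ?_ ?_
  · intro a b h
    simp only [Prod.mk.injEq] at h
    obtain ⟨h1, h2⟩ := h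
    have hq := fun q => congrFun h1 q
    have h2' := fun l => congrFun h2 l
    funext c
    rcases c with ((q | q) | (l | q)) | l
    · simpa [ddhCoins] using hq (.inl (.inl q))
    · exact hq (.inl (.inr q))
    · have := hq (.inr (.inl l))
      simp only [ddhCoins] at this h2'
      split_ifs at this with hf
      · rw [h2' l] at this
        exact add_left_cancel this
      · exact this
    · exact hq (.inr (.inr q))
    · exact h2' l
  · rw [← Fintype.card_prod]
    exact Fintype.card_congr (Equiv.sumArrowEquivProdArrow _ _ _)

theorem uniform_ddhCoins_of_ne {k u : ℕ} (hu : u < Fintype.card (E0 d)) {inp : Fin 5 → 𝔹.Zp}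
    (h4 : inp 4 ≠ inp 2 * inp 3) (t v : Fin d → 𝔹.Zp) (par : KI d n ⊕ KI d n → 𝔹.Zp)
    (hpar : flagV k t v → ∀ q : KI d n, e0Idx q.1 = u → par (.inl q) = par (.inr q) + inp 2) :
    (PMF.uniformOfFintype (DC d n → 𝔹.Zp)).map (ddhCoins k u inp t v par True) =
      PMF.uniformOfFintype (WC d n → 𝔹.Zp) := by
  classical
  let qu : E0 d := (Fintype.equivFin (E0 d)).symm ⟨u, hu⟩
  have hqu : e0Idx qu = u := by simp [e0Idx, qu]
  have hq' : ∀ q, e0Idx q = u → q = qu := fun q hq => by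
    apply (Fintype.equivFin (E0 d)).injective
    apply Fin.ext
    rw [← e0Idx, ← e0Idx, hq, hqu]
  refine uniform_map_of_injective_prod (C := Fin n → 𝔹.Zp) (h := fun co l =>
    if flagV k t v then co (.inl (.inl (.inl (qu, l)))) else co (.inr l)) ?_ ?_
  · intro a b h
    simp only [Prod.mk.injEq] at h
    obtain ⟨h1, h2⟩ := h
    have hq := fun q => congrFun h1 q
    have h2' := fun l => congrFun h2 l
    by_cases hf : flagV k t v
    · simp only [if_pos hf] at h2'
      have hz : ∀ l, inp 3 * a (.inr l) + a (.inl (.inr (.inl l))) =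
          inp 3 * b (.inr l) + b (.inl (.inr (.inl l))) := fun l => by
        simpa [ddhCoins, hf] using hq (.inr (.inl l))
      have hv : ∀ l, inp 4 * a (.inr l) + inp 2 * a (.inl (.inr (.inl l))) =
          inp 4 * b (.inr l) + inp 2 * b (.inl (.inr (.inl l))) := fun l => by
        have := hq (.inl (.inl (qu, l)))
        simp only [ddhCoins, ddhV, hqu, lt_irrefl, if_pos hf, if_true, hf, true_and, if_false,
          hz] at this
        exact add_right_cancel this
      have hζ : ∀ l, a (.inr l) = b (.inr l) := fun l => by
        have : (inp 4 - inp 2 * inp 3) * (a (.inr l) - b (.inr l)) = 0 := by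
          linear_combination hv l - inp 2 * hz l
        rcases mul_eq_zero.1 this with h | h
        · exact absurd (sub_eq_zero.1 h) h4
        · exact sub_eq_zero.1 h
      funext c
      rcases c with ((⟨q, l⟩ | q) | (l | q)) | l
      · by_cases hqe : e0Idx q = u
        · rw [hq' q hqe]; exact h2' l
        · simpa [ddhCoins, hqe] using hq (.inl (.inl (q, l)))
      · exact hq (.inl (.inr q))
      · have := hz l
        rw [hζ l] at this
        exact add_left_cancel this
      · exact hq (.inr (.inr q))
      · exact hζ l
    · simp only [if_neg hf] at h2'
      funext c
      rcases c with ((q | q) | (l | q)) | l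
      · simpa [ddhCoins, hf] using hq (.inl (.inl q))
      · exact hq (.inl (.inr q))
      · simpa [ddhCoins, hf] using hq (.inr (.inl l))
      · exact hq (.inr (.inr q))
      · exact h2' l
  · rw [← Fintype.card_prod]
    exact Fintype.card_congr (Equiv.sumArrowEquivProdArrow _ _ _)

theorem uniform_ddhDel {k u k' : ℕ} {ch : Prop} {inp : Fin 5 → 𝔹.Zp} {t v : Fin d → 𝔹.Zp}
    {e : KI d n → 𝔹.Zp} {x : 𝔹.Zp} (hx : x ≠ 0)
    (hco : ¬lowV k t v → (PMF.uniformOfFintype (DC d n → 𝔹.Zp)).map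
      (ddhCoins k u inp t v (ddhEmbed k u t (inp 2) v e) ch) = PMF.uniformOfFintype (WC d n → 𝔹.Zp))
    (h : ¬lowV k t v → ∀ co q, ddhV k u inp t v (ddhEmbed k u t (inp 2) v e) co q =
      (open Classical in if flagV k t v ∧ e0Idx q.1 < k' then
        ddhCoins k u inp t v (ddhEmbed k u t (inp 2) v e) ch co (.inl (.inl q)) else
        ddhCoins k u inp t v (ddhEmbed k u t (inp 2) v e) ch co (.inr (.inl q.2)) * e q)) :
    (PMF.uniformOfFintype (DC d n → 𝔹.Zp)).map
        (ddhDel k u inp t v (ddhEmbed k u t (inp 2) v e) x) =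
      ((PMF.uniformOfFintype (WC d n → 𝔹.Zp)).map (hybDel k k' t v e x)).map
        (ddhEmbed k u t (inp 2) (childV v x)) := by
  classical
  by_cases hl : lowV k t v
  · have e1 : ddhDel k u inp t v (ddhEmbed k u t (inp 2) v e) x =
        ddhKg (d := d) (n := n) k u t (inp 2) (childV v x) := by
      funext co q
      rw [ddhDel.eq_def, if_pos hl]
    have e2 : hybDel k k' t v e x = fun c : WC d n → 𝔹.Zp => c ∘ fun q => .inl (.inr q) := by
      funext c
      rw [hybDel, if_pos (show pfxV v t ∧ _ from hl)]
      rfl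
    rw [e1, uniform_ddhKg, e2, uniform_comp_injective (fun a b h => by simpa using h)]
  · rw [← hco hl, PMF.map_comp, PMF.map_comp]
    congr 1
    funext co q
    simp only [Function.comp]
    rw [ddhDel.eq_def, if_neg hl, hybDel, if_neg (show ¬(pfxV v t ∧ _) from hl)]
    rcases q with q | q
    · simp only [ddhEmbed]
      congr 1
      funext q'
      have := h hl co q'
      rw [this]
      simp only [flagV, and_assoc]
    · simp only [ddhEmbed, if_neg (not_flagV_child hx hl)]

end DDH

section DDHSim

variable {nb d n : ℕ}

theorem cp_mpkVal {ν : Type} {c : ℕ} {kd : ν → Kind} {ev : SI d n → Fn ν}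
    (hev : ∀ i, Cp nb kd .s c (ev i)) {t : Fin d → Fn ν} (ht : ∀ i, Cp nb kd .s c (t i)) (j : ℕ)
    (ov : Option (Fin n)) (i : MI d n) :
    Cp nb kd .s (6 * c + negCost nb + 80) fun 𝔹 σ =>
      mpkVal j ov (fun i => t i 𝔹 σ) (fun i => ev i 𝔹 σ) i := by
  rcases i with _ | l | ⟨i, i₂, l⟩ | l | ⟨l₂, l₁⟩ | ⟨i, k, l₂, l₁⟩
  · exact (hev _).mono (by omega)
  · exact (hev _).mono (by omega)
  · exact (hev _).mono (by omega)
  · exact (Cp.smul (hev _) (hev _)).mono (by omega)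
  · refine ((Cp.ite (Cp.const (ov = some l₁ ∧ l₂ = l₁)) (hev .ow)
      (Cp.smul (hev (.w l₁)) (hev (.s l₂)))).mono (by omega)).congr fun 𝔹 σ => ?_
    simp only [mpkVal]
    congr!
  · refine ((Cp.ite (Cp.const (ov = some l₁ ∧ l₂ = l₁)) (hev (.oc i k))
      (Cp.smul (Cp.sadd (Cp.smul (hev (.h i 0 l₁)) (Cp.ite (Cp.const (l₂ = l₁))
        (cp_yOf (decide (l₁.val < j)) ht i k) (Cp.zero nb kd .s (by decide))))
        (hev (.h i k.succ l₁))) (hev (.s l₂)))).mono (by omega)).congr fun 𝔹 σ => ?_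
    simp only [mpkVal]
    congr!

def flagCost (d c : ℕ) : ℕ := d * (d * (c + 29) + 4 * c + 60) + 20

theorem cp_flagV {ν : Type} {c : ℕ} {kd : ν → Kind} {w t : Fin d → Fn ν}
    (hw : ∀ i, Cp nb kd .s c (w i)) (ht : ∀ i, Cp nb kd .s c (t i)) (k : ℕ) :
    Cp nb kd .bit (flagCost d c) fun 𝔹 σ =>
      ind (flagV k (fun i => t i 𝔹 σ) fun i => w i 𝔹 σ) :=
  cp_pfx_and hw ht (fun i => i.val = k) fun i => cp_curV_of hw i

theorem cp_lowV {ν : Type} {c : ℕ} {kd : ν → Kind} {w t : Fin d → Fn ν}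
    (hw : ∀ i, Cp nb kd .s c (w i)) (ht : ∀ i, Cp nb kd .s c (t i)) (k : ℕ) :
    Cp nb kd .bit (flagCost d c) fun 𝔹 σ =>
      ind (lowV k (fun i => t i 𝔹 σ) fun i => w i 𝔹 σ) :=
  cp_pfx_and hw ht (fun i => i.val < k) fun i => (Cp.eq_zero (by decide) (hw i)).mono (by omega)

def ddhKind : Fin 5 → Kind := ![.g, .gh, .gh, .gh, .gh]

def ddhKeyKind : KI d n ⊕ KI d n → Kind
  | .inl _ => .gh
  | .inr _ => .s

abbrev DBN (d n : ℕ) : Type := BN 5 d (SI d n) (KI d n ⊕ KI d n) (DC d n)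

abbrev dkd : DBN d n → Kind := BN.kind ddhKind ddhKeyKind

theorem dvar (x : DBN d n) {k : Kind} (h : dkd x = k) : Cp nb dkd k 1 fun _ σ => σ x := Cp.var' x h

theorem cp_gh {ν : Type} {c : ℕ} {kd : ν → Kind} {f : Fn ν} (h : Cp nb kd .s c f) :
    Cp nb kd .gh (c + 2) f :=
  ((Cp.mul (by decide) Cp.genh h).mono (by omega)).congr fun 𝔹 σ => one_mul _

theorem cp_g {ν : Type} {c : ℕ} {kd : ν → Kind} {f : Fn ν} (h : Cp nb kd .s c f) :
    Cp nb kd .g (c + 2) f :=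
  ((Cp.mul (by decide) Cp.gen h).mono (by omega)).congr fun 𝔹 σ => one_mul _

theorem cp_ddhKg (k u : ℕ) {c : ℕ} {w : Fin d → Fn (DBN d n)} (hc : 1 ≤ c)
    (hw : ∀ i, Cp nb dkd .s c (w i)) (q : KI d n ⊕ KI d n) :
    Cp nb dkd (ddhKeyKind q) (flagCost d c + 30) fun 𝔹 σ =>
      ddhKg k u (fun i => σ (.tg i)) (σ (.inp 2)) (fun i => w i 𝔹 σ) (fun i => σ (.co i)) q := by
  have ht : ∀ i, Cp nb (dkd (d := d) (n := n)) .s c fun _ σ => σ (.tg i) := fun i =>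
    (dvar (.tg i) rfl).mono hc
  rcases q with q | q
  · have h := Cp.add (k := .gh) (by decide) (cp_gh (dvar
      (.co (.inl (.inl (.inr q)))) rfl)) (Cp.ite ((cp_flagV hw ht k).and
      (Cp.const (e0Idx q.1 = u))) (dvar (.inp 2) rfl) (Cp.zero nb _ .gh (by decide)))
    refine (h.mono (c' := flagCost d c + 30) ?_).congr fun 𝔹 σ => ?_
    · omega
    · simp only [ddhKg, ddhShift]
      congr!
  · have h := Cp.ite (cp_flagV hw ht k) (dvar (.co (.inl (.inl (.inr q)))) rfl) (Cp.zero nb _ .s (by decide))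
    refine h.mono ?_
    omega

theorem cp_ddhV (k u : ℕ) (q : KI d n) : Cp nb (dkd (d := d) (n := n)) .gh (flagCost d 1 + 60)
    fun 𝔹 σ => ddhV k u (fun i => σ (.inp i)) (fun i => σ (.tg i)) (fun i => σ (.id i))
      (fun i => σ (.par i)) (fun i => σ (.co i)) q := by
  have hζ : Cp nb (dkd (d := d) (n := n)) .s 1 fun _ σ => σ (.co (.inr q.2)) := dvar _ rfl
  have hξ : Cp nb (dkd (d := d) (n := n)) .s 1 fun _ σ => σ (.co (.inl (.inr (.inl q.2)))) :=
    dvar _ rfl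
  have hg : ∀ i : Fin 5, i ≠ 0 → Cp nb (dkd (d := d) (n := n)) .gh 1 fun _ σ => σ (.inp i) :=
    fun i hi => dvar _ (by fin_cases i <;> first | exact absurd rfl hi | rfl)
  have hb := Cp.mul (k := .gh) (by decide) (Cp.add (by decide)
    (Cp.mul (by decide) (hg 3 (by decide)) hζ) (cp_gh hξ))
    (dvar (.par (.inr q) : DBN d n) rfl : Cp nb dkd .s 1 _)
  refine ((Cp.ite (cp_flagV (fun i => dvar (.id i) rfl) (fun i => dvar (.tg i) rfl) k)
    (Cp.ite (Cp.const (e0Idx q.1 < u)) (cp_gh (dvar (.co (.inl (.inl (.inl q)))) rfl))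
      (Cp.ite (Cp.const (e0Idx q.1 = u)) (Cp.add (by decide) (Cp.add (by decide)
        (Cp.mul (by decide) (hg 4 (by decide)) hζ) (Cp.mul (by decide) (hg 2 (by decide)) hξ)) hb) hb))
    (Cp.mul (by decide) (dvar (.par (.inl q)) rfl) hξ)).mono (by omega)).congr fun 𝔹 σ => ?_
  simp only [ddhV]
  congr!

def ddhDelCost (d : ℕ) : ℕ :=
  delCost d (flagCost d 1 + 60) + flagCost d (d * 30 + 16) + flagCost d 1 + 40

theorem cp_ddhDel (k u : ℕ) (q : KI d n ⊕ KI d n) :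
    Cp nb (dkd (d := d) (n := n)) (ddhKeyKind q) (ddhDelCost d) fun 𝔹 σ =>
      ddhDel k u (fun i => σ (.inp i)) (fun i => σ (.tg i)) (fun i => σ (.id i))
        (fun i => σ (.par i)) (σ .x) (fun i => σ (.co i)) q := by
  have h1 := cp_lowV (nb := nb) (kd := dkd (d := d) (n := n)) (c := 1)
    (fun i => dvar (.id i) rfl) (fun i => dvar (.tg i) rfl) k
  have h2 := cp_ddhKg (nb := nb) k u (c := d * 30 + 16) (by omega)
    (fun i => (cp_childV_of (c := 1) (fun i => dvar (.id i) rfl) (dvar .x rfl) i).mono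
      (by omega)) q
  have h3 : ∀ q, Cp nb (dkd (d := d) (n := n)) .gh (delCost d (flagCost d 1 + 60)) fun 𝔹 σ =>
      delV (fun i => σ (.id i)) (σ .x) (fun q => σ (.par (.inl q))) (ddhV k u (fun i => σ (.inp i))
        (fun i => σ (.tg i)) (fun i => σ (.id i)) (fun i => σ (.par i)) (fun i => σ (.co i)))
        (fun q => σ (.co (.inl (.inl (.inr q))))) (fun q => σ (.co (.inl (.inr (.inr q))))) q :=
    fun q => cp_delV (k := .gh) (c := flagCost d 1 + 60) (w := fun i _ σ => σ (.id i))
      (x := fun _ σ => σ .x) (e := fun q _ σ => σ (.par (.inl q)))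
      (fr := fun q _ σ => σ (.co (.inl (.inl (.inr q)))))
      (τ := fun q _ σ => σ (.co (.inl (.inr (.inr q)))))
      (fun i => (dvar (.id i) rfl).mono (Nat.le_add_left _ _))
      ((dvar .x rfl).mono (Nat.le_add_left _ _))
      (by decide) (fun q => (dvar (.par (.inl q)) rfl).mono (Nat.le_add_left _ _)) (cp_ddhV k u)
      (fun q => (cp_gh (dvar (.co (.inl (.inl (.inr q)))) rfl)).mono
        ((by norm_num : 1 + 2 ≤ 60).trans (Nat.le_add_left _ _)))
      (fun q => (dvar (.co (.inl (.inr (.inr q)))) rfl).mono (Nat.le_add_left _ _)) q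
  rcases q with q | q
  · refine ((Cp.ite h1 h2 (h3 q)).mono ?_).congr fun 𝔹 σ => ?_
    · simp only [ddhDelCost]; omega
    · rw [ddhDel.eq_def]
  · refine ((Cp.ite h1 h2 (Cp.zero nb _ (ddhKeyKind (.inr q)) nofun)).mono ?_).congr fun 𝔹 σ => ?_
    · simp only [ddhDelCost]; omega
    · rw [ddhDel.eq_def]

theorem cp_worldWire (i : WI d n) : Cp nb (dkd (d := d) (n := n)) .gh (valCost d 1 + 2 * d * 1 + 40)
    fun 𝔹 σ => worldWire (fun i => σ (.ev i)) (fun i => σ (.id i)) (fun q => σ (.par (.inl q))) i := by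
  have h1 := fun r => cp_valOf (nb := nb) (kd := dkd (d := d) (n := n)) (c := 1) (k := .gh)
    (hs := fun i i₂ l _ σ => σ (.ev (.h i i₂ l))) (ws := fun l _ σ => σ (.ev (.w l)))
    (w := fun i _ σ => σ (.id i)) (e := fun q _ σ => σ (.par (.inl q)))
    (fun i i₂ l => dvar (.ev (.h i i₂ l)) rfl) (fun l => dvar (.ev (.w l)) rfl)
    (fun i => dvar (.id i) rfl) (by decide) (fun q => dvar (.par (.inl q)) rfl) r
  have h2 : ∀ q : KI d n, Cp nb (dkd (d := d) (n := n)) .gh (valCost d 1 + 2 * d * 1)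
      fun 𝔹 σ => σ (.ev .v) * σ (.par (.inl q)) := fun q =>
    (Cp.mul' (k := .gh) (by decide) (dvar (.ev .v) rfl) (dvar (.par (.inl q)) rfl)).mono
      (by simp only [valCost]; omega)
  refine (cp_wireOf (c := 1) (w := fun i _ σ => σ (.id i)) (fun i => dvar (.id i) rfl) (by decide)
    h1 h2 i).mono ?_
  omega

def ddhCost (nb d : ℕ) : ℕ := negCost nb + 100 + (flagCost d 1 + 30) + ddhDelCost d +
  (valCost d 1 + 2 * d * 1 + 40)

def ddhSim (nb d n k u : ℕ) (b : Bool) : SimDesc nb d where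
  ni := 5
  ik := ddhKind
  Ev := SI d n
  Kc := KI d n ⊕ KI d n
  Co := DC d n
  MI := MI d n
  WI := WI d n
  kk := ddhKeyKind
  kk_ne := by rintro (q | q) <;> exact nofun
  ml := mpkList d n
  wl := wireList d n
  mpk 𝔹 inp t ev i := mpkVal (if b then n else 0) none t ev i
  kg 𝔹 inp t ev v co q := ddhKg k u t (inp 2) v co q
  del 𝔹 inp t ev v par x co q := ddhDel k u inp t v par x co q
  wire 𝔹 inp t ev v par i := worldWire ev v (fun q => par (.inl q)) i
  cost := ddhCost nb d
  mpk_cp i := (cp_g (cp_mpkVal (c := 1) (fun i => dvar (.ev i) rfl)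
    (fun i => dvar (.tg i) rfl) _ none i)).mono (by simp only [ddhCost]; omega)
  kg_cp q := (cp_ddhKg k u le_rfl (fun i => dvar (.id i) rfl) q).mono
    (by simp only [ddhCost]; omega)
  del_cp q := (cp_ddhDel k u q).mono (by simp only [ddhCost]; omega)
  wire_cp i := (cp_worldWire i).mono (by simp only [ddhCost]; omega)

theorem ddhSim_close {𝔹 : BilinearGroup} {k u k' : ℕ} {ch : Prop} {b : Bool} (A : Adversary)
    {inp : Fin 5 → 𝔹.Zp}
    (hco : ∀ (t v : Fin d → 𝔹.Zp) e, (PMF.uniformOfFintype (DC d n → 𝔹.Zp)).map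
      (ddhCoins k u inp t v (ddhEmbed k u t (inp 2) v e) ch) = PMF.uniformOfFintype (WC d n → 𝔹.Zp))
    (h : ∀ (t v : Fin d → 𝔹.Zp) (e : KI d n → 𝔹.Zp) co q,
      ddhV k u inp t v (ddhEmbed k u t (inp 2) v e) co q =
      (open Classical in if flagV k t v ∧ e0Idx q.1 < k' then
        ddhCoins k u inp t v (ddhEmbed k u t (inp 2) v e) ch co (.inl (.inl q)) else
        ddhCoins k u inp t v (ddhEmbed k u t (inp 2) v e) ch co (.inr (.inl q.2)) * e q)) :
    Close 0 ((ddhSim nb d n k u b).run 𝔹 A inp) (world 𝔹 d n A k k' (if b then n else 0) none) := by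
  refine (gameV_close fun t m => Close.bind_right _ fun ev => Close.of_eq ?_ : Close 0
    (world 𝔹 d n A k k' (if b then n else 0) none) ((ddhSim nb d n k u b).run 𝔹 A inp)).symm
  refine runV_map_fst (ddhEmbed k u t (inp 2)) ?_ ?_ ?_ A.attack _ fun m => (m 0).toBit
  · intro m r
    exact uniform_ddhKg k u t (inp 2) _
  · intro m r e x hx hv
    exact uniform_ddhDel hx (fun _ => hco t _ e) (fun _ => h t _ e)
  · intro v e hp
    rfl

theorem ddhSim_real {𝔹 : BilinearGroup} (k u : ℕ) (b : Bool) (A : Adversary)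
    {inp : Fin 5 → 𝔹.Zp} (h4 : inp 4 = inp 2 * inp 3) :
    Close 0 ((ddhSim nb d n k u b).run 𝔹 A inp) (world 𝔹 d n A k u (if b then n else 0) none) := by
  refine ddhSim_close (ch := False) A (fun t v e => uniform_ddhCoins_of_eq _ _ _ _ _ _)
    fun t v e co q => ?_
  simp only [ddhV, ddhCoins, ddhEmbed, ddhShift, h4]
  by_cases hf : flagV k t v
  · by_cases h1 : e0Idx q.1 < u
    · simp [hf, h1]
    · by_cases h2 : e0Idx q.1 = u
      · simp only [hf, h2, lt_irrefl, and_self, and_false, if_true, if_false]; ring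
      · simp [hf, h1, h2]
  · simp [hf, mul_comm]

theorem ddhSim_random {𝔹 : BilinearGroup} (k : ℕ) {u : ℕ} (hu : u < Fintype.card (E0 d)) (b : Bool)
    (A : Adversary) {inp : Fin 5 → 𝔹.Zp} (h4 : inp 4 ≠ inp 2 * inp 3) :
    Close 0 ((ddhSim nb d n k u b).run 𝔹 A inp)
      (world 𝔹 d n A k (u + 1) (if b then n else 0) none) := by
  refine ddhSim_close (ch := True) A (fun t v e => uniform_ddhCoins_of_ne hu h4 _ _ _ ?_)
    fun t v e co q => ?_
  · intro hf q hq
    simp [ddhEmbed, ddhShift, hf, hq]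
  · by_cases hf : flagV k t v
    · by_cases h1 : e0Idx q.1 < u
      · simp [ddhV, ddhCoins, ddhEmbed, ddhShift, hf, h1, h1.ne, Nat.lt_succ_of_lt h1]
      · by_cases h2 : e0Idx q.1 = u
        · simp [ddhCoins, hf, h2]
        · have h3 : ¬ e0Idx q.1 < u + 1 := by omega
          simp [ddhV, ddhCoins, ddhEmbed, ddhShift, hf, h1, h2, h3]
    · simp [ddhV, ddhCoins, ddhEmbed, ddhShift, hf, mul_comm]

end DDHSim

/-! ## Simulation from a tuple of the bilinear assumption -/

section Linear

variable {𝔹 : BilinearGroup} {d n : ℕ}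

theorem valOf_lin {hs hs₁ hs₂ hs₃ : Fin d → Fin 3 → Fin n → 𝔹.Zp} {ws ws₁ ws₂ ws₃ : Fin n → 𝔹.Zp}
    {l : Fin n} (A B : 𝔹.Zp)
    (h : ∀ i (k : Fin 2), hs i k.succ l = hs₁ i k.succ l + A * hs₂ i k.succ l - B * hs₃ i k.succ l)
    (hw : ws l = ws₁ l + A * ws₂ l - B * ws₃ l) (v : Fin d → 𝔹.Zp) (e : KI d n → 𝔹.Zp)
    (R : Option (Fin d × Fin 2)) :
    valOf hs ws v e (R, l) =
      valOf hs₁ ws₁ v e (R, l) + A * valOf hs₂ ws₂ v e (R, l) - B * valOf hs₃ ws₃ v e (R, l) := by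
  classical
  have h1 : ∀ i, hs i 1 l = hs₁ i 1 l + A * hs₂ i 1 l - B * hs₃ i 1 l := fun i => h i 0
  have h2 : ∀ i, hs i 2 l = hs₁ i 2 l + A * hs₂ i 2 l - B * hs₃ i 2 l := fun i => h i 1
  have hsg : sgTerm hs e l R = sgTerm hs₁ e l R + A * sgTerm hs₂ e l R - B * sgTerm hs₃ e l R := by
    rcases R with _ | ⟨j, k⟩
    · simp [sgTerm]
    · simp only [sgTerm, h]; ring
  have hS : ∀ i, (if v i ≠ 0 then e (.inl (R, some i), l) * (hs i 1 l + v i * hs i 2 l) else 0) =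
      (if v i ≠ 0 then e (.inl (R, some i), l) * (hs₁ i 1 l + v i * hs₁ i 2 l) else 0) +
      A * (if v i ≠ 0 then e (.inl (R, some i), l) * (hs₂ i 1 l + v i * hs₂ i 2 l) else 0) -
      B * (if v i ≠ 0 then e (.inl (R, some i), l) * (hs₃ i 1 l + v i * hs₃ i 2 l) else 0) := by
    intro i
    rw [h1, h2]
    split_ifs <;> ring
  simp only [valOf, hS, hsg, hw, Finset.sum_sub_distrib, Finset.sum_add_distrib, ← Finset.mul_sum]
  ring

theorem valOf_congr {hs hs' : Fin d → Fin 3 → Fin n → 𝔹.Zp} {ws ws' : Fin n → 𝔹.Zp} {l : Fin n}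
    (h : ∀ i (k : Fin 2), hs i k.succ l = hs' i k.succ l) (hw : ws l = ws' l) (v : Fin d → 𝔹.Zp)
    (e : KI d n → 𝔹.Zp) (R : Option (Fin d × Fin 2)) :
    valOf hs ws v e (R, l) = valOf hs' ws' v e (R, l) := by
  rw [valOf_lin (hs₁ := hs') (ws₁ := ws') (hs₂ := hs') (ws₂ := ws') (hs₃ := hs') (ws₃ := ws') 0 0
    (by simpa using h) (by simpa using hw)]
  ring

theorem valOf_add_mul (hs : Fin d → Fin 3 → Fin n → 𝔹.Zp) (ws : Fin n → 𝔹.Zp) (v : Fin d → 𝔹.Zp)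
    (a : 𝔹.Zp) (e e' : KI d n → 𝔹.Zp) (r : RI d n) :
    valOf hs ws v (fun q => e q + a * e' q) r = valOf hs ws v e r + a * valOf hs ws v e' r := by
  classical
  obtain ⟨R, l⟩ := r
  have hsg : sgTerm hs (fun q => e q + a * e' q) l R = sgTerm hs e l R + a * sgTerm hs e' l R := by
    rcases R with _ | ⟨j, k⟩
    · simp [sgTerm]
    · simp only [sgTerm]; ring
  have hS : ∀ i, (if v i ≠ 0 then (e (.inl (R, some i), l) + a * e' (.inl (R, some i), l)) *
        (hs i 1 l + v i * hs i 2 l) else 0) =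
      (if v i ≠ 0 then e (.inl (R, some i), l) * (hs i 1 l + v i * hs i 2 l) else 0) +
      a * (if v i ≠ 0 then e' (.inl (R, some i), l) * (hs i 1 l + v i * hs i 2 l) else 0) := by
    intro i
    split_ifs <;> ring
  simp only [valOf, hS, hsg, Finset.sum_add_distrib, ← Finset.mul_sum]
  ring

end Linear

section PBDH

variable {𝔹 : BilinearGroup} {d n : ℕ} (b : Bool) (l₀ : Fin n)

def chiH (ev : SI d n → 𝔹.Zp) (i : Fin d) (i₂ : Fin 3) (_ : Fin n) : 𝔹.Zp :=
  Fin.cases 0 (fun k => ev (.oc i k)) i₂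

def yH (t : Fin d → 𝔹.Zp) (i : Fin d) (i₂ : Fin 3) (_ : Fin n) : 𝔹.Zp :=
  Fin.cases 0 (fun k => yOf b t i k) i₂

/-- The part of the exponents of `h` that is known to the simulator. -/
def kapH (t : Fin d → 𝔹.Zp) (ev : SI d n → 𝔹.Zp) (i : Fin d) (i₂ : Fin 3) (l : Fin n) : 𝔹.Zp :=
  if l = l₀ then
    Fin.cases (ev (.h i 0 l)) (fun k => ev (.h i k.succ l) - yOf b t i k * ev (.h i 0 l)) i₂
  else ev (.h i i₂ l)

/-- The exponents of `h`. -/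
def trueH (inp : Fin 8 → 𝔹.Zp) (t : Fin d → 𝔹.Zp) (ev : SI d n → 𝔹.Zp) (i : Fin d) (i₂ : Fin 3)
    (l : Fin n) : 𝔹.Zp :=
  if l = l₀ then
    Fin.cases (inp 1 + ev (.h i 0 l))
      (fun k => inp 2 * ev (.oc i k) + ev (.h i k.succ l) - yOf b t i k * (inp 1 + ev (.h i 0 l))) i₂
  else ev (.h i i₂ l)

/-- The exponents of `w`. -/
def trueW (inp : Fin 8 → 𝔹.Zp) (ev : SI d n → 𝔹.Zp) (l : Fin n) : 𝔹.Zp :=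
  if l = l₀ then inp 2 + ev (.w l) else ev (.w l)

def etaV (t v : Fin d → 𝔹.Zp) (i : Fin d) : 𝔹.Zp := yOf b t i 0 + v i * yOf b t i 1

/-- The first component of an identity that can be used for the simulation. -/
def starV (t v : Fin d → 𝔹.Zp) (i : Fin d) : Prop :=
  (v i ≠ 0 ∧ etaV b t v i ≠ 0) ∧ ∀ i' : Fin d, ¬ i' < i ∨ ¬(v i' ≠ 0 ∧ etaV b t v i' ≠ 0)

def uOf (ev : SI d n → 𝔹.Zp) (v : Fin d → 𝔹.Zp) (e : KI d n → 𝔹.Zp)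
    (R : Option (Fin d × Fin 2)) : 𝔹.Zp :=
  valOf (chiH ev) (fun _ => 1) v e (R, l₀)

open Classical in
/-- The coefficients of `a` in the exponents of the key components. -/
def shiftV (t : Fin d → 𝔹.Zp) (ev : SI d n → 𝔹.Zp) (v : Fin d → 𝔹.Zp) (e : KI d n → 𝔹.Zp) :
    KI d n → 𝔹.Zp
  | (.inl (R, some i), l) =>
      if l = l₀ ∧ starV b t v i then uOf l₀ ev v e R * (etaV b t v i)⁻¹ else 0
  | (.inl (R, none), l) =>
      if l = l₀ then -∑ i, if starV b t v i then
        uOf l₀ ev v e R * (etaV b t v i)⁻¹ * (ev (.oc i 0) + v i * ev (.oc i 1)) else 0 else 0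
  | (.inr _, _) => 0

def exV (inp : Fin 8 → 𝔹.Zp) (t : Fin d → 𝔹.Zp) (ev : SI d n → 𝔹.Zp) (v : Fin d → 𝔹.Zp)
    (e : KI d n → 𝔹.Zp) (q : KI d n) : 𝔹.Zp :=
  e q + inp 5 * shiftV b l₀ t ev v e q

def simVal (inp : Fin 8 → 𝔹.Zp) (t : Fin d → 𝔹.Zp) (ev : SI d n → 𝔹.Zp) (v : Fin d → 𝔹.Zp)
    (e : KI d n → 𝔹.Zp) (r : RI d n) : 𝔹.Zp :=
  valOf (kapH b l₀ t ev) (fun l => ev (.w l)) v (exV b l₀ inp t ev v e) r -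
    (if r.2 = l₀ then inp 6 * valOf (yH b t) (fun _ => 0) v e r else 0)

variable {b l₀}

theorem starV_unique {t v : Fin d → 𝔹.Zp} {i j : Fin d} (hi : starV b t v i) (hj : starV b t v j) :
    i = j := by
  rcases lt_trichotomy i j with h | h | h
  · rcases hj.2 i with h' | h'
    · exact absurd h h'
    · exact absurd hi.1 h'
  · exact h
  · rcases hi.2 j with h' | h'
    · exact absurd h h'
    · exact absurd hj.1 h'

theorem exists_starV {t v : Fin d → 𝔹.Zp} (h : ∃ i, v i ≠ 0 ∧ v i ≠ t i) : ∃ i, starV b t v i := by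
  classical
  have h' : ∃ i, v i ≠ 0 ∧ etaV b t v i ≠ 0 := by
    obtain ⟨i, h0, hi⟩ := h
    refine ⟨i, h0, ?_⟩
    by_cases hb : b = true ∧ t i ≠ 0
    · simp only [etaV, yOf, if_pos hb]
      simpa [neg_add_eq_sub, sub_eq_zero] using hi
    · simp [etaV, yOf, if_neg hb]
  let s := Finset.univ.filter fun i => v i ≠ 0 ∧ etaV b t v i ≠ 0
  have hs : s.Nonempty := by
    obtain ⟨i, hi⟩ := h'
    exact ⟨i, Finset.mem_filter.2 ⟨Finset.mem_univ _, hi⟩⟩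
  refine ⟨s.min' hs, (Finset.mem_filter.1 (s.min'_mem hs)).2, fun i' => ?_⟩
  by_cases hi : i' < s.min' hs
  · right
    intro hc
    exact absurd (s.min'_le i' (Finset.mem_filter.2 ⟨Finset.mem_univ _, hc⟩)) (not_le.2 hi)
  · exact .inl hi

theorem valOf_chi_shift (t : Fin d → 𝔹.Zp) (ev : SI d n → 𝔹.Zp) (v : Fin d → 𝔹.Zp)
    (e : KI d n → 𝔹.Zp) (R : Option (Fin d × Fin 2)) :
    valOf (chiH ev) (fun _ => 1) v (shiftV b l₀ t ev v e) (R, l₀) = 0 := by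
  classical
  have hsg : sgTerm (chiH ev) (shiftV b l₀ t ev v e) l₀ R = 0 := by
    rcases R with _ | ⟨j, k⟩ <;> simp [sgTerm, shiftV]
  rw [valOf, hsg]
  simp only [shiftV, if_true, true_and, mul_one, add_zero]
  rw [add_neg_eq_zero]
  refine Finset.sum_congr rfl fun i _ => ?_
  by_cases hi : starV b t v i
  · simp only [if_pos hi, if_pos hi.1.1]
    rfl
  · simp [hi]

theorem valOf_y_shift {t : Fin d → 𝔹.Zp} (ev : SI d n → 𝔹.Zp) {v : Fin d → 𝔹.Zp}
    (hv : ∃ i, starV b t v i) (e : KI d n → 𝔹.Zp) (R : Option (Fin d × Fin 2)) :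
    valOf (yH b t) (fun _ => 0) v (shiftV b l₀ t ev v e) (R, l₀) = uOf l₀ ev v e R := by
  classical
  obtain ⟨m, hm⟩ := hv
  have hsg : sgTerm (yH b t) (shiftV b l₀ t ev v e) l₀ R = 0 := by
    rcases R with _ | ⟨j, k⟩ <;> simp [sgTerm, shiftV]
  rw [valOf, hsg]
  simp only [shiftV, if_true, true_and, mul_zero, add_zero]
  rw [Finset.sum_eq_single m]
  · rw [if_pos hm.1.1, if_pos hm]
    have : yH b t m 1 l₀ + v m * yH b t m 2 l₀ = etaV b t v m := rfl
    rw [this, mul_assoc, inv_mul_cancel₀ hm.1.2, mul_one]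
  · intro i _ hi
    rw [if_neg fun h => hi (starV_unique h hm), zero_mul, ite_self]
  · simp

/-- The simulated components are those of the key with the given exponents. -/
theorem simVal_eq {inp : Fin 8 → 𝔹.Zp} (h2 : inp 2 = inp 5 * inp 1) (h6 : inp 6 = inp 1)
    {t : Fin d → 𝔹.Zp} (ev : SI d n → 𝔹.Zp) {v : Fin d → 𝔹.Zp} (hv : ∃ i, starV b t v i)
    (e : KI d n → 𝔹.Zp) (r : RI d n) :
    simVal b l₀ inp t ev v e r =
      valOf (trueH b l₀ inp t ev) (trueW l₀ inp ev) v (exV b l₀ inp t ev v e) r := by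
  obtain ⟨R, l⟩ := r
  by_cases hl : l = l₀
  · subst hl
    rw [valOf_lin (hs := trueH b l inp t ev) (ws := trueW l inp ev) (hs₁ := kapH b l t ev)
      (ws₁ := fun l => ev (.w l)) (hs₂ := chiH ev) (ws₂ := fun _ => 1) (hs₃ := yH b t)
      (ws₃ := fun _ => 0) (inp 2) (inp 1)]
    · have h3 : valOf (chiH ev) (fun _ => 1) v (exV b l inp t ev v e) (R, l) = uOf l ev v e R := by
        unfold exV
        rw [valOf_add_mul, valOf_chi_shift, mul_zero, add_zero, uOf]
      have h4 : valOf (yH b t) (fun _ => 0) v (exV b l inp t ev v e) (R, l) =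
          valOf (yH b t) (fun _ => 0) v e (R, l) + inp 5 * uOf l ev v e R := by
        unfold exV
        rw [valOf_add_mul, valOf_y_shift ev hv]
      rw [h3, h4, simVal, if_pos rfl, h2, h6]
      ring
    · intro i k
      simp only [trueH, kapH, chiH, yH, if_true, Fin.cases_succ]
      ring
    · simp only [trueW, if_true]
      ring
  · rw [simVal, if_neg hl, sub_zero]
    refine valOf_congr (fun i k => ?_) ?_ _ _ _
    · simp only [trueH, kapH, if_neg hl]
    · simp only [trueW, if_neg hl]

theorem uOf_exV (inp : Fin 8 → 𝔹.Zp) (t : Fin d → 𝔹.Zp) (ev : SI d n → 𝔹.Zp) (v : Fin d → 𝔹.Zp)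
    (e : KI d n → 𝔹.Zp) (R : Option (Fin d × Fin 2)) :
    uOf l₀ ev v (exV b l₀ inp t ev v e) R = uOf l₀ ev v e R := by
  unfold exV
  rw [uOf, valOf_add_mul, valOf_chi_shift, mul_zero, add_zero, uOf]

theorem exV_injective (inp : Fin 8 → 𝔹.Zp) (t : Fin d → 𝔹.Zp) (ev : SI d n → 𝔹.Zp)
    (v : Fin d → 𝔹.Zp) : Function.Injective (exV b l₀ inp t ev v) := by
  intro e e' h
  have hu : uOf l₀ ev v e = uOf l₀ ev v e' := by
    funext R
    rw [← uOf_exV inp t ev v e (b := b), h, uOf_exV]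
  funext q
  have hq := congrFun h q
  have hsh : shiftV b l₀ t ev v e q = shiftV b l₀ t ev v e' q := by
    rcases q with ⟨⟨R, _ | i⟩ | j, l⟩ <;> simp only [shiftV, hu]
  rw [exV, exV, hsh] at hq
  exact add_right_cancel hq

/-! ### Keys -/

variable (b l₀)

def starRow (v : Fin d → 𝔹.Zp) (x : 𝔹.Zp) (par : WI d n → 𝔹.Zp) (l : Fin n) : 𝔹.Zp :=
  open Classical in
  ∑ j, if curV v j then par (.inl (some (j, 0), l)) + x * par (.inl (some (j, 1), l)) else 0

open Classical in
def pbdhKey (inp : Fin 8 → 𝔹.Zp) (t : Fin d → 𝔹.Zp) (ev : SI d n → 𝔹.Zp) (v : Fin d → 𝔹.Zp)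
    (e : KI d n → 𝔹.Zp) : WI d n → 𝔹.Zp
  | .inl r => if ¬pfxV v t ∧ rowAct v r.1 then simVal b l₀ inp t ev v e r else 0
  | .inr q => if ¬pfxV v t then exV b l₀ inp t ev v e q else 0

/-- Keys for prefixes of the target are not simulated. -/
def pbdhEmbed (inp : Fin 8 → 𝔹.Zp) (t : Fin d → 𝔹.Zp) (ev : SI d n → 𝔹.Zp) (v : Fin d → 𝔹.Zp)
    (e : KI d n → 𝔹.Zp) : WI d n → 𝔹.Zp
  | .inl r => open Classical in if ¬pfxV v t ∧ rowAct v r.1 then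
      valOf (trueH b l₀ inp t ev) (trueW l₀ inp ev) v e r else 0
  | .inr q => open Classical in if ¬pfxV v t then e q else 0

open Classical in
def pbdhDel (inp : Fin 8 → 𝔹.Zp) (t : Fin d → 𝔹.Zp) (ev : SI d n → 𝔹.Zp) (v : Fin d → 𝔹.Zp)
    (par : WI d n → 𝔹.Zp) (x : 𝔹.Zp) (co : WC d n → 𝔹.Zp) (i : WI d n) : 𝔹.Zp :=
  if pfxV v t then pbdhKey b l₀ inp t ev (childV v x) (fun q => co (.inl (.inr q))) i
  else match i with
    | .inl (none, l) =>
        par (.inl (none, l)) + co (.inr (.inl l)) * starRow v x par l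
    | .inl (some (j, k), l) =>
        if childV v x j = 0 then co (.inr (.inl l)) * par (.inl (some (j, k), l)) +
          co (.inr (.inr (j, k, l))) * (co (.inr (.inl l)) * starRow v x par l) else 0
    | .inr q => delV v x (fun q => par (.inr q)) (fun q => co (.inr (.inl q.2)) * par (.inr q))
        (fun q => co (.inl (.inr q))) (fun q => co (.inr (.inr q))) q

variable {b l₀}

theorem exists_ne_of_not_pfxV {v t : Fin d → 𝔹.Zp} (h : ¬pfxV v t) : ∃ i, v i ≠ 0 ∧ v i ≠ t i := by
  simpa [pfxV, not_forall] using h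

theorem pbdhKey_eq {inp : Fin 8 → 𝔹.Zp} (h2 : inp 2 = inp 5 * inp 1) (h6 : inp 6 = inp 1)
    (t : Fin d → 𝔹.Zp) (ev : SI d n → 𝔹.Zp) (v : Fin d → 𝔹.Zp) (e : KI d n → 𝔹.Zp) :
    pbdhKey b l₀ inp t ev v e = pbdhEmbed b l₀ inp t ev v (exV b l₀ inp t ev v e) := by
  classical
  funext i
  by_cases hp : pfxV v t
  · rcases i with r | q <;> simp [pbdhKey, pbdhEmbed, hp]
  · have hs := exists_starV (b := b) (exists_ne_of_not_pfxV hp)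
    rcases i with r | q
    · simp only [pbdhKey, pbdhEmbed, simVal_eq h2 h6 ev hs]
    · simp only [pbdhKey, pbdhEmbed]

theorem uniform_pbdhKey {inp : Fin 8 → 𝔹.Zp} (h2 : inp 2 = inp 5 * inp 1) (h6 : inp 6 = inp 1)
    (t : Fin d → 𝔹.Zp) (ev : SI d n → 𝔹.Zp) (v : Fin d → 𝔹.Zp) :
    (PMF.uniformOfFintype (WC d n → 𝔹.Zp)).map
        (fun co => pbdhKey b l₀ inp t ev v fun q => co (.inl (.inr q))) =
      (PMF.uniformOfFintype (KI d n → 𝔹.Zp)).map (pbdhEmbed b l₀ inp t ev v) := by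
  have h1 : Function.Injective fun q : KI d n => (.inl (.inr q) : WC d n) :=
    fun a b h => by simpa using h
  rw [← uniform_map_injective (exV_injective (b := b) (l₀ := l₀) inp t ev v),
    ← uniform_comp_injective (R := 𝔹.Zp) h1, PMF.map_comp, PMF.map_comp]
  congr 1
  funext co
  rw [pbdhKey_eq h2 h6]
  rfl

theorem starRow_of_cur {v : Fin d → 𝔹.Zp} {m : Fin d} (hm : curV v m) (x : 𝔹.Zp)
    (par : WI d n → 𝔹.Zp) (l : Fin n) :
    starRow v x par l = par (.inl (some (m, 0), l)) + x * par (.inl (some (m, 1), l)) := by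
  classical
  rw [starRow, Finset.sum_eq_single m]
  · rw [if_pos hm]
  · exact fun j _ hj => if_neg fun h => hj (curV_unique h hm)
  · simp

theorem uniform_pbdhDel {inp : Fin 8 → 𝔹.Zp} (h2 : inp 2 = inp 5 * inp 1) (h6 : inp 6 = inp 1)
    (t : Fin d → 𝔹.Zp) (ev : SI d n → 𝔹.Zp) {v : Fin d → 𝔹.Zp} (hv : ∃ i, v i = 0)
    (e : KI d n → 𝔹.Zp) {x : 𝔹.Zp} (hx : x ≠ 0) :
    (PMF.uniformOfFintype (WC d n → 𝔹.Zp)).map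
        (pbdhDel b l₀ inp t ev v (pbdhEmbed b l₀ inp t ev v e) x) =
      ((PMF.uniformOfFintype (WC d n → 𝔹.Zp)).map (hybDel d 0 t v e x)).map
        (pbdhEmbed b l₀ inp t ev (childV v x)) := by
  classical
  by_cases hp : pfxV v t
  · have e1 : pbdhDel b l₀ inp t ev v (pbdhEmbed b l₀ inp t ev v e) x = fun co =>
        pbdhKey b l₀ inp t ev (childV v x) fun q => co (.inl (.inr q)) := by
      funext co i
      rw [pbdhDel.eq_def, if_pos hp]
    have e2 : hybDel d 0 t v e x = fun c : WC d n → 𝔹.Zp => c ∘ fun q => .inl (.inr q) := by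
      funext c
      obtain ⟨i, hi⟩ := hv
      rw [hybDel, if_pos ⟨hp, i, i.isLt, hi⟩]
      rfl
    rw [e1, uniform_pbdhKey h2 h6, e2, uniform_comp_injective (fun a b h => by simpa using h)]
  · obtain ⟨m, hm⟩ := exists_curV hv
    have hc : ¬pfxV (childV v x) t := fun h => hp (pfxV_of_child hx h)
    have hrow : ∀ k, rowAct v (some (m, k)) := fun k => hm.1
    rw [PMF.map_comp]
    congr 1
    funext co i
    have e2 : hybDel d 0 t v e x co = delV v x e (fun q => co (.inr (.inl q.2)) * e q)
        (fun q => co (.inl (.inr q))) (fun q => co (.inr (.inr q))) := by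
      rw [hybDel, if_neg fun h => hp h.1]
      congr 1
      funext q
      rw [if_neg fun h => absurd h.2.2 (Nat.not_lt_zero _)]
    simp only [Function.comp, e2]
    rw [pbdhDel.eq_def, if_neg hp]
    rcases i with ⟨_ | ⟨j, k⟩, l⟩ | q
    · simp only [pbdhEmbed, starRow_of_cur hm]
      rw [if_pos (show _ ∧ rowAct v none from ⟨hp, trivial⟩),
        if_pos (show _ ∧ rowAct (childV v x) none from ⟨hc, trivial⟩),
        if_pos (show _ ∧ rowAct v (some (m, 0)) from ⟨hp, hrow 0⟩),
        if_pos (show _ ∧ rowAct v (some (m, 1)) from ⟨hp, hrow 1⟩),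
        valOf_delV_none _ _ hx hm, valStar, valOf_mul _ _ _ fun l => co (.inr (.inl l)),
        valOf_mul _ _ _ fun l => co (.inr (.inl l))]
      ring
    · simp only [pbdhEmbed, starRow_of_cur hm]
      by_cases hj : childV v x j = 0
      · have hj' : v j = 0 := ((childV_eq_zero hx j).1 hj).1
        rw [if_pos hj, if_pos (show _ ∧ rowAct (childV v x) (some (j, k)) from ⟨hc, hj⟩),
          if_pos (show _ ∧ rowAct v (some (j, k)) from ⟨hp, hj'⟩), if_pos ⟨hp, hrow 0⟩,
          if_pos ⟨hp, hrow 1⟩, valOf_delV_some _ _ hx hm _ _ _ _ _ _ hj, valStar,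
          valOf_mul _ _ _ fun l => co (.inr (.inl l)), valOf_mul _ _ _ fun l => co (.inr (.inl l)),
          valOf_mul _ _ _ fun l => co (.inr (.inl l))]
        ring
      · rw [if_neg hj, if_neg fun h => hj h.2]
    · simp only [pbdhEmbed, if_pos hp, if_pos hc, not_false_eq_true, if_true, hp, hc]

end PBDH

section PBDHSim

variable {nb d n : ℕ} (b : Bool) (l₀ : Fin n)

/-- The simulated master public key. -/
def pbdhMpk {𝔹 : BilinearGroup} (inp : Fin 8 → 𝔹.Zp) (t : Fin d → 𝔹.Zp) (ev : SI d n → 𝔹.Zp) :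
    MI d n → 𝔹.Zp
  | .v => ev .v
  | .w l => trueW l₀ inp ev l
  | .h i i₂ l => trueH b l₀ inp t ev i i₂ l
  | .J l => if l = l₀ then inp 3 * ev .v else ev .v * ev (.s l)
  | .Cw l₂ l₁ =>
      if l₂ = l₀ then
        if l₁ = l₀ then inp 7 + inp 3 * ev (.w l₁) else inp 3 * ev (.w l₁)
      else trueW l₀ inp ev l₁ * ev (.s l₂)
  | .C i k l₂ l₁ =>
      if l₂ = l₀ then
        if l₁ = l₀ then inp 7 * ev (.oc i k) + inp 3 * ev (.h i k.succ l₁)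
        else inp 3 * ev (.h i k.succ l₁)
      else (trueH b l₀ inp t ev i 0 l₁ *
        (if l₂ = l₁ then yOf (decide (l₁.val < l₀.val)) t i k else 0) +
          trueH b l₀ inp t ev i k.succ l₁) * ev (.s l₂)

def pbdhKind : Fin 8 → Kind := ![.g, .g, .g, .g, .gh, .gh, .gh, .g]

abbrev PBN (d n : ℕ) : Type := BN 8 d (SI d n) (WI d n) (WC d n)

abbrev pkd : PBN d n → Kind := BN.kind pbdhKind fun _ => .gh

theorem pvar (x : PBN d n) {k : Kind} (h : pkd x = k) : Cp nb pkd k 1 fun _ σ => σ x := Cp.var' x h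

theorem pvg (i : Fin 8) (h : pbdhKind i = .g) :
    Cp nb (pkd (d := d) (n := n)) .g 1 fun _ σ => σ (.inp i) := pvar (.inp i) h

theorem pvgh (i : Fin 8) (h : pbdhKind i = .gh) :
    Cp nb (pkd (d := d) (n := n)) .gh 1 fun _ σ => σ (.inp i) := pvar (.inp i) h

theorem ppar (q : WI d n) : Cp nb (pkd (d := d) (n := n)) .gh 1 fun _ σ => σ (.par q) :=
  pvar (.par q) rfl

theorem cp_trueW (l : Fin n) : Cp nb (pkd (d := d) (n := n)) .g 5 fun 𝔹 σ =>
    trueW l₀ (fun i => σ (.inp i)) (fun i => σ (.ev i)) l := by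
  by_cases hl : l = l₀
  · refine ((Cp.add (by decide) (pvg 2 rfl) (cp_g (pvar (.ev (.w l)) rfl))).mono
      (by omega)).congr fun 𝔹 σ => ?_
    rw [trueW, if_pos hl]
  · refine ((cp_g (pvar (.ev (.w l)) rfl)).mono (by omega)).congr fun 𝔹 σ => ?_
    rw [trueW, if_neg hl]

theorem cp_trueH (i : Fin d) (i₂ : Fin 3) (l : Fin n) :
    Cp nb (pkd (d := d) (n := n)) .g (2 * negCost nb + 60) fun 𝔹 σ =>
      trueH b l₀ (fun i => σ (.inp i)) (fun i => σ (.tg i)) (fun i => σ (.ev i)) i i₂ l := by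
  have h0 := Cp.add (k := .g) (by decide) (pvg (nb := nb) 1 rfl)
    (cp_g (pvar (.ev (.h i 0 l)) rfl))
  by_cases hl : l = l₀
  · induction i₂ using Fin.cases with
    | zero =>
      refine (h0.mono (by omega)).congr fun 𝔹 σ => ?_
      rw [trueH, if_pos hl]
      rfl
    | succ k =>
      refine ((Cp.sub (by decide) (Cp.add (by decide) (Cp.mul (by decide) (pvg 2 rfl)
        (pvar (.ev (.oc i k)) rfl)) (cp_g (pvar (.ev (.h i k.succ l)) rfl)))
        (Cp.mul' (by decide) (cp_yOf (kd := pkd (d := d) (n := n)) (c := 1) (t := fun i _ σ => σ (.tg i)) b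
          (fun i => pvar (.tg i) rfl) i k) h0)).mono (by omega)).congr fun 𝔹 σ => ?_
      rw [trueH, if_pos hl]
      rfl
  · refine ((cp_g (pvar (.ev (.h i i₂ l)) rfl)).mono (by omega)).congr fun 𝔹 σ => ?_
    rw [trueH, if_neg hl]

theorem cp_pbdhMpk (i : MI d n) : Cp nb (pkd (d := d) (n := n)) .g (5 * negCost nb + 200) fun 𝔹 σ =>
    pbdhMpk b l₀ (fun i => σ (.inp i)) (fun i => σ (.tg i)) (fun i => σ (.ev i)) i := by
  rcases i with _ | l | ⟨i, i₂, l⟩ | l | ⟨l₂, l₁⟩ | ⟨i, k, l₂, l₁⟩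
  · exact (cp_g (pvar (.ev .v) rfl)).mono (by omega)
  · exact (cp_trueW l₀ l).mono (by omega)
  · exact (cp_trueH b l₀ i i₂ l).mono (by omega)
  · by_cases hl : l = l₀
    · refine ((Cp.mul (by decide) (pvg 3 rfl) (pvar (.ev .v) rfl)).mono
        (by omega)).congr fun 𝔹 σ => ?_
      rw [pbdhMpk, if_pos hl]
    · refine ((cp_g (Cp.smul (pvar (.ev .v) rfl) (pvar (.ev (.s l)) rfl))).mono
        (by omega)).congr fun 𝔹 σ => ?_
      rw [pbdhMpk, if_neg hl]
  · by_cases h2 : l₂ = l₀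
    · by_cases h1 : l₁ = l₀
      · refine ((Cp.add (by decide) (pvg 7 rfl) (Cp.mul (by decide) (pvg 3 rfl)
          (pvar (.ev (.w l₁)) rfl))).mono (by omega)).congr fun 𝔹 σ => ?_
        rw [pbdhMpk, if_pos h2, if_pos h1]
      · refine ((Cp.mul (by decide) (pvg 3 rfl)
          (pvar (.ev (.w l₁)) rfl)).mono (by omega)).congr fun 𝔹 σ => ?_
        rw [pbdhMpk, if_pos h2, if_neg h1]
    · refine ((Cp.mul (by decide) (cp_trueW l₀ l₁) (pvar (.ev (.s l₂)) rfl)).mono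
        (by omega)).congr fun 𝔹 σ => ?_
      rw [pbdhMpk, if_neg h2]
  · by_cases h2 : l₂ = l₀
    · by_cases h1 : l₁ = l₀
      · refine ((Cp.add (by decide) (Cp.mul (by decide) (pvg 7 rfl)
          (pvar (.ev (.oc i k)) rfl)) (Cp.mul (by decide) (pvg 3 rfl)
          (pvar (.ev (.h i k.succ l₁)) rfl))).mono (by omega)).congr fun 𝔹 σ => ?_
        rw [pbdhMpk, if_pos h2, if_pos h1]
      · refine ((Cp.mul (by decide) (pvg 3 rfl)
          (pvar (.ev (.h i k.succ l₁)) rfl)).mono (by omega)).congr fun 𝔹 σ => ?_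
        rw [pbdhMpk, if_pos h2, if_neg h1]
    · refine ((Cp.mul (by decide) (Cp.add (by decide) (Cp.mul (by decide) (cp_trueH b l₀ i 0 l₁)
        (Cp.ite (Cp.const (l₂ = l₁)) (cp_yOf (kd := pkd (d := d) (n := n)) (c := 1) (t := fun i _ σ => σ (.tg i))
          (decide (l₁.val < l₀.val)) (fun i => pvar (.tg i) rfl) i k)
          (Cp.zero nb _ .s (by decide)))) (cp_trueH b l₀ i k.succ l₁))
        (pvar (.ev (.s l₂)) rfl)).mono (by omega)).congr fun 𝔹 σ => ?_
      rw [pbdhMpk, if_neg h2]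
      congr!

section

variable {ν : Type} {c : ℕ} {kd : ν → Kind} {t v : Fin d → Fn ν} {ev : SI d n → Fn ν}
  {e : KI d n → Fn ν}

theorem cp_chiH (hc : 3 ≤ c) (hev : ∀ i, Cp nb kd .s 1 (ev i)) (i : Fin d) (i₂ : Fin 3) (l : Fin n) :
    Cp nb kd .s c fun 𝔹 σ => chiH (fun i => ev i 𝔹 σ) i i₂ l := by
  induction i₂ using Fin.cases with
  | zero => exact (Cp.zero nb kd .s (by decide)).mono hc
  | succ k => exact (hev (.oc i k)).mono (by omega)

theorem cp_yH (hc : 2 * negCost nb + 60 ≤ c) (ht : ∀ i, Cp nb kd .s 1 (t i)) (i : Fin d) (i₂ : Fin 3)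
    (l : Fin n) : Cp nb kd .s c fun 𝔹 σ => yH b (fun i => t i 𝔹 σ) i i₂ l := by
  induction i₂ using Fin.cases with
  | zero => exact (Cp.zero nb kd .s (by decide)).mono (by omega)
  | succ k => exact (cp_yOf b ht i k).mono (by omega)

theorem cp_kapH (hc : 2 * negCost nb + 60 ≤ c) (ht : ∀ i, Cp nb kd .s 1 (t i))
    (hev : ∀ i, Cp nb kd .s 1 (ev i)) (i : Fin d) (i₂ : Fin 3) (l : Fin n) :
    Cp nb kd .s c fun 𝔹 σ => kapH b l₀ (fun i => t i 𝔹 σ) (fun i => ev i 𝔹 σ) i i₂ l := by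
  by_cases hl : l = l₀
  · induction i₂ using Fin.cases with
    | zero =>
      refine ((hev (.h i 0 l)).mono (by omega)).congr fun 𝔹 σ => ?_
      rw [kapH, if_pos hl]
      rfl
    | succ k =>
      refine ((Cp.sub (by decide) (hev (.h i k.succ l)) (Cp.smul (cp_yOf b ht i k)
        (hev (.h i 0 l)))).mono (by omega)).congr fun 𝔹 σ => ?_
      rw [kapH, if_pos hl]
      rfl
  · refine ((hev (.h i i₂ l)).mono (by omega)).congr fun 𝔹 σ => ?_
    rw [kapH, if_neg hl]

theorem cp_etaV (hc : 2 * negCost nb + 60 ≤ c) (ht : ∀ i, Cp nb kd .s 1 (t i))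
    (hv : ∀ i, Cp nb kd .s c (v i)) (i : Fin d) :
    Cp nb kd .s (2 * c + 30) fun 𝔹 σ => etaV b (fun i => t i 𝔹 σ) (fun i => v i 𝔹 σ) i :=
  (Cp.sadd (cp_yOf b ht i 0) (Cp.smul (hv i) (cp_yOf b ht i 1))).mono (by omega)

def starVCost (d c : ℕ) : ℕ := d * (3 * c + 80) + 3 * c + 80

theorem cp_starV (hc : 2 * negCost nb + 60 ≤ c) (ht : ∀ i, Cp nb kd .s 1 (t i))
    (hv : ∀ i, Cp nb kd .s c (v i)) (i : Fin d) :
    Cp nb kd .bit (starVCost d c) fun 𝔹 σ =>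
      ind (starV b (fun i => t i 𝔹 σ) (fun i => v i 𝔹 σ) i) := by
  have h : ∀ i, Cp nb kd .bit (3 * c + 51) fun 𝔹 σ =>
      ind (v i 𝔹 σ ≠ 0 ∧ etaV b (fun i => t i 𝔹 σ) (fun i => v i 𝔹 σ) i ≠ 0) := fun i =>
    ((Cp.nonzero (by decide) (hv i)).and (Cp.nonzero (by decide) (cp_etaV b hc ht hv i))).mono
      (by omega)
  refine ((h i).and (Cp.forall fun i' : Fin d => (Cp.const (i' < i)).not.or (h i').not)).mono ?_
  simp only [Fintype.card_fin, starVCost]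
  ring_nf
  omega

def uCost (d c : ℕ) : ℕ := valCost d c + 2 * d * c

theorem cp_uOf (hc : 3 ≤ c) (hev : ∀ i, Cp nb kd .s 1 (ev i)) (hv : ∀ i, Cp nb kd .s c (v i))
    (he : ∀ q, Cp nb kd .s 1 (e q)) (R : Option (Fin d × Fin 2)) :
    Cp nb kd .s (uCost d c) fun 𝔹 σ =>
      uOf l₀ (fun i => ev i 𝔹 σ) (fun i => v i 𝔹 σ) (fun q => e q 𝔹 σ) R :=
  cp_valOf (hs := fun i i₂ l 𝔹 σ => chiH (fun i => ev i 𝔹 σ) i i₂ l) (ws := fun _ _ _ => 1)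
    (fun i i₂ l => cp_chiH hc hev i i₂ l)
    (fun _ => ((Cp.lit 1).mono (by omega)).congr fun _ _ => Nat.cast_one) hv
    (by decide) (fun q => (he q).mono (by omega)) (R, l₀)

def shiftCost (d c : ℕ) : ℕ :=
  d * (starVCost d c + uCost d c + 4 * c + 60) + starVCost d c + uCost d c + 4 * c + 100

theorem cp_shiftV (hc : 2 * negCost nb + 60 ≤ c) (ht : ∀ i, Cp nb kd .s 1 (t i))
    (hev : ∀ i, Cp nb kd .s 1 (ev i)) (hv : ∀ i, Cp nb kd .s c (v i))
    (he : ∀ q, Cp nb kd .s 1 (e q)) (q : KI d n) :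
    Cp nb kd .s (shiftCost d c) fun 𝔹 σ => shiftV b l₀ (fun i => t i 𝔹 σ) (fun i => ev i 𝔹 σ)
      (fun i => v i 𝔹 σ) (fun q => e q 𝔹 σ) q := by
  have hu := fun R i => Cp.smul (cp_uOf l₀ (by omega : 3 ≤ c) hev hv he R)
    (Cp.inv (cp_etaV b hc ht hv i))
  rcases q with ⟨⟨R, _ | i⟩ | j, l⟩
  · refine ((Cp.ite (Cp.const (l = l₀)) (Cp.neg (by decide) (Cp.sum (by decide) fun i : Fin d =>
      Cp.ite (cp_starV b hc ht hv i) (Cp.smul (hu R i) (Cp.sadd (hev (.oc i 0))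
        (Cp.smul (hv i) (hev (.oc i 1))))) (Cp.zero nb kd .s (by decide))))
      (Cp.zero nb kd .s (by decide))).mono ?_).congr fun 𝔹 σ => ?_
    · simp only [Fintype.card_fin, shiftCost]
      have : starVCost d c + (uCost d c + (2 * c + 30 + 1) + 1 + (1 + (c + 1 + 1) + 1) + 1) + 3 + 1 + 1
        ≤ starVCost d c + uCost d c + 4 * c + 60 := by omega
      have := Nat.mul_le_mul_left d this
      omega
    · simp only [shiftV]
      congr!
  · refine ((Cp.ite ((Cp.const (l = l₀)).and (cp_starV b hc ht hv i)) (hu R i)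
      (Cp.zero nb kd .s (by decide))).mono ?_).congr fun 𝔹 σ => ?_
    · simp only [shiftCost]; omega
    · simp only [shiftV]
      congr!
  · exact (Cp.zero nb kd .s (by decide)).mono (by simp only [shiftCost]; omega)

end

section

variable {c : ℕ} {v : Fin d → Fn (PBN d n)} {e : KI d n → Fn (PBN d n)}

theorem cp_exV (hc : 2 * negCost nb + 60 ≤ c) (hv : ∀ i, Cp nb pkd .s c (v i))
    (he : ∀ q, Cp nb pkd .s 1 (e q)) (q : KI d n) :
    Cp nb pkd .gh (shiftCost d c + 10) fun 𝔹 σ => exV b l₀ (fun i => σ (.inp i))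
      (fun i => σ (.tg i)) (fun i => σ (.ev i)) (fun i => v i 𝔹 σ) (fun q => e q 𝔹 σ) q := by
  refine (Cp.add (by decide) (cp_gh (he q)) (Cp.mul (by decide) (pvgh 5 rfl)
    (cp_shiftV b l₀ (t := fun i _ σ => σ (.tg i)) (ev := fun i _ σ => σ (.ev i)) hc
      (fun i => pvar (.tg i) rfl) (fun i => pvar (.ev i) rfl) hv he q))).mono ?_
  omega

def simValCost (d c : ℕ) : ℕ := uCost d (shiftCost d c + 10) + uCost d c + c + 10

theorem cp_simVal (hc : 2 * negCost nb + 60 ≤ c) (hv : ∀ i, Cp nb pkd .s c (v i))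
    (he : ∀ q, Cp nb pkd .s 1 (e q)) (r : RI d n) :
    Cp nb pkd .gh (simValCost d c) fun 𝔹 σ => simVal b l₀ (fun i => σ (.inp i))
      (fun i => σ (.tg i)) (fun i => σ (.ev i)) (fun i => v i 𝔹 σ) (fun q => e q 𝔹 σ) r := by
  have hle : c ≤ shiftCost d c + 10 := by simp only [shiftCost]; omega
  have h1 := cp_valOf (nb := nb) (kd := pkd (d := d) (n := n)) (k := .gh)
    (hs := fun i i₂ l 𝔹 σ => kapH b l₀ (fun i => σ (.tg i)) (fun i => σ (.ev i)) i i₂ l)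
    (ws := fun l _ σ => σ (.ev (.w l)))
    (fun i i₂ l => (cp_kapH b l₀ (kd := pkd (d := d) (n := n)) (t := fun i _ σ => σ (.tg i)) (ev := fun i _ σ => σ (.ev i)) hc
      (fun i => pvar (.tg i) rfl) (fun i => pvar (.ev i) rfl) i i₂ l).mono hle)
    (fun l => (pvar (.ev (.w l)) rfl).mono (by omega)) (fun i => (hv i).mono hle) (by decide)
    (cp_exV b l₀ hc hv he) r
  have h2 := cp_valOf (nb := nb) (kd := pkd (d := d) (n := n)) (k := .s)
    (hs := fun i i₂ l 𝔹 σ => yH b (fun i => σ (.tg i)) i i₂ l) (ws := fun l _ _ => 0)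
    (fun i i₂ l => cp_yH b (kd := pkd (d := d) (n := n)) (t := fun i _ σ => σ (.tg i)) hc (fun i => pvar (.tg i) rfl) i i₂ l)
    (fun l => (Cp.zero nb _ .s (by decide)).mono (by omega)) hv (by decide)
    (fun q => (he q).mono (by omega)) r
  by_cases hl : r.2 = l₀
  · refine ((Cp.sub (by decide) h1 (Cp.mul (by decide) (pvgh 6 rfl) h2)).mono ?_).congr
      fun 𝔹 σ => ?_
    · simp only [simValCost, uCost]; omega
    · rw [simVal, if_pos hl]
  · refine (h1.mono ?_).congr fun 𝔹 σ => ?_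
    · simp only [simValCost, uCost]; omega
    · rw [simVal, if_neg hl, sub_zero]

def keyCost (d c : ℕ) : ℕ := simValCost d c + shiftCost d c + d * (3 * c + 19) + c + 50

theorem cp_pbdhKey (hc : 2 * negCost nb + 60 ≤ c) (hv : ∀ i, Cp nb pkd .s c (v i))
    (he : ∀ q, Cp nb pkd .s 1 (e q)) (i : WI d n) :
    Cp nb pkd .gh (keyCost d c) fun 𝔹 σ => pbdhKey b l₀ (fun i => σ (.inp i))
      (fun i => σ (.tg i)) (fun i => σ (.ev i)) (fun i => v i 𝔹 σ) (fun q => e q 𝔹 σ) i := by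
  have hp := (cp_pfxV_of (t := fun i _ σ => σ (.tg i)) hv
    (fun i => (pvar (.tg i) rfl).mono (by omega))).not
  rcases i with r | q
  · refine ((Cp.ite (hp.and (cp_rowAct hv r.1)) (cp_simVal b l₀ hc hv he r)
      (Cp.zero nb _ .gh (by decide))).mono ?_).congr fun 𝔹 σ => ?_
    · simp only [keyCost]; omega
    · simp only [pbdhKey]; congr!
  · refine ((Cp.ite hp (cp_exV b l₀ hc hv he q) (Cp.zero nb _ .gh (by decide))).mono ?_).congr
      fun 𝔹 σ => ?_
    · simp only [keyCost]; omega
    · simp only [pbdhKey]; congr!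

end

def rowCost (d : ℕ) : ℕ := d * (d * 30 + 30) + 3

theorem cp_starRow (l : Fin n) : Cp nb (pkd (d := d) (n := n)) .gh (rowCost d) fun 𝔹 σ =>
    starRow (fun i => σ (.id i)) (σ .x) (fun q => σ (.par q)) l := by
  refine ((Cp.sum (by decide) fun j : Fin d => Cp.ite (cp_curV_of (kd := pkd (d := d) (n := n)) (c := 1) (w := fun i _ σ => σ (.id i))
    (fun i => pvar (.id i) rfl) j) (Cp.add (by decide) (ppar (.inl (some (j, 0), l)))
    (Cp.mul' (by decide) (pvar .x rfl) (ppar (.inl (some (j, 1), l)))))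
    (Cp.zero nb _ .gh (by decide))).mono ?_).congr fun 𝔹 σ => ?_
  · simp only [Fintype.card_fin, rowCost]; ring_nf; omega
  · rw [starRow]

def pbdhDelCost (nb d : ℕ) : ℕ := keyCost d (2 * negCost nb + d * 30 + 80) + delCost d 3 + rowCost d +
  d * 70 + 80

theorem cp_pbdhDel (i : WI d n) : Cp nb (pkd (d := d) (n := n)) .gh (pbdhDelCost nb d) fun 𝔹 σ =>
    pbdhDel b l₀ (fun i => σ (.inp i)) (fun i => σ (.tg i)) (fun i => σ (.ev i)) (fun i => σ (.id i))
      (fun i => σ (.par i)) (σ .x) (fun i => σ (.co i)) i := by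
  have h1 := cp_pfxV_of (nb := nb) (kd := pkd (d := d) (n := n)) (c := 1)
    (w := fun i _ σ => σ (.id i)) (t := fun i _ σ => σ (.tg i))
    (fun i => pvar (.id i) rfl) (fun i => pvar (.tg i) rfl)
  have hch := cp_childV_of (nb := nb) (kd := pkd (d := d) (n := n)) (c := 1)
    (w := fun i _ σ => σ (.id i)) (x := fun _ σ => σ .x) (fun i => pvar (.id i) rfl) (pvar .x rfl)
  have h2 := cp_pbdhKey (nb := nb) b l₀ (c := 2 * negCost nb + d * 30 + 80)
    (v := fun i 𝔹 σ => childV (fun i => σ (.id i)) (σ .x) i)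
    (e := fun q _ σ => σ (.co (.inl (.inr q)))) (by omega) (fun i => (hch i).mono (by omega))
    (fun q => pvar (.co (.inl (.inr q))) rfl) i
  have hz := fun l => Cp.mul' (k := .gh) (by decide) (pvar (nb := nb) (.co (.inr (.inl l)) : PBN d n) rfl)
    (cp_starRow (nb := nb) (d := d) l)
  rcases i with ⟨_ | ⟨j, k⟩, l⟩ | q
  · refine ((Cp.ite h1 h2 (Cp.add (by decide) (ppar (.inl (none, l))) (hz l))).mono
      ?_).congr fun 𝔹 σ => ?_
    · simp only [pbdhDelCost]; omega
    · rw [pbdhDel.eq_def]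
  · refine ((Cp.ite h1 h2 (Cp.ite (Cp.eq_zero (by decide) (hch j)) (Cp.add (by decide)
      (Cp.mul' (by decide) (pvar (.co (.inr (.inl l))) rfl) (ppar (.inl (some (j, k), l))))
      (Cp.mul' (by decide) (pvar (.co (.inr (.inr (j, k, l)))) rfl) (hz l)))
      (Cp.zero nb _ .gh (by decide)))).mono ?_).congr fun 𝔹 σ => ?_
    · simp only [pbdhDelCost]; omega
    · rw [pbdhDel.eq_def]; congr!
  · have h3 := cp_delV (nb := nb) (kd := pkd (d := d) (n := n)) (k := .gh) (c := 3)
      (w := fun i _ σ => σ (.id i))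
      (x := fun _ σ => σ .x) (e := fun q _ σ => σ (.par (.inr q)))
      (V := fun q _ σ => σ (.co (.inr (.inl q.2))) * σ (.par (.inr q)))
      (fr := fun q _ σ => σ (.co (.inl (.inr q)))) (τ := fun q _ σ => σ (.co (.inr (.inr q))))
      (fun i => (pvar (.id i) rfl).mono (by omega)) ((pvar .x rfl).mono (by omega)) (by decide)
      (fun q => (ppar (.inr q)).mono (by omega))
      (fun q => Cp.mul' (by decide) (pvar (.co (.inr (.inl q.2))) rfl) (ppar (.inr q)))
      (fun q => cp_gh (pvar (.co (.inl (.inr q))) rfl))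
      (fun q => (pvar (.co (.inr (.inr q))) rfl).mono (by omega)) q
    refine ((Cp.ite h1 h2 h3).mono ?_).congr fun 𝔹 σ => ?_
    · simp only [pbdhDelCost]; omega
    · rw [pbdhDel.eq_def]

theorem cp_pbdhWire (i : WI d n) : Cp nb (pkd (d := d) (n := n)) .gh 30 fun 𝔹 σ =>
    wireOf (fun i => σ (.id i)) (fun r => σ (.par (.inl r))) (fun q => σ (.ev .v) * σ (.par (.inr q))) i := by
  refine (cp_wireOf (kd := pkd (d := d) (n := n)) (k := .gh) (c := 1) (c' := 3) (w := fun i _ σ => σ (.id i)) (val := fun r _ σ => σ (.par (.inl r)))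
    (ex := fun q _ σ => σ (.ev .v) * σ (.par (.inr q))) (fun i => pvar (.id i) rfl) (by decide)
    (fun r => (ppar (.inl r)).mono (by omega))
    (fun q => Cp.mul' (by decide) (pvar (.ev .v) rfl) (ppar (.inr q))) i).mono ?_
  omega

def pbdhCost (nb d : ℕ) : ℕ := 5 * negCost nb + 200 + keyCost d (2 * negCost nb + 60) + pbdhDelCost nb d

def pbdhSim (nb d n : ℕ) (b : Bool) (l₀ : Fin n) : SimDesc nb d where
  ni := 8
  ik := pbdhKind
  Ev := SI d n
  Kc := WI d n
  Co := WC d n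
  MI := MI d n
  WI := WI d n
  kk := fun _ => .gh
  kk_ne := fun _ => nofun
  ml := mpkList d n
  wl := wireList d n
  mpk 𝔹 inp t ev i := pbdhMpk b l₀ inp t ev i
  kg 𝔹 inp t ev v co q := pbdhKey b l₀ inp t ev v (fun q => co (.inl (.inr q))) q
  del 𝔹 inp t ev v par x co q := pbdhDel b l₀ inp t ev v par x co q
  wire 𝔹 inp t ev v par i := wireOf v (fun r => par (.inl r)) (fun q => ev .v * par (.inr q)) i
  cost := pbdhCost nb d
  mpk_cp i := (cp_pbdhMpk b l₀ i).mono (by simp only [pbdhCost]; omega)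
  kg_cp q := (cp_pbdhKey b l₀ (v := fun i _ σ => σ (.id i)) (e := fun q _ σ => σ (.co (.inl (.inr q))))
    (le_refl _) (fun i => (pvar (.id i) rfl).mono (by omega))
    (fun q => pvar (.co (.inl (.inr q))) rfl) q).mono (by simp only [pbdhCost]; omega)
  del_cp q := (cp_pbdhDel b l₀ q).mono (by simp only [pbdhCost]; omega)
  wire_cp i := (cp_pbdhWire i).mono (by simp only [pbdhCost]; omega)

end PBDHSim

section PBDHClose

variable {𝔹 : BilinearGroup} {nb d n : ℕ} (b : Bool) (l₀ : Fin n)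

/-- The exponents that are implicit in the simulation. -/
def pbdhEv (inp : Fin 8 → 𝔹.Zp) (t : Fin d → 𝔹.Zp) (ev : SI d n → 𝔹.Zp) (w' : 𝔹.Zp)
    (c' : Fin d → Fin 2 → 𝔹.Zp) : SI d n → 𝔹.Zp
  | .v => ev .v
  | .w l => trueW l₀ inp ev l
  | .h i i₂ l => trueH b l₀ inp t ev i i₂ l
  | .s l => if l = l₀ then inp 3 else ev (.s l)
  | .ow => w'
  | .oc i k => c' i k

/-- The tuple of the bilinear assumption. -/
def pbdhInp (a b c z : 𝔹.Zp) : Fin 8 → 𝔹.Zp := ![1, b, a * b, c, 1, a, b, z]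

theorem pbdhInp_one (a b c z : 𝔹.Zp) : pbdhInp a b c z 1 = b := rfl

theorem pbdhInp_two (a b c z : 𝔹.Zp) : pbdhInp a b c z 2 = a * b := rfl

theorem pbdhInp_three (a b c z : 𝔹.Zp) : pbdhInp a b c z 3 = c := rfl

theorem pbdhInp_five (a b c z : 𝔹.Zp) : pbdhInp a b c z 5 = a := rfl

theorem pbdhInp_six (a b c z : 𝔹.Zp) : pbdhInp a b c z 6 = b := rfl

theorem pbdhInp_seven (a b c z : 𝔹.Zp) : pbdhInp a b c z 7 = z := rfl

variable {b l₀}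

theorem pbdhMpk_real {inp : Fin 8 → 𝔹.Zp} (h7 : inp 7 = inp 2 * inp 3) (t : Fin d → 𝔹.Zp)
    (ev : SI d n → 𝔹.Zp) (w' : 𝔹.Zp) (c' : Fin d → Fin 2 → 𝔹.Zp) :
    pbdhMpk b l₀ inp t ev =
      mpkVal (l₀.val + if b then 1 else 0) none t (pbdhEv b l₀ inp t ev w' c') := by
  funext i
  rcases i with _ | l | ⟨i, i₂, l⟩ | l | ⟨l₂, l₁⟩ | ⟨i, k, l₂, l₁⟩
  · rfl
  · rfl
  · rfl
  · simp only [pbdhMpk, mpkVal, pbdhEv]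
    split_ifs
    · ring
    · rfl
  · simp only [pbdhMpk, mpkVal, pbdhEv, reduceCtorEq, false_and, if_false]
    by_cases h2 : l₂ = l₀
    · by_cases h1 : l₁ = l₀
      · simp only [if_pos h2, if_pos h1, trueW, h7]; ring
      · simp only [if_pos h2, if_neg h1, trueW]; ring
    · simp only [if_neg h2]
  · simp only [pbdhMpk, mpkVal, pbdhEv, reduceCtorEq, false_and, if_false]
    by_cases h2 : l₂ = l₀
    · by_cases h1 : l₁ = l₀
      · subst h2
        subst h1
        have hb : decide (l₁.val < l₁.val + if b = true then 1 else 0) = b := by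
          cases b <;> simp
        simp only [if_true, trueH, h7, hb, Fin.cases_zero, Fin.cases_succ]; ring
      · have h3 : l₂ ≠ l₁ := fun h => h1 (h ▸ h2)
        simp only [if_pos h2, if_neg h1, if_neg h3, trueH]; ring
    · simp only [if_neg h2]
      by_cases h3 : l₂ = l₁
      · have h4 : l₁.val ≠ l₀.val := fun h => h2 (h3.trans (Fin.ext h))
        have h5 : decide (l₁.val < l₀.val) = decide (l₁.val < l₀.val + if b = true then 1 else 0) := by
          cases b
          · simp
          · simp only [if_true, decide_eq_decide]; omega
        rw [h5]
      · simp only [if_neg h3]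

theorem pbdhMpk_random (inp : Fin 8 → 𝔹.Zp) (t : Fin d → 𝔹.Zp) (ev : SI d n → 𝔹.Zp) :
    pbdhMpk b l₀ inp t ev = mpkVal l₀.val (some l₀) t (pbdhEv b l₀ inp t ev
      (inp 7 + inp 3 * ev (.w l₀)) fun i k => inp 7 * ev (.oc i k) + inp 3 * ev (.h i k.succ l₀)) := by
  funext i
  rcases i with _ | l | ⟨i, i₂, l⟩ | l | ⟨l₂, l₁⟩ | ⟨i, k, l₂, l₁⟩
  · rfl
  · rfl
  · rfl
  · simp only [pbdhMpk, mpkVal, pbdhEv]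
    split_ifs
    · ring
    · rfl
  · simp only [pbdhMpk, mpkVal, pbdhEv, Option.some.injEq]
    by_cases h2 : l₂ = l₀
    · by_cases h1 : l₁ = l₀
      · subst h2
        subst h1
        simp only [and_self, if_true]
      · rw [if_neg (show ¬(l₀ = l₁ ∧ _) from fun h => h1 h.1.symm)]
        simp only [if_pos h2, if_neg h1, trueW]; ring
    · rw [if_neg (show ¬(l₀ = l₁ ∧ _) from fun h => h2 (h.2.trans h.1.symm))]
      simp only [if_neg h2]
  · simp only [pbdhMpk, mpkVal, pbdhEv, Option.some.injEq]
    by_cases h2 : l₂ = l₀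
    · by_cases h1 : l₁ = l₀
      · subst h2
        subst h1
        simp only [and_self, if_true]
      · have h3 : l₂ ≠ l₁ := fun h => h1 (h ▸ h2)
        rw [if_neg (show ¬(l₀ = l₁ ∧ _) from fun h => h1 h.1.symm)]
        simp only [if_pos h2, if_neg h1, if_neg h3, trueH]; ring
    · rw [if_neg (show ¬(l₀ = l₁ ∧ _) from fun h => h2 (h.2.trans h.1.symm))]
      simp only [if_neg h2]

theorem pbdhSim_run {inp : Fin 8 → 𝔹.Zp} (h2 : inp 2 = inp 5 * inp 1) (h6 : inp 6 = inp 1)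
    (t : Fin d → 𝔹.Zp) (ev : SI d n → 𝔹.Zp) (w' : 𝔹.Zp) (c' : Fin d → Fin 2 → 𝔹.Zp) (cs : List Cmd)
    (m : Mem 𝔹) :
    (runV ((pbdhSim nb d n b l₀).game 𝔹 inp t ev) t cs (m, [])).map (fun st => (st.1 0).toBit) =
      (runV (worldGame d 0 t (pbdhEv b l₀ inp t ev w' c')) t cs (m, [])).map
        fun st => (st.1 0).toBit := by
  refine (runV_map_fst (pbdhEmbed b l₀ inp t ev) ?_ ?_ ?_ cs m fun m => (m 0).toBit).symm
  · intro m r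
    exact uniform_pbdhKey h2 h6 t ev _
  · intro m r e x hx hv
    exact uniform_pbdhDel h2 h6 t ev hv e hx
  · intro v e hp
    have : (fun i => wireOf v (fun r => pbdhEmbed b l₀ inp t ev v e (.inl r))
        (fun q => ev .v * pbdhEmbed b l₀ inp t ev v e (.inr q)) i) =
        worldWire (pbdhEv b l₀ inp t ev w' c') v e := by
      funext i
      rcases i with r | q
      · simp only [wireOf, worldWire, pbdhEmbed]
        by_cases hr : rowAct v r.1
        · rw [if_pos hr, if_pos hr, if_pos ⟨hp, hr⟩]
          rfl
        · rw [if_neg hr, if_neg hr]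
      · simp only [wireOf, worldWire, pbdhEmbed, if_pos hp, pbdhEv]
    have h' := fun i => congrFun this i
    show (wireList d n).map (fun i => emb .gh _) = (wireList d n).map fun i => emb .gh _
    exact List.map_congr_left fun i _ => congrArg (emb .gh) (h' i)

theorem trueH_injective {a a' : Fin 8 → 𝔹.Zp} (h1 : a 1 = a' 1) (h2 : a 2 = a' 2) {t : Fin d → 𝔹.Zp}
    {ev ev' : SI d n → 𝔹.Zp} (h : ∀ i i₂ l, trueH b l₀ a t ev i i₂ l = trueH b l₀ a' t ev' i i₂ l)
    (i : Fin d) :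
    ev (.h i 0 l₀) = ev' (.h i 0 l₀) ∧ (∀ k : Fin 2, a 2 * ev (.oc i k) + ev (.h i k.succ l₀) =
      a 2 * ev' (.oc i k) + ev' (.h i k.succ l₀)) ∧
      ∀ i₂ l, l ≠ l₀ → ev (.h i i₂ l) = ev' (.h i i₂ l) := by
  have h0 : ev (.h i 0 l₀) = ev' (.h i 0 l₀) := by
    have := h i 0 l₀
    simp only [trueH, if_true, Fin.cases_zero, h1] at this
    exact add_left_cancel this
  refine ⟨h0, fun k => ?_, fun i₂ l hl => ?_⟩
  · have := h i k.succ l₀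
    simp only [trueH, if_true, Fin.cases_succ, h0, h1, ← h2] at this
    exact sub_left_inj.1 this
  · have := h i i₂ l
    simpa only [trueH, if_neg hl] using this

theorem ev_ext {ev ev' : SI d n → 𝔹.Zp} (hv : ev .v = ev' .v) (hw : ∀ l, ev (.w l) = ev' (.w l))
    (h0 : ∀ i, ev (.h i 0 l₀) = ev' (.h i 0 l₀))
    (hk : ∀ i (k : Fin 2), ev (.h i k.succ l₀) = ev' (.h i k.succ l₀))
    (hl : ∀ i i₂ l, l ≠ l₀ → ev (.h i i₂ l) = ev' (.h i i₂ l)) (hs : ∀ l, ev (.s l) = ev' (.s l))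
    (how : ev .ow = ev' .ow) (hoc : ∀ i k, ev (.oc i k) = ev' (.oc i k)) : ev = ev' := by
  funext q
  rcases q with _ | l | ⟨i, i₂, l⟩ | l | _ | ⟨i, k⟩
  · exact hv
  · exact hw l
  · by_cases h : l = l₀
    · subst h
      induction i₂ using Fin.cases with
      | zero => exact h0 i
      | succ k => exact hk i k
    · exact hl i i₂ l h
  · exact hs l
  · exact how
  · exact hoc i k

theorem trueW_cancel {a a' : Fin 8 → 𝔹.Zp} (h2 : a 2 = a' 2) {ev ev' : SI d n → 𝔹.Zp} {l : Fin n}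
    (h : trueW l₀ a ev l = trueW l₀ a' ev' l) : ev (.w l) = ev' (.w l) := by
  simp only [trueW, h2] at h
  split_ifs at h
  · exact add_left_cancel h
  · exact h

theorem uniform_pbdhEv_real (a y : 𝔹.Zp) (t : Fin d → 𝔹.Zp) :
    (PMF.uniformOfFintype (𝔹.Zp × (SI d n → 𝔹.Zp))).map (fun c =>
      pbdhEv b l₀ (pbdhInp a y c.1 (a * y * c.1)) t c.2 (c.2 .ow) fun i k => c.2 (.oc i k)) =
      PMF.uniformOfFintype (SI d n → 𝔹.Zp) := by
  refine uniform_map_of_injective_prod (C := 𝔹.Zp) (h := fun c => c.2 (.s l₀)) ?_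
    (by rw [Fintype.card_prod, mul_comm])
  rintro ⟨c, ev⟩ ⟨c', ev'⟩ h
  simp only [Prod.mk.injEq] at h
  obtain ⟨h, hs⟩ := h
  have hq := fun q => congrFun h q
  have hc : c = c' := by
    have := hq (.s l₀)
    simpa only [pbdhEv, if_true, pbdhInp_three] using this
  have hh := trueH_injective (b := b) (l₀ := l₀) (a := pbdhInp a y c (a * y * c))
    (a' := pbdhInp a y c' (a * y * c')) (by simp only [pbdhInp_one])
    (by simp only [pbdhInp_two]) fun i i₂ l => hq (.h i i₂ l)
  have hoc : ∀ i k, ev (.oc i k) = ev' (.oc i k) := fun i k => hq (.oc i k)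
  refine Prod.ext hc (ev_ext (l₀ := l₀) (hq .v) (fun l => ?_) (fun i => (hh i).1) (fun i k => ?_)
    (fun i => (hh i).2.2) (fun l => ?_) (hq .ow) hoc)
  · exact trueW_cancel (l₀ := l₀) (a := pbdhInp a y c (a * y * c))
      (a' := pbdhInp a y c' (a * y * c')) (by simp only [pbdhInp_two]) (hq (.w l))
  · have := (hh i).2.1 k
    rw [hoc, pbdhInp_two] at this
    exact add_left_cancel this
  · by_cases hl : l = l₀
    · rw [hl]; exact hs
    · have := hq (.s l)
      simpa only [pbdhEv, if_neg hl] using this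

theorem uniform_pbdhEv_random (a y : 𝔹.Zp) (t : Fin d → 𝔹.Zp) :
    (PMF.uniformOfFintype ((𝔹.Zp × 𝔹.Zp) × (SI d n → 𝔹.Zp))).map (fun c =>
      pbdhEv b l₀ (pbdhInp a y c.1.1 c.1.2) t c.2 (c.1.2 + c.1.1 * c.2 (.w l₀)) fun i k =>
        (if c.1.2 - a * y * c.1.1 = 0 then 1 else c.1.2 - a * y * c.1.1) * c.2 (.oc i k) +
          c.1.1 * (a * y * c.2 (.oc i k) + c.2 (.h i k.succ l₀))) =
      PMF.uniformOfFintype (SI d n → 𝔹.Zp) := by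
  refine uniform_map_of_injective_prod (C := 𝔹.Zp × 𝔹.Zp) (h := fun c => (c.2 (.s l₀), c.2 .ow)) ?_
    (by rw [Fintype.card_prod, mul_comm])
  rintro ⟨⟨c, z⟩, ev⟩ ⟨⟨c', z'⟩, ev'⟩ h
  simp only [Prod.mk.injEq] at h
  obtain ⟨h, hs, how⟩ := h
  have hq := fun q => congrFun h q
  have hc : c = c' := by
    have := hq (.s l₀)
    simpa only [pbdhEv, if_true, pbdhInp_three] using this
  subst hc
  have hw : ∀ l, ev (.w l) = ev' (.w l) := fun l =>
    trueW_cancel (l₀ := l₀) (a := pbdhInp a y c z) (a' := pbdhInp a y c z')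
      (by simp only [pbdhInp_two]) (hq (.w l))
  have hz : z = z' := by
    have := hq .ow
    simp only [pbdhEv, hw] at this
    exact add_right_cancel this
  subst hz
  have hh := trueH_injective (b := b) (l₀ := l₀) (a := pbdhInp a y c z)
    (a' := pbdhInp a y c z) (by simp only [pbdhInp_one])
    (by simp only [pbdhInp_two]) fun i i₂ l => hq (.h i i₂ l)
  have h2 : ∀ i (k : Fin 2), a * y * ev (.oc i k) + ev (.h i k.succ l₀) =
      a * y * ev' (.oc i k) + ev' (.h i k.succ l₀) := fun i k => by
    simpa only [pbdhInp_two] using (hh i).2.1 k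
  have hoc : ∀ i k, ev (.oc i k) = ev' (.oc i k) := fun i k => by
    have := hq (.oc i k)
    simp only [pbdhEv, h2] at this
    have := add_right_cancel this
    refine mul_left_cancel₀ ?_ this
    split_ifs with h0
    · exact one_ne_zero
    · exact h0
  refine Prod.ext rfl (ev_ext (l₀ := l₀) (hq .v) hw (fun i => (hh i).1) (fun i k => ?_)
    (fun i => (hh i).2.2) (fun l => ?_) how hoc)
  · have := h2 i k
    rw [hoc] at this
    exact add_left_cancel this
  · by_cases hl : l = l₀
    · rw [hl]; exact hs
    · have := hq (.s l)
      simpa only [pbdhEv, if_neg hl] using this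

/-- Output bit of an adversary against the game with given exponents. -/
def worldAt (A : Adversary) (k u j : ℕ) (ov : Option (Fin n)) (t : Fin d → 𝔹.Zp) (m : Mem 𝔹)
    (ev : SI d n → 𝔹.Zp) : PMF Bool :=
  (runV (worldGame k u t ev) t A.attack
    (m.write 0 ((mpkList d n).map fun i => emb .g (mpkVal j ov t ev i)), [])).map
      fun st => (st.1 0).toBit

theorem pbdhSim_at {inp : Fin 8 → 𝔹.Zp} (h2 : inp 2 = inp 5 * inp 1) (h6 : inp 6 = inp 1)
    {A : Adversary} {t : Fin d → 𝔹.Zp} {m : Mem 𝔹} {ev : SI d n → 𝔹.Zp} {w' : 𝔹.Zp}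
    {c' : Fin d → Fin 2 → 𝔹.Zp} {j : ℕ} {ov : Option (Fin n)}
    (h : pbdhMpk b l₀ inp t ev = mpkVal j ov t (pbdhEv b l₀ inp t ev w' c')) :
    (runV ((pbdhSim nb d n b l₀).game 𝔹 inp t ev) t A.attack (m.write 0
      ((mpkList d n).map fun i => emb .g (pbdhMpk b l₀ inp t ev i)), [])).map
        (fun st => (st.1 0).toBit) =
      worldAt A d 0 j ov t m (pbdhEv b l₀ inp t ev w' c') := by
  rw [pbdhSim_run h2 h6 t ev w' c', worldAt, h]

theorem bind_run_eq {I : Type} [Fintype I] [Nonempty I] (A : Adversary) (f : I → Fin 8 → 𝔹.Zp) :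
    ((PMF.uniformOfFintype I).bind fun c => (pbdhSim nb d n b l₀).run 𝔹 A (f c)) =
      (runInstrs A.choose (Mem.empty 𝔹)).bind fun m =>
        (PMF.uniformOfFintype (I × (SI d n → 𝔹.Zp))).bind fun c =>
          (runV ((pbdhSim nb d n b l₀).game 𝔹 (f c.1) (tgtOf (readV d m 0)) c.2)
            (tgtOf (readV d m 0)) A.attack (m.write 0 ((mpkList d n).map fun i =>
              emb .g (pbdhMpk b l₀ (f c.1) (tgtOf (readV d m 0)) c.2 i)), [])).map
                fun st => (st.1 0).toBit := by
  have h : ∀ c, (pbdhSim nb d n b l₀).run 𝔹 A (f c) = (runInstrs A.choose (Mem.empty 𝔹)).bind fun m =>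
      (PMF.uniformOfFintype (SI d n → 𝔹.Zp)).bind fun ev =>
          (runV ((pbdhSim nb d n b l₀).game 𝔹 (f c) (tgtOf (readV d m 0)) ev)
            (tgtOf (readV d m 0)) A.attack (m.write 0 ((mpkList d n).map fun i =>
              emb .g (pbdhMpk b l₀ (f c) (tgtOf (readV d m 0)) ev i)), [])).map
                fun st => (st.1 0).toBit := fun c => rfl
  simp only [h]
  rw [PMF.bind_comm]
  congr 1
  funext m
  rw [uniform_prod_bind]

theorem pbdhSim_real (A : Adversary) (a y : 𝔹.Zp) :
    ((PMF.uniformOfFintype 𝔹.Zp).bind fun c =>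
      (pbdhSim nb d n b l₀).run 𝔹 A (pbdhInp a y c (a * y * c))) =
      world 𝔹 d n A d 0 (l₀.val + if b then 1 else 0) none := by
  rw [bind_run_eq]
  show _ = PMF.bind _ _
  congr 1
  funext m
  rw [← uniform_pbdhEv_real (b := b) (l₀ := l₀) a y, PMF.map, PMF.bind_bind]
  congr 1
  funext c
  rw [Function.comp, PMF.pure_bind]
  refine pbdhSim_at ?_ ?_ (pbdhMpk_real ?_ _ _ _ _)
  · rw [pbdhInp_two, pbdhInp_five, pbdhInp_one]
  · rw [pbdhInp_six, pbdhInp_one]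
  · rw [pbdhInp_two, pbdhInp_seven, pbdhInp_three]

theorem pbdhSim_random (A : Adversary) (a y : 𝔹.Zp) :
    Close ((1 : ℝ) / 𝔹.p) ((PMF.uniformOfFintype (𝔹.Zp × 𝔹.Zp)).bind fun c =>
      (pbdhSim nb d n b l₀).run 𝔹 A (pbdhInp a y c.1 c.2))
      (world 𝔹 d n A d 0 l₀.val (some l₀)) := by
  rw [bind_run_eq]
  refine Close.bind_right _ fun m => ?_
  have h1 := close_of_eq_of_ne_zero (α := (𝔹.Zp × 𝔹.Zp) × (SI d n → 𝔹.Zp)) (ι := Fin 1) (𝔹 := 𝔹)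
    (fun _ c => c.1.2 - a * y * c.1.1) (fun _ => ?_)
    (F := fun c => (runV ((pbdhSim nb d n b l₀).game 𝔹 (pbdhInp a y c.1.1 c.1.2)
      (tgtOf (readV d m 0)) c.2) (tgtOf (readV d m 0)) A.attack (m.write 0 ((mpkList d n).map fun i =>
        emb .g (pbdhMpk b l₀ (pbdhInp a y c.1.1 c.1.2) (tgtOf (readV d m 0)) c.2 i)), [])).map
          fun st => (st.1 0).toBit)
    (G := fun c => worldAt A d 0 l₀.val (some l₀) (tgtOf (readV d m 0)) m
      (pbdhEv b l₀ (pbdhInp a y c.1.1 c.1.2) (tgtOf (readV d m 0)) c.2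
        (c.1.2 + c.1.1 * c.2 (.w l₀)) fun i k =>
        (if c.1.2 - a * y * c.1.1 = 0 then 1 else c.1.2 - a * y * c.1.1) * c.2 (.oc i k) +
          c.1.1 * (a * y * c.2 (.oc i k) + c.2 (.h i k.succ l₀)))) ?_
  · rw [Fintype.card_fin, Nat.cast_one] at h1
    have h2 := uniform_pbdhEv_random (d := d) (b := b) (l₀ := l₀) a y (tgtOf (readV d m 0))
    rw [← h2, PMF.map, PMF.bind_bind]
    simp only [Function.comp, PMF.pure_bind]
    exact h1
  · refine uniform_map_of_injective_prod (C := 𝔹.Zp × (SI d n → 𝔹.Zp))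
      (h := fun c => (c.1.1, c.2)) ?_ ?_
    · rintro ⟨⟨c, z⟩, ev⟩ ⟨⟨c', z'⟩, ev'⟩ h
      simp only [Prod.mk.injEq] at h
      obtain ⟨h, rfl, rfl⟩ := h
      rw [sub_left_inj.1 h]
    · simp only [Fintype.card_prod]; ring
  · intro c hc
    have h0 : ¬(c.1.2 - a * y * c.1.1 = 0) := hc 0
    have h2 : pbdhInp a y c.1.1 c.1.2 2 = pbdhInp a y c.1.1 c.1.2 5 * pbdhInp a y c.1.1 c.1.2 1 := by
      rw [pbdhInp_two, pbdhInp_five, pbdhInp_one]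
    have h6 : pbdhInp a y c.1.1 c.1.2 6 = pbdhInp a y c.1.1 c.1.2 1 := by
      rw [pbdhInp_six, pbdhInp_one]
    have h3 := pbdhSim_at (nb := nb) (A := A) (m := m) h2 h6
      (pbdhMpk_random (b := b) (l₀ := l₀) (pbdhInp a y c.1.1 c.1.2) (tgtOf (readV d m 0)) c.2)
    refine h3.trans ?_
    congr 2
    funext i k
    rw [pbdhInp_seven, pbdhInp_three, if_neg h0]
    ring

end PBDHClose

/-! ## Identities as lists and as vectors -/

section Identities

variable {𝔹 : BilinearGroup} {d : ℕ}

/-- The vector of an identity. -/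
def idv (d : ℕ) (id : List 𝔹.Zpu) : Fin d → 𝔹.Zp := fun i =>
  match id[i.val]? with
  | some x => (x : 𝔹.Zp)
  | none => 0

theorem idv_of_lt {id : List 𝔹.Zpu} {i : Fin d} (h : i.val < id.length) :
    idv d id i = (id[i.val] : 𝔹.Zp) := by
  simp [idv, List.getElem?_eq_getElem h]

theorem idv_of_ge {id : List 𝔹.Zpu} {i : Fin d} (h : id.length ≤ i.val) : idv d id i = 0 := by
  simp [idv, List.getElem?_eq_none h]

theorem idv_ne_zero {id : List 𝔹.Zpu} {i : Fin d} : idv d id i ≠ 0 ↔ i.val < id.length := by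
  constructor
  · intro h
    by_contra h'
    exact h (idv_of_ge (not_lt.1 h'))
  · intro h
    rw [idv_of_lt h]
    exact Units.ne_zero _

theorem idv_eq_zero {id : List 𝔹.Zpu} {i : Fin d} : idv d id i = 0 ↔ id.length ≤ i.val := by
  rw [← not_iff_not, ← ne_eq, idv_ne_zero, not_le]

theorem idv_injective {id id' : List 𝔹.Zpu} (h : id.length ≤ d) (h' : id'.length ≤ d)
    (he : idv d id = idv d id') : id = id' := by
  have hlen : ∀ i : Fin d, i.val < id.length ↔ i.val < id'.length := fun i => by
    rw [← idv_ne_zero, he, idv_ne_zero]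
  have hl : id.length = id'.length := by
    by_contra hne
    rcases lt_or_gt_of_ne hne with hlt | hlt
    · have := (hlen ⟨id.length, by omega⟩).2 hlt
      exact lt_irrefl _ this
    · have := (hlen ⟨id'.length, by omega⟩).1 hlt
      exact lt_irrefl _ this
  refine List.ext_getElem hl fun i h1 h2 => ?_
  have := congrFun he ⟨i, by omega⟩
  rw [idv_of_lt (i := ⟨i, by omega⟩) h1, idv_of_lt (i := ⟨i, by omega⟩) h2] at this
  exact Units.ext this

theorem exists_idv_ne_zero {id : List 𝔹.Zpu} (hd : 1 ≤ d) : (∃ i : Fin d, idv d id i ≠ 0) ↔ id ≠ [] := by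
  constructor
  · rintro ⟨i, hi⟩ rfl
    exact hi (idv_of_ge (Nat.zero_le _))
  · intro h
    exact ⟨⟨0, hd⟩, idv_ne_zero.2 (List.length_pos_iff.2 h)⟩

theorem exists_idv_eq_zero {id : List 𝔹.Zpu} : (∃ i : Fin d, idv d id i = 0) ↔ id.length < d := by
  constructor
  · rintro ⟨i, hi⟩
    exact (idv_eq_zero.1 hi).trans_lt i.isLt
  · intro h
    exact ⟨⟨id.length, h⟩, idv_of_ge le_rfl⟩

theorem curV_idv {id : List 𝔹.Zpu} (h : id.length < d) : curV (idv d id) ⟨id.length, h⟩ :=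
  ⟨idv_of_ge le_rfl, fun i' hi' => idv_ne_zero.2 hi'⟩

theorem idv_append {id : List 𝔹.Zpu} (h : id.length < d) (x : 𝔹.Zpu) :
    idv d (id ++ [x]) = childV (idv d id) x := by
  funext i
  by_cases hi : i = ⟨id.length, h⟩
  · subst hi
    rw [childV_of_cur (curV_idv h), idv_of_lt (by simp)]
    simp
  · rw [childV_of_ne (curV_idv h) _ hi]
    have hne : i.val ≠ id.length := fun h' => hi (Fin.ext h')
    simp only [idv]
    by_cases hlt : i.val < id.length
    · rw [List.getElem?_append_left hlt]
    · rw [List.getElem?_eq_none (by simp; omega), List.getElem?_eq_none (by omega)]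

theorem prefix_iff_pfxV {id t : List 𝔹.Zpu} (h : id.length ≤ d) :
    id <+: t ↔ pfxV (idv d id) (idv d t) := by
  rw [List.prefix_iff_getElem]
  constructor
  · rintro ⟨hl, hq⟩ i
    by_cases hi : i.val < id.length
    · right
      rw [idv_of_lt hi, idv_of_lt (hi.trans_le hl), hq i.val hi]
    · exact .inl (idv_of_ge (not_lt.1 hi))
  · intro hp
    have key : ∀ i (hi : i < id.length), ∃ h : i < t.length, id[i] = t[i] := by
      intro i hi
      rcases hp ⟨i, by omega⟩ with h0 | h0
      · exact absurd h0 (idv_ne_zero.2 hi)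
      · have hne : idv d t ⟨i, by omega⟩ ≠ 0 := h0 ▸ idv_ne_zero.2 hi
        have hlt : i < t.length := idv_ne_zero.1 hne
        refine ⟨hlt, Units.ext ?_⟩
        rwa [idv_of_lt (i := ⟨i, by omega⟩) hi, idv_of_lt (i := ⟨i, by omega⟩) hlt] at h0
    have hl : id.length ≤ t.length := by
      by_contra hlt
      obtain ⟨h, -⟩ := key t.length (by omega)
      exact lt_irrefl _ h
    exact ⟨hl, fun i hi => (key i hi).2⟩

theorem getElem?_takeWhile_reduceOption {α : Type} (L : List (Option α)) (i : ℕ) (a : α) :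
    ((L.takeWhile Option.isSome).reduceOption)[i]? = some a ↔
      (∀ i' ≤ i, ∃ b, L[i']? = some (some b)) ∧ L[i]? = some (some a) := by
  induction L generalizing i with
  | nil => simp
  | cons x L ih =>
    rcases x with _ | x
    · simp only [List.takeWhile_cons, Option.isSome_none, List.reduceOption_nil, List.getElem?_nil]
      constructor
      · exact nofun
      · rintro ⟨h, -⟩
        obtain ⟨b, hb⟩ := h 0 (Nat.zero_le _)
        simp at hb
    · simp only [List.takeWhile_cons, Option.isSome_some, if_true, List.reduceOption_cons_of_some]
      rcases i with _ | i
      · simp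
      · rw [List.getElem?_cons_succ, ih, List.getElem?_cons_succ]
        refine and_congr_left fun _ => ⟨fun h i' hi' => ?_, fun h i' hi' => ?_⟩
        · rcases i' with _ | i'
          · exact ⟨x, by simp⟩
          · exact h i' (by omega)
        · exact h (i' + 1) (by omega)

theorem readUnit_eq_some {w : Val 𝔹} {x : 𝔹.Zpu} : readUnit w = some x ↔ w.toScalar = x := by
  rcases w with b | y | y | y | y
  · simp [readUnit, Val.toScalar, eq_comm]
  · simp only [readUnit, Val.toScalar]
    by_cases hy : y ≠ 0
    · rw [dif_pos hy, Option.some.injEq, Units.ext_iff, Units.val_mk0]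
    · rw [dif_neg hy]
      simp only [reduceCtorEq, false_iff]
      rw [not_not.1 hy]
      exact fun h => Units.ne_zero x h.symm
  · simp [readUnit, Val.toScalar, eq_comm]
  · simp [readUnit, Val.toScalar, eq_comm]
  · simp [readUnit, Val.toScalar, eq_comm]

theorem exists_readUnit {w : Val 𝔹} : (∃ x, readUnit w = some x) ↔ w.toScalar ≠ 0 := by
  constructor
  · rintro ⟨x, hx⟩
    rw [readUnit_eq_some.1 hx]
    exact Units.ne_zero x
  · exact fun h => ⟨Units.mk0 _ h, readUnit_eq_some.2 rfl⟩

variable {n : ℕ}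

theorem idv_readId (m : Mem 𝔹) (base : ℕ) :
    idv d ((selHF d n 𝔹).readId m base) = readV d m base := by
  funext i
  have key := fun a => getElem?_takeWhile_reduceOption
    ((List.range d).map fun i => readUnit (m (base + i))) i.val a
  have hget : ∀ i', i' ≤ i.val → ((List.range d).map fun i => readUnit (m (base + i)))[i']? =
      some (readUnit (m (base + i'))) := fun i' hi' => by
    rw [List.getElem?_map, List.getElem?_range (by omega)]
    rfl
  have hall : (∀ i' ≤ i.val, ∃ b, ((List.range d).map fun i => readUnit (m (base + i)))[i']? =
      some (some b)) ↔ ∀ i' ≤ i, (m (base + i'.val)).toScalar ≠ 0 := by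
    constructor
    · intro h i' hi'
      obtain ⟨b, hb⟩ := h i'.val hi'
      rw [hget _ hi', Option.some.injEq] at hb
      exact exists_readUnit.1 ⟨b, hb⟩
    · intro h i' hi'
      obtain ⟨b, hb⟩ := exists_readUnit.2 (h ⟨i', by omega⟩ hi')
      exact ⟨b, by rw [hget _ hi', hb]⟩
  rw [hall, hget _ le_rfl] at key
  simp only [Option.some.injEq, readUnit_eq_some] at key
  have hid : ((selHF d n 𝔹).readId m base) = (((List.range d).map fun i =>
    readUnit (m (base + i))).takeWhile Option.isSome).reduceOption := rfl
  rw [readV]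
  split_ifs with hc
  · obtain ⟨b, hb⟩ := exists_readUnit.2 (hc i le_rfl)
    have hb' := readUnit_eq_some.1 hb
    have := (key b).2 ⟨hc, hb'⟩
    simp only [idv, hid, this, hb']
  · simp only [idv, hid]
    split
    · next x hx => exact absurd ((key x).1 hx).1 hc
    · rfl

theorem length_readId (m : Mem 𝔹) (base : ℕ) : ((selHF d n 𝔹).readId m base).length ≤ d := by
  refine (List.reduceOption_length_le _).trans ?_
  refine (List.IsPrefix.length_le (List.takeWhile_prefix _)).trans ?_
  simp

theorem length_readTarget (hd : 1 ≤ d) (m : Mem 𝔹) :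
    ((selHF d n 𝔹).readTarget m 0).length ≤ d := by
  unfold HIBTDF.readTarget
  split
  · simpa using hd
  · exact length_readId m 0

theorem idv_readTarget (hd : 1 ≤ d) (m : Mem 𝔹) :
    idv d ((selHF d n 𝔹).readTarget m 0) = tgtOf (readV d m 0) := by
  rw [tgtOf, ← idv_readId (n := n)]
  unfold HIBTDF.readTarget
  split
  · next h =>
    rw [h, if_neg (fun h' => ((exists_idv_ne_zero hd).1 h') rfl)]
    funext i
    by_cases hi : i.val = 0
    · rw [if_pos hi, idv_of_lt (by simp [hi])]
      simp [hi]
    · rw [if_neg hi, idv_of_ge (by simp; omega)]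
  · next h =>
    rw [if_pos ((exists_idv_ne_zero hd).2 h)]

end Identities

/-! ## The experiments with identities as vectors -/

section Experiments

variable {𝔹 : BilinearGroup} {d n : ℕ}

def vState (st : GameState (selHF d n 𝔹)) : VState 𝔹 d (PrivateKey 𝔹 d 2 n) :=
  (st.mem, st.keys.map fun e => (idv d e.1, e.2))

open Classical in
/-- The identity with a given vector. -/
def ofV (v : Fin d → 𝔹.Zp) : List 𝔹.Zpu :=
  if h : ∃ id : List 𝔹.Zpu, id.length ≤ d ∧ idv d id = v then h.choose else []

theorem ofV_idv {id : List 𝔹.Zpu} (h : id.length ≤ d) : ofV (idv d id) = id := by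
  have h' : ∃ id' : List 𝔹.Zpu, id'.length ≤ d ∧ idv d id' = idv d id := ⟨id, h, rfl⟩
  rw [ofV, dif_pos h']
  exact idv_injective h'.choose_spec.1 h h'.choose_spec.2

open Classical in
def trueGame (msk : MasterSecretKey 𝔹 d 2 n) : VGame 𝔹 d (PrivateKey 𝔹 d 2 n) where
  kg v := hfKg msk ((ofV v).map unitVec)
  del v sk x := if hx : x ≠ 0 then hfDel ((ofV v).map unitVec) sk (unitVec (Units.mk0 x hx))
    else PMF.pure sk
  wire _ k := k.wire

structure GoodState (target : List 𝔹.Zpu) (st : GameState (selHF d n 𝔹)) : Prop where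
  keys : ∀ e ∈ st.keys, e.1 ≠ [] ∧ e.1.length ≤ d
  revealed : ∀ id ∈ st.revealed, ¬ id <+: target ∧ id ≠ [] ∧ id.length ≤ d

theorem lookupV_vState {K : Type} (keys : List (List 𝔹.Zpu × K)) (h : ∀ e ∈ keys, e.1.length ≤ d)
    {id : List 𝔹.Zpu} (hid : id.length ≤ d) :
    lookupV (keys.map fun e => (idv d e.1, e.2)) (idv d id) = lookupKey keys id := by
  induction keys with
  | nil => rfl
  | cons e keys ih =>
    have ih := ih fun e he => h e (List.mem_cons_of_mem _ he)
    simp only [lookupV, lookupKey, List.map_cons, List.find?_cons] at ih ⊢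
    by_cases he : e.1 = id
    · simp [he]
    · have : idv d e.1 ≠ idv d id := fun h' => he (idv_injective (h e (by simp)) hid h')
      simp only [he, this, decide_false]
      exact ih

theorem lookupKey_mem {C K : Type} {keys : List (List C × K)} {id : List C} {k : K}
    (h : lookupKey keys id = some k) : ∃ e ∈ keys, e.1 = id := by
  classical
  simp only [lookupKey, Option.map_eq_some_iff] at h
  obtain ⟨e, he, -⟩ := h
  exact ⟨e, List.mem_of_find?_eq_some he, by simpa using List.find?_some he⟩

theorem exec_vState (hd : 1 ≤ d) (mpk : MasterPublicKey 𝔹 d 2 n) (msk : MasterSecretKey 𝔹 d 2 n)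
    (target : List 𝔹.Zpu) (c : Cmd) {st : GameState (selHF d n 𝔹)} (hst : GoodState target st) :
    execV (trueGame msk) (idv d target) c (vState st) =
        (c.exec (selHF d n 𝔹) ((selHF d n 𝔹).kg msk) ((selHF d n 𝔹).del mpk) target st).map vState ∧
      ∀ st' ∈ (c.exec (selHF d n 𝔹) ((selHF d n 𝔹).kg msk) ((selHF d n 𝔹).del mpk) target st).support,
        GoodState target st' := by
  classical
  have hk : ∀ e ∈ st.keys, e.1.length ≤ d := fun e he => (hst.keys e he).2
  rcases c with i | ⟨f, r⟩ | ⟨f, r, x⟩ | ⟨f, r, dst⟩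
  · constructor
    · simp only [execV, Cmd.exec, vState, PMF.map_comp]
      rfl
    · intro st' h'
      simp only [Cmd.exec, PMF.support_map, Set.mem_image] at h'
      obtain ⟨m, -, rfl⟩ := h'
      exact ⟨hst.keys, hst.revealed⟩
  · have hl := length_readId (d := d) (n := n) st.mem r
    have e1 : readV d (vState st).1 r = idv d ((selHF d n 𝔹).readId st.mem r) :=
      (idv_readId st.mem r).symm
    simp only [execV, Cmd.exec, e1]
    have e2 := exists_idv_ne_zero (id := (selHF d n 𝔹).readId st.mem r) hd
    by_cases hc : (st.mem f).toBit = true ∧ (selHF d n 𝔹).readId st.mem r ≠ []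
    · rw [if_pos hc, if_pos ⟨hc.1, e2.2 hc.2⟩]
      constructor
      · simp only [trueGame, ofV_idv hl, PMF.map_comp]
        rfl
      · intro st' h'
        simp only [PMF.support_map, Set.mem_image] at h'
        obtain ⟨sk, -, rfl⟩ := h'
        refine ⟨fun e he => ?_, hst.revealed⟩
        rcases List.mem_cons.1 he with rfl | he
        · exact ⟨hc.2, hl⟩
        · exact hst.keys e he
    · rw [if_neg hc, if_neg fun h => hc ⟨h.1, e2.1 h.2⟩, PMF.pure_map]
      refine ⟨rfl, fun st' h' => ?_⟩
      rw [PMF.mem_support_pure_iff] at h'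
      exact h' ▸ hst
  · have hl := length_readId (d := d) (n := n) st.mem r
    have e1 : readV d (vState st).1 r = idv d ((selHF d n 𝔹).readId st.mem r) :=
      (idv_readId st.mem r).symm
    have e3 := exists_idv_eq_zero (d := d) (id := (selHF d n 𝔹).readId st.mem r)
    have e4 : lookupV (vState st).2 (idv d ((selHF d n 𝔹).readId st.mem r)) =
        lookupKey st.keys ((selHF d n 𝔹).readId st.mem r) := lookupV_vState st.keys hk hl
    simp only [execV, Cmd.exec, e1, e4, e3]
    generalize hid : (selHF d n 𝔹).readId st.mem r = id at *
    rcases hlk : lookupKey st.keys id with _ | sk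
    · simp only [PMF.pure_map, true_and]
      intro st' h'
      rw [PMF.mem_support_pure_iff] at h'
      exact h' ▸ hst
    · rcases hx : readUnit (st.mem x) with _ | y
      · have hx0 : ((vState st).1 x).toScalar = 0 := by
          by_contra h0
          obtain ⟨z, hz⟩ := exists_readUnit.2 h0
          have hz' : readUnit (st.mem x) = some z := hz
          rw [hx] at hz'
          exact absurd hz' (by simp)
        simp only [hx0, ne_eq, not_true_eq_false, false_and, and_false, if_false, PMF.pure_map,
          true_and]
        intro st' h'
        rw [PMF.mem_support_pure_iff] at h'
        exact h' ▸ hst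
      · have hx1 : ((vState st).1 x).toScalar = (y : 𝔹.Zp) := readUnit_eq_some.1 hx
        have hx0 : (y : 𝔹.Zp) ≠ 0 := Units.ne_zero y
        by_cases hc : (st.mem f).toBit = true ∧ id.length < d
        · have hc' : ((vState st).1 f).toBit = true ∧ (y : 𝔹.Zp) ≠ 0 ∧ id.length < d :=
            ⟨hc.1, hx0, hc.2⟩
          simp only [hx1, if_pos hc', if_pos hc]
          constructor
          · have hy : Units.mk0 (y : 𝔹.Zp) hx0 = y := Units.ext rfl
            simp only [trueGame, ofV_idv hl, dif_pos hx0, hy, PMF.map_comp, vState,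
              ← idv_append hc.2]
            rfl
          · intro st' h'
            simp only [PMF.support_map, Set.mem_image] at h'
            obtain ⟨sk', -, rfl⟩ := h'
            refine ⟨fun e he => ?_, hst.revealed⟩
            rcases List.mem_cons.1 he with rfl | he
            · exact ⟨by simp, by simpa using hc.2⟩
            · exact hst.keys e he
        · have hc' : ¬(((vState st).1 f).toBit = true ∧ (y : 𝔹.Zp) ≠ 0 ∧ id.length < d) :=
            fun h => hc ⟨h.1, h.2.2⟩
          simp only [hx1, if_neg hc', if_neg hc, PMF.pure_map, true_and]
          intro st' h'
          rw [PMF.mem_support_pure_iff] at h'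
          exact h' ▸ hst
  · have hl := length_readId (d := d) (n := n) st.mem r
    have e1 : readV d (vState st).1 r = idv d ((selHF d n 𝔹).readId st.mem r) :=
      (idv_readId st.mem r).symm
    have e4 : lookupV (vState st).2 (idv d ((selHF d n 𝔹).readId st.mem r)) =
        lookupKey st.keys ((selHF d n 𝔹).readId st.mem r) := lookupV_vState st.keys hk hl
    have e5 := prefix_iff_pfxV (d := d) (t := target) hl
    simp only [execV, Cmd.exec, e1, e4]
    generalize hid : (selHF d n 𝔹).readId st.mem r = id at *
    by_cases hf : (st.mem f).toBit = true
    · have hf' : ((vState st).1 f).toBit = true := hf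
      rw [if_pos hf, if_pos hf']
      rcases hlk : lookupKey st.keys id with _ | sk
      · simp only [PMF.pure_map]
        refine ⟨rfl, fun st' h' => ?_⟩
        rw [PMF.mem_support_pure_iff] at h'
        exact h' ▸ ⟨hst.keys, hst.revealed⟩
      · by_cases hp : id <+: target
        · simp only [if_pos hp, if_pos (e5.1 hp), PMF.pure_map]
          refine ⟨rfl, fun st' h' => ?_⟩
          rw [PMF.mem_support_pure_iff] at h'
          exact h' ▸ ⟨hst.keys, hst.revealed⟩
        · simp only [if_neg hp, if_neg (fun h => hp (e5.2 h)), PMF.pure_map]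
          refine ⟨rfl, fun st' h' => ?_⟩
          rw [PMF.mem_support_pure_iff] at h'
          subst h'
          refine ⟨hst.keys, fun id' h'' => ?_⟩
          rcases List.mem_cons.1 h'' with rfl | h''
          · obtain ⟨e, he, he'⟩ := lookupKey_mem hlk
            exact ⟨hp, he' ▸ (hst.keys e he).1, hl⟩
          · exact hst.revealed id' h''
    · have hf' : ¬((vState st).1 f).toBit = true := hf
      rw [if_neg hf, if_neg hf', PMF.pure_map]
      refine ⟨rfl, fun st' h' => ?_⟩
      rw [PMF.mem_support_pure_iff] at h'
      exact h' ▸ hst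

theorem bind_congr_support {α β : Type} (μ : PMF α) {f g : α → PMF β} (h : ∀ a ∈ μ.support, f a = g a) :
    μ.bind f = μ.bind g := by
  ext b
  simp only [PMF.bind_apply]
  refine tsum_congr fun a => ?_
  by_cases ha : μ a = 0
  · rw [ha, zero_mul, zero_mul]
  · rw [h a ((PMF.mem_support_iff _ _).2 ha)]

theorem runCmds_vState (hd : 1 ≤ d) (mpk : MasterPublicKey 𝔹 d 2 n) (msk : MasterSecretKey 𝔹 d 2 n)
    (target : List 𝔹.Zpu) (cs : List Cmd) {st : GameState (selHF d n 𝔹)} (hst : GoodState target st) :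
    runV (trueGame msk) (idv d target) cs (vState st) =
        (runCmds (selHF d n 𝔹) ((selHF d n 𝔹).kg msk) ((selHF d n 𝔹).del mpk) target cs st).map
          vState ∧
      ∀ st' ∈ (runCmds (selHF d n 𝔹) ((selHF d n 𝔹).kg msk) ((selHF d n 𝔹).del mpk) target cs
        st).support, GoodState target st' := by
  induction cs generalizing st with
  | nil =>
    refine ⟨by rw [runV, runCmds, PMF.pure_map], fun st' h' => ?_⟩
    rw [runCmds, PMF.mem_support_pure_iff] at h'
    exact h' ▸ hst
  | cons c cs ih =>
    obtain ⟨h1, h2⟩ := exec_vState hd mpk msk target c hst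
    constructor
    · rw [runV, h1, runCmds, PMF.map_bind, PMF.bind_map]
      exact bind_congr_support _ fun st' h' => (ih (h2 st' h')).1
    · intro st' h'
      rw [runCmds, PMF.mem_support_bind_iff] at h'
      obtain ⟨st₁, hs₁, hs'⟩ := h'
      exact (ih (h2 st₁ hs₁)).2 st' hs'

end Experiments

/-! ## Keys and their exponents -/

theorem uniform_map_of_bijective_prod {A B C : Type} [Fintype A] [Fintype B] [Fintype C] [Nonempty A]
    [Nonempty B] [Nonempty C] {f : A → B} (h : A → C) (hb : Function.Bijective fun a => (f a, h a)) :
    (PMF.uniformOfFintype A).map f = PMF.uniformOfFintype B := by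
  refine uniform_map_of_injective_prod (h := h) hb.1 ?_
  rw [Fintype.card_of_bijective hb, Fintype.card_prod]

section Keys

variable {𝔹 : BilinearGroup} {d n : ℕ}

/-- The private key with given discrete logarithms. -/
def keyOfLog (W : WI d n → 𝔹.Zp) : PrivateKey 𝔹 d 2 n where
  D l := zexp 𝔹.gh (W (.inl (none, l)))
  Dw l := zexp 𝔹.gh (W (.inr (.inl (none, none), l)))
  Di i l := zexp 𝔹.gh (W (.inr (.inl (none, some i), l)))
  K j k l := zexp 𝔹.gh (W (.inl (some (j, k), l)))
  L j l := zexp 𝔹.gh (W (.inr (.inr j, l)))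
  L' j k i l := zexp 𝔹.gh (W (.inr (.inl (some (j, k), some i), l)))
  Lw j k l := zexp 𝔹.gh (W (.inr (.inl (some (j, k), none), l)))

theorem wire_keyOfLog (W : WI d n → 𝔹.Zp) :
    (keyOfLog W).wire = (wireList d n).map fun i => emb .gh (W i) := by
  simp only [PrivateKey.wire, wireList, keyOfLog, List.map_append, map_listOf, List.map_cons,
    List.map_nil, emb]

/-- Exponents of a master key. -/
structure IsLog (ev : SI d n → 𝔹.Zp) (msk : MasterSecretKey 𝔹 d 2 n) : Prop where
  vh : msk.vh = zexp 𝔹.gh (ev .v)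
  wh : ∀ l, msk.wh l = zexp 𝔹.gh (ev (.w l))
  hh : ∀ i i₂ l, msk.hh i i₂ l = zexp 𝔹.gh (ev (.h i i₂ l))

def kgLog (ρ : KgCoins 𝔹 d 2 n) : KI d n → 𝔹.Zpu
  | (.inl (none, none), l) => ρ.1 l
  | (.inl (none, some i), l) => ρ.2.1 i l
  | (.inl (some (j, k), some i), l) => ρ.2.2.1 j k i l
  | (.inl (some (j, k), none), l) => ρ.2.2.2.2 j k l
  | (.inr j, l) => ρ.2.2.2.1 j l

theorem kgLog_bijective : Function.Bijective (kgLog (𝔹 := 𝔹) (d := d) (n := n)) := by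
  refine Function.bijective_iff_has_inverse.2 ⟨fun e =>
    (fun l => e (.inl (none, none), l), fun i l => e (.inl (none, some i), l),
      fun j k i l => e (.inl (some (j, k), some i), l), fun j l => e (.inr j, l),
      fun j k l => e (.inl (some (j, k), none), l)), fun ρ => rfl, fun e => ?_⟩
  funext q
  obtain ⟨(⟨_ | ⟨j, k⟩, _ | i⟩ | j), l⟩ := q <;> rfl

theorem zexp_ite {c : Prop} [Decidable c] (a : 𝔹.Zp) :
    (if c then zexp 𝔹.gh a else 1) = zexp 𝔹.gh (if c then a else 0) := by
  split_ifs
  · rfl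
  · rw [zexp_zero]

theorem zexp_gh_add (a b : 𝔹.Zp) : zexp 𝔹.gh a * zexp 𝔹.gh b = zexp 𝔹.gh (a + b) :=
  (zexp_add (𝔹.pow_p_Gh _) a b).symm

theorem zexp_gh_zexp (a b : 𝔹.Zp) : zexp (zexp 𝔹.gh a) b = zexp 𝔹.gh (a * b) :=
  zexp_zexp (𝔹.pow_p_Gh _) a b

theorem zexp_gh_sum {ι : Type} (s : Finset ι) (f : ι → 𝔹.Zp) :
    ∏ i ∈ s, zexp 𝔹.gh (f i) = zexp 𝔹.gh (∑ i ∈ s, f i) := (zexp_sum (𝔹.pow_p_Gh _) s f).symm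

theorem idComp_unitVec {id : List 𝔹.Zpu} {i : Fin d} (h : i.val < id.length) (k : Fin 2) :
    idComp (id.map unitVec) i.val k = if k = 0 then 1 else idv d id i := by
  have : idComp (id.map unitVec) i.val = unitVec id[i.val] := by
    simp [idComp, List.getD_eq_getElem?_getD, h]
  rw [this, idv_of_lt h]
  fin_cases k <;> simp [unitVec]

open Classical in
theorem rowF {id : List 𝔹.Zpu} {ev : SI d n → 𝔹.Zp} {msk : MasterSecretKey 𝔹 d 2 n} (hm : IsLog ev msk)
    (i : Fin d) (l : Fin n) (a : 𝔹.Zp) :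
    (if i.val < id.length then zexp (∏ i₂ : Fin 2, zexp (msk.hh i i₂.succ l)
      (idComp (id.map unitVec) i.val i₂)) a else 1) =
    zexp 𝔹.gh (if idv d id i ≠ 0 then a * (ev (.h i 1 l) + idv d id i * ev (.h i 2 l)) else 0) := by
  by_cases h : i.val < id.length
  · rw [if_pos h, if_pos (idv_ne_zero.2 h)]
    simp only [hm.hh, zexp_gh_zexp, zexp_gh_sum, Fin.sum_univ_two, idComp_unitVec h, Fin.succ_zero_eq_one,
      Fin.succ_one_eq_two, if_true, Fin.one_eq_zero_iff, OfNat.ofNat_ne_one, if_false]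
    congr 1
    ring
  · rw [if_neg h, if_neg fun h' => h (idv_ne_zero.1 h'), zexp_zero]

theorem keyOf_eq {id : List 𝔹.Zpu} {ev : SI d n → 𝔹.Zp} {msk : MasterSecretKey 𝔹 d 2 n}
    (hm : IsLog ev msk) (ρ : KgCoins 𝔹 d 2 n) :
    keyOf msk (id.map unitVec) ρ =
      keyOfLog (worldWire ev (idv d id) fun q => (kgLog ρ q : 𝔹.Zp)) := by
  classical
  have h0 : ∀ i : Fin d, (id.length ≤ i.val) = (idv d id i = 0) := fun i => by rw [idv_eq_zero]
  have h1 : ∀ i : Fin d, (i.val < id.length) = (idv d id i ≠ 0) := fun i => by rw [idv_ne_zero]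
  have hl : (id.map unitVec).length = id.length := List.length_map _
  unfold keyOf keyOfLog
  simp only [hl, PrivateKey.mk.injEq]
  refine ⟨?_, ?_, ?_, ?_, ?_, ?_, ?_⟩
  · funext l
    simp only [rowF hm, zexp_gh_sum, hm.wh, zexp_gh_zexp, zexp_gh_add, worldWire, wireOf, rowAct,
      if_true, valOf, sgTerm, kgLog, add_zero]
    congr 2
    ring
  · funext l
    simp only [hm.vh, zexp_gh_zexp, worldWire, wireOf, actV, rowAct, entAct, and_self, if_true, kgLog]
  · funext i l
    simp only [hm.vh, zexp_gh_zexp, h1, zexp_ite, worldWire, wireOf, actV, rowAct, entAct, true_and,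
      kgLog]
  · funext j k l
    simp only [rowF hm]
    simp only [zexp_gh_sum, hm.wh, hm.hh, zexp_gh_zexp, zexp_gh_add, h0, zexp_ite, worldWire,
      wireOf, rowAct, valOf, sgTerm, kgLog]
    congr 2
    ring
  · funext j l
    simp only [hm.vh, zexp_gh_zexp, h0, zexp_ite, worldWire, wireOf, kgLog]
    by_cases h : idv d id j = 0
    · have h' : actV (idv d id) (.inr j) := h
      rw [if_pos h, if_pos h']
    · have h' : ¬actV (idv d id) (.inr j) := h
      rw [if_neg h, if_neg h']
  · funext j k i l
    simp only [hm.vh, zexp_gh_zexp, h0, h1, zexp_ite, worldWire, wireOf, kgLog]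
    by_cases h : idv d id j = 0 ∧ idv d id i ≠ 0
    · have h' : actV (idv d id) (.inl (some (j, k), some i)) := h
      rw [if_pos h, if_pos h']
    · have h' : ¬actV (idv d id) (.inl (some (j, k), some i)) := h
      rw [if_neg h, if_neg h']
  · funext j k l
    simp only [hm.vh, zexp_gh_zexp, h0, zexp_ite, worldWire, wireOf, actV, rowAct, entAct, and_true,
      kgLog]

theorem delegateKey_eq {id : List 𝔹.Zpu} (h : id.length < d) {ev : SI d n → 𝔹.Zp}
    (e fr : KI d n → 𝔹.Zp) (x : 𝔹.Zpu) (ρ : DelCoins 𝔹 d 2 n) :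
    delegateKey ⟨id.length, h⟩ (keyOfLog (worldWire ev (idv d id) e)) (unitVec x) ρ =
      keyOfLog (worldWire ev (childV (idv d id) x) (delV (idv d id) x e
        (fun q => (ρ.1 q.2 : 𝔹.Zp) * e q) fr fun q => (ρ.2 q.1 q.2.1 q.2.2 : 𝔹.Zp))) := by
  classical
  have hx : (x : 𝔹.Zp) ≠ 0 := Units.ne_zero x
  have hm := curV_idv h
  set m : Fin d := ⟨id.length, h⟩ with hmd
  have hm0 : idv d id m = 0 := hm.1
  have hc : ∀ i : Fin d, childV (idv d id) (x : 𝔹.Zp) i = 0 ↔ m < i := fun i => by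
    rw [childV_eq_zero hx, idv_eq_zero, Fin.lt_def]
    constructor
    · rintro ⟨h1, h2⟩
      refine lt_of_le_of_ne h1 fun h3 => h2 ?_
      rwa [show i = m from Fin.ext h3.symm]
    · intro h1
      exact ⟨h1.le, fun h2 => absurd (curV_unique h2 hm) (Fin.ne_of_gt h1)⟩
  have h0 : ∀ i : Fin d, m < i → idv d id i = 0 := fun i hi => idv_eq_zero.2 (le_of_lt hi)
  have h0' : ∀ i : Fin d, ¬ m < i → i ≠ m → idv d id i ≠ 0 := fun i hi hi' =>
    idv_ne_zero.2 (lt_of_le_of_ne (not_lt.1 hi) fun h3 => hi' (Fin.ext h3))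
  have hj' : ∀ j : Fin d, m < j → ¬curV (idv d id) j := fun j hj h1 =>
    absurd (curV_unique h1 hm) (Fin.ne_of_gt hj)
  have hK : ∀ l, (∏ k : Fin 2, zexp (zexp 𝔹.gh (worldWire ev (idv d id) e (.inl (some (m, k), l)) *
      (ρ.1 l).val)) (unitVec x k)) = zexp 𝔹.gh (valStar (fun i i₂ l => ev (.h i i₂ l))
        (fun l => ev (.w l)) (idv d id) (fun q => (ρ.1 q.2 : 𝔹.Zp) * e q) m x l) := by
    intro l
    simp only [zexp_gh_zexp, zexp_gh_sum, Fin.sum_univ_two, unitVec, Matrix.cons_val_zero,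
      Matrix.cons_val_one, worldWire, wireOf, rowAct, hm0, if_true, valStar,
      valOf_mul _ _ _ (fun l => (ρ.1 l : 𝔹.Zp))]
    congr 1
    ring
  have hLw : ∀ l, (∏ k : Fin 2, zexp (zexp 𝔹.gh (worldWire ev (idv d id) e
      (.inr (.inl (some (m, k), none), l)) * (ρ.1 l).val)) (unitVec x k)) =
      zexp 𝔹.gh (ev .v * vMain (idv d id) x (fun q => (ρ.1 q.2 : 𝔹.Zp) * e q) none l) := by
    intro l
    simp only [zexp_gh_zexp, zexp_gh_sum, Fin.sum_univ_two, unitVec, Matrix.cons_val_zero,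
      Matrix.cons_val_one, worldWire, wireOf, actV, rowAct, entAct, hm0, and_self, if_true,
      vMain_of_cur hm]
    congr 1
    ring
  have hL : ∀ i l, (if i = m then zexp 𝔹.gh (worldWire ev (idv d id) e (.inr (.inr m, l)) * (ρ.1 l).val)
      else ∏ k : Fin 2, zexp (zexp 𝔹.gh (worldWire ev (idv d id) e
      (.inr (.inl (some (m, k), some i), l)) * (ρ.1 l).val)) (unitVec x k)) =
      zexp 𝔹.gh (if i = m then ev .v * ((ρ.1 l : 𝔹.Zp) * e (.inr m, l)) else
        if m < i then 0 else
        ev .v * vMain (idv d id) x (fun q => (ρ.1 q.2 : 𝔹.Zp) * e q) (some i) l) := by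
    intro i l
    by_cases hi : i = m
    · simp only [if_pos hi, worldWire, wireOf, actV, hm0, if_true]
      congr 1
      ring
    · simp only [if_neg hi, zexp_gh_zexp, zexp_gh_sum, Fin.sum_univ_two, unitVec, Matrix.cons_val_zero,
        Matrix.cons_val_one, worldWire, wireOf, actV, rowAct, entAct, hm0, true_and]
      by_cases hi' : m < i
      · simp [h0 i hi', hi']
      · simp only [if_pos (h0' i hi' hi), if_neg hi', vMain_of_cur hm]
        congr 1
        ring
  unfold delegateKey
  simp only [keyOfLog, PrivateKey.mk.injEq, zexp_gh_zexp _ (Units.val _)]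
  simp only [hK, hL, hLw]
  refine ⟨?_, ?_, ?_, ?_, ?_, ?_, ?_⟩
  · funext l
    simp only [zexp_gh_add, worldWire, wireOf, rowAct, reduceIte, valOf_delV_none _ _ hx hm]
  · funext l
    simp only [zexp_gh_add, worldWire, wireOf, actV, rowAct, entAct, and_self, delV, curE,
      reduceIte, mul_add]
  · funext i l
    simp only [zexp_gh_add, worldWire, wireOf, actV, rowAct, entAct, true_and, ne_eq, hc, delV,
      curE_of_cur hm, vSg_of_cur hm]
    by_cases hi : i = m
    · subst hi
      simp [hm0]
    · by_cases hi' : m < i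
      · simp [hi, hi', h0 i hi']
      · simp [hi, hi', h0' i hi' hi, mul_add]
  · funext j k l
    simp only [zexp_gh_add, zexp_gh_zexp, worldWire, wireOf, rowAct, zexp_ite, hc]
    congr 1
    by_cases hj : m < j
    · simp only [if_pos hj, valOf_delV_some _ _ hx hm _ _ _ _ _ _ ((hc j).2 hj), h0 j hj, if_true,
        valOf_mul _ _ _ (fun l => (ρ.1 l : 𝔹.Zp))]
      ring
    · simp only [if_neg hj]
  · funext j l
    simp only [worldWire, wireOf, actV, zexp_ite, hc]
    congr 1
    by_cases hj : m < j
    · simp only [if_pos hj, delV, ne_eq, not_true_eq_false, false_or, hj' j hj, h0 j hj, reduceIte]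
      ring
    · simp only [if_neg hj]
  · funext j k i l
    simp only [zexp_gh_add, zexp_gh_zexp, worldWire, wireOf, actV, rowAct, entAct, zexp_ite, hc, ne_eq]
    congr 1
    by_cases hj : m < j
    · simp only [hj, delV, ne_eq, not_true_eq_false, false_or, hj' j hj, h0 j hj, reduceIte, true_and, curE_of_cur hm,
        vSg_of_cur hm, Option.some.injEq]
      by_cases hi : i = m
      · subst hi
        simp only [hm0, lt_irrefl, not_true_eq_false, not_false_eq_true, if_true, if_false]
        ring
      · by_cases hi' : m < i
        · simp [hi, hi', h0 i hi']
        · simp only [hi, hi', h0' i hi' hi, not_false_eq_true, if_true, if_false]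
          ring
    · simp only [hj, if_false, false_and]
  · funext j k l
    simp only [zexp_gh_add, zexp_gh_zexp, worldWire, wireOf, actV, rowAct, entAct, and_true, zexp_ite, hc]
    congr 1
    by_cases hj : m < j
    · simp only [hj, delV, ne_eq, not_true_eq_false, false_or, hj' j hj, h0 j hj, reduceIte, curE]
      ring
    · simp only [hj, if_false]

end Keys

section Experiments

variable {𝔹 : BilinearGroup} {d n : ℕ}

/-- The game in terms of exponents, with non-zero coins. -/
def unitGame (t : Fin d → 𝔹.Zp) (ev : SI d n → 𝔹.Zp) : VGame 𝔹 d (KI d n → 𝔹.Zp) where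
  kg _ := (PMF.uniformOfFintype (KI d n → 𝔹.Zpu)).map fun c q => (c q : 𝔹.Zp)
  del v e x := ((PMF.uniformOfFintype (WC d n → 𝔹.Zpu)).map fun c q => (c q : 𝔹.Zp)).map
    (hybDel 0 0 t v e x)
  wire v e := (wireList d n).map fun i => emb .gh (worldWire ev v e i)

theorem hybDel_zero (t v : Fin d → 𝔹.Zp) (e : KI d n → 𝔹.Zp) (x : 𝔹.Zp) (c : WC d n → 𝔹.Zp) :
    hybDel 0 0 t v e x c = delV v x e (fun q => c (.inr (.inl q.2)) * e q)
      (fun q => c (.inl (.inr q))) fun q => c (.inr (.inr q)) := by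
  simp only [hybDel, Nat.not_lt_zero, false_and, exists_false, and_false, if_false]

set_option synthInstance.maxSize 1024 in
set_option synthInstance.maxHeartbeats 200000 in
theorem hfKg_eq {id : List 𝔹.Zpu} {ev : SI d n → 𝔹.Zp} {msk : MasterSecretKey 𝔹 d 2 n}
    (hm : IsLog ev msk) :
    hfKg msk (id.map unitVec) = ((PMF.uniformOfFintype (KI d n → 𝔹.Zpu)).map
      fun c q => (c q : 𝔹.Zp)).map fun e => keyOfLog (worldWire ev (idv d id) e) := by
  rw [hfKg, ← uniform_map_of_bijective (kgLog_bijective (𝔹 := 𝔹) (d := d) (n := n)), PMF.map_comp,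
    PMF.map_comp]
  congr 1
  funext ρ
  exact keyOf_eq hm ρ

theorem uniform_delCoins : (PMF.uniformOfFintype (WC d n → 𝔹.Zpu)).map (fun c =>
    ((fun l => c (.inr (.inl l)), fun j k l => c (.inr (.inr (j, k, l)))) : DelCoins 𝔹 d 2 n)) =
    PMF.uniformOfFintype (DelCoins 𝔹 d 2 n) := by
  refine uniform_map_of_bijective_prod (C := KI d n ⊕ KI d n → 𝔹.Zpu) (fun c q => c (.inl q)) ?_
  refine Function.bijective_iff_has_inverse.2 ⟨fun a q => match q with
    | .inl q => a.2 q
    | .inr (.inl l) => a.1.1 l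
    | .inr (.inr (j, k, l)) => a.1.2 j k l, fun c => ?_, fun a => rfl⟩
  funext q
  rcases q with q | l | ⟨j, k, l⟩ <;> rfl

theorem hfDel_eq {id : List 𝔹.Zpu} (h : id.length < d) (ev : SI d n → 𝔹.Zp) (t : Fin d → 𝔹.Zp)
    (e : KI d n → 𝔹.Zp) (x : 𝔹.Zpu) :
    hfDel (id.map unitVec) (keyOfLog (worldWire ev (idv d id) e)) (unitVec x) =
      (((PMF.uniformOfFintype (WC d n → 𝔹.Zpu)).map fun c q => (c q : 𝔹.Zp)).map
        (hybDel 0 0 t (idv d id) e x)).map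
          fun e' => keyOfLog (worldWire ev (childV (idv d id) x) e') := by
  have hl : (id.map (unitVec (𝔹 := 𝔹))).length = id.length := List.length_map _
  rw [hfDel, dif_pos (by rwa [hl]), ← uniform_delCoins, PMF.map_comp, PMF.map_comp, PMF.map_comp]
  congr 1
  funext c
  simp only [Function.comp, hybDel_zero, hl]
  exact delegateKey_eq h (ev := ev) e _ x _

theorem runV_trueGame {ev : SI d n → 𝔹.Zp} {msk : MasterSecretKey 𝔹 d 2 n} (hm : IsLog ev msk)
    (t : Fin d → 𝔹.Zp) (cs : List Cmd) (m : Mem 𝔹) :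
    (runV (trueGame msk) t cs (m, [])).map (fun st => (st.1 0).toBit) =
      (runV (unitGame t ev) t cs (m, [])).map fun st => (st.1 0).toBit := by
  refine (runV_map_fst (fun v e => keyOfLog (worldWire ev v e)) ?_ ?_ ?_ cs m
    fun m => (m 0).toBit).symm
  · intro m r
    have hl := length_readId (d := d) (n := n) m r
    rw [← idv_readId (n := n) m r]
    simp only [trueGame, ofV_idv hl, unitGame]
    exact hfKg_eq hm
  · intro m r e x hx h
    have hl := length_readId (d := d) (n := n) m r
    rw [← idv_readId (n := n) m r] at h ⊢
    simp only [trueGame, ofV_idv hl, unitGame, dif_pos hx]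
    exact hfDel_eq (exists_idv_eq_zero.1 h) ev t e (Units.mk0 x hx)
  · intro v e _
    exact wire_keyOfLog _

theorem runV_unitGame_close (t : Fin d → 𝔹.Zp) (ev : SI d n → 𝔹.Zp) (cs : List Cmd)
    (st : VState 𝔹 d (KI d n → 𝔹.Zp)) :
    Close (cs.countP Cmd.isQuery *
        (((Fintype.card (KI d n) + Fintype.card (WC d n) : ℕ) : ℝ) / 𝔹.p))
      (runV (unitGame t ev) t cs st) (runV (worldGame 0 0 t ev) t cs st) := by
  refine runV_close (by positivity) ?_ ?_ ?_ _ _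
  · intro v
    refine (close_units 𝔹).mono ?_
    gcongr
    exact Nat.le_add_right _ _
  · intro v e x hx hv
    refine Close.map ((close_units 𝔹).mono ?_) _
    gcongr
    exact Nat.le_add_left _ _
  · intro v e _
    rfl

/-- Exponents of the master keys. -/
def mkgCoins (c : SI d n → 𝔹.Zpu) : MKgCoins 𝔹 d 2 n :=
  (c .v, fun l => c (.w l), fun i i₂ l => c (.h i i₂ l), fun l => c (.s l))

theorem uniform_mkgCoins : (PMF.uniformOfFintype (SI d n → 𝔹.Zpu)).map mkgCoins =
    PMF.uniformOfFintype (MKgCoins 𝔹 d 2 n) := by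
  refine uniform_map_of_bijective_prod (C := 𝔹.Zpu × (Fin d → Fin 2 → 𝔹.Zpu))
    (fun c => (c .ow, fun i k => c (.oc i k))) ?_
  refine Function.bijective_iff_has_inverse.2 ⟨fun a q => match q with
    | .v => a.1.1
    | .w l => a.1.2.1 l
    | .h i i₂ l => a.1.2.2.1 i i₂ l
    | .s l => a.1.2.2.2 l
    | .ow => a.2.1
    | .oc i k => a.2.2 i k, fun c => ?_, fun a => rfl⟩
  funext q
  cases q <;> rfl

theorem isLog_masterKeys (y : Fin d → Fin 2 → 𝔹.Zp) (c : SI d n → 𝔹.Zpu) :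
    IsLog (fun q => (c q : 𝔹.Zp)) (masterKeys y (mkgCoins c)).2 :=
  ⟨rfl, fun _ => rfl, fun _ _ _ => rfl⟩

theorem zexp_g_zexp (a b : 𝔹.Zp) : zexp (zexp 𝔹.g a) b = zexp 𝔹.g (a * b) :=
  zexp_zexp (𝔹.pow_p_G _) a b

theorem zexp_g_add (a b : 𝔹.Zp) : zexp 𝔹.g a * zexp 𝔹.g b = zexp 𝔹.g (a + b) :=
  (zexp_add (𝔹.pow_p_G _) a b).symm

theorem wire_masterKeys (b : Bool) (t : Fin d → 𝔹.Zp) (c : SI d n → 𝔹.Zpu) :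
    (masterKeys (yOf b t) (mkgCoins c)).1.wire = (mpkList d n).map fun i =>
      emb .g (mpkVal (if b then n else 0) none t (fun q => (c q : 𝔹.Zp)) i) := by
  have hj : ∀ l : Fin n, decide (l.val < if b then n else 0) = b := fun l => by
    cases b <;> simp
  simp only [MasterPublicKey.wire, mpkList, masterKeys, mkgCoins, List.map_append, map_listOf,
    List.map_cons, List.map_nil, emb, zexp_g_zexp, zexp_g_add, mpkVal, reduceCtorEq, false_and,
    if_false, hj]

/-- The experiments in terms of vectors. -/
def trueWorld (𝔹 : BilinearGroup) (d n : ℕ) (A : Adversary) (b : Bool) : PMF Bool :=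
  gameV A (fun _ => PMF.uniformOfFintype (MKgCoins 𝔹 d 2 n))
    (fun t ρ => (masterKeys (yOf b t) ρ).1.wire) fun t ρ => trueGame (masterKeys (yOf b t) ρ).2

theorem trueWorld_close (A : Adversary) (b : Bool) :
    Close ((Fintype.card (SI d n) : ℝ) / 𝔹.p + A.queries *
        (((Fintype.card (KI d n) + Fintype.card (WC d n) : ℕ) : ℝ) / 𝔹.p))
      (trueWorld 𝔹 d n A b) (world 𝔹 d n A 0 0 (if b then n else 0) none) := by
  refine gameV_close fun t m => ?_
  have h1 : ((PMF.uniformOfFintype (MKgCoins 𝔹 d 2 n)).bind fun ρ =>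
      (runV (trueGame (masterKeys (yOf b t) ρ).2) t A.attack
        (m.write 0 (masterKeys (yOf b t) ρ).1.wire, [])).map fun st => (st.1 0).toBit) =
      ((PMF.uniformOfFintype (SI d n → 𝔹.Zpu)).map fun c q => (c q : 𝔹.Zp)).bind fun ev =>
        (runV (unitGame t ev) t A.attack (m.write 0 ((mpkList d n).map fun i =>
          emb .g (mpkVal (if b then n else 0) none t ev i)), [])).map fun st => (st.1 0).toBit := by
    rw [← uniform_mkgCoins, PMF.bind_map, PMF.bind_map]
    congr 1
    funext c
    simp only [Function.comp, wire_masterKeys]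
    exact runV_trueGame (isLog_masterKeys _ c) t A.attack _
  rw [h1]
  exact (close_units 𝔹).bind fun ev => (runV_unitGame_close t ev A.attack _).map _

theorem auxLossy_eq (target : List 𝔹.Zpu) : auxLossy d target = yOf true (idv d target) := by
  funext i k
  by_cases h : i.val < target.length
  · have h' : idv d target i ≠ 0 := idv_ne_zero.2 h
    simp only [auxLossy, List.getElem?_eq_getElem h, yOf, true_and, if_pos h']
    rw [idv_of_lt h]
    fin_cases k <;> rfl
  · have h' : ¬idv d target i ≠ 0 := fun h' => h (idv_ne_zero.1 h')
    simp only [auxLossy, List.getElem?_eq_none (not_lt.1 h), yOf, true_and, if_neg h']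
    fin_cases k <;> rfl

theorem auxInjective_eq (t : Fin d → 𝔹.Zp) : auxInjective 𝔹 d = yOf false t := by
  funext i k
  simp only [auxInjective, yOf, Bool.false_eq_true, false_and, if_false]
  fin_cases k <;> rfl

theorem extMKg_bind {α : Type} (y : Fin d → Fin 2 → 𝔹.Zp)
    (F : MasterPublicKey 𝔹 d 2 n × MasterSecretKey 𝔹 d 2 n → PMF α) :
    (extMKg y).bind F = (PMF.uniformOfFintype (MKgCoins 𝔹 d 2 n)).bind fun ρ => F (masterKeys y ρ) := by
  rw [extMKg, PMF.bind_map]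
  rfl

theorem goodState_init (target : List 𝔹.Zpu) (m : Mem 𝔹) :
    GoodState target ({ mem := m, keys := [], revealed := [], reveals := 0 } :
      GameState (selHF d n 𝔹)) := ⟨by simp, by simp⟩

theorem runCmds_map_bit (hd : 1 ≤ d) (mpk : MasterPublicKey 𝔹 d 2 n) (msk : MasterSecretKey 𝔹 d 2 n)
    (target : List 𝔹.Zpu) (cs : List Cmd) (m : Mem 𝔹) :
    (runCmds (selHF d n 𝔹) ((selHF d n 𝔹).kg msk) ((selHF d n 𝔹).del mpk) target cs
      { mem := m, keys := [], revealed := [], reveals := 0 }).map (fun st => (st.mem 0).toBit) =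
    (runV (trueGame msk) (idv d target) cs (m, [])).map fun st => (st.1 0).toBit := by
  have := (runCmds_vState hd mpk msk target cs (goodState_init (n := n) target m)).1
  rw [show vState ({ mem := m, keys := [], revealed := [], reveals := 0 } :
      GameState (selHF d n 𝔹)) = (m, []) from rfl] at this
  rw [this, PMF.map_comp]
  rfl

theorem experimentAt_map_dA (hd : 1 ≤ d) (ω ζ : ℝ) (A : Adversary) (b : Bool) :
    (experimentAt (selHF d n 𝔹) (selLHF d n 𝔹) (trivialPreOutput _) ω ζ A b).map Outcome.dA =
      trueWorld 𝔹 d n A b := by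
  classical
  rw [experimentAt, PMF.map_bind, trueWorld, gameV]
  congr 1
  funext m
  have ht := idv_readTarget (𝔹 := 𝔹) (n := n) hd m
  simp only [PMF.map_bind, trivialPreOutput, PMF.map_comp, PMF.pure_map, PMF.bind_const,
    PMF.bind_pure_comp, Function.comp_def]
  rw [← ht]
  cases b
  · simp only [Bool.false_eq_true, if_false]
    rw [extMKg_bind, auxInjective_eq (idv d ((selHF d n 𝔹).readTarget m 0))]
    congr 1
    funext ρ
    rw [PMF.bind_const]
    exact runCmds_map_bit hd (masterKeys 0 ρ).1 _ _ _ _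
  · simp only [if_true]
    rw [PMF.bind_const, extMKg_bind, auxLossy_eq]
    congr 1
    funext ρ
    exact runCmds_map_bit hd (masterKeys 0 ρ).1 _ _ _ _

end Experiments

/-! ## Lossiness of the evaluation -/

section Eval

variable {𝔹 : BilinearGroup} {d n : ℕ}

theorem bitExp_zexp (a : 𝔹.Zp) (b : Bool) : bitExp (zexp 𝔹.g a) b = zexp 𝔹.g (if b then a else 0) := by
  cases b
  · simp [bitExp, zexp_zero]
  · simp [bitExp]

theorem prod_bitExp (c : 𝔹.Zp) (a : Fin n → 𝔹.Zp) (s : Fin n → 𝔹.Zpu) (X : Fin n → Bool) :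
    ∏ l, bitExp (zexp 𝔹.g ((c + a l) * (s l : 𝔹.Zp))) (X l) =
      zexp 𝔹.g (c * innerBits s X + ∑ l, if X l then a l * (s l : 𝔹.Zp) else 0) := by
  simp only [bitExp_zexp]
  rw [← zexp_sum (𝔹.pow_p_G _), innerBits, Finset.mul_sum, ← Finset.sum_add_distrib]
  congr 1
  refine Finset.sum_congr rfl fun l _ => ?_
  split_ifs <;> ring

theorem hfEval_eq (y : Fin d → Fin 2 → 𝔹.Zp) (ρ : MKgCoins 𝔹 d 2 n) (id : List 𝔹.Zpu)
    (X : Fin n → Bool) :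
    hfEval (masterKeys y ρ).1 (id.map unitVec) X =
      (zexp 𝔹.g ((ρ.1 : 𝔹.Zp) * innerBits ρ.2.2.2 X),
        fun l => zexp 𝔹.g ((ρ.2.1 l : 𝔹.Zp) * innerBits ρ.2.2.2 X),
        fun i l => if i.val < id.length then
          zexp 𝔹.g (((ρ.2.2.1 i 1 l : 𝔹.Zp) + idv d id i * (ρ.2.2.1 i 2 l : 𝔹.Zp)) * innerBits ρ.2.2.2 X +
            if X l then (ρ.2.2.1 i 0 l : 𝔹.Zp) * (y i 0 + idv d id i * y i 1) * (ρ.2.2.2 l : 𝔹.Zp) else 0)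
        else 1) := by
  have hl : (id.map (unitVec (𝔹 := 𝔹))).length = id.length := List.length_map _
  have h0 : ∀ c : 𝔹.Zp, ∏ l, bitExp (zexp (zexp 𝔹.g c) (ρ.2.2.2 l : 𝔹.Zp)) (X l) =
      zexp 𝔹.g (c * innerBits ρ.2.2.2 X) := fun c => by
    simpa only [zexp_g_zexp, add_zero, zero_mul, ite_self, Finset.sum_const_zero] using
      prod_bitExp c (fun _ => 0) ρ.2.2.2 X
  simp only [hfEval, hl, Prod.mk.injEq]
  refine ⟨h0 _, funext fun l => h0 _, ?_⟩
  funext i l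
  by_cases hi : i.val < id.length
  · rw [if_pos hi, if_pos hi]
    have h1 := prod_bitExp ((ρ.2.2.1 i 1 l : 𝔹.Zp) + idv d id i * (ρ.2.2.1 i 2 l : 𝔹.Zp))
      (fun l₂ => if l₂ = l then (ρ.2.2.1 i 0 l : 𝔹.Zp) * (y i 0 + idv d id i * y i 1) else 0) ρ.2.2.2 X
    rw [Finset.sum_eq_single l, if_pos rfl] at h1
    · rw [← h1]
      refine Finset.prod_congr rfl fun l₂ _ => ?_
      congr 1
      rw [Fin.prod_univ_two, idComp_unitVec hi, idComp_unitVec hi]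
      simp only [masterKeys, zexp_g_zexp, zexp_g_add, if_true, Fin.one_eq_zero_iff,
        OfNat.ofNat_ne_one, if_false, Fin.succ_zero_eq_one, Fin.succ_one_eq_two]
      congr 1
      by_cases hl : l₂ = l
      · simp only [if_pos hl]; ring
      · simp only [if_neg hl]; ring
    · intro l₂ _ h
      simp [h]
    · simp
  · rw [if_neg hi, if_neg hi]

theorem eta_eq_zero_iff (target id : List 𝔹.Zpu) {i : Fin d} (hi : i.val < id.length) :
    auxLossy d target i 0 + idv d id i * auxLossy d target i 1 = 0 ↔ target[i.val]? = id[i.val]? := by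
  rw [idv_of_lt hi, List.getElem?_eq_getElem hi]
  by_cases h : i.val < target.length
  · simp only [auxLossy, List.getElem?_eq_getElem h, Matrix.cons_val_zero, Matrix.cons_val_one, mul_one,
      neg_add_eq_zero, Option.some.injEq]
    exact Units.val_inj
  · simp [auxLossy, List.getElem?_eq_none (not_lt.1 h)]

theorem prefix_iff_getElem? {id target : List 𝔹.Zpu} (hid : id.length ≤ d) :
    id <+: target ↔ ∀ i : Fin d, i.val < id.length → target[i.val]? = id[i.val]? := by
  rw [List.prefix_iff_getElem?]
  constructor
  · intro h i hi
    rw [h i hi, List.getElem?_eq_getElem hi]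
  · intro h i hi
    rw [h ⟨i, hi.trans_le hid⟩ hi, List.getElem?_eq_getElem hi]

theorem hfEval_of_prefix {target id : List 𝔹.Zpu} (hid : id.length ≤ d) (h : id <+: target)
    (ρ : MKgCoins 𝔹 d 2 n) (X X' : Fin n → Bool)
    (hX : innerBits ρ.2.2.2 X = innerBits ρ.2.2.2 X') :
    hfEval (masterKeys (auxLossy d target) ρ).1 (id.map unitVec) X =
      hfEval (masterKeys (auxLossy d target) ρ).1 (id.map unitVec) X' := by
  simp only [hfEval_eq, hX, Prod.mk.injEq, true_and]
  funext i l
  by_cases hi : i.val < id.length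
  · simp [(eta_eq_zero_iff target id hi).2 ((prefix_iff_getElem? hid).1 h i hi)]
  · rw [if_neg hi, if_neg hi]

theorem hfEval_injective {target id : List 𝔹.Zpu} (hid : id.length ≤ d) (h : ¬id <+: target)
    (ρ : MKgCoins 𝔹 d 2 n) :
    Function.Injective (hfEval (masterKeys (auxLossy d target) ρ).1 (id.map unitVec)) := by
  intro X X' hX
  rw [prefix_iff_getElem? hid] at h
  push Not at h
  obtain ⟨i, hi, hne⟩ := h
  rw [hfEval_eq, hfEval_eq, Prod.mk.injEq, Prod.mk.injEq, BilinearGroup.zexp_g_inj] at hX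
  obtain ⟨h1, -, h3⟩ := hX
  have h1 := mul_left_cancel₀ (Units.ne_zero ρ.1) h1
  funext l
  have h3 := congrFun (congrFun h3 i) l
  rw [if_pos hi, if_pos hi, BilinearGroup.zexp_g_inj, h1, add_right_inj] at h3
  have h4 : (ρ.2.2.1 i 0 l : 𝔹.Zp) * (auxLossy d target i 0 + idv d id i * auxLossy d target i 1) *
      (ρ.2.2.2 l : 𝔹.Zp) ≠ 0 := mul_ne_zero (mul_ne_zero (Units.ne_zero _)
        (mt (eta_eq_zero_iff target id hi).1 hne)) (Units.ne_zero _)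
  by_contra hne'
  rcases hb : X l <;> rcases hb' : X' l <;> simp_all

theorem lossiness_of_injective {α β : Type} [Finite α] [Nonempty α] {f : α → β}
    (hf : Function.Injective f) : lossiness f = 0 := by
  rw [lossiness, Nat.card_range_of_injective hf, div_self, Real.logb_one]
  exact_mod_cast Nat.card_pos.ne'

theorem lossiness_of_prefix {target id : List 𝔹.Zpu} (hid : id.length ≤ d) (h : id <+: target)
    (ρ : MKgCoins 𝔹 d 2 n) :
    (n : ℝ) - Real.logb 2 𝔹.p ≤
      lossiness (hfEval (masterKeys (auxLossy d target) ρ).1 (id.map unitVec)) := by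
  set f := hfEval (masterKeys (auxLossy d target) ρ).1 (id.map unitVec)
  have h1 : Nat.card (Set.range f) ≤ 𝔹.p := by
    have : ∃ F : Set.range f → 𝔹.Zp, Function.Injective F := by
      refine ⟨fun y => innerBits ρ.2.2.2 y.2.choose, fun y y' hy => Subtype.ext ?_⟩
      rw [← y.2.choose_spec, ← y'.2.choose_spec]
      exact hfEval_of_prefix hid h ρ _ _ hy
    obtain ⟨F, hF⟩ := this
    refine (Nat.card_le_card_of_injective F hF).trans_eq ?_
    rw [Nat.card_eq_fintype_card, ZMod.card]
  have h2 : 0 < Nat.card (Set.range f) := Nat.card_pos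
  have hp : (0 : ℝ) < 𝔹.p := by exact_mod_cast 𝔹.prime.pos
  have hc : (Nat.card (Fin n → Bool) : ℝ) = 2 ^ n := by simp
  have h3 : (n : ℝ) = Real.logb 2 (2 ^ n) := by
    rw [Real.logb_pow, Real.logb_self_eq_one (by norm_num), mul_one]
  rw [lossiness, hc, h3, ← Real.logb_div (by positivity) hp.ne']
  refine Real.logb_le_logb_of_le (by norm_num) (by positivity) ?_
  gcongr

/-- In the experiments abortion does not occur. -/
theorem notAbort_of_mem_support (hd : 1 ≤ d) (hn : Real.logb 2 𝔹.p < n) (ζ : ℝ) (A : Adversary)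
    (b : Bool) {o : Outcome} (ho : o ∈ (experimentAt (selHF d n 𝔹) (selLHF d n 𝔹) (trivialPreOutput _)
      ((n : ℝ) - Real.logb 2 𝔹.p) ζ A b).support) : o.notAbort = true := by
  simp only [experimentAt, PMF.mem_support_bind_iff, trivialPreOutput, PMF.support_map, Set.mem_image,
    PMF.mem_support_pure_iff] at ho
  obtain ⟨m, -, k₀, hk₀, k₁, hk₁, st, hst, d₂, rfl, rfl⟩ := ho
  have hg : GoodState ((selHF d n 𝔹).readTarget m 0) st := by
    refine (runCmds_vState hd (if b = true then k₁.1 else k₀.1) (if b = true then k₁.2 else k₀.2) _ A.attack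
      (goodState_init _ (m.write 0 ((if b = true then k₁.1 else k₀.1)).wire))).2 st ?_
    cases b <;> exact hst
  have hk : k₁ ∈ (extMKg (n := n) (auxLossy d ((selHF d n 𝔹).readTarget m 0))).support := hk₁
  rw [extMKg, PMF.support_map] at hk
  obtain ⟨ρ, -, rfl⟩ := hk
  simp only [Bool.and_true, decide_eq_true_eq]
  refine ⟨fun id hid => ?_, ?_⟩
  · obtain ⟨h1, -, h2⟩ := hg.revealed id hid
    exact lossiness_of_injective (hfEval_injective h2 h1 ρ)
  · exact lossiness_of_prefix (length_readTarget hd m) (List.prefix_refl _) ρ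

end Eval

/-! ## Probabilities and expectations -/

theorem prob_eq_pr (ν : PMF Bool) : prob ν {true} = pr ν := by
  rw [prob, pr, PMF.toOuterMeasure_apply_singleton]

open Classical in
theorem prob_eq_pr_map {α : Type} (μ : PMF α) (s : Set α) :
    prob μ s = pr (μ.map fun a => decide (a ∈ s)) := by
  rw [← prob_eq_pr, prob, prob, PMF.toOuterMeasure_map_apply]
  congr 2
  ext a
  simp

theorem pr_map_and {ν : PMF Bool} {P : Prop} [Decidable P] :
    pr (ν.map fun b => b && decide P) = if P then pr ν else 0 := by
  by_cases h : P
  · simp only [h, decide_true, Bool.and_true, if_true]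
    rw [show (fun b : Bool => b) = id from rfl, PMF.map_id]
  · simp only [h, decide_false, Bool.and_false, if_false]
    rw [show (ν.map fun _ => false) = PMF.pure false from PMF.map_const _ _, pr_pure]
    simp

section Guess

variable {𝔹 : BilinearGroup}

theorem pbdhTuple_eq (a b c z : 𝔹.Zp) :
    pbdhTuple 𝔹 a b c z = List.ofFn fun i => emb (pbdhKind i) (pbdhInp a b c z i) := by
  simp [pbdhTuple, pbdhKind, pbdhInp, List.ofFn_succ, emb, zexp_one]

theorem ddhTuple_eq (a b z : 𝔹.Zp) :
    ddhTuple 𝔹 a b z = List.ofFn fun i => emb (ddhKind i) ((![1, 1, a, b, z] : Fin 5 → 𝔹.Zp) i) := by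
  simp [ddhTuple, ddhKind, List.ofFn_succ, emb, zexp_one]

/-- The discrete logarithms of `g^c` and of the last component are found among the first `N`
candidates for `c`. -/
def smallDlog (N : ℕ) (inp : Fin 8 → 𝔹.Zp) : Prop :=
  ∃ i : Fin N, inp 3 = (i.val : 𝔹.Zp) ∧ inp 7 = inp 2 * (i.val : 𝔹.Zp)

theorem cp_smallDlog (nb N : ℕ) : Cp nb pbdhKind .bit (N * 24 + 7) fun 𝔹 σ =>
    ind (smallDlog (𝔹 := 𝔹) N σ) := by
  have hv : ∀ i, pbdhKind i = .g → Cp nb pbdhKind .g 1 fun 𝔹 σ => σ i := fun i h => Cp.var' i h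
  refine ((Cp.exists fun i : Fin N => Cp.and
    (Cp.eq (k := .g) (by decide) (hv 3 rfl) (Cp.mul (by decide) .gen (.lit i.val)))
    (Cp.eq (k := .g) (by decide) (hv 7 rfl) (Cp.mul (by decide) (hv 2 rfl) (.lit i.val)))).mono
      (by simp)).congr fun 𝔹 σ => ?_
  simp only [smallDlog, one_mul]

/-- A program that searches for the discrete logarithm of `g^c`. -/
theorem exists_guess (nb N : ℕ) : ∃ B, instrTime B ≤ N * 24 + 8 ∧
    ∀ 𝔹 : BilinearGroup, 𝔹.p < 2 ^ nb → ∀ a b c z : 𝔹.Zp,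
      (runInstrs B ((Mem.empty 𝔹).write 0 (pbdhTuple 𝔹 a b c z))).map (fun m => (m 0).toBit) =
        PMF.pure (open Classical in decide (smallDlog N (pbdhInp a b c z))) := by
  classical
  obtain ⟨B, hB, h⟩ := (cp_smallDlog nb N).compile (addr := Fin.val) 8 fun v => v.isLt
  refine ⟨B ++ [.select 0 8 8 8], ?_, fun 𝔹 hp a b c z => ?_⟩
  · rw [instrTime_append]
    simpa [instrTime, Instr.cost] using hB
  · obtain ⟨m', hr, h8, -⟩ := h 𝔹 hp (pbdhInp a b c z)
      ((Mem.empty 𝔹).write 0 (pbdhTuple 𝔹 a b c z)) fun v => by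
        rw [pbdhTuple_eq, Mem.write, if_pos (Nat.zero_le _), Nat.sub_zero, List.getElem?_ofFn,
          dif_pos v.isLt]
        rfl
    have h2 : RunsTo [.select 0 8 8 8] m' (Function.update m' 0 (m' 8)) :=
      RunsTo.single (by simp [Instr.exec])
    rw [show runInstrs _ _ = _ from hr.append h2, PMF.pure_map]
    congr 1
    simp [h8, emb, Val.toBit, ind_ne_zero]

theorem smallDlog_iff (N : ℕ) (a b c z : 𝔹.Zp) : smallDlog N (pbdhInp a b c z) ↔
    (∃ i : Fin N, c = (i.val : 𝔹.Zp)) ∧ z = a * b * c := by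
  have h3 : pbdhInp a b c z 3 = c := rfl
  have h2 : pbdhInp a b c z 2 = a * b := rfl
  have h7 : pbdhInp a b c z 7 = z := rfl
  simp only [smallDlog, h2, h3, h7]
  constructor
  · rintro ⟨i, h1, h2⟩
    exact ⟨⟨i, h1⟩, by rw [h2, h1]⟩
  · rintro ⟨⟨i, h1⟩, h2⟩
    exact ⟨i, h1, by rw [h2, h1]⟩

open Classical in
theorem card_small (N : ℕ) : min N 𝔹.p ≤
    (Finset.univ.filter fun c : 𝔹.Zp => ∃ i : Fin N, c = (i.val : 𝔹.Zp)).card := by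
  have : (Finset.univ.image fun i : Fin (min N 𝔹.p) => ((i.val : ℕ) : 𝔹.Zp)) ⊆
      (Finset.univ.filter fun c : 𝔹.Zp => ∃ i : Fin N, c = (i.val : 𝔹.Zp)) := by
    intro c hc
    simp only [Finset.mem_image, Finset.mem_univ, true_and, Finset.mem_filter] at hc ⊢
    obtain ⟨i, rfl⟩ := hc
    exact ⟨⟨i.val, i.isLt.trans_le (min_le_left _ _)⟩, rfl⟩
  refine le_trans (le_of_eq ?_) (Finset.card_le_card this)
  rw [Finset.card_image_of_injective, Finset.card_univ, Fintype.card_fin]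
  intro i j h
  have h := (ZMod.natCast_eq_natCast_iff' _ _ _).1 h
  rw [Nat.mod_eq_of_lt (i.isLt.trans_le (min_le_right _ _)),
    Nat.mod_eq_of_lt (j.isLt.trans_le (min_le_right _ _))] at h
  exact Fin.ext h

open Classical in
theorem guess_gap {B : List Instr} {N : ℕ} (h : ∀ a b c z : 𝔹.Zp,
      (runInstrs B ((Mem.empty 𝔹).write 0 (pbdhTuple 𝔹 a b c z))).map (fun m => (m 0).toBit) =
        PMF.pure (decide (smallDlog N (pbdhInp a b c z)))) :
    min 1 ((N : ℝ) / 𝔹.p) / 2 ≤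
      pr ((pbdhDist 𝔹 true).bind fun x =>
        (runInstrs B ((Mem.empty 𝔹).write 0 x)).map fun m => (m 0).toBit) -
      pr ((pbdhDist 𝔹 false).bind fun x =>
        (runInstrs B ((Mem.empty 𝔹).write 0 x)).map fun m => (m 0).toBit) := by
  set S := Finset.univ.filter fun c : 𝔹.Zp => ∃ i : Fin N, c = (i.val : 𝔹.Zp) with hS
  have hp : (2 : ℝ) ≤ 𝔹.p := by exact_mod_cast 𝔹.prime.two_le
  have hcard : (Fintype.card (𝔹.Zp × 𝔹.Zp × 𝔹.Zp × 𝔹.Zp) : ℝ) = 𝔹.p ^ 4 := by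
    simp only [Fintype.card_prod, ZMod.card]
    push_cast
    ring
  have hs : ∀ k : ℝ, ∑ c : 𝔹.Zp, (if ∃ i : Fin N, c = (i.val : 𝔹.Zp) then k else 0) = S.card * k := by
    intro k
    rw [← Finset.sum_filter, Finset.sum_const, nsmul_eq_mul]
  have h1 : pr ((pbdhDist 𝔹 true).bind fun x =>
      (runInstrs B ((Mem.empty 𝔹).write 0 x)).map fun m => (m 0).toBit) = S.card / 𝔹.p := by
    rw [pbdhDist, PMF.bind_map, pr_bind, expec_uniform, hcard]
    obtain ⟨F, hF⟩ : ∃ F : 𝔹.Zp → ℝ, F = fun c => if ∃ i : Fin N, c = (i.val : 𝔹.Zp) then 1 else 0 :=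
      ⟨_, rfl⟩
    have hFs : ∑ c, F c = S.card := by rw [hF, hs, mul_one]
    have h4 : ∀ a b c : 𝔹.Zp, (if decide (smallDlog N (pbdhInp a b c (a * b * c))) = true then (1 : ℝ)
        else 0) = F c := fun a b c => by simp [smallDlog_iff, hF]
    simp only [Function.comp, h, pr_pure, if_true]
    rw [Finset.sum_congr rfl fun x _ => h4 x.1 x.2.1 x.2.2.1]
    simp only [Fintype.sum_prod_type, Finset.sum_const, Finset.card_univ, ZMod.card, nsmul_eq_mul,
      ← Finset.mul_sum, hFs]
    field_simp
  have h2 : pr ((pbdhDist 𝔹 false).bind fun x =>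
      (runInstrs B ((Mem.empty 𝔹).write 0 x)).map fun m => (m 0).toBit) = S.card / 𝔹.p ^ 2 := by
    rw [pbdhDist, PMF.bind_map, pr_bind, expec_uniform, hcard]
    simp only [Function.comp, h, pr_pure, decide_eq_true_eq, smallDlog_iff, Bool.false_eq_true, if_false,
      Fintype.sum_prod_type, ite_and]
    have h3 : ∀ a b c : 𝔹.Zp, ∑ z : 𝔹.Zp, (if ∃ i : Fin N, c = (i.val : 𝔹.Zp) then
        (if z = a * b * c then (1 : ℝ) else 0) else 0) =
        if ∃ i : Fin N, c = (i.val : 𝔹.Zp) then 1 else 0 := by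
      intro a b c
      split_ifs
      · simp
      · simp
    simp only [h3, hs, Finset.sum_const, Finset.card_univ, ZMod.card, nsmul_eq_mul, mul_one]
    field_simp
  rw [h1, h2]
  have hm : (min (N : ℝ) 𝔹.p) ≤ S.card := by exact_mod_cast card_small (𝔹 := 𝔹) N
  have h4 : min 1 ((N : ℝ) / 𝔹.p) ≤ S.card / 𝔹.p := by
    rw [le_div_iff₀ (by positivity)]
    refine le_trans (le_of_eq ?_) hm
    rw [min_mul_of_nonneg _ _ (by positivity), one_mul, div_mul_cancel₀ _ (by positivity), min_comm]
  have h5 : (S.card : ℝ) / 𝔹.p ^ 2 ≤ S.card / 𝔹.p / 2 := by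
    rw [div_div]
    gcongr
    nlinarith
  linarith

end Guess

/-! ## Advantages as expectations -/

theorem pr_distinguish (gen : PMF BilinearGroup) (dist : ∀ 𝔹, PMF (List (Val 𝔹))) (B : List Instr) :
    prob (distinguish gen dist B) {true} = expec gen fun 𝔹 => pr ((dist 𝔹).bind fun x =>
      (runInstrs B ((Mem.empty 𝔹).write 0 x)).map fun m => (m 0).toBit) := by
  rw [prob_eq_pr, distinguish, pr_bind]

theorem abs_min_one_div (N p : ℕ) : |min 1 ((N : ℝ) / p)| ≤ 1 := by
  rw [abs_of_nonneg (by positivity)]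
  exact min_le_left _ _

theorem exists_guess_adv (gen : PMF BilinearGroup) (nb N : ℕ)
    (hnb : ∀ 𝔹 ∈ gen.support, 𝔹.p < 2 ^ nb) : ∃ B, instrTime B ≤ N * 24 + 8 ∧
    expec gen (fun 𝔹 => min 1 ((N : ℝ) / 𝔹.p)) ≤ 2 * advPBDH1 gen B := by
  obtain ⟨B, hB, h⟩ := exists_guess nb N
  refine ⟨B, hB, ?_⟩
  have h1 : expec gen (fun 𝔹 => min 1 ((N : ℝ) / 𝔹.p) / 2) ≤ advPBDH1 gen B := by
    refine le_trans ?_ (le_abs_self _)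
    rw [pr_distinguish, pr_distinguish, ← expec_sub (fun _ => abs_pr_le _) (fun _ => abs_pr_le _)]
    refine expec_mono (C := 1) (D := 1) (fun 𝔹 => ?_) (fun 𝔹 => abs_pr_sub_le _ _)
      fun 𝔹 h𝔹 => guess_gap (h 𝔹 (hnb 𝔹 h𝔹))
    rw [abs_div, abs_two]
    linarith [abs_min_one_div N 𝔹.p]
  have h2 : expec gen (fun 𝔹 => min 1 ((N : ℝ) / 𝔹.p) / 2) =
      1 / 2 * expec gen fun 𝔹 => min 1 ((N : ℝ) / 𝔹.p) := by
    rw [← expec_const_mul]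
    congr 1
    funext 𝔹
    ring
  linarith

section Lossy

variable {d n : ℕ}

theorem prob_experiment (hd : 1 ≤ d) (gen : PMF BilinearGroup)
    (hn : ∀ 𝔹 ∈ gen.support, Real.logb 2 𝔹.p < n) (ζ : ℝ) (A : Adversary) (b : Bool) :
    prob (experiment gen (selHF d n) (selLHF d n) (fun 𝔹 => trivialPreOutput (selHF d n 𝔹))
      (fun 𝔹 => (n : ℝ) - Real.logb 2 𝔹.p) ζ A b) {o | o.dA = true ∧ o.notAbort = true} =
      expec gen fun 𝔹 => pr (trueWorld 𝔹 d n A b) := by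
  classical
  rw [prob_eq_pr_map, experiment, PMF.map_bind, pr_bind]
  refine expec_congr fun 𝔹 h𝔹 => ?_
  rw [← experimentAt_map_dA hd ((n : ℝ) - Real.logb 2 𝔹.p) ζ A b]
  congr 1
  rw [← PMF.bind_pure_comp, ← PMF.bind_pure_comp]
  refine bind_congr_support _ fun o ho => ?_
  simp [notAbort_of_mem_support hd (hn 𝔹 h𝔹) ζ A b ho]

theorem advLossy_eq (hd : 1 ≤ d) (gen : PMF BilinearGroup)
    (hn : ∀ 𝔹 ∈ gen.support, Real.logb 2 𝔹.p < n) (ζ : ℝ) (A : Adversary) :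
    advLossy gen (selHF d n) (selLHF d n) (fun 𝔹 => trivialPreOutput (selHF d n 𝔹))
      (fun 𝔹 => (n : ℝ) - Real.logb 2 𝔹.p) ζ A =
      |expec gen (fun 𝔹 => pr (trueWorld 𝔹 d n A false)) -
        expec gen (fun 𝔹 => pr (trueWorld 𝔹 d n A true))| := by
  rw [advLossy, prob_experiment hd gen hn, prob_experiment hd gen hn]

end Lossy

/-! ## The sequence of games -/

section Steps

variable {d n : ℕ} (gen : PMF BilinearGroup) (A : Adversary) (N : ℕ)

/-- Probability that the adversary wins a game and the group order is at least `N`. -/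
def winLarge (G : ∀ 𝔹 : BilinearGroup, PMF Bool) : ℝ :=
  expec gen fun 𝔹 => if N ≤ 𝔹.p then pr (G 𝔹) else 0

def invLarge : ℝ := expec gen fun 𝔹 => if N ≤ 𝔹.p then 1 / (𝔹.p : ℝ) else 0

theorem abs_ite_le (P : Prop) [Decidable P] {x : ℝ} (hx : |x| ≤ 1) : |if P then x else 0| ≤ 1 := by
  split_ifs
  · exact hx
  · simp

theorem abs_one_div_p_le (𝔹 : BilinearGroup) : |1 / (𝔹.p : ℝ)| ≤ 1 := by
  have hp : (1 : ℝ) ≤ 𝔹.p := by exact_mod_cast 𝔹.prime.one_le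
  rw [abs_of_nonneg (by positivity)]
  exact (div_le_one (by linarith)).2 hp

theorem invLarge_nonneg : 0 ≤ invLarge gen N := by
  have h0 : expec gen (fun _ => (0 : ℝ)) = 0 := expec_const 0
  refine h0.symm.trans_le (expec_mono (C := 0) (D := 1) (fun _ => by simp) (fun 𝔹 => abs_ite_le _ (abs_one_div_p_le 𝔹))
    fun 𝔹 _ => ?_)
  split_ifs <;> positivity

variable {gen N}

theorem abs_winLarge_sub_le {F G : BilinearGroup → ℝ} {c : ℝ} (hF : ∀ 𝔹, |F 𝔹| ≤ 1)
    (hG : ∀ 𝔹, |G 𝔹| ≤ 1) (h : ∀ 𝔹 ∈ gen.support, N ≤ 𝔹.p → |F 𝔹 - G 𝔹| ≤ c * (1 / 𝔹.p)) :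
    |expec gen (fun 𝔹 => if N ≤ 𝔹.p then F 𝔹 else 0) -
      expec gen (fun 𝔹 => if N ≤ 𝔹.p then G 𝔹 else 0)| ≤ c * invLarge gen N := by
  rw [invLarge, ← expec_const_mul]
  refine abs_expec_sub_le (C := 1) (D := 1) (E := |c|) (fun 𝔹 => abs_ite_le _ (hF 𝔹))
    (fun 𝔹 => abs_ite_le _ (hG 𝔹)) (fun 𝔹 => ?_) fun 𝔹 h𝔹 => ?_
  · rw [abs_mul]
    exact mul_le_of_le_one_right (abs_nonneg _) (abs_ite_le _ (abs_one_div_p_le 𝔹))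
  · by_cases hN : N ≤ 𝔹.p
    · simp only [if_pos hN]
      exact h 𝔹 h𝔹 hN
    · simp [if_neg hN]

theorem winLarge_close {F G : ∀ 𝔹 : BilinearGroup, PMF Bool} {c : ℝ}
    (h : ∀ 𝔹, Close (c * (1 / 𝔹.p)) (F 𝔹) (G 𝔹)) :
    |winLarge gen N F - winLarge gen N G| ≤ c * invLarge gen N :=
  abs_winLarge_sub_le (fun 𝔹 => abs_pr_le _) (fun 𝔹 => abs_pr_le _) fun 𝔹 _ _ => (h 𝔹).pr

theorem pbdhDist_bind {𝔹 : BilinearGroup} {α : Type} (b : Bool) (F : List (Val 𝔹) → PMF α) :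
    (pbdhDist 𝔹 b).bind F = (PMF.uniformOfFintype 𝔹.Zp).bind fun a =>
      (PMF.uniformOfFintype 𝔹.Zp).bind fun y => (PMF.uniformOfFintype (𝔹.Zp × 𝔹.Zp)).bind fun c =>
        F (pbdhTuple 𝔹 a y c.1 (if b then a * y * c.1 else c.2)) := by
  rw [pbdhDist, PMF.bind_map, uniform_prod_bind]
  congr 1
  funext a
  rw [uniform_prod_bind]
  rfl

theorem ddhDist_bind {𝔹 : BilinearGroup} {α : Type} (b : Bool) (F : List (Val 𝔹) → PMF α) :
    (ddhDist 𝔹 b).bind F = (PMF.uniformOfFintype 𝔹.Zp).bind fun a =>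
      (PMF.uniformOfFintype 𝔹.Zp).bind fun y => (PMF.uniformOfFintype 𝔹.Zp).bind fun z =>
        F (ddhTuple 𝔹 a y (if b then a * y else z)) := by
  rw [ddhDist, PMF.bind_map, uniform_prod_bind]
  congr 1
  funext a
  rw [uniform_prod_bind]
  rfl

/-- A reduction whose output is correct up to an error `1/p` gives an estimate by the advantage. -/
theorem step_of_reduction {real rand : ∀ 𝔹, PMF (List (Val 𝔹))} {B : List Instr}
    {F F' G G' : ∀ 𝔹 : BilinearGroup, PMF Bool}
    (hreal : ∀ 𝔹 ∈ gen.support, ((real 𝔹).bind fun x =>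
      (runInstrs B ((Mem.empty 𝔹).write 0 x)).map fun m => (m 0).toBit) =
        (F' 𝔹).map fun b => b && decide (N ≤ 𝔹.p))
    (hrand : ∀ 𝔹 ∈ gen.support, ((rand 𝔹).bind fun x =>
      (runInstrs B ((Mem.empty 𝔹).write 0 x)).map fun m => (m 0).toBit) =
        (G' 𝔹).map fun b => b && decide (N ≤ 𝔹.p))
    (hF : ∀ 𝔹, Close 0 (F' 𝔹) (F 𝔹)) (hG : ∀ 𝔹, Close (1 / 𝔹.p) (G' 𝔹) (G 𝔹)) :
    |winLarge gen N F - winLarge gen N G| ≤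
      |prob (distinguish gen real B) {true} - prob (distinguish gen rand B) {true}| +
        invLarge gen N := by
  have h1 : prob (distinguish gen real B) {true} = winLarge gen N F := by
    rw [pr_distinguish, winLarge]
    refine expec_congr fun 𝔹 h𝔹 => ?_
    rw [hreal 𝔹 h𝔹, pr_map_and]
    have := abs_nonpos_iff.1 (hF 𝔹).pr
    rw [sub_eq_zero.1 this]
  have h2 : prob (distinguish gen rand B) {true} = winLarge gen N G' := by
    rw [pr_distinguish, winLarge]
    refine expec_congr fun 𝔹 h𝔹 => ?_
    rw [hrand 𝔹 h𝔹, pr_map_and]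
  have h3 : |winLarge gen N G' - winLarge gen N G| ≤ 1 * invLarge gen N :=
    winLarge_close fun 𝔹 => (hG 𝔹).mono (by rw [one_mul])
  rw [h1, h2]
  rw [one_mul] at h3
  exact (abs_sub_le _ (winLarge gen N G') _).trans (by linarith)

theorem pbdh_step (hp : ∀ 𝔹 ∈ gen.support, 𝔹.p < 2 ^ n) (b : Bool) (l₀ : Fin n) :
    ∃ B, instrTime B ≤ A.time + (pbdhSim n d n b l₀).overhead A.queries N ∧
      |winLarge gen N (fun 𝔹 => world 𝔹 d n A d 0 (l₀.val + if b then 1 else 0) none) -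
        winLarge gen N (fun 𝔹 => world 𝔹 d n A d 0 l₀.val (some l₀))| ≤
      advPBDH1 gen B + invLarge gen N := by
  obtain ⟨B, hB, h⟩ := (pbdhSim n d n b l₀).exists_program A N
  refine ⟨B, hB, ?_⟩
  have h' : ∀ β, ∀ 𝔹 ∈ gen.support, ((pbdhDist 𝔹 β).bind fun x =>
      (runInstrs B ((Mem.empty 𝔹).write 0 x)).map fun m => (m 0).toBit) =
      (((PMF.uniformOfFintype 𝔹.Zp).bind fun a => (PMF.uniformOfFintype 𝔹.Zp).bind fun y =>
        (PMF.uniformOfFintype (𝔹.Zp × 𝔹.Zp)).bind fun c => (pbdhSim n d n b l₀).run 𝔹 A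
          (pbdhInp a y c.1 (if β then a * y * c.1 else c.2)))).map fun b => b && decide (N ≤ 𝔹.p) := by
    intro β 𝔹 h𝔹
    rw [pbdhDist_bind]
    simp only [PMF.map_bind, pbdhTuple_eq]
    congr 1; funext a; congr 1; funext y; congr 1; funext c
    exact h 𝔹 (hp 𝔹 h𝔹) (pbdhInp a y c.1 (if β then a * y * c.1 else c.2))
  refine step_of_reduction (h' true) (h' false) (fun 𝔹 => ?_) fun 𝔹 => ?_
  · have h1 : ∀ a y : 𝔹.Zp, ((PMF.uniformOfFintype (𝔹.Zp × 𝔹.Zp)).bind fun c =>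
        (pbdhSim n d n b l₀).run 𝔹 A (pbdhInp a y c.1 (if true = true then a * y * c.1 else c.2))) =
        world 𝔹 d n A d 0 (l₀.val + if b then 1 else 0) none := by
      intro a y
      rw [uniform_prod_bind]
      simp only [if_true, PMF.bind_const]
      exact pbdhSim_real A a y
    have h2 := Close.bind_right (PMF.uniformOfFintype 𝔹.Zp) fun a =>
      Close.bind_right (PMF.uniformOfFintype 𝔹.Zp) fun y => Close.of_eq (h1 a y)
    simpa only [PMF.bind_const] using h2
  · have h1 : ∀ a y : 𝔹.Zp, Close (1 / 𝔹.p) ((PMF.uniformOfFintype (𝔹.Zp × 𝔹.Zp)).bind fun c =>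
        (pbdhSim n d n b l₀).run 𝔹 A (pbdhInp a y c.1 (if false = true then a * y * c.1 else c.2)))
        (world 𝔹 d n A d 0 l₀.val (some l₀)) := by
      intro a y
      simp only [Bool.false_eq_true, if_false]
      exact pbdhSim_random A a y
    have h2 := Close.bind_right (PMF.uniformOfFintype 𝔹.Zp) fun a =>
      Close.bind_right (PMF.uniformOfFintype 𝔹.Zp) fun y => h1 a y
    simpa only [PMF.bind_const] using h2

theorem close_of_ne {α : Type} {𝔹 : BilinearGroup} (z₀ : 𝔹.Zp) {F : 𝔹.Zp → PMF α} {G : PMF α}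
    (h : ∀ z, z ≠ z₀ → Close 0 (F z) G) :
    Close (1 / 𝔹.p) ((PMF.uniformOfFintype 𝔹.Zp).bind F) G := by
  intro φ
  rw [PMF.bind_bind, pr_bind, ← expec_const (μ := PMF.uniformOfFintype 𝔹.Zp) (pr (G.bind φ))]
  have h1 : expec (PMF.uniformOfFintype 𝔹.Zp) (fun z => if z = z₀ then (1 : ℝ) else 0) = 1 / 𝔹.p := by
    rw [expec_uniform, ZMod.card]
    simp
  rw [← h1]
  refine abs_expec_sub_le (C := 1) (D := 1) (E := 1) (fun _ => abs_pr_le _) (fun _ => abs_pr_le _)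
    (fun z => ?_) fun z _ => ?_
  · split_ifs <;> simp
  · split_ifs with hz
    · exact abs_pr_sub_le _ _
    · exact h z hz φ

theorem ddh_step (hp : ∀ 𝔹 ∈ gen.support, 𝔹.p < 2 ^ n) (b : Bool) (k : ℕ) {u : ℕ}
    (hu : u < Fintype.card (E0 d)) :
    ∃ B, instrTime B ≤ A.time + (ddhSim n d n k u b).overhead A.queries N ∧
      |winLarge gen N (fun 𝔹 => world 𝔹 d n A k u (if b then n else 0) none) -
        winLarge gen N (fun 𝔹 => world 𝔹 d n A k (u + 1) (if b then n else 0) none)| ≤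
      advDDH2 gen B + invLarge gen N := by
  obtain ⟨B, hB, h⟩ := (ddhSim n d n k u b).exists_program A N
  refine ⟨B, hB, ?_⟩
  have h' : ∀ β, ∀ 𝔹 ∈ gen.support, ((ddhDist 𝔹 β).bind fun x =>
      (runInstrs B ((Mem.empty 𝔹).write 0 x)).map fun m => (m 0).toBit) =
      (((PMF.uniformOfFintype 𝔹.Zp).bind fun a => (PMF.uniformOfFintype 𝔹.Zp).bind fun y =>
        (PMF.uniformOfFintype 𝔹.Zp).bind fun z => (ddhSim n d n k u b).run 𝔹 A
          (![1, 1, a, y, if β then a * y else z]))).map fun b => b && decide (N ≤ 𝔹.p) := by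
    intro β 𝔹 h𝔹
    rw [ddhDist_bind]
    simp only [PMF.map_bind, ddhTuple_eq]
    congr 1; funext a; congr 1; funext y; congr 1; funext z
    exact h 𝔹 (hp 𝔹 h𝔹) (![1, 1, a, y, if β then a * y else z])
  refine step_of_reduction (h' true) (h' false) (fun 𝔹 => ?_) fun 𝔹 => ?_
  · have h2 := Close.bind_right (PMF.uniformOfFintype 𝔹.Zp) fun a =>
      Close.bind_right (PMF.uniformOfFintype 𝔹.Zp) fun y =>
      Close.bind_right (PMF.uniformOfFintype 𝔹.Zp) fun z =>
        ddhSim_real (nb := n) (d := d) (n := n) k u b A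
          (inp := ![1, 1, a, y, if true = true then a * y else z]) rfl
    simpa only [PMF.bind_const] using h2
  · have h2 := Close.bind_right (PMF.uniformOfFintype 𝔹.Zp) fun a =>
      Close.bind_right (PMF.uniformOfFintype 𝔹.Zp) fun y =>
        close_of_ne (a * y) fun z hz => ddhSim_random (nb := n) (n := n) k hu b A
          (inp := ![1, 1, a, y, if false = true then a * y else z]) hz
    simpa only [PMF.bind_const] using h2

end Steps

theorem exists_better {adv : List Instr → ℝ} {P : List Instr → Prop} {B B' : List Instr} (h : P B)
    (h' : P B') : ∃ C, P C ∧ adv B ≤ adv C ∧ adv B' ≤ adv C := by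
  rcases le_total (adv B) (adv B') with hle | hle
  · exact ⟨B', h', hle, le_rfl⟩
  · exact ⟨B, h, le_rfl, hle⟩

theorem chain_le {adv : List Instr → ℝ} {P : List Instr → Prop} {e : ℝ} (x : ℕ → ℝ) {m : ℕ}
    (hne : ∃ B, P B) (h : ∀ i < m, ∃ B, P B ∧ |x i - x (i + 1)| ≤ adv B + e) :
    ∃ B, P B ∧ |x 0 - x m| ≤ m * (adv B + e) := by
  induction m with
  | zero =>
    obtain ⟨B, hB⟩ := hne
    exact ⟨B, hB, by simp⟩
  | succ m ih =>
    obtain ⟨B, hB, h1⟩ := ih fun i hi => h i (by omega)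
    obtain ⟨B', hB', h2⟩ := h m (by omega)
    obtain ⟨C, hC, h3, h4⟩ := exists_better (adv := adv) hB hB'
    refine ⟨C, hC, (abs_sub_le _ (x m) _).trans ?_⟩
    have h5 : (m : ℝ) * (adv B + e) ≤ m * (adv C + e) := by gcongr
    push_cast
    linarith

theorem close_one {α : Type} (ν ν' : PMF α) : Close 1 ν ν' := fun _ => abs_pr_sub_le _ _

section Bound

variable {d n : ℕ}

theorem world_close_of_queries_eq_zero {𝔹 : BilinearGroup} {A : Adversary} (hA : A.queries = 0)
    (k k' u u' j : ℕ) (ov : Option (Fin n)) :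
    Close 0 (world 𝔹 d n A k u j ov) (world 𝔹 d n A k' u' j ov) := by
  refine gameV_close fun t m => Close.bind_right _ fun ev => Close.map ?_ _
  refine (runV_close (O₁ := worldGame k u t ev) (O₂ := worldGame k' u' t ev) (t := t) zero_le_one
    (fun _ => close_one _ _) (fun _ _ _ _ _ => close_one _ _) (fun _ _ _ => rfl) A.attack _).mono ?_
  rw [show A.attack.countP Cmd.isQuery = 0 from hA]
  simp

variable (gen : PMF BilinearGroup) (A : Adversary) {N τ : ℕ}

theorem ddh_total (hp : ∀ 𝔹 ∈ gen.support, 𝔹.p < 2 ^ n)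
    (hτ : ∀ k u b, (ddhSim n d n k u b).overhead A.queries N ≤ τ) (b : Bool) :
    ∃ B, instrTime B ≤ A.time + τ ∧
      |winLarge gen N (fun 𝔹 => world 𝔹 d n A 0 0 (if b then n else 0) none) -
        winLarge gen N (fun 𝔹 => world 𝔹 d n A d 0 (if b then n else 0) none)| ≤
      (if A.queries = 0 then 0 else d * Fintype.card (E0 d) : ℕ) * advDDH2 gen B +
        (d * (Fintype.card (E0 d) + A.queries * n) : ℕ) * invLarge gen N := by
  have h0 := invLarge_nonneg gen N
  by_cases hA : A.queries = 0
  · refine ⟨[], Nat.zero_le _, ?_⟩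
    have h1 : |winLarge gen N (fun 𝔹 => world 𝔹 d n A 0 0 (if b then n else 0) none) -
        winLarge gen N (fun 𝔹 => world 𝔹 d n A d 0 (if b then n else 0) none)| ≤ 0 * invLarge gen N :=
      winLarge_close fun 𝔹 => (world_close_of_queries_eq_zero hA _ _ _ _ _ _).mono (by simp)
    rw [zero_mul] at h1
    simp only [hA, if_true, Nat.cast_zero, zero_mul, zero_add]
    exact h1.trans (by positivity)
  · simp only [if_neg hA]
    have h1 : ∀ k < d, ∃ B, instrTime B ≤ A.time + τ ∧
        |winLarge gen N (fun 𝔹 => world 𝔹 d n A k 0 (if b then n else 0) none) -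
          winLarge gen N (fun 𝔹 => world 𝔹 d n A (k + 1) 0 (if b then n else 0) none)| ≤
        Fintype.card (E0 d) * advDDH2 gen B +
          (Fintype.card (E0 d) + A.queries * n : ℕ) * invLarge gen N := by
      intro k _
      obtain ⟨B, hB, h2⟩ := chain_le (adv := advDDH2 gen) (P := fun B => instrTime B ≤ A.time + τ)
        (e := invLarge gen N) (m := Fintype.card (E0 d))
        (fun u => winLarge gen N fun 𝔹 => world 𝔹 d n A k u (if b then n else 0) none)
        ⟨[], Nat.zero_le _⟩ fun u hu => by
          obtain ⟨B, hB, h⟩ := ddh_step (gen := gen) (N := N) A hp b k hu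
          exact ⟨B, hB.trans (Nat.add_le_add_left (hτ k u b) _), h⟩
      have h3 : |winLarge gen N (fun 𝔹 => world 𝔹 d n A k (Fintype.card (E0 d))
          (if b then n else 0) none) -
          winLarge gen N (fun 𝔹 => world 𝔹 d n A (k + 1) 0 (if b then n else 0) none)| ≤
          (A.queries * n : ℕ) * invLarge gen N :=
        winLarge_close fun 𝔹 => (world_level_succ A k _ none).mono (le_of_eq (by push_cast; ring))
      refine ⟨B, hB, (abs_sub_le _ _ _).trans ((add_le_add h2 h3).trans (le_of_eq ?_))⟩
      push_cast
      ring
    obtain ⟨B, hB, h2⟩ := chain_le (adv := fun B => Fintype.card (E0 d) * advDDH2 gen B)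
      (P := fun B => instrTime B ≤ A.time + τ)
      (fun k => winLarge gen N fun 𝔹 => world 𝔹 d n A k 0 (if b then n else 0) none)
      ⟨[], Nat.zero_le _⟩ h1
    refine ⟨B, hB, h2.trans (le_of_eq ?_)⟩
    push_cast
    ring

theorem pbdh_total (hp : ∀ 𝔹 ∈ gen.support, 𝔹.p < 2 ^ n)
    (hτ : ∀ b l₀, (pbdhSim n d n b l₀).overhead A.queries N ≤ τ) :
    ∃ B, instrTime B ≤ A.time + τ ∧
      |winLarge gen N (fun 𝔹 => world 𝔹 d n A d 0 0 none) -
        winLarge gen N (fun 𝔹 => world 𝔹 d n A d 0 n none)| ≤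
      (2 * n : ℕ) * advPBDH1 gen B + (2 * n : ℕ) * invLarge gen N := by
  obtain ⟨B, hB, h⟩ := chain_le (adv := fun B => 2 * advPBDH1 gen B) (e := 2 * invLarge gen N)
    (P := fun B => instrTime B ≤ A.time + τ) (m := n)
    (fun l => winLarge gen N fun 𝔹 => world 𝔹 d n A d 0 l none) ⟨[], Nat.zero_le _⟩ fun l hl => by
      obtain ⟨B, hB, h1⟩ := pbdh_step (d := d) (gen := gen) (N := N) A hp false ⟨l, hl⟩
      obtain ⟨B', hB', h2⟩ := pbdh_step (d := d) (gen := gen) (N := N) A hp true ⟨l, hl⟩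
      obtain ⟨C, hC, h3, h4⟩ := exists_better (adv := advPBDH1 gen)
        (P := fun B => instrTime B ≤ A.time + τ) (hB.trans (Nat.add_le_add_left (hτ _ _) _))
        (hB'.trans (Nat.add_le_add_left (hτ _ _) _))
      simp only [Bool.false_eq_true, if_false, add_zero, if_true] at h1 h2
      rw [abs_sub_comm] at h2
      exact ⟨C, hC, (abs_sub_le _ _ _).trans ((add_le_add h1 h2).trans (by linarith))⟩
  refine ⟨B, hB, h.trans (le_of_eq ?_)⟩
  push_cast
  ring

/-- Bound for the number of statistical errors `1/p`. -/
def errConst (d n Q : ℕ) : ℕ :=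
  2 * (Fintype.card (SI d n) + Q * (Fintype.card (KI d n) + Fintype.card (WC d n))) + 2 * n +
    2 * (d * (Fintype.card (E0 d) + Q * n))

theorem expec_split (N : ℕ) (F : BilinearGroup → ℝ) (hF : ∀ 𝔹, |F 𝔹| ≤ 1) : expec gen F =
    expec gen (fun 𝔹 => if N ≤ 𝔹.p then F 𝔹 else 0) + expec gen fun 𝔹 => if N ≤ 𝔹.p then 0 else F 𝔹 := by
  rw [← expec_add (C := 1) (D := 1)]
  · congr 1
    funext 𝔹
    split_ifs <;> simp
  · exact fun 𝔹 => abs_ite_le _ (hF 𝔹)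
  · intro 𝔹
    split_ifs
    · simp
    · exact hF 𝔹

theorem error_le {c : ℕ} (hc : c ≤ N) : c * invLarge gen N +
    expec gen (fun 𝔹 => if N ≤ 𝔹.p then 0 else 1) ≤ expec gen fun 𝔹 => min 1 ((N : ℝ) / 𝔹.p) := by
  have hb : ∀ 𝔹 : BilinearGroup, |(c : ℝ) * if N ≤ 𝔹.p then 1 / (𝔹.p : ℝ) else 0| ≤ c := fun 𝔹 => by
    rw [abs_mul, Nat.abs_cast]
    exact mul_le_of_le_one_right (Nat.cast_nonneg _) (abs_ite_le _ (abs_one_div_p_le 𝔹))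
  have hb' : ∀ 𝔹 : BilinearGroup, |(if N ≤ 𝔹.p then 0 else 1 : ℝ)| ≤ 1 := fun 𝔹 => by
    split_ifs <;> simp
  rw [invLarge, ← expec_const_mul, ← expec_add hb hb']
  refine expec_mono (C := c + 1) (D := 1) (fun 𝔹 => (abs_add_le _ _).trans (add_le_add (hb 𝔹) (hb' 𝔹)))
    (fun 𝔹 => abs_min_one_div _ _) fun 𝔹 _ => ?_
  have hp : (0 : ℝ) < 𝔹.p := by exact_mod_cast 𝔹.prime.pos
  by_cases hN : N ≤ 𝔹.p
  · simp only [if_pos hN, add_zero, mul_one_div]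
    rw [min_eq_right ((div_le_one hp).2 (by exact_mod_cast hN))]
    gcongr
  · simp only [if_neg hN, mul_zero, zero_add]
    rw [min_eq_left ((one_le_div hp).2 (by exact_mod_cast (not_le.1 hN).le))]

/-- The concrete bound. -/
theorem trueWorld_bound (hp : ∀ 𝔹 ∈ gen.support, 𝔹.p < 2 ^ n)
    (hτ₁ : ∀ b l₀, (pbdhSim n d n b l₀).overhead A.queries N ≤ τ)
    (hτ₂ : ∀ k u b, (ddhSim n d n k u b).overhead A.queries N ≤ τ)
    (hτ₃ : N * 24 + 8 ≤ τ) (hN : errConst d n A.queries ≤ N) :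
    ∃ B₁ B₂, instrTime B₁ ≤ A.time + τ ∧ instrTime B₂ ≤ A.time + τ ∧
      |expec gen (fun 𝔹 => pr (trueWorld 𝔹 d n A false)) -
        expec gen (fun 𝔹 => pr (trueWorld 𝔹 d n A true))| ≤ (2 * n + 2) * advPBDH1 gen B₁ +
        (if A.queries = 0 then 0 else 2 * d * Fintype.card (E0 d) : ℕ) * advDDH2 gen B₂ ∧
      expec gen (fun 𝔹 => min 1 ((N : ℝ) / 𝔹.p)) ≤ 2 * advPBDH1 gen B₁ := by
  obtain ⟨G, hG, h1⟩ := exists_guess_adv gen n N hp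
  obtain ⟨P, hP, h2⟩ := pbdh_total gen A hp hτ₁
  obtain ⟨D, hD, h3⟩ := ddh_total gen A hp hτ₂ false
  obtain ⟨D', hD', h4⟩ := ddh_total gen A hp hτ₂ true
  obtain ⟨B₁, hB₁, h5, h6⟩ := exists_better (adv := advPBDH1 gen)
    (P := fun B => instrTime B ≤ A.time + τ) hP ((hG.trans hτ₃).trans (Nat.le_add_left _ _))
  obtain ⟨B₂, hB₂, h7, h8⟩ := exists_better (adv := advDDH2 gen)
    (P := fun B => instrTime B ≤ A.time + τ) hD hD'
  refine ⟨B₁, B₂, hB₁, hB₂, ?_, by linarith⟩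
  have h9 : ∀ b, |winLarge gen N (fun 𝔹 => trueWorld 𝔹 d n A b) -
      winLarge gen N (fun 𝔹 => world 𝔹 d n A 0 0 (if b then n else 0) none)| ≤
      (Fintype.card (SI d n) + A.queries * (Fintype.card (KI d n) + Fintype.card (WC d n)) : ℕ) *
        invLarge gen N := fun b => winLarge_close fun 𝔹 =>
    (trueWorld_close A b).mono (le_of_eq (by push_cast; ring))
  have h10 := h9 false
  have h11 := h9 true
  have h12 := error_le gen hN
  have h13 : |expec gen (fun 𝔹 => if N ≤ 𝔹.p then 0 else pr (trueWorld 𝔹 d n A false)) -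
      expec gen (fun 𝔹 => if N ≤ 𝔹.p then 0 else pr (trueWorld 𝔹 d n A true))| ≤
      expec gen (fun 𝔹 => if N ≤ 𝔹.p then 0 else 1) := by
    have hb : ∀ b, ∀ 𝔹 : BilinearGroup, |if N ≤ 𝔹.p then 0 else pr (trueWorld 𝔹 d n A b)| ≤ 1 :=
      fun b 𝔹 => by
        split_ifs
        · simp
        · exact abs_pr_le _
    refine abs_expec_sub_le (hb false) (hb true) (E := 1) (fun 𝔹 => by split_ifs <;> simp) fun 𝔹 _ => ?_
    split_ifs
    · simp
    · exact abs_pr_sub_le _ _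
  rw [expec_split gen N _ fun 𝔹 => abs_pr_le _,
    expec_split gen N (fun 𝔹 => pr (trueWorld 𝔹 d n A true)) fun 𝔹 => abs_pr_le _]
  simp only [Bool.false_eq_true, if_false, if_true] at h3 h4 h10 h11
  have h14 : ((if A.queries = 0 then 0 else 2 * d * Fintype.card (E0 d) : ℕ) : ℝ) =
      2 * ((if A.queries = 0 then 0 else d * Fintype.card (E0 d) : ℕ) : ℝ) := by
    split_ifs <;> push_cast <;> ring
  rw [h14]
  set κ : ℝ := ((if A.queries = 0 then 0 else d * Fintype.card (E0 d) : ℕ) : ℝ) with hκ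
  have hκ0 : 0 ≤ κ := Nat.cast_nonneg _
  have h15 : κ * advDDH2 gen D ≤ κ * advDDH2 gen B₂ := by gcongr
  have h16 : κ * advDDH2 gen D' ≤ κ * advDDH2 gen B₂ := by gcongr
  have h17 : ((2 * n : ℕ) : ℝ) * advPBDH1 gen P ≤ (2 * n : ℕ) * advPBDH1 gen B₁ := by gcongr
  rw [errConst] at h12
  push_cast at h2 h3 h4 h10 h11 h12 h17
  unfold winLarge at h2 h3 h4 h10 h11
  rw [abs_le] at h2 h3 h4 h10 h11 h13 ⊢
  constructor <;> linarith
end Bound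

/-! ## Polynomial bounds for running times -/

/-- Functions of two arguments that are bounded by a polynomial. -/
def PB (F : ℕ → ℕ → ℕ) : Prop := ∃ C k, ∀ n Q, F n Q ≤ C * (n + Q + 1) ^ k

namespace PB

variable {F G : ℕ → ℕ → ℕ}

theorem const (c : ℕ) : PB fun _ _ => c := ⟨c, 0, fun _ _ => by simp⟩

theorem fst : PB fun n _ => n := ⟨1, 1, fun _ _ => by simp; omega⟩

theorem snd : PB fun _ Q => Q := ⟨1, 1, fun _ _ => by simp; omega⟩

theorem add (hF : PB F) (hG : PB G) : PB fun n Q => F n Q + G n Q := by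
  obtain ⟨C, k, h⟩ := hF
  obtain ⟨C', k', h'⟩ := hG
  refine ⟨C + C', k + k', fun n Q => ?_⟩
  have h1 : (n + Q + 1) ^ k ≤ (n + Q + 1) ^ (k + k') := Nat.pow_le_pow_right (by omega) (by omega)
  have h2 : (n + Q + 1) ^ k' ≤ (n + Q + 1) ^ (k + k') := Nat.pow_le_pow_right (by omega) (by omega)
  calc _ ≤ C * (n + Q + 1) ^ k + C' * (n + Q + 1) ^ k' := add_le_add (h n Q) (h' n Q)
    _ ≤ C * (n + Q + 1) ^ (k + k') + C' * (n + Q + 1) ^ (k + k') := by gcongr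
    _ = _ := by ring

theorem mul (hF : PB F) (hG : PB G) : PB fun n Q => F n Q * G n Q := by
  obtain ⟨C, k, h⟩ := hF
  obtain ⟨C', k', h'⟩ := hG
  refine ⟨C * C', k + k', fun n Q => ?_⟩
  calc _ ≤ (C * (n + Q + 1) ^ k) * (C' * (n + Q + 1) ^ k') := Nat.mul_le_mul (h n Q) (h' n Q)
    _ = _ := by ring

theorem negCost (h : PB F) : PB fun n Q => negCost (F n Q) := by
  unfold LossyHIB.negCost
  repeat' with_reducible first | exact const _ | exact h | apply add | apply mul

theorem valCost {d : ℕ} (h : PB F) : PB fun n Q => valCost d (F n Q) := by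
  unfold LossyHIB.valCost
  repeat' with_reducible first | exact const _ | exact h | apply add | apply mul

theorem ddhCost {d : ℕ} : PB fun n _ => ddhCost n d := by
  unfold LossyHIB.ddhCost
  repeat' with_reducible first | exact const _ | exact fst | apply negCost | apply add

theorem starVCost {d : ℕ} (h : PB F) : PB fun n Q => starVCost d (F n Q) := by
  unfold LossyHIB.starVCost
  repeat' with_reducible first | exact const _ | exact h | apply add | apply mul

theorem uCost {d : ℕ} (h : PB F) : PB fun n Q => uCost d (F n Q) := by
  unfold LossyHIB.uCost
  repeat' with_reducible first | exact const _ | exact h | apply valCost | apply add | apply mul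

theorem shiftCost {d : ℕ} (h : PB F) : PB fun n Q => shiftCost d (F n Q) := by
  unfold LossyHIB.shiftCost
  repeat' with_reducible first | exact const _ | exact h | apply starVCost | apply uCost | apply add | apply mul

theorem simValCost {d : ℕ} (h : PB F) : PB fun n Q => simValCost d (F n Q) := by
  unfold LossyHIB.simValCost
  repeat' with_reducible first | exact const _ | exact h | apply uCost | apply shiftCost | apply add

theorem keyCost {d : ℕ} (h : PB F) : PB fun n Q => keyCost d (F n Q) := by
  unfold LossyHIB.keyCost
  repeat' with_reducible first | exact const _ | exact h | apply simValCost | apply shiftCost | apply add | apply mul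

theorem pbdhCost {d : ℕ} : PB fun n _ => pbdhCost n d := by
  unfold LossyHIB.pbdhCost pbdhDelCost
  repeat' with_reducible first | exact const _ | exact fst | apply negCost | apply keyCost | apply add | apply mul

end PB

/-! ### Numbers of variables -/

theorem card_E0 (d : ℕ) : Fintype.card (E0 d) = (d * 2 + 1) * (d + 1) + d := by
  simp [Fintype.card_sum, Fintype.card_prod, Fintype.card_option]

theorem card_KI (d n : ℕ) : Fintype.card (KI d n) = ((d * 2 + 1) * (d + 1) + d) * n := by
  rw [← card_E0, ← Fintype.card_fin n, ← Fintype.card_prod]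
  exact Fintype.card_congr (Equiv.cast (by rw [Fintype.card_fin]))

theorem card_WI (d n : ℕ) : Fintype.card (WI d n) = (d * 2 + 1) * n + ((d * 2 + 1) * (d + 1) + d) * n := by
  rw [← card_KI, ← Nat.card_eq_fintype_card, ← Nat.card_eq_fintype_card, Nat.card_sum]
  congr 1
  simp [Nat.card_eq_fintype_card]

theorem card_WC (d n : ℕ) : Fintype.card (WC d n) =
    (((d * 2 + 1) * (d + 1) + d) * n + ((d * 2 + 1) * (d + 1) + d) * n) + (n + d * (2 * n)) := by
  rw [← card_KI, ← Nat.card_eq_fintype_card, ← Nat.card_eq_fintype_card, Nat.card_sum, Nat.card_sum]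
  congr 1
  simp [Nat.card_eq_fintype_card]

theorem card_SI_le (d n : ℕ) : Fintype.card (SI d n) ≤ 2 + (n + (d * (3 * n) + (n + d * 2))) := by
  refine (Fintype.card_le_of_injective (β := Fin 2 ⊕ Fin n ⊕ (Fin d × Fin 3 × Fin n) ⊕ Fin n ⊕ Fin d × Fin 2)
    (fun x => match x with
      | .v => .inl 0
      | .ow => .inl 1
      | .w l => .inr (.inl l)
      | .h i i₂ l => .inr (.inr (.inl (i, i₂, l)))
      | .s l => .inr (.inr (.inr (.inl l)))
      | .oc i k => .inr (.inr (.inr (.inr (i, k))))) ?_).trans (by simp)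
  intro x y h
  cases x <;> cases y <;> simp_all

theorem card_MI_le (d n : ℕ) : Fintype.card (MI d n) ≤
    1 + (n + (d * (3 * n) + (n + (n * n + d * (2 * (n * n)))))) := by
  refine (Fintype.card_le_of_injective (β := Fin 1 ⊕ Fin n ⊕ (Fin d × Fin 3 × Fin n) ⊕ Fin n ⊕
      (Fin n × Fin n) ⊕ Fin d × Fin 2 × Fin n × Fin n)
    (fun x => match x with
      | .v => .inl 0
      | .w l => .inr (.inl l)
      | .h i i₂ l => .inr (.inr (.inl (i, i₂, l)))
      | .J l => .inr (.inr (.inr (.inl l)))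
      | .Cw l₂ l₁ => .inr (.inr (.inr (.inr (.inl (l₂, l₁)))))
      | .C i k l₂ l₁ => .inr (.inr (.inr (.inr (.inr (i, k, l₂, l₁)))))) ?_).trans (by simp)
  intro x y h
  cases x <;> cases y <;> simp_all

theorem length_listOf {α : Type} {m c : ℕ} {f : Fin m → List α} (h : ∀ i, (f i).length = c) :
    (listOf f).length = m * c := by
  rw [listOf, List.length_flatten, List.map_ofFn, List.sum_ofFn]
  simp [h]

theorem length_mpkList (d n : ℕ) : (mpkList d n).length =
    1 + n * 1 + d * (3 * (n * 1)) + n * 1 + n * (n * 1) + d * (2 * (n * (n * 1))) := by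
  simp only [mpkList, List.length_append]
  refine congrArg₂ _ (congrArg₂ _ (congrArg₂ _ (congrArg₂ _ (congrArg₂ _ rfl ?_) ?_) ?_) ?_) ?_
  · exact length_listOf fun _ => rfl
  · exact length_listOf fun _ => length_listOf fun _ => length_listOf fun _ => rfl
  · exact length_listOf fun _ => rfl
  · exact length_listOf fun _ => length_listOf fun _ => rfl
  · exact length_listOf fun _ => length_listOf fun _ => length_listOf fun _ => length_listOf fun _ => rfl

theorem length_wireList (d n : ℕ) : (wireList d n).length =
    n * 1 + n * 1 + d * (n * 1) + d * (2 * (n * 1)) + d * (n * 1) + d * (2 * (d * (n * 1))) +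
      d * (2 * (n * 1)) := by
  simp only [wireList, List.length_append]
  refine congrArg₂ _ (congrArg₂ _ (congrArg₂ _ (congrArg₂ _ (congrArg₂ _ (congrArg₂ _ ?_ ?_) ?_) ?_) ?_)
    ?_) ?_
  · exact length_listOf fun _ => rfl
  · exact length_listOf fun _ => rfl
  · exact length_listOf fun _ => length_listOf fun _ => rfl
  · exact length_listOf fun _ => length_listOf fun _ => length_listOf fun _ => rfl
  · exact length_listOf fun _ => length_listOf fun _ => rfl
  · exact length_listOf fun _ => length_listOf fun _ => length_listOf fun _ => length_listOf fun _ => rfl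
  · exact length_listOf fun _ => length_listOf fun _ => length_listOf fun _ => rfl

/-! ### Running time of the simulators -/

/-- Upper bound for the additional running time of a simulator, for bounds `M` for the numbers of its
variables and `c` for the size of its circuits. -/
def simCost (d M c Q N : ℕ) : ℕ :=
  (M + d + (M + d + (M + M)) + (d + 7 + (M + M + (Q + (Q * d + Q * M))))) * 3 +
  (SimDesc.readIdCost d + (d * (d * 18 + 7 + 1 + 1 + 1 + 1) + (M + (M * (c + 1) + (4 + M))))) +
  Q * ((SimDesc.readIdCost d + (2 + (M + (M * (c + 1) + (d * 2 + (9 + (d * 18 + 7) + 5 + 1)))))) +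
    (SimDesc.readIdCost d + (2 + (2 + ((Q * (d * 8 + 26) + 7 + 1 + M * (Q * (d * 8 + 19) + 3 + 1)) +
      (M + (M * (c + 1) + (d * (d * 30 + 16 + 1) + (9 + 9 + 5 + (9 + (d * 14 + 7) + 5) + 5 + 1)))))))) +
    (SimDesc.readIdCost d + (2 + ((Q * (d * 8 + 26) + 7 + 1 + M * (Q * (d * 8 + 19) + 3 + 1)) +
      (M * (c + 1) + (4 + (4 + (4 + ((9 + (9 + (d * 22 + 3 + 4) + 5 + 4) + 5 + 1) +
      ((9 + (9 + (d * 22 + 3 + 4) + 5) + 5 + 1) + (1 + (M + 1)))))))))))) +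
  (2 + (9 + (N * 22 + 7 + 4) + 5 + 1)) + 1

theorem SimDesc.overhead_le {nb d : ℕ} (S : SimDesc nb d) {M : ℕ} (Q N : ℕ) (hni : S.ni ≤ M)
    (hEv : Fintype.card S.Ev ≤ M) (hKc : Fintype.card S.Kc ≤ M) (hCo : Fintype.card S.Co ≤ M)
    (hMI : Fintype.card S.MI ≤ M) (hWI : Fintype.card S.WI ≤ M) (hml : S.ml.length ≤ M)
    (hwl : S.wl.length ≤ M) : S.overhead Q N ≤ simCost d M S.cost Q N := by
  simp only [overhead, setupCost, queryCost, createCost, delegateCost, revealCost, lookupCost, finalCost,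
    Fintype.card_sum, Fintype.card_prod, Fintype.card_fin, simCost]
  gcongr

theorem PB.simCost {d : ℕ} {M c N : ℕ → ℕ → ℕ} (hM : PB M) (hc : PB c) (hN : PB N) :
    PB fun n Q => simCost d (M n Q) (c n Q) Q (N n Q) := by
  unfold LossyHIB.simCost
  repeat' with_reducible first | exact const _ | exact hM | exact hc | exact hN | exact snd | apply add | apply mul

/-- Bound for the numbers of variables of the simulators. -/
def simVars (d n : ℕ) : ℕ :=
  8 + (2 + (n + (d * (3 * n) + (n + d * 2)))) + (1 + (n + (d * (3 * n) + (n + (n * n + d * (2 * (n * n))))))) +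
  4 * ((d * 2 + 1) * n + (((d * 2 + 1) * (d + 1) + d) * n)) + (n + d * (2 * n)) + n +
  (1 + n * 1 + d * (3 * (n * 1)) + n * 1 + n * (n * 1) + d * (2 * (n * (n * 1)))) +
  (n * 1 + n * 1 + d * (n * 1) + d * (2 * (n * 1)) + d * (n * 1) + d * (2 * (d * (n * 1))) +
      d * (2 * (n * 1)))

theorem ddh_overhead_le (d n k u Q N : ℕ) (b : Bool) :
    (ddhSim n d n k u b).overhead Q N ≤ simCost d (simVars d n) (ddhCost n d) Q N := by
  have hS := card_SI_le d n
  have hM := card_MI_le d n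
  refine SimDesc.overhead_le _ Q N ?_ ?_ ?_ ?_ ?_ ?_ ?_ ?_
  · show 5 ≤ _
    unfold simVars; omega
  · show Fintype.card (SI d n) ≤ _
    unfold simVars; omega
  · show Fintype.card (KI d n ⊕ KI d n) ≤ _
    rw [Fintype.card_sum, card_KI]
    unfold simVars; omega
  · show Fintype.card (WC d n ⊕ Fin n) ≤ _
    rw [Fintype.card_sum, card_WC, Fintype.card_fin]
    unfold simVars; omega
  · show Fintype.card (MI d n) ≤ _
    unfold simVars; omega
  · show Fintype.card (WI d n) ≤ _
    rw [card_WI]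
    unfold simVars; omega
  · show (mpkList d n).length ≤ _
    rw [length_mpkList]
    unfold simVars; omega
  · show (wireList d n).length ≤ _
    rw [length_wireList]
    unfold simVars; omega

theorem pbdh_overhead_le (d n Q N : ℕ) (b : Bool) (l₀ : Fin n) :
    (pbdhSim n d n b l₀).overhead Q N ≤ simCost d (simVars d n) (pbdhCost n d) Q N := by
  have hS := card_SI_le d n
  have hM := card_MI_le d n
  refine SimDesc.overhead_le _ Q N ?_ ?_ ?_ ?_ ?_ ?_ ?_ ?_
  · show 8 ≤ _
    unfold simVars; omega
  · show Fintype.card (SI d n) ≤ _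
    unfold simVars; omega
  · show Fintype.card (WI d n) ≤ _
    rw [card_WI]
    unfold simVars; omega
  · show Fintype.card (WC d n) ≤ _
    rw [card_WC]
    unfold simVars; omega
  · show Fintype.card (MI d n) ≤ _
    unfold simVars; omega
  · show Fintype.card (WI d n) ≤ _
    rw [card_WI]
    unfold simVars; omega
  · show (mpkList d n).length ≤ _
    rw [length_mpkList]
    unfold simVars; omega
  · show (wireList d n).length ≤ _
    rw [length_wireList]
    unfold simVars; omega

theorem errConst_le (d n Q : ℕ) : errConst d n Q ≤
    2 * (simVars d n + Q * (simVars d n + simVars d n)) + 2 * n +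
      2 * (d * (((d * 2 + 1) * (d + 1) + d) + Q * n)) := by
  have hS := card_SI_le d n
  have h1 : Fintype.card (SI d n) ≤ simVars d n := by unfold simVars; omega
  have h2 : Fintype.card (KI d n) ≤ simVars d n := by rw [card_KI]; unfold simVars; omega
  have h3 : Fintype.card (WC d n) ≤ simVars d n := by rw [card_WC]; unfold simVars; omega
  rw [errConst, card_E0]
  gcongr

theorem PB.simVars {d : ℕ} : PB fun n _ => simVars d n := by
  unfold LossyHIB.simVars
  repeat' with_reducible first | exact const _ | exact fst | apply add | apply mul

/-- Bound below which the groups are treated by exhaustive search. -/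
def threshold (d n Q : ℕ) : ℕ :=
  2 * (simVars d n + Q * (simVars d n + simVars d n)) + 2 * n +
      2 * (d * (((d * 2 + 1) * (d + 1) + d) + Q * n)) + 2 ^ (2 * d * ((d * 2 + 1) * (d + 1) + d))

/-- Additional running time of the reductions. -/
def reductionTime (d n Q : ℕ) : ℕ :=
  simCost d (simVars d n) (pbdhCost n d) Q (threshold d n Q) +
    simCost d (simVars d n) (ddhCost n d) Q (threshold d n Q) + (threshold d n Q * 24 + 8)

theorem PB.threshold {d : ℕ} : PB fun n Q => threshold d n Q := by
  unfold LossyHIB.threshold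
  repeat' with_reducible first | exact const _ | exact fst | exact snd | exact simVars | apply add | apply mul

theorem PB.reductionTime {d : ℕ} : PB fun n Q => reductionTime d n Q :=
  ((simCost simVars pbdhCost threshold).add (simCost simVars ddhCost threshold)).add
    ((threshold.mul (const 24)).add (const 8))

theorem polynomial_eval_mono (P : Polynomial ℕ) {a b : ℕ} (h : a ≤ b) : P.eval a ≤ P.eval b := by
  rw [Polynomial.eval_eq_sum, Polynomial.eval_eq_sum]
  exact Finset.sum_le_sum fun i _ => Nat.mul_le_mul_left _ (Nat.pow_le_pow_left h i)

theorem PB.exists_polynomial {F : ℕ → ℕ → ℕ} (hF : PB F) {n : ℕ → ℕ} (hn : PolyBounded n) :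
    ∃ T : Polynomial ℕ, ∀ ϱ Q, F (n ϱ) Q ≤ T.eval (ϱ + Q) := by
  obtain ⟨C, k, h⟩ := hF
  obtain ⟨P, hP⟩ := hn
  refine ⟨Polynomial.C C * (P + Polynomial.X + 1) ^ k, fun ϱ Q => (h _ _).trans ?_⟩
  simp only [Polynomial.eval_mul, Polynomial.eval_C, Polynomial.eval_pow, Polynomial.eval_add,
    Polynomial.eval_X, Polynomial.eval_one]
  have h1 : n ϱ ≤ P.eval (ϱ + Q) := (hP ϱ).trans (polynomial_eval_mono P (Nat.le_add_right _ _))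
  gcongr
  omega

/-! ## Adversaries that do not reveal keys -/

/-- The adversary without its oracle queries. -/
def Adversary.withoutQueries (A : Adversary) : Adversary :=
  ⟨A.choose, A.attack.filter fun c => !c.isQuery⟩

theorem queries_withoutQueries (A : Adversary) : A.withoutQueries.queries = 0 := by
  simp [Adversary.queries, Adversary.withoutQueries, List.countP_eq_zero]

theorem time_withoutQueries (A : Adversary) : A.withoutQueries.time ≤ A.time := by
  refine Nat.add_le_add_left ?_ _
  show ((A.attack.filter fun c => !c.isQuery).map Cmd.cost).sum ≤ _
  induction A.attack with
  | nil => simp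
  | cons c cs ih =>
    rw [List.filter_cons]
    split_ifs <;> simp only [List.map_cons, List.sum_cons] <;> omega

section NoReveals

variable {𝔹 : BilinearGroup} {S : HIBTDF 𝔹} {kg : List S.Comp → PMF S.SK}
  {del : List S.Comp → S.SK → S.Comp → PMF S.SK} {target : List S.Comp}

theorem exec_query_cases {c : Cmd} (hc : c.isQuery = true) {st s : GameState S}
    (hs : s ∈ (c.exec S kg del target st).support) :
    (s.mem = st.mem ∧ s.reveals = st.reveals) ∨ s.reveals = st.reveals + 1 := by
  cases c with
  | loc i => cases hc
  | createKey flag r =>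
    simp only [Cmd.exec] at hs
    split_ifs at hs
    · rw [PMF.support_map] at hs
      obtain ⟨sk, -, rfl⟩ := hs
      exact .inl ⟨rfl, rfl⟩
    · rw [PMF.mem_support_pure_iff] at hs
      exact .inl ⟨by rw [hs], by rw [hs]⟩
  | createDelegatedKey flag r x =>
    simp only [Cmd.exec] at hs
    split at hs
    · split_ifs at hs
      · rw [PMF.support_map] at hs
        obtain ⟨sk, -, rfl⟩ := hs
        exact .inl ⟨rfl, rfl⟩
      · rw [PMF.mem_support_pure_iff] at hs
        exact .inl ⟨by rw [hs], by rw [hs]⟩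
    · rw [PMF.mem_support_pure_iff] at hs
      exact .inl ⟨by rw [hs], by rw [hs]⟩
  | revealKey flag r dst =>
    simp only [Cmd.exec] at hs
    by_cases hf : (st.mem flag).toBit = true
    · rw [if_pos hf] at hs
      split at hs
      · split_ifs at hs <;>
        · rw [PMF.mem_support_pure_iff] at hs
          exact .inr (by rw [hs])
      · rw [PMF.mem_support_pure_iff] at hs
        exact .inr (by rw [hs])
    · rw [if_neg hf, PMF.mem_support_pure_iff] at hs
      exact .inl ⟨by rw [hs], by rw [hs]⟩

theorem reveals_exec_le {c : Cmd} {st s : GameState S}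
    (hs : s ∈ (c.exec S kg del target st).support) : st.reveals ≤ s.reveals := by
  cases hc : c.isQuery with
  | true => rcases exec_query_cases hc hs with h | h <;> omega
  | false =>
    cases c with
    | loc i =>
      rw [Cmd.exec, PMF.support_map] at hs
      obtain ⟨m, -, rfl⟩ := hs
      exact le_rfl
    | _ => cases hc

theorem reveals_runCmds_le {cs : List Cmd} {st s : GameState S}
    (hs : s ∈ (runCmds S kg del target cs st).support) : st.reveals ≤ s.reveals := by
  induction cs generalizing st with
  | nil =>
    rw [runCmds, PMF.mem_support_pure_iff] at hs
    rw [hs]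
  | cons c cs ih =>
    rw [runCmds, PMF.mem_support_bind_iff] at hs
    obtain ⟨s', h, h'⟩ := hs
    exact (reveals_exec_le h).trans (ih h')

/-- Without reveal queries, the oracle has no influence on the memory of the adversary. -/
theorem runCmds_map_mem {cs : List Cmd} {st st' : GameState S} (hm : st.mem = st'.mem)
    (h : ∀ s ∈ (runCmds S kg del target cs st).support, s.reveals ≤ st.reveals) :
    (runCmds S kg del target cs st).map GameState.mem =
      (runCmds S kg del target (cs.filter fun c => !c.isQuery) st').map GameState.mem := by
  induction cs generalizing st st' with
  | nil => simp [runCmds, PMF.pure_map, hm]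
  | cons c cs ih =>
    simp only [runCmds, PMF.mem_support_bind_iff] at h
    cases hc : c.isQuery with
    | true =>
      rw [List.filter_cons_of_neg (by simp [hc]), runCmds, PMF.map_bind]
      rw [bind_congr_support (g := fun _ => (runCmds S kg del target
        (cs.filter fun c => !c.isQuery) st').map GameState.mem) _ fun s hs => ?_, PMF.bind_const]
      obtain ⟨s', hs'⟩ := (runCmds S kg del target cs s).support_nonempty
      have h1 := h s' ⟨s, hs, hs'⟩
      have h2 := reveals_runCmds_le hs'
      rcases exec_query_cases hc hs with ⟨h3, h4⟩ | h3
      · exact ih (h3.trans hm) fun s'' h'' => (h s'' ⟨s, hs, h''⟩).trans h4.ge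
      · omega
    | false =>
      rw [List.filter_cons_of_pos (by simp [hc])]
      cases c with
      | loc i =>
        simp only [runCmds, Cmd.exec, PMF.bind_map, PMF.map_bind, hm]
        refine bind_congr_support _ fun m hmm => ?_
        refine ih rfl fun s hs => h s ⟨{ st with mem := m }, ?_, hs⟩
        rw [Cmd.exec, PMF.support_map, hm]
        exact ⟨m, hmm, rfl⟩
      | _ => cases hc

theorem experimentAt_map_dA_withoutQueries {S : HIBTDF 𝔹} {L : Sibling S} {ω ζ : ℝ} {A : Adversary}
    {b : Bool} (h : ∀ o ∈ (experimentAt S L (trivialPreOutput S) ω ζ A b).support, o.reveals ≤ 0) :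
    (experimentAt S L (trivialPreOutput S) ω ζ A b).map Outcome.dA =
      (experimentAt S L (trivialPreOutput S) ω ζ A.withoutQueries b).map Outcome.dA := by
  classical
  simp only [experimentAt, trivialPreOutput, PMF.map_bind, PMF.pure_map] at h ⊢
  refine bind_congr_support _ fun m hm => bind_congr_support _ fun k₀ hk₀ =>
    bind_congr_support _ fun k₁ hk₁ => ?_
  have h1 : ∀ μ : PMF (GameState S), (μ.bind fun st => PMF.pure (st.mem 0).toBit) =
      (μ.map GameState.mem).bind fun m => PMF.pure (m 0).toBit := fun μ => by
    rw [PMF.bind_map]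
    rfl
  rw [h1, h1, runCmds_map_mem rfl fun s hs => ?_]
  · rfl
  · simp only [PMF.mem_support_bind_iff, PMF.mem_support_pure_iff] at h
    exact h _ ⟨m, hm, k₀, hk₀, k₁, hk₁, s, hs, rfl⟩

end NoReveals

/-! ## The concrete bound -/

section Bound

variable {d n : ℕ} {gen : PMF BilinearGroup}

theorem lt_two_pow {p : ℕ} (hp : 0 < p) (h : Real.logb 2 p < n) : p < 2 ^ n := by
  have h1 : (p : ℝ) < 2 ^ (n : ℝ) :=
    (Real.logb_lt_iff_lt_rpow (by norm_num) (by exact_mod_cast hp)).1 h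
  rw [Real.rpow_natCast] at h1
  exact_mod_cast h1

theorem threshold_ge (d n Q : ℕ) : errConst d n Q ≤ threshold d n Q :=
  (errConst_le d n Q).trans (Nat.le_add_right _ _)

theorem advPBDH1_nonneg (gen : PMF BilinearGroup) (B : List Instr) : 0 ≤ advPBDH1 gen B := abs_nonneg _

theorem advDDH2_nonneg (gen : PMF BilinearGroup) (B : List Instr) : 0 ≤ advDDH2 gen B := abs_nonneg _

theorem exists_reductions (hd : 1 ≤ d) (hn : ∀ 𝔹 ∈ gen.support, Real.logb 2 𝔹.p < n) (A : Adversary) :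
    ∃ B₁ B₂, instrTime B₁ ≤ A.time + reductionTime d n A.queries ∧
      instrTime B₂ ≤ A.time + reductionTime d n A.queries ∧
      |expec gen (fun 𝔹 => pr (trueWorld 𝔹 d n A false)) -
        expec gen (fun 𝔹 => pr (trueWorld 𝔹 d n A true))| ≤
        n * ((2 * d + 1) * advPBDH1 gen B₁ + (if A.queries = 0 then 0 else 1) * advDDH2 gen B₂) := by
  have hp : ∀ 𝔹 ∈ gen.support, 𝔹.p < 2 ^ n := fun 𝔹 h => lt_two_pow 𝔹.prime.pos (hn 𝔹 h)
  obtain ⟨𝔹₀, h𝔹₀⟩ := gen.support_nonempty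
  have hn2 : 2 ≤ n := by
    by_contra hlt
    have h1 : 2 ^ n ≤ 2 ^ 1 := Nat.pow_le_pow_right (by norm_num) (by omega)
    have := hp 𝔹₀ h𝔹₀
    have := 𝔹₀.prime.two_le
    omega
  obtain ⟨B₁, B₂, hB₁, hB₂, h1, h2⟩ := trueWorld_bound gen A (N := threshold d n A.queries)
    (τ := reductionTime d n A.queries) hp
    (fun b l₀ => (pbdh_overhead_le d n _ _ b l₀).trans
      ((Nat.le_add_right _ _).trans (Nat.le_add_right _ _)))
    (fun k u b => (ddh_overhead_le d n k u _ _ b).trans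
      ((Nat.le_add_left _ _).trans (Nat.le_add_right _ _)))
    (Nat.le_add_left _ _) (threshold_ge d n _)
  refine ⟨B₁, B₂, hB₁, hB₂, ?_⟩
  have hn2' : (2 : ℝ) ≤ n := by exact_mod_cast hn2
  have hd' : (1 : ℝ) ≤ d := by exact_mod_cast hd
  have ha₁ := advPBDH1_nonneg gen B₁
  have ha₂ := advDDH2_nonneg gen B₂
  by_cases hlarge : 2 * d * Fintype.card (E0 d) ≤ n
  · refine h1.trans ?_
    rw [mul_add, ← mul_assoc, ← mul_assoc]
    have h3 : (2 * n + 2 : ℝ) ≤ n * (2 * d + 1) := by nlinarith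
    gcongr
    split_ifs
    · simp
    · rw [mul_one]
      exact_mod_cast hlarge
  · have h3 : expec gen (fun 𝔹 => min 1 ((threshold d n A.queries : ℝ) / 𝔹.p)) = 1 := by
      rw [expec_congr (g := fun _ => 1) fun 𝔹 h𝔹 => min_eq_left ?_, expec_const]
      rw [le_div_iff₀ (by exact_mod_cast 𝔹.prime.pos), one_mul]
      have h4 : 2 ^ n ≤ 2 ^ (2 * d * ((d * 2 + 1) * (d + 1) + d)) :=
        Nat.pow_le_pow_right (by norm_num) (by rw [← card_E0]; omega)
      exact_mod_cast (hp 𝔹 h𝔹).le.trans (h4.trans (Nat.le_add_left _ _))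
    have h4 : |expec gen (fun 𝔹 => pr (trueWorld 𝔹 d n A false)) -
        expec gen (fun 𝔹 => pr (trueWorld 𝔹 d n A true))| ≤ 1 := by
      rw [← pr_bind, ← pr_bind]
      exact abs_pr_sub_le _ _
    have h5 : 0 ≤ (if A.queries = 0 then 0 else 1) * advDDH2 gen B₂ := by
      split_ifs <;> simp [ha₂]
    have h6 : 2 * advPBDH1 gen B₁ ≤ n * ((2 * d + 1) * advPBDH1 gen B₁) := by
      rw [← mul_assoc]
      gcongr
      nlinarith
    have h7 : n * ((2 * d + 1) * advPBDH1 gen B₁) ≤ n * ((2 * d + 1) * advPBDH1 gen B₁ +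
        (if A.queries = 0 then 0 else 1) * advDDH2 gen B₂) := by
      gcongr
      linarith
    linarith

theorem trueWorld_withoutQueries (hd : 1 ≤ d) {ω : BilinearGroup → ℝ} {ζ : ℝ} {A : Adversary}
    (h : RevealsAtMost gen (selHF d n) (selLHF d n) (fun 𝔹 => trivialPreOutput (selHF d n 𝔹)) ω ζ A 0)
    (b : Bool) : expec gen (fun 𝔹 => pr (trueWorld 𝔹 d n A b)) =
      expec gen fun 𝔹 => pr (trueWorld 𝔹 d n A.withoutQueries b) := by
  refine expec_congr fun 𝔹 h𝔹 => ?_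
  rw [← experimentAt_map_dA hd (ω 𝔹) ζ A b, ← experimentAt_map_dA hd (ω 𝔹) ζ A.withoutQueries b,
    experimentAt_map_dA_withoutQueries fun o ho => h b o ?_]
  rw [experiment, PMF.mem_support_bind_iff]
  exact ⟨𝔹, h𝔹, ho⟩

theorem advLossy_le (hd : 1 ≤ d) (hn : ∀ 𝔹 ∈ gen.support, Real.logb 2 𝔹.p < n) {T : ℕ → ℕ}
    (hT : Monotone T) (hrT : ∀ Q, reductionTime d n Q ≤ T Q) (A : Adversary) (q : ℕ) (ζ : ℝ)
    (h : RevealsAtMost gen (selHF d n) (selLHF d n) (fun 𝔹 => trivialPreOutput (selHF d n 𝔹))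
      (fun 𝔹 => (n : ℝ) - Real.logb 2 𝔹.p) ζ A q) :
    ∃ B₁ B₂, instrTime B₁ ≤ A.time + T A.queries ∧ instrTime B₂ ≤ A.time + T A.queries ∧
      advLossy gen (selHF d n) (selLHF d n) (fun 𝔹 => trivialPreOutput (selHF d n 𝔹))
        (fun 𝔹 => (n : ℝ) - Real.logb 2 𝔹.p) ζ A ≤
        n * ((2 * d + 1) * advPBDH1 gen B₁ + q * advDDH2 gen B₂) := by
  rw [advLossy_eq hd gen hn]
  rcases Nat.eq_zero_or_pos q with rfl | hq
  · obtain ⟨B₁, B₂, h1, h2, h3⟩ := exists_reductions hd hn A.withoutQueries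
    have ht : A.withoutQueries.time + reductionTime d n A.withoutQueries.queries ≤
        A.time + T A.queries := by
      rw [queries_withoutQueries]
      exact add_le_add (time_withoutQueries A) ((hrT 0).trans (hT (Nat.zero_le _)))
    refine ⟨B₁, B₂, h1.trans ht, h2.trans ht, ?_⟩
    rw [trueWorld_withoutQueries hd h, trueWorld_withoutQueries hd h]
    rw [if_pos (queries_withoutQueries A)] at h3
    exact_mod_cast h3
  · obtain ⟨B₁, B₂, h1, h2, h3⟩ := exists_reductions hd hn A
    have ht := Nat.add_le_add_left (hrT A.queries) A.time
    refine ⟨B₁, B₂, h1.trans ht, h2.trans ht, h3.trans ?_⟩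
    have hq' : (1 : ℝ) ≤ q := by exact_mod_cast hq
    have ha₂ := advDDH2_nonneg gen B₂
    gcongr
    split_ifs <;> linarith

end Bound

/-! ## Partial lossiness -/

theorem nonNegligible_one : NonNegligible fun _ => 1 := by
  intro h
  have h0 := h 0
  simp only [pow_zero, one_mul] at h0
  exact one_ne_zero (tendsto_nhds_unique tendsto_const_nhds h0)

theorem prob_eq_one {α : Type} {μ : PMF α} {s : Set α} (h : ∀ a ∈ μ.support, a ∈ s) : prob μ s = 1 := by
  rw [prob, (PMF.toOuterMeasure_apply_eq_one_iff μ s).2 h, ENNReal.toReal_one]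

theorem prob_congr {α : Type} {μ : PMF α} {s t : Set α} (h : ∀ a ∈ μ.support, a ∈ s ↔ a ∈ t) :
    prob μ s = prob μ t := by
  rw [prob, prob]
  congr 1
  refine PMF.toOuterMeasure_apply_eq_of_inter_support_eq μ ?_
  ext a
  simp only [Set.mem_inter_iff]
  exact ⟨fun ha => ⟨(h a ha.2).1 ha.1, ha.2⟩, fun ha => ⟨(h a ha.2).2 ha.1, ha.2⟩⟩

theorem queries_le_time (A : Adversary) : A.queries ≤ A.time := by
  refine le_trans ?_ (Nat.le_add_left _ _)
  show A.attack.countP Cmd.isQuery ≤ _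
  induction A.attack with
  | nil => simp
  | cons c cs ih =>
    rw [List.countP_cons, List.map_cons, List.sum_cons]
    have : (if c.isQuery = true then 1 else 0) ≤ c.cost := by
      cases c <;> simp [Cmd.isQuery, Cmd.cost]
    omega

theorem polyBounded_comp {t Q : ℕ → ℕ} (ht : PolyBounded t) (hQ : ∀ ϱ, Q ϱ ≤ t ϱ) (T : Polynomial ℕ) :
    PolyBounded fun ϱ => t ϱ + T.eval (ϱ + Q ϱ) := by
  obtain ⟨P, hP⟩ := ht
  refine ⟨P + T.comp (Polynomial.X + P), fun ϱ => ?_⟩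
  rw [Polynomial.eval_add, Polynomial.eval_comp, Polynomial.eval_add, Polynomial.eval_X]
  exact add_le_add (hP ϱ) (polynomial_eval_mono T (Nat.add_le_add_left ((hQ ϱ).trans (hP ϱ)) ϱ))

theorem PolyBounded.mono {s t : ℕ → ℕ} (ht : PolyBounded t) (h : ∀ ϱ, s ϱ ≤ t ϱ) : PolyBounded s := by
  obtain ⟨P, hP⟩ := ht
  exact ⟨P, fun ϱ => (h ϱ).trans (hP ϱ)⟩

theorem Negligible.polyBounded_mul {t : ℕ → ℕ} {f : ℕ → ℝ} (ht : PolyBounded t) (hf : Negligible f)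
    : Negligible fun ϱ => t ϱ * f ϱ := by
  obtain ⟨P, hP⟩ := ht
  refine (Asymptotics.SuperpolynomialDecay.polynomial_mul hf (P.map (Nat.castRingHom ℝ))).trans_abs_le
    fun ϱ => ?_
  rw [abs_mul, abs_mul]
  refine mul_le_mul_of_nonneg_right ?_ (abs_nonneg _)
  rw [Polynomial.eval_natCast_map, Nat.abs_cast]
  refine le_trans ?_ (le_abs_self _)
  have h := hP ϱ
  rw [← Nat.cast_le (α := ℝ)] at h
  simpa using h

end LossyHIB

end

theorem theorem4
    (gen : ℕ → PMF BilinearGroup)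
    (hgen : ∀ ϱ, ∀ 𝔹 ∈ (gen ϱ).support, 2 ^ ϱ < 𝔹.p)
    (d : ℕ) (hd : 1 ≤ d)
    (n : ℕ → ℕ) (hn_poly : PolyBounded n)
    (hn : ∀ ϱ, ∀ 𝔹 ∈ (gen ϱ).support, Real.logb 2 𝔹.p < n ϱ) :
    -- `(n - log p, 1)`-partial lossiness under the two assumptions
    (PBDH1Assumption gen → DDH2Assumption gen →
      PartiallyLossy gen (fun ϱ 𝔹 => selHF d (n ϱ) 𝔹) (fun ϱ 𝔹 => selLHF d (n ϱ) 𝔹)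
        (fun ϱ 𝔹 => trivialPreOutput (selHF d (n ϱ) 𝔹))
        (fun ϱ 𝔹 => (n ϱ : ℝ) - Real.logb 2 𝔹.p) (fun _ => 1)) ∧
    -- the concrete bound, with reductions of comparable running time
    (∃ T : Polynomial ℕ, ∀ (ϱ : ℕ) (A : Adversary) (q : ℕ) (ζ : ℝ),
      RevealsAtMost (gen ϱ) (selHF d (n ϱ)) (selLHF d (n ϱ))
        (fun 𝔹 => trivialPreOutput (selHF d (n ϱ) 𝔹))
        (fun 𝔹 => (n ϱ : ℝ) - Real.logb 2 𝔹.p) ζ A q →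
      ∃ B₁ B₂ : List Instr,
        instrTime B₁ ≤ A.time + T.eval (ϱ + A.queries) ∧
        instrTime B₂ ≤ A.time + T.eval (ϱ + A.queries) ∧
        advLossy (gen ϱ) (selHF d (n ϱ)) (selLHF d (n ϱ))
            (fun 𝔹 => trivialPreOutput (selHF d (n ϱ) 𝔹))
            (fun 𝔹 => (n ϱ : ℝ) - Real.logb 2 𝔹.p) ζ A ≤
          n ϱ * ((2 * d + 1) * advPBDH1 (gen ϱ) B₁ + q * advDDH2 (gen ϱ) B₂)) ∧
    -- the lossy identities are the prefixes of the target
    (∀ ϱ, ∀ 𝔹 ∈ (gen ϱ).support, ∀ (target id : List 𝔹.Zpu),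
      target ≠ [] → target.length ≤ d → id ≠ [] → id.length ≤ d →
      ∀ ρ : MKgCoins 𝔹 d 2 (n ϱ),
        let f := (selHF d (n ϱ) 𝔹).eval (masterKeys (auxLossy d target) ρ).1 id
        (((n ϱ : ℝ) - Real.logb 2 𝔹.p ≤ lossiness f) ↔ id <+: target) ∧
        (¬ id <+: target → lossiness f = 0 ∧ Function.Injective f) ∧
        (id <+: target → ∀ X X' : Fin (n ϱ) → Bool,
          innerBits ρ.2.2.2 X = innerBits ρ.2.2.2 X' → f X = f X')) := by
  refine ⟨fun hP hD A hA ζ hζ hζ' => ?_, ?_, ?_⟩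
  · choose B₁ B₂ h1 h2 h3 using fun ϱ => exists_reductions hd (hn ϱ) (A ϱ)
    obtain ⟨T, hT⟩ := (PB.reductionTime (d := d)).exists_polynomial hn_poly
    have ht := polyBounded_comp hA (fun ϱ => queries_le_time (A ϱ)) T
    have hB₁ := hP B₁ (ht.mono fun ϱ => (h1 ϱ).trans (Nat.add_le_add_left (hT ϱ _) _))
    have hB₂ := hD B₂ (ht.mono fun ϱ => (h2 ϱ).trans (Nat.add_le_add_left (hT ϱ _) _))
    have hna : ∀ ϱ, ∀ o ∈ (experiment (gen ϱ) (selHF d (n ϱ)) (selLHF d (n ϱ))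
        (fun 𝔹 => trivialPreOutput (selHF d (n ϱ) 𝔹)) (fun 𝔹 => (n ϱ : ℝ) - Real.logb 2 𝔹.p)
        (ζ ϱ) (A ϱ) false).support, o.notAbort = true := by
      intro ϱ o ho
      rw [experiment, PMF.mem_support_bind_iff] at ho
      obtain ⟨𝔹, h𝔹, ho⟩ := ho
      exact notAbort_of_mem_support hd (hn ϱ 𝔹 h𝔹) (ζ ϱ) (A ϱ) false ho
    refine ⟨fun _ => 1, fun _ => 1, nonNegligible_one, nonNegligible_one, fun ϱ => (one_mul 1).symm,
      ?_, fun ϱ => ⟨(prob_eq_one (hna ϱ)).ge, fun h => ?_⟩⟩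
    · refine (Negligible.polyBounded_mul hn_poly ((hB₁.const_mul (2 * d + 1)).add hB₂)).trans_abs_le
        fun ϱ => ?_
      rw [advLossy_eq hd (gen ϱ) (hn ϱ), abs_abs]
      refine (h3 ϱ).trans (le_trans ?_ (le_abs_self _))
      have ha₂ := advDDH2_nonneg (gen ϱ) (B₂ ϱ)
      refine mul_le_mul_of_nonneg_left (add_le_add le_rfl ?_) (Nat.cast_nonneg _)
      split_ifs <;> linarith
    · have e₁ := prob_eq_one (s := {o : Outcome | o.notAbort = true}) (hna ϱ)
      have e₂ := prob_congr (s := {o : Outcome | o.dA = true ∧ o.notAbort = true}) (t := {o : Outcome | o.dA = true})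
        fun o ho => and_iff_left (hna ϱ o ho)
      beta_reduce at h ⊢
      rw [e₁, e₂, div_one, one_mul]
      exact h
  · obtain ⟨T, hT⟩ := (PB.reductionTime (d := d)).exists_polynomial hn_poly
    exact ⟨T, fun ϱ A q ζ h => advLossy_le hd (hn ϱ) (T := fun Q => T.eval (ϱ + Q))
      (fun a b hab => polynomial_eval_mono T (Nat.add_le_add_left hab ϱ)) (hT ϱ) A q ζ h⟩
  · intro ϱ 𝔹 h𝔹 target id _ _ _ hid ρ
    have hinj : ¬ id <+: target → Function.Injective
        (hfEval (masterKeys (auxLossy d target) ρ).1 (id.map unitVec)) := fun h =>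
      hfEval_injective hid h ρ
    refine ⟨⟨fun h => ?_, fun h => lossiness_of_prefix hid h ρ⟩,
      fun h => ⟨lossiness_of_injective (hinj h), hinj h⟩, fun h => hfEval_of_prefix hid h ρ⟩
    by_contra hpre
    have h0 := lossiness_of_injective (hinj hpre)
    have h4 := hn ϱ 𝔹 h𝔹
    have h5 : (n ϱ : ℝ) - Real.logb 2 𝔹.p ≤
        lossiness (hfEval (masterKeys (auxLossy d target) ρ).1 (id.map unitVec)) := h
    rw [h0] at h5
    linarith
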